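/- Let $k$ be an algebraically closed field of characteristic $0$, let $M$ be a smooth scheme over $k$ (for example a smooth variety) with a Poisson structure $\{\,,\}$ on $\mathcal O_M$, and let $\mathcal L^+M$ be the scheme that represents the functor $R\mapsto M(R[[z]])$ on $k$-algebras. For $U=\mathrm{Spec}\,A\subseteq M$ affine and $V=\mathrm{Spec}\,B$ an affine open of $\mathcal L^+M$ lying over $U$, write $ev:A\to B[[z]]$, $a\mapsto\sum_i a_iz^i$, for the evaluation homomorphism. Then: 1. $\mathcal L^+M$ has exactly one structure of Poisson vertex scheme (a derivation $\delta$ and a $\lambda$-bracket on $\mathcal O_{\mathcal L^+M}$ that make it a sheaf of Poisson vertex algebras) with $\delta(a_i)=(i+1)a_{i+1}$ and $\{a_0\,{}_\lambda\, b_0\}=\{a,b\}_0$ for functions $a,b$ on $M$. The module $\int\Omega^1_M$, given on $V$ by $\Omega^1_A\otimes_AB[[z]]$ with the $z$-adic topology and with $\delta=\delta_B-\partial_z$, has exactly one structure of Lie algebroid over $B$ with continuous bracket such that the anchor of $f\,da$ ($f\in B[[z]]$) sends $b_i$ to the coefficient of $z^i$ in $f\cdot ev\{a,b\}$, and $[z^i\,da,z^j\,db]=z^{i+j}\,d\{a,b\}$.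 2. Let $C^n_{PV}(\mathcal L^+M,\mathcal O)$ be the sheaf of $k$-multilinear maps $Y_{\lambda_1,\dots,\lambda_n}:\mathcal O^{n}\to\mathcal O[\lambda_1,\dots,\lambda_n]/(\delta+\lambda_1+\cdots+\lambda_n)$ that are antisymmetric, satisfy $Y(\dots,\delta a_i,\dots)=-\lambda_iY(\dots,a_i,\dots)$, and satisfy in each argument the Leibniz rule $Y(\dots,bc,\dots)=b\star_iY(\dots,c,\dots)+c\star_iY(\dots,b,\dots)$, where $b\star_i p(\lambda_i)=p(\lambda_i+\delta)b$ with this $\delta$ acting on $b$ only; its differential is $$(dY)(a_0,\dots,a_n)=\sum_i(-1)^i\{a_i\,{}_{\lambda_i}Y(\dots,\widehat{a_i},\dots)\}+\sum_{i<j}(-1)^{i+j}Y_{\lambda_i+\lambda_j,\dots}(\{a_i\,{}_{\lambda_i}a_j\},\dots,\widehat{a_i},\dots,\widehat{a_j},\dots).$$ Let $C^{n}_{dR,Lie}(\mathcal L^+M,\int\Omega^1_M)$ be the sheaf of continuous alternating $\mathcal O$-multilinear maps $(\int\Omega^1_M)^n\to\mathcal O$ ($\mathcal O$ discrete), with the Lie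 algebroid differential. Both are complexes, and $\delta$ acts on the second one. 3. There is a natural isomorphism of complexes of sheaves on $\mathcal L^+M$ $$\mathcal L^+_\delta C^*_{dR,Lie}(M,\Omega^1_M):=C^{*}_{dR,Lie}(\mathcal L^+M,\textstyle\int\Omega^1_M)/\delta\;\cong\;C^*_{PV}(\mathcal L^+M,\mathcal O).$$ In every degree it sends the class of $\varphi$ to the cochain whose value on functions $a_1,\dots,a_n$ on $M$ is the class of $\varphi(e^{\lambda_1z}da_1,\dots,e^{\lambda_nz}da_n)$. Equivalently: for a vector field $\eta$ on $U$ let $\eta_i\in\mathcal L^+\Theta_M=(\int\Omega^1_M)^\vee$ be the form $f\omega\mapsto$ coefficient of $z^i$ in $f\cdot ev(\omega(\eta))$. Then $b\,\eta^1_{i_1}\wedge\dots\wedge\eta^n_{i_n}$ $(b\in B)$ is sent to the cochain with $(a_1,\dots,a_n)\mapsto b\det\big(\tfrac1{i_p!}(\lambda_q+\delta)^{i_p}\,\eta^p(a_q)\big)_{p,q}$. So $\eta_i$ corresponds to $\frac1{i!}(\lambda+\delta)^i(\eta\otimes1)$, whose leading term in $\lambda$ is $\eta\otimes\lambda^i/i!$.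 -/

import Mathlib

open CategoryTheory AlgebraicGeometry TopologicalSpace Opposite
open scoped TensorProduct

universe u

noncomputable section

namespace LoopPoisson

/-! ## Polynomials in formal variables over an algebra with a derivation -/

section Polynomials

variable {k B N : Type*} [Field k] [CommRing B] [Algebra k B] [AddCommGroup N] [Module k N]

/-- The `k`-linear map on `B[λ_s : s ∈ σ]` given on the terms `b λ^m` by `F m b`. -/
def mvLift {σ : Type*} (F : (σ →₀ ℕ) → B →ₗ[k] N) : MvPolynomial σ B →ₗ[k] N :=
  (Finsupp.lsum k F) ∘ₗ (AddMonoidAlgebra.coeffLinearEquiv k).toLinearMap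

theorem mvLift_monomial {σ : Type*} (F : (σ →₀ ℕ) → B →ₗ[k] N) (m : σ →₀ ℕ) (b : B) :
    mvLift F (MvPolynomial.monomial m b) = F m b := by
  simp [mvLift, MvPolynomial.monomial]

theorem mv_ext {σ : Type*} {f g : MvPolynomial σ B →ₗ[k] N}
    (h : ∀ m b, f (MvPolynomial.monomial m b) = g (MvPolynomial.monomial m b)) : f = g := by
  refine LinearMap.ext fun p => ?_
  induction p using MvPolynomial.induction_on' with
  | monomial m b => exact h m b
  | add p q hp hq => rw [map_add, map_add, hp, hq]

/-- A `k`-linear map applied to the coefficients of a polynomial. -/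
def coefMap {σ : Type*} (δ : B →ₗ[k] B) : MvPolynomial σ B →ₗ[k] MvPolynomial σ B :=
  mvLift fun m => (MvPolynomial.monomial m).restrictScalars k ∘ₗ δ

/-- The operator `δ + ∑ λ_i` on `B[λ_1, …, λ_n]`. -/
def totalOp (δ : Derivation k B B) (n : ℕ) :
    MvPolynomial (Fin n) B →ₗ[k] MvPolynomial (Fin n) B :=
  coefMap δ.toLinearMap + LinearMap.mulLeft k (∑ i, MvPolynomial.X i)

/-- The space `B[λ_1, …, λ_n] / (δ + λ_1 + ⋯ + λ_n)`. -/
abbrev LamQuot (δ : Derivation k B B) (n : ℕ) : Type _ :=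
  MvPolynomial (Fin n) B ⧸ LinearMap.range (totalOp δ n)

/-- A `k`-linear map of polynomial spaces intertwining the operators `δ + ∑ λ_i` descends to the
quotients. -/
def LamQuot.map {B' : Type*} [CommRing B'] [Algebra k B'] {δ : Derivation k B B}
    {δ' : Derivation k B' B'} {n m : ℕ}
    (f : MvPolynomial (Fin n) B →ₗ[k] MvPolynomial (Fin m) B')
    (h : f ∘ₗ totalOp δ n = totalOp δ' m ∘ₗ f) : LamQuot δ n →ₗ[k] LamQuot δ' m :=
  Submodule.mapQ _ _ f (by
    rintro _ ⟨p, rfl⟩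
    exact ⟨f p, (LinearMap.congr_fun h p).symm⟩)

theorem coefMap_monomial {σ : Type*} (δ : B →ₗ[k] B) (m : σ →₀ ℕ) (b : B) :
    coefMap δ (MvPolynomial.monomial m b) = MvPolynomial.monomial m (δ b) := by
  simp [coefMap, mvLift_monomial]

theorem coefMap_monomial_mul {σ : Type*} (δ : B →ₗ[k] B) (m : σ →₀ ℕ) (p : MvPolynomial σ B) :
    coefMap δ (MvPolynomial.monomial m 1 * p) = MvPolynomial.monomial m 1 * coefMap δ p := by
  induction p using MvPolynomial.induction_on' with
  | monomial m' b => simp [coefMap_monomial, MvPolynomial.monomial_mul]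
  | add p q hp hq => rw [mul_add, map_add, map_add, hp, hq, mul_add]

theorem coefMap_X_mul {σ : Type*} (δ : B →ₗ[k] B) (i : σ) (p : MvPolynomial σ B) :
    coefMap δ (MvPolynomial.X i * p) = MvPolynomial.X i * coefMap δ p :=
  coefMap_monomial_mul δ (Finsupp.single i 1) p

theorem coefMap_C {σ : Type*} (δ : B →ₗ[k] B) (b : B) :
    coefMap (σ := σ) δ (MvPolynomial.C b) = MvPolynomial.C (δ b) :=
  coefMap_monomial δ 0 b

/-- Multiplication by `λ_i` on `B[λ_1, …, λ_n] / (δ + ∑ λ_i)`. -/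
def lamMul (δ : Derivation k B B) {n : ℕ} (i : Fin n) : LamQuot δ n →ₗ[k] LamQuot δ n :=
  LamQuot.map (LinearMap.mulLeft k (MvPolynomial.X i)) (by
    refine LinearMap.ext fun p => ?_
    simp only [totalOp, LinearMap.comp_apply, LinearMap.add_apply, LinearMap.mulLeft_apply,
      coefMap_X_mul, mul_add]
    ring)

/-- Permutation of the variables, `λ_i ↦ λ_{τ i}`. -/
def lamPerm (δ : Derivation k B B) {n : ℕ} (τ : Equiv.Perm (Fin n)) :
    LamQuot δ n →ₗ[k] LamQuot δ n :=
  LamQuot.map ((MvPolynomial.rename τ : MvPolynomial (Fin n) B →ₐ[B] _).toLinearMap.restrictScalars k)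
  (by
    refine mv_ext fun m b => ?_
    simp only [totalOp, LinearMap.comp_apply, LinearMap.add_apply, LinearMap.mulLeft_apply,
      coefMap_monomial, LinearMap.restrictScalars_apply, AlgHom.toLinearMap_apply, map_add, map_mul,
      map_sum, MvPolynomial.rename_X, MvPolynomial.rename_monomial]
    rw [Equiv.sum_comp τ (fun i => (MvPolynomial.X i : MvPolynomial (Fin n) B))])

/-- The operator on `B[λ_1, …, λ_n]` by which `a ∈ B` acts in the `i`-th variable, sending `p(λ_i)`
to `p(λ_i + δ) a`; the shifted derivative `δ` acts on `a` only. Explicitly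
`b λ_i^m ↦ b ∑_l (m choose l) λ_i^{m-l} δ^l(a)`. -/
def shiftMulPoly (δ : Derivation k B B) {n : ℕ} (i : Fin n) (a : B) :
    MvPolynomial (Fin n) B →ₗ[k] MvPolynomial (Fin n) B :=
  mvLift fun m => ∑ l ∈ Finset.range (m i + 1), (m i).choose l •
    ((MvPolynomial.monomial (m - Finsupp.single i l)).restrictScalars k ∘ₗ
      LinearMap.mulRight k ((δ^[l]) a))

theorem shiftMulPoly_monomial (δ : Derivation k B B) {n : ℕ} (i : Fin n) (a : B)
    (m : Fin n →₀ ℕ) (b : B) : shiftMulPoly δ i a (MvPolynomial.monomial m b) =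
      ∑ l ∈ Finset.range (m i + 1), (m i).choose l •
        MvPolynomial.monomial (m - Finsupp.single i l) (b * (δ^[l]) a) := by
  simp [shiftMulPoly, mvLift_monomial, LinearMap.sum_apply]

theorem coefMap_shiftMulPoly (δ : Derivation k B B) {n : ℕ} (i : Fin n) (a : B)
    (p : MvPolynomial (Fin n) B) : coefMap δ.toLinearMap (shiftMulPoly δ i a p) =
      shiftMulPoly δ i a (coefMap δ.toLinearMap p) + shiftMulPoly δ i (δ a) p := by
  induction p using MvPolynomial.induction_on' with
  | add p q hp hq => simp only [map_add, hp, hq]; abel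
  | monomial m b =>
    simp only [shiftMulPoly_monomial, coefMap_monomial, map_sum, map_nsmul,
      ← Finset.sum_add_distrib, ← smul_add, ← map_add]
    refine Finset.sum_congr rfl fun l _ => ?_
    congr 2
    rw [← Function.iterate_succ_apply, Function.iterate_succ_apply']
    simp [mul_comm, add_comm]

theorem shiftMulPoly_X_mul_of_ne (δ : Derivation k B B) {n : ℕ} {i j : Fin n} (h : j ≠ i) (a : B)
    (p : MvPolynomial (Fin n) B) :
    shiftMulPoly δ i a (MvPolynomial.X j * p) = MvPolynomial.X j * shiftMulPoly δ i a p := by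
  induction p using MvPolynomial.induction_on' with
  | add p q hp hq => simp only [map_add, mul_add, hp, hq]
  | monomial m b =>
    have hm : (Finsupp.single j 1 + m : Fin n →₀ ℕ) i = m i := by simp [h]
    rw [MvPolynomial.X, MvPolynomial.monomial_mul, shiftMulPoly_monomial, shiftMulPoly_monomial,
      hm, Finset.mul_sum]
    refine Finset.sum_congr rfl fun l hl => ?_
    rw [mul_smul_comm, MvPolynomial.monomial_mul, one_mul, one_mul, add_tsub_assoc_of_le]
    simpa [Finsupp.single_le_iff] using Nat.lt_succ_iff.mp (Finset.mem_range.mp hl)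

theorem shiftMulPoly_X_mul_self (δ : Derivation k B B) {n : ℕ} (i : Fin n) (a : B)
    (p : MvPolynomial (Fin n) B) : shiftMulPoly δ i a (MvPolynomial.X i * p) =
      MvPolynomial.X i * shiftMulPoly δ i a p + shiftMulPoly δ i (δ a) p := by
  induction p using MvPolynomial.induction_on' with
  | add p q hp hq => simp only [map_add, mul_add, hp, hq]; abel
  | monomial m b =>
    have hm : (Finsupp.single i 1 + m : Fin n →₀ ℕ) i = m i + 1 := by simp [add_comm]
    rw [MvPolynomial.X, MvPolynomial.monomial_mul, shiftMulPoly_monomial, shiftMulPoly_monomial,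
      shiftMulPoly_monomial, hm, Finset.mul_sum, Finset.sum_range_succ']
    simp only [Nat.choose_succ_succ, add_smul, Finset.sum_add_distrib]
    have h1 : ∀ l, Finsupp.single i 1 + m - Finsupp.single i (l + 1) = m - Finsupp.single i l := by
      intro l
      rw [Finsupp.single_add, add_comm (Finsupp.single i l), ← tsub_tsub, add_tsub_cancel_left]
    have h2 : ∀ l ∈ Finset.range (m i + 1),
        (MvPolynomial.monomial (Finsupp.single i 1) 1 : MvPolynomial (Fin n) B) *
          ((m i).choose l • MvPolynomial.monomial (m - Finsupp.single i l) (b * (δ^[l]) a)) =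
        (m i).choose l •
          MvPolynomial.monomial (Finsupp.single i 1 + m - Finsupp.single i l) (b * (δ^[l]) a) := by
      intro l hl
      rw [mul_smul_comm, MvPolynomial.monomial_mul, one_mul, add_tsub_assoc_of_le]
      simpa [Finsupp.single_le_iff] using Nat.lt_succ_iff.mp (Finset.mem_range.mp hl)
    have h3 : ∑ l ∈ Finset.range (m i + 1), (m i).choose l •
          MvPolynomial.monomial (Finsupp.single i 1 + m - Finsupp.single i l) (b * (δ^[l]) a) =
        (∑ l ∈ Finset.range (m i + 1), (m i).choose (l + 1) •
          MvPolynomial.monomial (m - Finsupp.single i l) (b * (δ^[l]) (δ a))) +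
        MvPolynomial.monomial (Finsupp.single i 1 + m) (b * a) := by
      rw [Finset.sum_range_succ', Finset.sum_range_succ (fun l => (m i).choose (l + 1) •
        MvPolynomial.monomial (m - Finsupp.single i l) (b * (δ^[l]) (δ a)))]
      simp only [h1]
      simp [Function.iterate_succ_apply]
    rw [Finset.sum_congr rfl h2, h3]
    simp only [h1, Function.iterate_succ_apply, one_mul, Nat.choose_zero_right,
      Function.iterate_zero_apply, Finsupp.single_zero, tsub_zero, one_smul]
    abel

/-- The action of `a ∈ B` in the `i`-th variable of `B[λ_1, …, λ_n] / (δ + ∑ λ_i)`. -/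
def shiftMul (δ : Derivation k B B) {n : ℕ} (i : Fin n) (a : B) :
    LamQuot δ n →ₗ[k] LamQuot δ n :=
  LamQuot.map (shiftMulPoly δ i a) (by
    refine LinearMap.ext fun p => ?_
    simp only [totalOp, LinearMap.comp_apply, LinearMap.add_apply, LinearMap.mulLeft_apply,
      coefMap_shiftMulPoly, map_add, Finset.sum_mul, map_sum]
    have h : ∀ j, shiftMulPoly δ i a (MvPolynomial.X j * p) =
        MvPolynomial.X j * shiftMulPoly δ i a p +
          if j = i then shiftMulPoly δ i (δ a) p else 0 := by
      intro j
      by_cases hj : j = i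
      · subst hj; simp [shiftMulPoly_X_mul_self]
      · simp [hj, shiftMulPoly_X_mul_of_ne δ hj]
    simp only [h, Finset.sum_add_distrib, Finset.sum_ite_eq', Finset.mem_univ, if_true]
    abel)

/-- For `i' : Fin (n + 1)` and `j : Fin (n + 2)`, with `i = i'` as an element of `Fin (n + 2)` and
`i < j`: the substitution that puts `λ_i + λ_j` for the first variable, and for the others, in
order, the variables `λ_q` with `q ≠ i, j`. -/
def lamInsert (δ : Derivation k B B) {n : ℕ} (i' : Fin (n + 1)) (j : Fin (n + 2))
    (h : i'.castSucc < j) : LamQuot δ (n + 1) →ₗ[k] LamQuot δ (n + 2) :=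
  LamQuot.map ((MvPolynomial.aeval (R := B) (Fin.cons (α := fun _ => MvPolynomial (Fin (n + 2)) B)
      (MvPolynomial.X i'.castSucc + MvPolynomial.X j)
      (fun q => MvPolynomial.X (j.succAbove (i'.succAbove q))))).toLinearMap.restrictScalars k) (by
    set e : Fin (n + 1) → MvPolynomial (Fin (n + 2)) B := Fin.cons
      (α := fun _ => MvPolynomial (Fin (n + 2)) B)
      (MvPolynomial.X i'.castSucc + MvPolynomial.X j)
      (fun q => MvPolynomial.X (j.succAbove (i'.succAbove q))) with he
    have hj : j.succAbove i' = i'.castSucc := Fin.succAbove_of_castSucc_lt _ _ h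
    have hsum : ∑ q, e q = ∑ q, MvPolynomial.X q := by
      rw [Fin.sum_univ_succ, Fin.sum_univ_succAbove _ j, Fin.sum_univ_succAbove _ i', hj]
      simp only [he, Fin.cons_zero, Fin.cons_succ]
      ring
    have hcoef : ∀ p, coefMap δ.toLinearMap (MvPolynomial.aeval e p) =
        MvPolynomial.aeval e (coefMap δ.toLinearMap p) := by
      intro p
      induction p using MvPolynomial.induction_on with
      | C b => simp [coefMap_C, MvPolynomial.algebraMap_eq]
      | add p q hp hq => simp only [map_add, hp, hq]
      | mul_X p q hp =>
        rw [mul_comm p, coefMap_X_mul, map_mul (MvPolynomial.aeval e), map_mul (MvPolynomial.aeval e),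
          MvPolynomial.aeval_X, ← hp]
        refine Fin.cases ?_ (fun q => ?_) q
        · simp only [he, Fin.cons_zero, add_mul, map_add, coefMap_X_mul]
        · simp only [he, Fin.cons_succ, coefMap_X_mul]
    refine LinearMap.ext fun p => ?_
    simp only [totalOp, LinearMap.comp_apply, LinearMap.add_apply, LinearMap.mulLeft_apply,
      LinearMap.restrictScalars_apply, AlgHom.toLinearMap_apply, map_add, map_mul, map_sum,
      MvPolynomial.aeval_X, hsum, hcoef])

/-- A `k`-linear map applied to the coefficients of a polynomial in one variable. -/
def polyCoefMap (δ : B →ₗ[k] B) : Polynomial B →ₗ[k] Polynomial B where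
  toFun p := p.sum fun n b => Polynomial.monomial n (δ b)
  map_add' p q := Polynomial.sum_add_index _ _ _ (by simp) (by simp)
  map_smul' c p := by
    rw [Polynomial.sum_smul_index' _ _ _ (by simp), RingHom.id_apply, Polynomial.smul_sum]
    exact Finset.sum_congr rfl fun n _ => by
      simp only [map_smul, Polynomial.smul_monomial]

theorem polyCoefMap_monomial (δ : B →ₗ[k] B) (n : ℕ) (b : B) :
    polyCoefMap δ (Polynomial.monomial n b) = Polynomial.monomial n (δ b) :=
  Polynomial.sum_monomial_index b (fun n b => Polynomial.monomial n (δ b)) (by simp)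

theorem coefMap_aeval_X {σ : Type*} (δ : B →ₗ[k] B) (i : σ) (r : Polynomial B) :
    coefMap δ (Polynomial.aeval (MvPolynomial.X i : MvPolynomial σ B) r) =
      Polynomial.aeval (MvPolynomial.X i) (polyCoefMap δ r) := by
  induction r using Polynomial.induction_on' with
  | add p q hp hq => simp only [map_add, hp, hq]
  | monomial n b =>
    rw [polyCoefMap_monomial, Polynomial.aeval_monomial, Polynomial.aeval_monomial]
    induction n with
    | zero => simpa using coefMap_C δ b
    | succ n ih => rw [pow_succ', mul_left_comm, coefMap_X_mul, ih, mul_left_comm]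

end Polynomials

/-! ## Poisson algebras, Poisson vertex algebras and their cochains -/

section PVA

/-- A Poisson bracket on a commutative `k`-algebra. -/
structure PoissonBracket (k A : Type*) [Field k] [CommRing A] [Algebra k A] where
  br : A →ₗ[k] A →ₗ[k] A
  self : ∀ a, br a a = 0
  jacobi : ∀ a b c, br a (br b c) = br (br a b) c + br b (br a c)
  leibniz : ∀ a b c, br a (b * c) = br a b * c + b * br a c

/-- A Poisson vertex algebra structure on a commutative `k`-algebra: a derivation `δ` and a lambda
bracket `br a b = {a_λ b} ∈ B[λ]`. In `skew` the right hand side is `-{b_{-δ-λ} a}`, where `δ` acts on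
the coefficients. In `jacobi`, `λ` and `μ` are the variables `X 0` and `X 1`. -/
structure PVA (k B : Type*) [Field k] [CommRing B] [Algebra k B] where
  δ : Derivation k B B
  br : B →ₗ[k] B →ₗ[k] Polynomial B
  δ_br : ∀ a b, polyCoefMap δ.toLinearMap (br a b) = br (δ a) b + br a (δ b)
  sesq : ∀ a b, br (δ a) b = -(Polynomial.X * br a b)
  skew : ∀ a b, br a b = -(br b a).sum fun m c =>
    ((-(polyCoefMap δ.toLinearMap + LinearMap.mulLeft k Polynomial.X) : Module.End k (Polynomial B)) ^ m)
      (Polynomial.C c)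
  jacobi : ∀ a b c,
    ((br a b).sum fun m x => (MvPolynomial.X 0 : MvPolynomial (Fin 2) B) ^ m *
        Polynomial.aeval (MvPolynomial.X 0 + MvPolynomial.X 1 : MvPolynomial (Fin 2) B) (br x c)) =
      ((br b c).sum fun m x => (MvPolynomial.X 1 : MvPolynomial (Fin 2) B) ^ m *
        Polynomial.aeval (MvPolynomial.X 0 : MvPolynomial (Fin 2) B) (br a x)) -
      ((br a c).sum fun m x => (MvPolynomial.X 0 : MvPolynomial (Fin 2) B) ^ m *
        Polynomial.aeval (MvPolynomial.X 1 : MvPolynomial (Fin 2) B) (br b x))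
  leibniz : ∀ a b c, br a (b * c) = Polynomial.C b * br a c + Polynomial.C c * br a b

variable {k B : Type*} [Field k] [CommRing B] [Algebra k B] (𝒱 : PVA k B)

/-- The map `p ↦ {a_{λ_i} p}` from `B[λ_q : q ≠ i]` to `B[λ_0, …, λ_n]`, the bracket with `a` being
applied to the coefficients of `p`. -/
def PVA.brOpPoly {n : ℕ} (i : Fin (n + 1)) (a : B) :
    MvPolynomial (Fin n) B →ₗ[k] MvPolynomial (Fin (n + 1)) B :=
  mvLift fun m => LinearMap.mulLeft k (MvPolynomial.rename i.succAbove (MvPolynomial.monomial m 1)) ∘ₗ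
    (Polynomial.aeval (R := B) (MvPolynomial.X i : MvPolynomial (Fin (n + 1)) B)
      ).toLinearMap.restrictScalars k ∘ₗ 𝒱.br a

/-- The map `p ↦ {a_{λ_i} p}` modulo the images of `δ + ∑ λ_q`. -/
def PVA.brOp {n : ℕ} (i : Fin (n + 1)) (a : B) : LamQuot 𝒱.δ n →ₗ[k] LamQuot 𝒱.δ (n + 1) :=
  LamQuot.map (𝒱.brOpPoly i a) (by
    have h : ∀ m b, 𝒱.brOpPoly i a (MvPolynomial.monomial m b) =
        MvPolynomial.rename i.succAbove (MvPolynomial.monomial m 1) *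
          Polynomial.aeval (MvPolynomial.X i) (𝒱.br a b) := by
      intro m b; simp [PVA.brOpPoly, mvLift_monomial]
    refine mv_ext fun m b => ?_
    have h1 : ∀ j : Fin n, 𝒱.brOpPoly i a (MvPolynomial.X j * MvPolynomial.monomial m b) =
        MvPolynomial.X (i.succAbove j) * 𝒱.brOpPoly i a (MvPolynomial.monomial m b) := by
      intro j
      rw [MvPolynomial.X, MvPolynomial.monomial_mul, one_mul, h, h]
      simp only [MvPolynomial.rename_monomial, MvPolynomial.X, ← mul_assoc,
        MvPolynomial.monomial_mul, one_mul, Finsupp.mapDomain_add, Finsupp.mapDomain_single]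
    have h2 : 𝒱.br a (𝒱.δ b) =
        polyCoefMap 𝒱.δ.toLinearMap (𝒱.br a b) + Polynomial.X * 𝒱.br a b := by
      rw [𝒱.δ_br, 𝒱.sesq]; ring
    simp only [totalOp, LinearMap.comp_apply, LinearMap.add_apply, LinearMap.mulLeft_apply,
      map_add, Finset.sum_mul, map_sum, h1, coefMap_monomial]
    rw [Fin.sum_univ_succAbove _ i, h, h, MvPolynomial.rename_monomial, coefMap_monomial_mul,
      coefMap_aeval_X]
    have h3 : (𝒱.δ.toLinearMap) b = 𝒱.δ b := rfl
    rw [h3, h2, map_add, map_mul, Polynomial.aeval_X]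
    ring)

/-- The polyderivation cochains of degree `n`: multilinear maps
`Y : B^n → B[λ_1, …, λ_n] / (δ + ∑ λ_i)` that are sesquilinear, antisymmetric and satisfy the Leibniz rule in
each argument. The Leibniz rule is the one that is compatible with sesquilinearity. -/
structure PVA.IsCochain {n : ℕ} (Y : (Fin n → B) → LamQuot 𝒱.δ n) : Prop where
  multilinear : ∃ f : MultilinearMap k (fun _ : Fin n => B) (LamQuot 𝒱.δ n), ⇑f = Y
  sesq : ∀ (a : Fin n → B) (i : Fin n),
    Y (Function.update a i (𝒱.δ (a i))) = -lamMul 𝒱.δ i (Y a)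
  antisymm : ∀ (a : Fin n → B) (τ : Equiv.Perm (Fin n)),
    lamPerm 𝒱.δ τ (Y (a ∘ τ)) = (Equiv.Perm.sign τ : ℤ) • Y a
  leibniz : ∀ (a : Fin n → B) (i : Fin n) (b c : B),
    Y (Function.update a i (b * c)) = shiftMul 𝒱.δ i b (Y (Function.update a i c)) +
      shiftMul 𝒱.δ i c (Y (Function.update a i b))

/-- The sum of the terms of the differential that contain `{a_i λ_i a_j}`, `i < j`. -/
def PVA.dInsert : ∀ {n : ℕ}, ((Fin n → B) → LamQuot 𝒱.δ n) → (Fin (n + 1) → B) →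
    LamQuot 𝒱.δ (n + 1)
  | 0, _, _ => 0
  | n + 1, Y, a => ∑ i' : Fin (n + 1), ∑ j : Fin (n + 2), if h : i'.castSucc < j then (-1 : ℤ) ^ ((i' : ℕ) + (j : ℕ)) •
      ((𝒱.br (a i'.castSucc) (a j)).sum fun m c => (lamMul 𝒱.δ i'.castSucc ^ m)
        (lamInsert 𝒱.δ i' j h (Y (Fin.cons c fun q => a (j.succAbove (i'.succAbove q)))))) else 0

/-- The differential of the complex of a Lie conformal algebra, arguments being numbered from `0`. -/
def PVA.d {n : ℕ} (Y : (Fin n → B) → LamQuot 𝒱.δ n) (a : Fin (n + 1) → B) : LamQuot 𝒱.δ (n + 1) :=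
  (∑ i : Fin (n + 1), (-1 : ℤ) ^ (i : ℕ) • 𝒱.brOp i (a i) (Y (a ∘ i.succAbove))) + 𝒱.dInsert Y a

theorem PVA.dInsert_add {n : ℕ} (Y Z : (Fin n → B) → LamQuot 𝒱.δ n) (a : Fin (n + 1) → B) :
    𝒱.dInsert (Y + Z) a = 𝒱.dInsert Y a + 𝒱.dInsert Z a := by
  cases n with
  | zero => simp [PVA.dInsert]
  | succ n =>
    simp only [PVA.dInsert, ← Finset.sum_add_distrib]
    refine Finset.sum_congr rfl fun i _ => Finset.sum_congr rfl fun j _ => ?_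
    split_ifs
    · simp only [Polynomial.sum, Pi.add_apply, map_add, Finset.sum_add_distrib, smul_add]
    · simp

theorem PVA.dInsert_smul {n : ℕ} (t : k) (Y : (Fin n → B) → LamQuot 𝒱.δ n) (a : Fin (n + 1) → B) :
    𝒱.dInsert (t • Y) a = t • 𝒱.dInsert Y a := by
  cases n with
  | zero => simp [PVA.dInsert]
  | succ n =>
    simp only [PVA.dInsert, Finset.smul_sum]
    refine Finset.sum_congr rfl fun i _ => Finset.sum_congr rfl fun j _ => ?_
    split_ifs
    · simp only [Polynomial.sum, Pi.smul_apply, map_smul]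
      rw [smul_comm, ← Finset.smul_sum]
    · simp

theorem PVA.d_add {n : ℕ} (Y Z : (Fin n → B) → LamQuot 𝒱.δ n) (a : Fin (n + 1) → B) :
    𝒱.d (Y + Z) a = 𝒱.d Y a + 𝒱.d Z a := by
  simp only [PVA.d, PVA.dInsert_add, Pi.add_apply, map_add, smul_add, Finset.sum_add_distrib]
  abel

theorem PVA.d_smul {n : ℕ} (t : k) (Y : (Fin n → B) → LamQuot 𝒱.δ n) (a : Fin (n + 1) → B) :
    𝒱.d (t • Y) a = t • 𝒱.d Y a := by
  simp only [PVA.d, PVA.dInsert_smul, Pi.smul_apply, map_smul, smul_add, Finset.smul_sum]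
  congr 1
  exact Finset.sum_congr rfl fun i _ => smul_comm _ _ _

theorem PVA.IsCochain.zero {n : ℕ} : 𝒱.IsCochain (0 : (Fin n → B) → LamQuot 𝒱.δ n) where
  multilinear := ⟨0, rfl⟩
  sesq a i := by simp
  antisymm a τ := by simp
  leibniz a i b c := by simp

theorem PVA.IsCochain.add {n : ℕ} {Y Z : (Fin n → B) → LamQuot 𝒱.δ n} (hY : 𝒱.IsCochain Y)
    (hZ : 𝒱.IsCochain Z) : 𝒱.IsCochain (Y + Z) where
  multilinear := by
    obtain ⟨f, hf⟩ := hY.multilinear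
    obtain ⟨g, hg⟩ := hZ.multilinear
    exact ⟨f + g, by rw [← hf, ← hg]; rfl⟩
  sesq a i := by simp only [Pi.add_apply, hY.sesq, hZ.sesq, map_add]; abel
  antisymm a τ := by simp only [Pi.add_apply, hY.antisymm, hZ.antisymm, map_add, smul_add]
  leibniz a i b c := by
    simp only [Pi.add_apply, hY.leibniz a i b c, hZ.leibniz a i b c, map_add]; abel

theorem PVA.IsCochain.smul {n : ℕ} (t : k) {Y : (Fin n → B) → LamQuot 𝒱.δ n}
    (hY : 𝒱.IsCochain Y) : 𝒱.IsCochain (t • Y) where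
  multilinear := by
    obtain ⟨f, hf⟩ := hY.multilinear
    exact ⟨t • f, by rw [← hf]; rfl⟩
  sesq a i := by simp only [Pi.smul_apply, hY.sesq, map_smul, smul_neg]
  antisymm a τ := by
    simp only [Pi.smul_apply, hY.antisymm, map_smul]
    exact smul_comm _ _ _
  leibniz a i b c := by
    simp only [Pi.smul_apply, hY.leibniz a i b c, map_smul, smul_add]

end PVA

/-! ## The forms on the formal disc along an arc -/

section Loop

variable {k A B : Type*} [Field k] [CommRing A] [CommRing B] [Algebra k A] [Algebra k B]

/-- The ring `B[[z]]`, considered as an `A`-algebra by the homomorphism `ev : A → B[[z]]`,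
`a ↦ ∑ a_i z^i`. -/
def ArcRing (_ev : A →ₐ[k] PowerSeries B) : Type _ := PowerSeries B

variable (ev : A →ₐ[k] PowerSeries B)

instance : CommRing (ArcRing ev) := inferInstanceAs (CommRing (PowerSeries B))
instance : Algebra B (ArcRing ev) := inferInstanceAs (Algebra B (PowerSeries B))
instance : Algebra k (ArcRing ev) := inferInstanceAs (Algebra k (PowerSeries B))
instance : IsScalarTower k B (ArcRing ev) := inferInstanceAs (IsScalarTower k B (PowerSeries B))
instance : Algebra A (ArcRing ev) := RingHom.toAlgebra (ev : A →+* PowerSeries B)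

/-- The coordinate `z`. -/
def ArcRing.z : ArcRing ev := (PowerSeries.X : PowerSeries B)

/-- The coefficient of `z^i`. -/
def ArcRing.coeff (i : ℕ) : ArcRing ev →ₗ[B] B := PowerSeries.coeff i

/-- `a_i`, the coefficient of `z^i` in `ev a`. -/
def jet (i : ℕ) (a : A) : B := PowerSeries.coeff i (ev a)

/-- The module `∫ Ω¹ = Ω¹_A ⊗_A B[[z]]` over `B`. -/
abbrev LoopForms : Type _ := ArcRing ev ⊗[A] Ω[A⁄k]

/-- The element `f da`. -/
def formGen (f : ArcRing ev) (a : A) : LoopForms ev := f ⊗ₜ[A] KaehlerDifferential.D k A a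

/-- The submodules `z^N ∫ Ω¹`, which define the topology. -/
def loopFilt (N : ℕ) : Set (LoopForms ev) := Set.range fun w => (ArcRing.z ev ^ N) • w

/-- `δ` satisfies `δ(a_i) = (i + 1) a_{i+1}`. -/
def IsArcDerivation (δ : Derivation k B B) : Prop :=
  ∀ (a : A) (i : ℕ), δ (jet ev i a) = ((i : B) + 1) * jet ev (i + 1) a

/-- The operator `δ - ∂_z` on `B[[z]]`, where `δ` acts on the coefficients. -/
def seriesDelta (δ : Derivation k B B) (f : PowerSeries B) : PowerSeries B :=
  (PowerSeries.mk fun i => δ (PowerSeries.coeff i f)) - PowerSeries.derivative B f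

theorem seriesDelta_add (δ : Derivation k B B) (f g : PowerSeries B) :
    seriesDelta δ (f + g) = seriesDelta δ f + seriesDelta δ g := by
  refine PowerSeries.ext fun i => ?_
  simp only [seriesDelta, map_add, map_sub, PowerSeries.coeff_mk]
  abel

theorem seriesDelta_mul (δ : Derivation k B B) (f g : PowerSeries B) :
    seriesDelta δ (f * g) = seriesDelta δ f * g + f * seriesDelta δ g := by
  have h2 : (PowerSeries.mk fun i => δ (PowerSeries.coeff i (f * g))) =
      f * (PowerSeries.mk fun i => δ (PowerSeries.coeff i g)) +
        (PowerSeries.mk fun i => δ (PowerSeries.coeff i f)) * g := by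
    refine PowerSeries.ext fun i => ?_
    rw [PowerSeries.coeff_mk, map_add, PowerSeries.coeff_mul, PowerSeries.coeff_mul,
      PowerSeries.coeff_mul, map_sum, ← Finset.sum_add_distrib]
    refine Finset.sum_congr rfl fun p _ => ?_
    rw [Derivation.leibniz, PowerSeries.coeff_mk, PowerSeries.coeff_mk]
    simp only [smul_eq_mul]
    ring
  simp only [seriesDelta, h2, Derivation.leibniz, smul_eq_mul]
  ring

theorem seriesDelta_ev (δ : Derivation k B B) (h : IsArcDerivation ev δ) (a : A) :
    seriesDelta δ (ev a) = 0 := by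
  refine PowerSeries.ext fun i => ?_
  have h3 := h a i
  simp only [jet] at h3
  rw [seriesDelta, map_sub, PowerSeries.coeff_mk, PowerSeries.coeff_derivative, h3, map_zero]
  ring

theorem seriesDelta_ev_mul (δ : Derivation k B B) (h : IsArcDerivation ev δ) (a : A)
    (f : PowerSeries B) : seriesDelta δ (ev a * f) = ev a * seriesDelta δ f := by
  rw [seriesDelta_mul, seriesDelta_ev ev δ h, zero_mul, zero_add]

/-- The operator `δ - ∂_z` on `B[[z]]`; it is `A`-linear. -/
def arcDelta (δ : Derivation k B B) (h : IsArcDerivation ev δ) : ArcRing ev →ₗ[A] ArcRing ev where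
  toFun := seriesDelta δ
  map_add' := seriesDelta_add δ
  map_smul' a f := seriesDelta_ev_mul ev δ h a f

/-- The operator `δ` on `∫ Ω¹`, namely `f ω ↦ (δ f - ∂_z f) ω`. -/
def loopDelta (δ : Derivation k B B) (h : IsArcDerivation ev δ) : LoopForms ev →ₗ[A] LoopForms ev :=
  (arcDelta ev δ h).rTensor Ω[A⁄k]

/-- A Lie algebroid over `B` on the topological module `∫ Ω¹`, with continuous bracket. -/
structure TopLieAlgebroid where
  anchor : LoopForms ev →ₗ[B] Derivation k B B
  br : LoopForms ev →ₗ[k] LoopForms ev →ₗ[k] LoopForms ev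
  self : ∀ v, br v v = 0
  jacobi : ∀ u v w, br u (br v w) = br (br u v) w + br v (br u w)
  leibniz : ∀ v w (b : B), br v (b • w) = b • br v w + anchor v b • w
  continuous : ∀ w N, ∃ N', ∀ v ∈ loopFilt ev N', br v w ∈ loopFilt ev N

variable {ev}

/-- The Lie algebroid structure on `∫ Ω¹` given by a Poisson bracket on `A`: the anchor sends `f da`
to the vector field `b_i ↦ (the coefficient of z^i in f · ev {a, b})`, and the bracket is
`[z^i da, z^j db] = z^{i+j} d{a, b}`. -/
structure TopLieAlgebroid.IsCotangent (L : TopLieAlgebroid ev) (P : PoissonBracket k A) : Prop where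
  anchor : ∀ f a b i, L.anchor (formGen ev f a) (jet ev i b) =
    ArcRing.coeff ev i (f * algebraMap A (ArcRing ev) (P.br a b))
  br : ∀ i j a b, L.br (formGen ev (ArcRing.z ev ^ i) a) (formGen ev (ArcRing.z ev ^ j) b) =
    formGen ev (ArcRing.z ev ^ (i + j)) (P.br a b)

/-- The continuous de Rham–Lie cochains of degree `n`: continuous alternating `B`-multilinear maps
`(∫ Ω¹)^n → B`, where `B` is discrete. -/
structure IsLoopCochain {n : ℕ} (φ : (Fin n → LoopForms ev) → B) : Prop where
  alternating : ∃ ψ : LoopForms ev [⋀^Fin n]→ₗ[B] B, ⇑ψ = φ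
  continuous : ∃ N, ∀ v, (∃ i, v i ∈ loopFilt ev N) → φ v = 0

/-- The sum of the terms of the de Rham–Lie differential that contain `[v_i, v_j]`, `i < j`. -/
def TopLieAlgebroid.dInsert (L : TopLieAlgebroid ev) : ∀ {n : ℕ}, ((Fin n → LoopForms ev) → B) →
    (Fin (n + 1) → LoopForms ev) → B
  | 0, _, _ => 0
  | n + 1, φ, v => ∑ i' : Fin (n + 1), ∑ j : Fin (n + 2), if i'.castSucc < j then
      (-1 : ℤ) ^ ((i' : ℕ) + (j : ℕ)) •
        φ (Fin.cons (L.br (v i'.castSucc) (v j)) fun q => v (j.succAbove (i'.succAbove q))) else 0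

/-- The de Rham–Lie differential. -/
def TopLieAlgebroid.d (L : TopLieAlgebroid ev) {n : ℕ} (φ : (Fin n → LoopForms ev) → B)
    (v : Fin (n + 1) → LoopForms ev) : B :=
  (∑ i : Fin (n + 1), (-1 : ℤ) ^ (i : ℕ) • L.anchor (v i) (φ (v ∘ i.succAbove))) + L.dInsert φ v

/-- The operator `δ` on cochains. -/
def cochainDelta (δ : Derivation k B B) (h : IsArcDerivation ev δ) {n : ℕ}
    (φ : (Fin n → LoopForms ev) → B) (v : Fin n → LoopForms ev) : B :=
  δ (φ v) - ∑ i, φ (Function.update v i (loopDelta ev δ h (v i)))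

theorem TopLieAlgebroid.dInsert_add (L : TopLieAlgebroid ev) {n : ℕ}
    (φ ψ : (Fin n → LoopForms ev) → B) (v : Fin (n + 1) → LoopForms ev) :
    L.dInsert (φ + ψ) v = L.dInsert φ v + L.dInsert ψ v := by
  cases n with
  | zero => simp [TopLieAlgebroid.dInsert]
  | succ n =>
    simp only [TopLieAlgebroid.dInsert, ← Finset.sum_add_distrib]
    refine Finset.sum_congr rfl fun i _ => Finset.sum_congr rfl fun j _ => ?_
    split_ifs
    · simp only [Pi.add_apply, smul_add]
    · simp

theorem TopLieAlgebroid.dInsert_smul (L : TopLieAlgebroid ev) {n : ℕ} (t : k)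
    (φ : (Fin n → LoopForms ev) → B) (v : Fin (n + 1) → LoopForms ev) :
    L.dInsert (t • φ) v = t • L.dInsert φ v := by
  cases n with
  | zero => simp [TopLieAlgebroid.dInsert]
  | succ n =>
    simp only [TopLieAlgebroid.dInsert, Finset.smul_sum]
    refine Finset.sum_congr rfl fun i _ => Finset.sum_congr rfl fun j _ => ?_
    split_ifs
    · simp only [Pi.smul_apply]
      rw [smul_comm]
    · simp

theorem TopLieAlgebroid.d_add (L : TopLieAlgebroid ev) {n : ℕ}
    (φ ψ : (Fin n → LoopForms ev) → B) (v : Fin (n + 1) → LoopForms ev) :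
    L.d (φ + ψ) v = L.d φ v + L.d ψ v := by
  simp only [TopLieAlgebroid.d, TopLieAlgebroid.dInsert_add, Pi.add_apply, map_add, smul_add,
    Finset.sum_add_distrib]
  abel

theorem TopLieAlgebroid.d_smul (L : TopLieAlgebroid ev) {n : ℕ} (t : k)
    (φ : (Fin n → LoopForms ev) → B) (v : Fin (n + 1) → LoopForms ev) :
    L.d (t • φ) v = t • L.d φ v := by
  simp only [TopLieAlgebroid.d, TopLieAlgebroid.dInsert_smul, Pi.smul_apply, smul_add,
    Finset.smul_sum, Derivation.map_smul]
  congr 1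
  exact Finset.sum_congr rfl fun i _ => smul_comm _ _ _

theorem cochainDelta_add (δ : Derivation k B B) (h : IsArcDerivation ev δ) {n : ℕ}
    (φ ψ : (Fin n → LoopForms ev) → B) (v : Fin n → LoopForms ev) :
    cochainDelta δ h (φ + ψ) v = cochainDelta δ h φ v + cochainDelta δ h ψ v := by
  simp only [cochainDelta, Pi.add_apply, map_add, Finset.sum_add_distrib]
  abel

theorem cochainDelta_smul (δ : Derivation k B B) (h : IsArcDerivation ev δ) {n : ℕ} (t : k)
    (φ : (Fin n → LoopForms ev) → B) (v : Fin n → LoopForms ev) :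
    cochainDelta δ h (t • φ) v = t • cochainDelta δ h φ v := by
  simp only [cochainDelta, Pi.smul_apply, Derivation.map_smul, smul_sub, Finset.smul_sum]

theorem IsLoopCochain.zero {n : ℕ} : IsLoopCochain (0 : (Fin n → LoopForms ev) → B) where
  alternating := ⟨0, rfl⟩
  continuous := ⟨0, fun _ _ => rfl⟩

theorem loopFilt_mono {N N' : ℕ} (h : N ≤ N') : loopFilt ev N' ⊆ loopFilt ev N := by
  rintro _ ⟨w, rfl⟩
  exact ⟨(ArcRing.z ev ^ (N' - N)) • w, by
    simp only [smul_smul, ← pow_add, Nat.add_sub_cancel' h]⟩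

theorem IsLoopCochain.add {n : ℕ} {φ ψ : (Fin n → LoopForms ev) → B} (hφ : IsLoopCochain φ)
    (hψ : IsLoopCochain ψ) : IsLoopCochain (φ + ψ) where
  alternating := by
    obtain ⟨f, hf⟩ := hφ.alternating
    obtain ⟨g, hg⟩ := hψ.alternating
    exact ⟨f + g, by rw [← hf, ← hg]; rfl⟩
  continuous := by
    obtain ⟨N, hN⟩ := hφ.continuous
    obtain ⟨N', hN'⟩ := hψ.continuous
    refine ⟨max N N', fun v hv => ?_⟩
    obtain ⟨i, hi⟩ := hv
    rw [Pi.add_apply, hN v ⟨i, loopFilt_mono (le_max_left _ _) hi⟩,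
      hN' v ⟨i, loopFilt_mono (le_max_right _ _) hi⟩, add_zero]

theorem IsLoopCochain.smul {n : ℕ} (t : k) {φ : (Fin n → LoopForms ev) → B}
    (hφ : IsLoopCochain φ) : IsLoopCochain (t • φ) where
  alternating := by
    obtain ⟨f, hf⟩ := hφ.alternating
    refine ⟨algebraMap k B t • f, ?_⟩
    rw [← hf]
    funext v
    simp [Algebra.smul_def]
  continuous := by
    obtain ⟨N, hN⟩ := hφ.continuous
    exact ⟨N, fun v hv => by rw [Pi.smul_apply, hN v hv, smul_zero]⟩

variable (ev)

/-- The pairing `f ω ↦ f · ev (ω(η))` of `∫ Ω¹` with a vector field `η` on `A`. -/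
def contract (η : Derivation k A A) : LoopForms ev →ₗ[A] ArcRing ev :=
  (TensorProduct.rid A (ArcRing ev)).toLinearMap ∘ₗ
    η.liftKaehlerDifferential.lTensor (ArcRing ev)

/-- The element `η_i` of `L⁺Θ`, as a continuous linear form on `∫ Ω¹`; it sends `z^j ω` to
`(ω(η))_{i-j}`, and to `0` if `i < j`. -/
def thetaForm (η : Derivation k A A) (i : ℕ) (v : LoopForms ev) : B :=
  ArcRing.coeff ev i (contract ev η v)

/-- The cochain `b · (η^1)_{i_1} ∧ ⋯ ∧ (η^n)_{i_n}`. -/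
def thetaWedge {n : ℕ} (b : B) (η : Fin n → Derivation k A A) (i : Fin n → ℕ)
    (v : Fin n → LoopForms ev) : B :=
  b * Matrix.det (Matrix.of fun p q => thetaForm ev (η p) (i p) (v q))

/-- The polynomial `(1 / i!) (λ_q + δ)^i (η ⊗ 1)` in `B[λ_1, …, λ_n]`, evaluated at `a ∈ A`. -/
def thetaLam (δ : Derivation k B B) {n : ℕ} (η : Derivation k A A) (i : ℕ) (q : Fin n) (a : A) :
    MvPolynomial (Fin n) B :=
  ((i.factorial : k)⁻¹) • ((coefMap δ.toLinearMap + LinearMap.mulLeft k (MvPolynomial.X q) :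
    Module.End k (MvPolynomial (Fin n) B)) ^ i) (MvPolynomial.C (jet ev 0 (η a)))

/-- The polynomial `φ(e^{λ_1 z} da_1, …, e^{λ_n z} da_n)`. -/
def expEval {n : ℕ} (φ : (Fin n → LoopForms ev) → B) (a : Fin n → A) : MvPolynomial (Fin n) B :=
  ∑ᶠ m : Fin n →₀ ℕ, MvPolynomial.monomial m
    ((∏ q, ((m q).factorial : k))⁻¹ • φ fun q => formGen ev (ArcRing.z ev ^ m q) (a q))

end Loop

/-! ## Schemes over `k`, Poisson structures, arc spaces -/

section Schemes

variable {k : Type u} [Field k]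

variable (k) in
/-- Schemes over `k`. -/
abbrev SchOver : Type (u + 1) := Over (Spec (CommRingCat.of k))

/-- The functions on an affine open subscheme. -/
def Sec (X : SchOver k) (V : X.left.affineOpens) : Type u := Γ(X.left, V.1)

instance (X : SchOver k) (V : X.left.affineOpens) : CommRing (Sec X V) :=
  inferInstanceAs (CommRing Γ(X.left, V.1))

/-- The `k`-algebra structure given by the composite `Spec Γ(X, V) ⟶ X ⟶ Spec k`. -/
instance (X : SchOver k) (V : X.left.affineOpens) : Algebra k (Sec X V) :=
  RingHom.toAlgebra (Spec.preimage (V.2.fromSpec ≫ X.hom)).hom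

variable (k) in
/-- `Spec R` as a scheme over `k`. -/
def specOver (R : Type u) [CommRing R] [Algebra k R] : SchOver k :=
  Over.mk (Spec.map (CommRingCat.ofHom (algebraMap k R)))

/-- The morphism of spectra given by a homomorphism of `k`-algebras. -/
def specOverMap {R S : Type u} [CommRing R] [Algebra k R] [CommRing S] [Algebra k S]
    (f : R →ₐ[k] S) : specOver k S ⟶ specOver k R :=
  Over.homMk (Spec.map (CommRingCat.ofHom (f : R →+* S))) (by
    simp only [specOver, Over.mk_left, Over.mk_hom]
    rw [← Spec.map_comp, ← CommRingCat.ofHom_comp, AlgHom.comp_algebraMap_of_tower])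

/-- The inclusion of an affine open subscheme. -/
def affineIncl (X : SchOver k) (V : X.left.affineOpens) : specOver k (Sec X V) ⟶ X :=
  Over.homMk V.2.fromSpec (by
    simp only [specOver, Over.mk_hom]
    exact (Spec.map_preimage _).symm)

/-- Restriction of functions. -/
def secRes (X : SchOver k) {V' V : X.left.affineOpens} (h : V'.1 ≤ V.1) : Sec X V →ₐ[k] Sec X V' where
  toRingHom := (X.left.presheaf.map (homOfLE h).op).hom
  commutes' c := by
    have h1 : Spec.preimage (V.2.fromSpec ≫ X.hom) ≫ X.left.presheaf.map (homOfLE h).op =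
        Spec.preimage (V'.2.fromSpec ≫ X.hom) := by
      apply Spec.map_injective
      rw [Spec.map_comp, Spec.map_preimage, Spec.map_preimage, ← Category.assoc,
        V.2.map_fromSpec V'.2]
    exact congrArg (fun g => g.hom c) h1

/-- A Poisson structure on a scheme: Poisson brackets on the algebras of functions of the affine open
subschemes, compatible with restriction. -/
structure PoissonStr (M : SchOver k) where
  bracket : ∀ U : M.left.affineOpens, PoissonBracket k (Sec M U)
  res : ∀ {U' U : M.left.affineOpens} (h : U'.1 ≤ U.1) (a b : Sec M U),
    (bracket U').br (secRes M h a) (secRes M h b) = secRes M h ((bracket U).br a b)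

/-- The arc space of `M`: a scheme `X` that represents the functor `R ↦ M(R[[z]])` on `k`-algebras.
It is unique up to unique isomorphism. -/
structure ArcSpace (M : SchOver k) where
  X : SchOver k
  rep : ∀ (R : Type u) [CommRing R] [Algebra k R],
    (specOver k R ⟶ X) ≃ (specOver k (PowerSeries R) ⟶ M)
  natural : ∀ {R S : Type u} [CommRing R] [Algebra k R] [CommRing S] [Algebra k S] (f : R →ₐ[k] S)
    (x : specOver k R ⟶ X),
    rep S (specOverMap f ≫ x) = specOverMap (PowerSeries.mapAlgHom f) ≫ rep R x

/-- The data of an affine open `U ⊆ M` and an affine open `V ⊆ X` such that the evaluation morphism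
`Spec Γ(X, V)[[z]] ⟶ M` factors through `U`, together with the homomorphism
`ev : Γ(M, U) → Γ(X, V)[[z]]` that gives the factorization. -/
structure Chart {M : SchOver k} (L : ArcSpace M) where
  U : M.left.affineOpens
  V : L.X.left.affineOpens
  ev : Sec M U →ₐ[k] PowerSeries (Sec L.X V)
  fac : specOverMap ev ≫ affineIncl M U = L.rep (Sec L.X V) (affineIncl L.X V)

end Schemes


/-! ## The complex of a Poisson vertex scheme -/

section PVScheme

variable {k : Type u} [Field k]

/-- The structure of a Poisson vertex scheme on `X`: Poisson vertex algebra structures on the algebras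
of functions of the affine open subschemes, compatible with restriction. -/
structure PVStr (X : SchOver k) where
  pva : ∀ V : X.left.affineOpens, PVA k (Sec X V)
  res_δ : ∀ {V' V : X.left.affineOpens} (h : V'.1 ≤ V.1) (b : Sec X V),
    (pva V').δ (secRes X h b) = secRes X h ((pva V).δ b)
  res_br : ∀ {V' V : X.left.affineOpens} (h : V'.1 ≤ V.1) (a b : Sec X V),
    (pva V').br (secRes X h a) (secRes X h b) =
      ((pva V).br a b).map (secRes X h : Sec X V →+* Sec X V')

variable {X : SchOver k} (S : PVStr X)

/-- The restriction map `Γ(V)[λ_1, …, λ_n] / (δ + ∑ λ_i) → Γ(V')[λ_1, …, λ_n] / (δ + ∑ λ_i)`. -/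
def PVStr.lamRes {V' V : X.left.affineOpens} (h : V'.1 ≤ V.1) (n : ℕ) :
    LamQuot (S.pva V).δ n →ₗ[k] LamQuot (S.pva V').δ n :=
  LamQuot.map (MvPolynomial.mapAlgHom (secRes X h)).toLinearMap (by
    refine mv_ext fun m b => ?_
    have h1 : ((S.pva V').δ.toLinearMap) (secRes X h b) =
      secRes X h ((S.pva V).δ.toLinearMap b) := S.res_δ h b
    simp [totalOp, coefMap_monomial, MvPolynomial.map_monomial, h1])

/-- Families of maps `Γ(V)^n → Γ(V)[λ_1, …, λ_n] / (δ + ∑ λ_i)`, for the affine opens `V ⊆ W`. -/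
abbrev PVStr.Fam (n : ℕ) (W : Opens X.left) : Type u :=
  ∀ V : {V : X.left.affineOpens // V.1 ≤ W},
    (Fin n → Sec X V.1) → LamQuot (S.pva V.1).δ n

/-- The sections over `W` of the sheaf of polyderivation cochains of degree `n` of `𝒪_X`: families of
polyderivation cochains that are compatible with restriction. -/
def PVStr.cochains (n : ℕ) (W : Opens X.left) : Submodule k (S.Fam n W) where
  carrier := {Y | (∀ V, (S.pva V.1).IsCochain (Y V)) ∧
    ∀ (V V' : {V : X.left.affineOpens // V.1 ≤ W}) (h : V'.1.1 ≤ V.1.1) (a : Fin n → Sec X V.1),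
      Y V' (fun q => secRes X h (a q)) = S.lamRes h n (Y V a)}
  add_mem' := by
    rintro Y Z ⟨hY, hY'⟩ ⟨hZ, hZ'⟩
    refine ⟨fun V => (hY V).add _ (hZ V), fun V V' h a => ?_⟩
    simp only [Pi.add_apply, hY' V V' h, hZ' V V' h, map_add]
  zero_mem' := ⟨fun V => PVA.IsCochain.zero _, fun V V' h a => by simp⟩
  smul_mem' := by
    rintro t Y ⟨hY, hY'⟩
    refine ⟨fun V => (hY V).smul _ t, fun V V' h a => ?_⟩
    simp only [Pi.smul_apply, hY' V V' h, map_smul]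

/-- Restriction of sections. -/
def PVStr.res (n : ℕ) {W' W : Opens X.left} (f : W' ≤ W) :
    S.cochains n W →ₗ[k] S.cochains n W' where
  toFun Y := ⟨fun V => Y.1 ⟨V.1, V.2.trans f⟩, fun V => Y.2.1 ⟨V.1, V.2.trans f⟩,
    fun V V' h a => Y.2.2 ⟨V.1, V.2.trans f⟩ ⟨V'.1, V'.2.trans f⟩ h a⟩
  map_add' _ _ := rfl
  map_smul' _ _ := rfl

/-- The differential of the Poisson vertex algebra complex, on families. -/
def PVStr.famD (n : ℕ) (W : Opens X.left) : S.Fam n W →ₗ[k] S.Fam (n + 1) W where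
  toFun Y V := (S.pva V.1).d (Y V)
  map_add' Y Z := by funext V a; exact PVA.d_add _ _ _ _
  map_smul' t Y := by funext V a; exact PVA.d_smul _ _ _ _

/-- The differential maps cochains to cochains, and its square is `0`. -/
structure PVStr.IsComplex : Prop where
  mem : ∀ n W, ∀ Y ∈ S.cochains n W, S.famD n W Y ∈ S.cochains (n + 1) W
  sq : ∀ n W, ∀ Y ∈ S.cochains n W, S.famD (n + 1) W (S.famD n W Y) = 0

/-- Polyderivation cochains of degree `n`, as a presheaf. -/
def PVStr.presheaf (n : ℕ) : (Opens X.left)ᵒᵖ ⥤ ModuleCat.{u} k where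
  obj W := ModuleCat.of k (S.cochains n W.unop)
  map f := ModuleCat.ofHom (S.res n f.unop.le)

/-- The differential on cochains of degree `n`. -/
def PVStr.presheafD (h : S.IsComplex) (n : ℕ) : S.presheaf n ⟶ S.presheaf (n + 1) where
  app W := ModuleCat.ofHom ((S.famD n W.unop).restrict (h.mem n W.unop))

/-- The Poisson vertex algebra complex of `𝒪_X`, as a complex of presheaves. -/
def PVStr.presheafComplex (h : S.IsComplex) :
    CochainComplex ((Opens X.left)ᵒᵖ ⥤ ModuleCat.{u} k) ℕ :=
  CochainComplex.of S.presheaf (S.presheafD h)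
    (fun n => by
      ext W Y
      exact Subtype.ext (h.sq n W.unop Y.1 Y.2))

variable (X) in
/-- The functor that replaces a complex of presheaves by the complex of the associated sheaves. -/
abbrev sheafify : CochainComplex ((Opens X.left)ᵒᵖ ⥤ ModuleCat.{u} k) ℕ ⥤
    CochainComplex (Sheaf (Opens.grothendieckTopology X.left) (ModuleCat.{u} k)) ℕ :=
  (presheafToSheaf (Opens.grothendieckTopology X.left) (ModuleCat.{u} k)).mapHomologicalComplex
    (ComplexShape.up ℕ)

/-- The Poisson vertex algebra complex `C_PV(X, 𝒪)`, a complex of sheaves on `X`. -/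
def PVStr.complex (h : S.IsComplex) :
    CochainComplex (Sheaf (Opens.grothendieckTopology X.left) (ModuleCat.{u} k)) ℕ :=
  (sheafify X).obj (S.presheafComplex h)

end PVScheme

/-! ## The loop de Rham–Lie complex -/

section LoopComplex

variable {k : Type u} [Field k] {M : SchOver k} {L : ArcSpace M}

/-- The Poisson vertex structure of the arc space of a Poisson scheme: the derivation is
`a_i ↦ (i + 1) a_{i+1}`, and `{a_λ b} = {a, b}` for functions `a`, `b` on `M`. -/
structure PVStr.IsArc (S : PVStr L.X) (P : PoissonStr M) : Prop where
  δ : ∀ c : Chart L, IsArcDerivation c.ev (S.pva c.V).δ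
  br : ∀ (c : Chart L) (a b : Sec M c.U), (S.pva c.V).br (jet c.ev 0 a) (jet c.ev 0 b) =
    Polynomial.C (jet c.ev 0 ((P.bracket c.U).br a b))

variable (L) in
/-- Families of maps `(∫ Ω¹)^n → 𝒪`, for the charts inside `W`. -/
abbrev LoopFam (n : ℕ) (W : Opens L.X.left) : Type u :=
  ∀ c : {c : Chart L // c.V.1 ≤ W}, (Fin n → LoopForms c.1.ev) → Sec L.X c.1.V

variable (L) in
/-- The sections over `W` of the sheaf of continuous de Rham–Lie cochains of degree `n`: families of
cochains that are compatible with restriction. Compatibility is tested on the elements `z^m da`, which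
determine a cochain since their `B`-span is dense. -/
def loopCochains (n : ℕ) (W : Opens L.X.left) : Submodule k (LoopFam L n W) where
  carrier := {φ | (∀ c, IsLoopCochain (φ c)) ∧
    ∀ (c c' : {c : Chart L // c.V.1 ≤ W}) (hU : c'.1.U.1 ≤ c.1.U.1) (hV : c'.1.V.1 ≤ c.1.V.1)
      (m : Fin n → ℕ) (a : Fin n → Sec M c.1.U),
      φ c' (fun q => formGen c'.1.ev (ArcRing.z c'.1.ev ^ m q) (secRes M hU (a q))) =
        secRes L.X hV (φ c fun q => formGen c.1.ev (ArcRing.z c.1.ev ^ m q) (a q))}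
  add_mem' := by
    rintro Y Z ⟨hY, hY'⟩ ⟨hZ, hZ'⟩
    refine ⟨fun c => (hY c).add (hZ c), fun c c' hU hV m a => ?_⟩
    simp only [Pi.add_apply, hY' c c' hU hV, hZ' c c' hU hV, map_add]
  zero_mem' := ⟨fun c => IsLoopCochain.zero, fun c c' hU hV m a => by simp⟩
  smul_mem' := by
    rintro t Y ⟨hY, hY'⟩
    refine ⟨fun c => (hY c).smul t, fun c c' hU hV m a => ?_⟩
    simp only [Pi.smul_apply, hY' c c' hU hV, map_smul]

variable (L) in
/-- Restriction of sections. -/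
def loopRes (n : ℕ) {W' W : Opens L.X.left} (f : W' ≤ W) :
    loopCochains L n W →ₗ[k] loopCochains L n W' where
  toFun φ := ⟨fun c => φ.1 ⟨c.1, c.2.trans f⟩, fun c => φ.2.1 ⟨c.1, c.2.trans f⟩,
    fun c c' hU hV m a => φ.2.2 ⟨c.1, c.2.trans f⟩ ⟨c'.1, c'.2.trans f⟩ hU hV m a⟩
  map_add' _ _ := rfl
  map_smul' _ _ := rfl

/-- The de Rham–Lie differential, on families. -/
def loopFamD (𝒜 : ∀ c : Chart L, TopLieAlgebroid c.ev) (n : ℕ) (W : Opens L.X.left) :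
    LoopFam L n W →ₗ[k] LoopFam L (n + 1) W where
  toFun φ c := (𝒜 c.1).d (φ c)
  map_add' φ ψ := by funext c v; exact TopLieAlgebroid.d_add _ _ _ _
  map_smul' t φ := by funext c v; exact TopLieAlgebroid.d_smul _ _ _ _

/-- The operator `δ`, on families. -/
def loopFamDelta {S : PVStr L.X} {P : PoissonStr M} (h : S.IsArc P) (n : ℕ)
    (W : Opens L.X.left) : LoopFam L n W →ₗ[k] LoopFam L n W where
  toFun φ c := cochainDelta _ (h.δ c.1) (φ c)
  map_add' φ ψ := by funext c v; exact cochainDelta_add _ _ _ _ _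
  map_smul' t φ := by funext c v; exact cochainDelta_smul _ _ _ _ _

/-- The differential and `δ` map cochains to cochains, the square of the differential is `0`, and
`δ` commutes with the differential. -/
structure IsLoopComplex (𝒜 : ∀ c : Chart L, TopLieAlgebroid c.ev) {S : PVStr L.X}
    {P : PoissonStr M} (h : S.IsArc P) : Prop where
  mem : ∀ n W, ∀ φ ∈ loopCochains L n W, loopFamD 𝒜 n W φ ∈ loopCochains L (n + 1) W
  sq : ∀ n W, ∀ φ ∈ loopCochains L n W, loopFamD 𝒜 (n + 1) W (loopFamD 𝒜 n W φ) = 0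
  mem_δ : ∀ n W, ∀ φ ∈ loopCochains L n W, loopFamDelta h n W φ ∈ loopCochains L n W
  comm : ∀ n W, ∀ φ ∈ loopCochains L n W,
    loopFamD 𝒜 n W (loopFamDelta h n W φ) = loopFamDelta h (n + 1) W (loopFamD 𝒜 n W φ)

variable (L) in
/-- Continuous de Rham–Lie cochains of degree `n`, as a presheaf. -/
def loopPresheaf (n : ℕ) : (Opens L.X.left)ᵒᵖ ⥤ ModuleCat.{u} k where
  obj W := ModuleCat.of k (loopCochains L n W.unop)
  map f := ModuleCat.ofHom (loopRes L n f.unop.le)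

variable {𝒜 : ∀ c : Chart L, TopLieAlgebroid c.ev} {S : PVStr L.X} {P : PoissonStr M}
  {h : S.IsArc P}

/-- The de Rham–Lie differential on cochains of degree `n`. -/
def loopPresheafD (hL : IsLoopComplex 𝒜 h) (n : ℕ) : loopPresheaf L n ⟶ loopPresheaf L (n + 1) where
  app W := ModuleCat.ofHom ((loopFamD 𝒜 n W.unop).restrict (hL.mem n W.unop))

/-- The big loop de Rham–Lie complex, as a complex of presheaves. -/
def loopPresheafComplex (hL : IsLoopComplex 𝒜 h) :
    CochainComplex ((Opens L.X.left)ᵒᵖ ⥤ ModuleCat.{u} k) ℕ :=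
  CochainComplex.of (loopPresheaf L) (loopPresheafD hL)
    (fun n => by
      ext W φ
      exact Subtype.ext (hL.sq n W.unop φ.1 φ.2))

/-- The endomorphism `δ` of the big loop de Rham–Lie complex. -/
def loopPresheafDelta (hL : IsLoopComplex 𝒜 h) : loopPresheafComplex hL ⟶ loopPresheafComplex hL :=
  CochainComplex.ofHom (X := loopPresheafComplex hL) (Y := loopPresheafComplex hL)
    (fun n => { app := fun W =>
      ModuleCat.ofHom ((loopFamDelta h n W.unop).restrict (hL.mem_δ n W.unop)) })
    (fun n => by
      have hd : (loopPresheafComplex hL).d n (n + 1) = loopPresheafD hL n :=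
        CochainComplex.of_d ..
      rw [hd]
      ext W φ
      exact Subtype.ext (hL.comm n W.unop φ.1 φ.2))

/-- The loop de Rham–Lie complex: the quotient by `δ` of the big loop de Rham–Lie complex, in complexes
of sheaves on the arc space. -/
def loopComplex (hL : IsLoopComplex 𝒜 h) :
    CochainComplex (Sheaf (Opens.grothendieckTopology L.X.left) (ModuleCat.{u} k)) ℕ :=
  Limits.cokernel ((sheafify L.X).map (loopPresheafDelta hL))

/-- The projection of the big loop de Rham–Lie complex to its quotient by `δ`. -/
def loopProj (hL : IsLoopComplex 𝒜 h) :
    (sheafify L.X).obj (loopPresheafComplex hL) ⟶ loopComplex hL :=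
  Limits.cokernel.π _

/-- The family of Poisson vertex algebra cochains that corresponds to a section of the big complex
under a morphism of complexes of presheaves. -/
def imageFam {hL : IsLoopComplex 𝒜 h} {hP : S.IsComplex}
    (Φ : loopPresheafComplex hL ⟶ S.presheafComplex hP) (n : ℕ) (W : Opens L.X.left)
    (φ : loopCochains L n W) : S.cochains n W :=
  ((Φ.f n).app (op W)).hom φ

end LoopComplex

end LoopPoisson
end

noncomputable section

namespace LoopPoisson

/-! ## Divided powers of operators -/

section DividedPowers

variable {k : Type*} [Field k]

/-- The divided power `D^l / l!` of an operator. -/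
def dpw {N : Type*} [AddCommGroup N] [Module k N] (D : N →ₗ[k] N) (l : ℕ) : N →ₗ[k] N :=
  ((l.factorial : k)⁻¹) • (D ^ l : Module.End k N)

variable {N : Type*} [AddCommGroup N] [Module k N]

theorem dpw_apply (D : N →ₗ[k] N) (l : ℕ) (v : N) :
    dpw D l v = ((l.factorial : k)⁻¹) • (D ^ l : Module.End k N) v := rfl

@[simp] theorem dpw_zero (D : N →ₗ[k] N) (v : N) : dpw D 0 v = v := by
  simp [dpw]

theorem dpw_comm (D : N →ₗ[k] N) (l : ℕ) (v : N) : D (dpw D l v) = dpw D l (D v) := by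
  rw [dpw_apply, dpw_apply, map_smul]
  congr 1
  rw [← Module.End.mul_apply, ← Module.End.mul_apply, ← pow_succ', ← pow_succ]

variable [CharZero k]

theorem succ_smul_dpw_succ (D : N →ₗ[k] N) (l : ℕ) (v : N) :
    (l + 1) • dpw D (l + 1) v = D (dpw D l v) := by
  have h : ((l : k) + 1) ≠ 0 := by exact_mod_cast Nat.succ_ne_zero l
  rw [← Nat.cast_smul_eq_nsmul k, dpw_apply, dpw_apply, map_smul, smul_smul, Nat.factorial_succ,
    pow_succ', Module.End.mul_apply]
  congr 1
  push_cast
  field_simp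

theorem dpw_succ (D : N →ₗ[k] N) (l : ℕ) (v : N) :
    dpw D (l + 1) v = (((l + 1 : ℕ) : k)⁻¹) • D (dpw D l v) := by
  rw [← succ_smul_dpw_succ, ← Nat.cast_smul_eq_nsmul k, smul_smul, inv_mul_cancel₀, one_smul]
  exact_mod_cast Nat.succ_ne_zero l

/-- The Leibniz rule for divided powers. -/
theorem dpw_leibniz {X P : Type*} [AddCommGroup X] [Module k X] [AddCommGroup P] [Module k P]
    (δ : X →ₗ[k] X) (D : N →ₗ[k] N) (E : P →ₗ[k] P) (μ : X →ₗ[k] N →ₗ[k] P)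
    (h : ∀ x v, E (μ x v) = μ (δ x) v + μ x (D v)) (l : ℕ) (x : X) (v : N) :
    dpw E l (μ x v) = ∑ p ∈ Finset.HasAntidiagonal.antidiagonal l, μ (dpw δ p.1 x) (dpw D p.2 v) := by
  have key : (E ^ l : Module.End k P) (μ x v) = ∑ p ∈ Finset.HasAntidiagonal.antidiagonal l,
      l.choose p.1 • μ ((δ ^ p.1 : Module.End k X) x) ((D ^ p.2 : Module.End k N) v) := by
    induction l with
    | zero => simp
    | succ l ih =>
      rw [Finset.sum_antidiagonal_choose_succ_nsmul (M := P)
        (fun i j => μ ((δ ^ i : Module.End k X) x) ((D ^ j : Module.End k N) v)) l,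
        pow_succ', Module.End.mul_apply, ih, map_sum, ← Finset.sum_add_distrib]
      refine Finset.sum_congr rfl fun p hp => ?_
      rw [map_nsmul, h, ← Module.End.mul_apply, ← Module.End.mul_apply, ← pow_succ', ← pow_succ',
        smul_add, add_comm, Nat.choose_symm_of_eq_add (Finset.HasAntidiagonal.mem_antidiagonal.mp hp).symm]
  rw [dpw_apply, key, Finset.smul_sum]
  refine Finset.sum_congr rfl fun p hp => ?_
  obtain ⟨p, q⟩ := p
  have hp' : p + q = l := Finset.HasAntidiagonal.mem_antidiagonal.mp hp
  subst hp'
  simp only [dpw_apply, map_smul, LinearMap.smul_apply, smul_smul]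
  rw [← Nat.cast_smul_eq_nsmul k, smul_smul]
  congr 1
  have h1 : ((p + q).factorial : k) ≠ 0 := by exact_mod_cast (p + q).factorial_ne_zero
  have h2 : (p.factorial : k) ≠ 0 := by exact_mod_cast p.factorial_ne_zero
  have h3 : (q.factorial : k) ≠ 0 := by exact_mod_cast q.factorial_ne_zero
  have h4 : ((p + q).choose p : k) * p.factorial * q.factorial = (p + q).factorial := by
    rw [Nat.choose_symm_add]
    exact_mod_cast Nat.add_choose_mul_factorial_mul_factorial p q
  field_simp
  linear_combination h4

end DividedPowers

section NilpotentAction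

variable {k B : Type*} [Field k] [CommRing B] [Algebra k B] (δ : Derivation k B B)

/-- `δ^l x / l!`. -/
abbrev dpow (l : ℕ) (x : B) : B := dpw δ.toLinearMap l x

theorem dpow_iterate (l : ℕ) (x : B) : dpow δ l x = ((l.factorial : k)⁻¹) • (δ^[l]) x := by
  rw [dpow, dpw_apply, Module.End.pow_apply]; rfl

theorem dpow_one_of_ne {l : ℕ} (h : l ≠ 0) : dpow δ l (1 : B) = 0 := by
  obtain ⟨l, rfl⟩ := Nat.exists_eq_succ_of_ne_zero h
  rw [dpow_iterate, Function.iterate_succ_apply, Derivation.map_one_eq_zero, iterate_map_zero,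
    smul_zero]

variable [CharZero k]

theorem dpow_mul (l : ℕ) (x y : B) :
    dpow δ l (x * y) = ∑ p ∈ Finset.HasAntidiagonal.antidiagonal l, dpow δ p.1 x * dpow δ p.2 y :=
  dpw_leibniz δ.toLinearMap δ.toLinearMap δ.toLinearMap (LinearMap.mul k B) (fun x y => by
    simp [mul_comm, add_comm]) l x y

variable {N : Type*} [AddCommGroup N] [Module k N] [Module B N] [IsScalarTower k B N]

/-- The action `x ↦ ∑ (δ^l x / l!) S^l` of `B` on a module with a locally nilpotent operator. -/
def twist (S : N →ₗ[B] N) (hS : ∀ v, ∃ K, (S ^ K : Module.End B N) v = 0) :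
    B →ₐ[k] Module.End k N := by
  have hz : ∀ {v K}, (S ^ K : Module.End B N) v = 0 → ∀ l, K ≤ l → (S ^ l : Module.End B N) v = 0 := by
    intro v K hK l hl
    obtain ⟨j, rfl⟩ := Nat.exists_eq_add_of_le' hl
    rw [pow_add, Module.End.mul_apply, hK, map_zero]
  have hsum : ∀ {v K}, (S ^ K : Module.End B N) v = 0 → ∀ x : B,
      ∑ᶠ l, dpow δ l x • (S ^ l : Module.End B N) v =
        ∑ l ∈ Finset.range K, dpow δ l x • (S ^ l : Module.End B N) v := by
    intro v K hK x
    refine finsum_eq_sum_of_support_subset _ fun l hl => ?_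
    rw [Finset.mem_coe, Finset.mem_range]
    by_contra h
    exact hl (by simp only [hz hK l (not_lt.mp h), smul_zero])
  let T : B → Module.End k N := fun x =>
    { toFun := fun v => ∑ᶠ l, dpow δ l x • (S ^ l : Module.End B N) v
      map_add' := fun v w => by
        obtain ⟨K, hK⟩ := hS v
        obtain ⟨K', hK'⟩ := hS w
        have h1 := hz hK (max K K') (le_max_left _ _)
        have h2 := hz hK' (max K K') (le_max_right _ _)
        have h3 : (S ^ max K K' : Module.End B N) (v + w) = 0 := by rw [map_add, h1, h2, add_zero]
        rw [hsum h1, hsum h2, hsum h3, ← Finset.sum_add_distrib]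
        simp only [map_add, smul_add]
      map_smul' := fun c v => by
        obtain ⟨K, hK⟩ := hS v
        have hc : ∀ l, (S ^ l : Module.End B N) (c • v) = c • (S ^ l : Module.End B N) v := fun l => by
          rw [← algebraMap_smul B c v, map_smul, algebraMap_smul]
        have h2 : (S ^ K : Module.End B N) (c • v) = 0 := by rw [hc, hK, smul_zero]
        rw [hsum hK, hsum h2, RingHom.id_apply, Finset.smul_sum]
        refine Finset.sum_congr rfl fun l _ => ?_
        rw [hc, ← algebraMap_smul B c ((S ^ l : Module.End B N) v), smul_comm, algebraMap_smul] }
  have hT : ∀ {v K}, (S ^ K : Module.End B N) v = 0 → ∀ x : B,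
      T x v = ∑ l ∈ Finset.range K, dpow δ l x • (S ^ l : Module.End B N) v := fun hK x => hsum hK x
  refine AlgHom.ofLinearMap
    { toFun := T
      map_add' := fun x y => LinearMap.ext fun v => ?_
      map_smul' := fun c x => LinearMap.ext fun v => ?_ } (LinearMap.ext fun v => ?_)
      fun x y => LinearMap.ext fun v => ?_
  · obtain ⟨K, hK⟩ := hS v
    rw [LinearMap.add_apply, hT hK, hT hK, hT hK, ← Finset.sum_add_distrib]
    simp only [dpow, map_add, add_smul]
  · obtain ⟨K, hK⟩ := hS v
    rw [LinearMap.smul_apply, hT hK, hT hK, RingHom.id_apply, Finset.smul_sum]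
    simp only [dpow, map_smul, smul_assoc]
  · obtain ⟨K, hK⟩ := hS v
    have hK1 := hz hK (K + 1) (Nat.le_succ K)
    simp only [LinearMap.coe_mk, AddHom.coe_mk]
    rw [hT hK1, Finset.sum_eq_single 0]
    · simp
    · intro l _ hl
      rw [dpow_one_of_ne δ hl, zero_smul]
    · simp
  · obtain ⟨K, hK⟩ := hS v
    simp only [LinearMap.coe_mk, AddHom.coe_mk]
    have hy : ∀ p, (S ^ p : Module.End B N) (T y v) =
        ∑ q ∈ Finset.range K, dpow δ q y • (S ^ (p + q) : Module.End B N) v := by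
      intro p
      rw [hT hK, map_sum]
      refine Finset.sum_congr rfl fun q _ => ?_
      rw [map_smul, pow_add, Module.End.mul_apply]
    have hKy : (S ^ K : Module.End B N) (T y v) = 0 := by
      rw [hy]
      exact Finset.sum_eq_zero fun q _ => by rw [hz hK _ (Nat.le_add_right _ _), smul_zero]
    rw [Module.End.mul_apply, hT hK, hT hKy]
    simp only [hy, Finset.smul_sum, dpow_mul, Finset.sum_smul]
    rw [Finset.sum_sigma', ← Finset.sum_product' (f := fun p q => dpow δ p x • dpow δ q y • (S ^ (p + q) : Module.End B N) v)]
    refine Finset.sum_of_injOn (fun s => s.2) ?_ ?_ ?_ ?_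
    · rintro ⟨l, p, q⟩ h ⟨l', p', q'⟩ h' e
      simp only [Finset.coe_sigma, Set.mem_sigma_iff, Finset.mem_coe, Finset.HasAntidiagonal.mem_antidiagonal] at h h'
      rw [← h.2, ← h'.2]
      cases e
      rfl
    · rintro ⟨l, p, q⟩ h
      simp only [Finset.coe_sigma, Set.mem_sigma_iff, Finset.mem_coe, Finset.HasAntidiagonal.mem_antidiagonal,
        Finset.mem_range] at h
      simp only [Finset.coe_product, Set.mem_prod, Finset.mem_coe, Finset.mem_range]
      omega
    · rintro ⟨p, q⟩ h h'
      have : K ≤ p + q := by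
        by_contra hc
        refine h' ⟨⟨p + q, p, q⟩, ?_, rfl⟩
        simp only [Finset.coe_sigma, Set.mem_sigma_iff, Finset.mem_coe, Finset.HasAntidiagonal.mem_antidiagonal,
          Finset.mem_range, and_true]
        omega
      simp only [hz hK _ this, smul_zero]
    · rintro ⟨l, p, q⟩ h
      have h2 := (Finset.mem_sigma.mp h).2
      rw [Finset.HasAntidiagonal.mem_antidiagonal] at h2
      simp only at h2
      simp only [smul_smul, h2]

theorem twist_eq_sum (S : N →ₗ[B] N) (hS : ∀ v, ∃ K, (S ^ K : Module.End B N) v = 0) (x : B) {v : N}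
    {K : ℕ} (hK : ∀ l, K ≤ l → (S ^ l : Module.End B N) v = 0) :
    twist (k := k) δ S hS x v = ∑ l ∈ Finset.range K, dpow δ l x • (S ^ l : Module.End B N) v := by
  refine finsum_eq_sum_of_support_subset _ fun l hl => ?_
  rw [Finset.mem_coe, Finset.mem_range]
  by_contra h
  exact hl (by simp only [hK l (not_lt.mp h), smul_zero])

end NilpotentAction

/-! ## Coefficients with respect to divided powers of the variables -/

section DividedCoefficients

variable {k B : Type*} [Field k] [CommRing B] [Algebra k B] {n : ℕ}

/-- The number `∏ m_q!`. -/
def mfact (m : Fin n →₀ ℕ) : ℕ := ∏ q, (m q).factorial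

theorem mfact_ne_zero (m : Fin n →₀ ℕ) : mfact m ≠ 0 :=
  Finset.prod_ne_zero_iff.mpr fun q _ => (m q).factorial_ne_zero

theorem mfact_add_single (m : Fin n →₀ ℕ) (q : Fin n) :
    mfact (m + Finsupp.single q 1) = mfact m * (m q + 1) := by
  rw [mfact, mfact, ← Finset.mul_prod_erase _ _ (Finset.mem_univ q),
    ← Finset.mul_prod_erase _ (fun q => (m q).factorial) (Finset.mem_univ q)]
  have h : ∀ p ∈ Finset.univ.erase q, ((m + Finsupp.single q 1 : Fin n →₀ ℕ) p).factorial = (m p).factorial := by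
    intro p hp
    rw [Finsupp.add_apply, Finsupp.single_eq_of_ne (Finset.ne_of_mem_erase hp), add_zero]
  rw [Finset.prod_congr rfl h, Finsupp.add_apply, Finsupp.single_eq_same, Nat.factorial_succ]
  ring

/-- The coefficient of `∏ λ_q^{m_q} / m_q!`. -/
def dcoeff (m : Fin n →₀ ℕ) : MvPolynomial (Fin n) B →ₗ[B] B := mfact m • MvPolynomial.lcoeff B m

theorem dcoeff_apply (m : Fin n →₀ ℕ) (p : MvPolynomial (Fin n) B) :
    dcoeff m p = mfact m • MvPolynomial.coeff m p := rfl

theorem dcoeff_smul (m : Fin n →₀ ℕ) (c : k) (p : MvPolynomial (Fin n) B) :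
    dcoeff m (c • p) = c • dcoeff m p := by
  rw [dcoeff_apply, dcoeff_apply, MvPolynomial.coeff_smul, smul_comm]

theorem dcoeff_C_mul (m : Fin n →₀ ℕ) (b : B) (p : MvPolynomial (Fin n) B) :
    dcoeff m (MvPolynomial.C b * p) = b * dcoeff m p := by
  rw [← MvPolynomial.smul_eq_C_mul, map_smul, smul_eq_mul]

theorem dcoeff_monomial (m m' : Fin n →₀ ℕ) (b : B) :
    dcoeff m (MvPolynomial.monomial m' b) = if m' = m then mfact m • b else 0 := by
  rw [dcoeff_apply, MvPolynomial.coeff_monomial, smul_ite, smul_zero]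

theorem dcoeff_X_mul (m : Fin n →₀ ℕ) (q : Fin n) (p : MvPolynomial (Fin n) B) :
    dcoeff m (MvPolynomial.X q * p) = m q • dcoeff (m - Finsupp.single q 1) p := by
  rw [dcoeff_apply, dcoeff_apply, MvPolynomial.coeff_X_mul']
  split_ifs with h
  · have h1 : m - Finsupp.single q 1 + Finsupp.single q 1 = m := by
      refine tsub_add_cancel_of_le (Finsupp.single_le_iff.mpr ?_)
      exact Nat.one_le_iff_ne_zero.mpr (Finsupp.mem_support_iff.mp h)
    have h2 := mfact_add_single (m - Finsupp.single q 1) q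
    have h3 : (m - Finsupp.single q 1 : Fin n →₀ ℕ) q + 1 = m q := by
      conv_rhs => rw [← h1]
      simp
    rw [h1, h3] at h2
    rw [h2, smul_smul, mul_comm]
  · rw [Finsupp.notMem_support_iff.mp h, zero_smul, smul_zero]

theorem dcoeff_pderiv_pow (m : Fin n →₀ ℕ) (q : Fin n) (l : ℕ) (p : MvPolynomial (Fin n) B) :
    dcoeff m (((MvPolynomial.pderiv q).toLinearMap ^ l : Module.End B (MvPolynomial (Fin n) B)) p) =
      dcoeff (m + Finsupp.single q l) p := by
  induction l generalizing m with
  | zero => simp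
  | succ l ih =>
    rw [pow_succ', Module.End.mul_apply]
    have h1 : ∀ r : MvPolynomial (Fin n) B, dcoeff m ((MvPolynomial.pderiv q).toLinearMap r) =
        dcoeff (m + Finsupp.single q 1) r := by
      intro r
      rw [dcoeff_apply, dcoeff_apply, show (MvPolynomial.pderiv q).toLinearMap r = MvPolynomial.pderiv q r from rfl,
        MvPolynomial.coeff_pderiv, mfact_add_single, mul_smul, nsmul_eq_mul (m q + 1), mul_comm]
      push_cast
      rfl
    rw [h1, ih, add_assoc, ← Finsupp.single_add, add_comm 1 l]

/-- The polynomial with given coefficients of the `∏ λ_q^{m_q} / m_q!`. -/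
def genPoly (k : Type*) [Field k] [Algebra k B] (f : (Fin n →₀ ℕ) → B) : MvPolynomial (Fin n) B :=
  ∑ᶠ m : Fin n →₀ ℕ, MvPolynomial.monomial m ((∏ q, ((m q).factorial : k))⁻¹ • f m)

theorem coe_mfact (m : Fin n →₀ ℕ) : (mfact m : k) = ∏ q, ((m q).factorial : k) := by
  simp [mfact]

theorem dcoeff_coefMap (m : Fin n →₀ ℕ) (D : B →ₗ[k] B) (p : MvPolynomial (Fin n) B) :
    dcoeff m (coefMap D p) = D (dcoeff m p) := by
  induction p using MvPolynomial.induction_on' with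
  | add p q hp hq => simp only [map_add, hp, hq]
  | monomial m' b =>
    rw [coefMap_monomial, dcoeff_monomial, dcoeff_monomial]
    split_ifs
    · rw [map_nsmul]
    · rw [map_zero]

theorem dcoeff_totalOp (δ : Derivation k B B) (m : Fin n →₀ ℕ) (p : MvPolynomial (Fin n) B) :
    dcoeff m (totalOp δ n p) = δ (dcoeff m p) + ∑ q, m q • dcoeff (m - Finsupp.single q 1) p := by
  rw [totalOp, LinearMap.add_apply, map_add, dcoeff_coefMap, LinearMap.mulLeft_apply, Finset.sum_mul,
    map_sum]
  simp only [dcoeff_X_mul]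
  rfl

theorem dcoeff_mapAlgHom {B' : Type*} [CommRing B'] [Algebra k B'] (f : B →ₐ[k] B')
    (m : Fin n →₀ ℕ) (p : MvPolynomial (Fin n) B) :
    dcoeff m (MvPolynomial.mapAlgHom f p) = f (dcoeff m p) := by
  rw [dcoeff_apply, dcoeff_apply, map_nsmul, MvPolynomial.mapAlgHom_apply]
  congr 1

theorem dcoeff_rename (τ : Equiv.Perm (Fin n)) (m : Fin n →₀ ℕ) (p : MvPolynomial (Fin n) B) :
    dcoeff m (MvPolynomial.rename τ p) = dcoeff (Finsupp.equivMapDomain τ.symm m) p := by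
  have h : m = Finsupp.mapDomain τ (Finsupp.equivMapDomain τ.symm m) := by
    ext q
    rw [← Finsupp.equivMapDomain_eq_mapDomain, Finsupp.equivMapDomain_apply,
      Finsupp.equivMapDomain_apply, Equiv.symm_symm, Equiv.apply_symm_apply]
  rw [dcoeff_apply, dcoeff_apply]
  conv_lhs => rw [h]
  rw [MvPolynomial.coeff_rename_mapDomain _ τ.injective, ← h]
  congr 1
  simp only [mfact, Finsupp.equivMapDomain_apply, Equiv.symm_symm]
  exact (Equiv.prod_comp τ fun q => (m q).factorial).symm

theorem dcoeff_ext (k : Type*) {B : Type*} [Field k] [CommRing B] [Algebra k B] [CharZero k] {n : ℕ}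
    {p p' : MvPolynomial (Fin n) B} (h : ∀ m, dcoeff m p = dcoeff m p') : p = p' := by
  refine MvPolynomial.ext _ _ fun m => ?_
  have h1 := h m
  rw [dcoeff_apply, dcoeff_apply, ← Nat.cast_smul_eq_nsmul k, ← Nat.cast_smul_eq_nsmul k] at h1
  exact smul_right_injective B (show (mfact m : k) ≠ 0 by exact_mod_cast mfact_ne_zero m) h1

theorem dcoeff_genPoly [CharZero k] {f : (Fin n →₀ ℕ) → B} (hf : f.support.Finite) (m : Fin n →₀ ℕ) :
    dcoeff m (genPoly k f) = f m := by
  have hs : (Function.support fun m : Fin n →₀ ℕ => (MvPolynomial.monomial m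
      ((∏ q, ((m q).factorial : k))⁻¹ • f m) : MvPolynomial (Fin n) B)) ⊆ hf.toFinset := by
    intro m hm
    rw [Finset.mem_coe, Set.Finite.mem_toFinset, Function.mem_support]
    rintro h
    exact hm (by simp only [h, smul_zero, map_zero])
  rw [genPoly, finsum_eq_sum_of_support_subset _ hs, map_sum]
  simp only [dcoeff_monomial]
  rw [Finset.sum_ite_eq']
  split_ifs with h
  · rw [← Nat.cast_smul_eq_nsmul k, smul_smul, coe_mfact, mul_inv_cancel₀, one_smul]
    rw [← coe_mfact]
    exact_mod_cast mfact_ne_zero m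
  · rw [Set.Finite.mem_toFinset, Function.mem_support, not_not] at h
    exact h.symm

theorem dcoeff_add_single_eq_zero (m : Fin n →₀ ℕ) (q : Fin n) (p : MvPolynomial (Fin n) B) :
    ∃ K, ∀ l, K ≤ l → dcoeff (m + Finsupp.single q l) p = 0 := by
  refine ⟨p.degreeOf q + 1, fun l hl => ?_⟩
  rw [dcoeff_apply, MvPolynomial.notMem_support_iff.mp
    (MvPolynomial.notMem_support_of_degreeOf_lt q ?_), smul_zero]
  simp only [Finsupp.add_apply, Finsupp.single_eq_same]
  omega

/-! ### The shift operators -/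

theorem pderiv_pow_eq_zero (k : Type*) {B : Type*} [Field k] [CommRing B] [Algebra k B] [CharZero k]
    {n : ℕ} (q : Fin n) (p : MvPolynomial (Fin n) B) : ∃ K,
      ((MvPolynomial.pderiv q).toLinearMap ^ K : Module.End B (MvPolynomial (Fin n) B)) p = 0 := by
  refine ⟨p.degreeOf q + 1, dcoeff_ext k fun m => ?_⟩
  rw [dcoeff_pderiv_pow, map_zero, dcoeff_apply, MvPolynomial.notMem_support_iff.mp
    (MvPolynomial.notMem_support_of_degreeOf_lt q ?_), smul_zero]
  simp only [Finsupp.add_apply, Finsupp.single_eq_same]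
  omega

variable [CharZero k]

/-- The operators `shiftMulPoly δ q x` form an action of `B`. -/
def shiftHom (δ : Derivation k B B) (q : Fin n) : B →ₐ[k] Module.End k (MvPolynomial (Fin n) B) :=
  twist δ (MvPolynomial.pderiv q).toLinearMap (pderiv_pow_eq_zero k q)

theorem dcoeff_shiftHom (δ : Derivation k B B) (q : Fin n) (x : B) (m : Fin n →₀ ℕ)
    (p : MvPolynomial (Fin n) B) {K : ℕ} (hK : ∀ l, K ≤ l → dcoeff (m + Finsupp.single q l) p = 0) :
    dcoeff m (shiftHom δ q x p) =
      ∑ l ∈ Finset.range K, dpow δ l x * dcoeff (m + Finsupp.single q l) p := by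
  obtain ⟨K', hK'⟩ := pderiv_pow_eq_zero k q p
  have h1 : ∀ l, max K K' ≤ l →
      ((MvPolynomial.pderiv q).toLinearMap ^ l : Module.End B (MvPolynomial (Fin n) B)) p = 0 := by
    intro l hl
    obtain ⟨j, rfl⟩ := Nat.exists_eq_add_of_le' ((le_max_right K K').trans hl)
    rw [pow_add, Module.End.mul_apply, hK', map_zero]
  rw [shiftHom, twist_eq_sum δ _ _ x h1, map_sum]
  simp only [map_smul, dcoeff_pderiv_pow, smul_eq_mul]
  refine (Finset.sum_subset (Finset.range_mono (le_max_left K K')) fun l _ hl => ?_).symm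
  rw [hK l (by simpa using hl), mul_zero]

theorem shiftHom_apply (δ : Derivation k B B) (q : Fin n) (x : B) (p : MvPolynomial (Fin n) B) :
    shiftHom δ q x p = shiftMulPoly δ q x p := by
  induction p using MvPolynomial.induction_on' with
  | add p q hp hq => simp only [map_add, hp, hq]
  | monomial m b =>
    have key : ∀ l, ((MvPolynomial.pderiv q).toLinearMap ^ l : Module.End B (MvPolynomial (Fin n) B))
        (MvPolynomial.monomial m b) =
          MvPolynomial.monomial (m - Finsupp.single q l) (((m q).descFactorial l : B) * b) := by
      intro l
      induction l with
      | zero => simp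
      | succ l ih =>
        rw [pow_succ', Module.End.mul_apply, ih]
        change MvPolynomial.pderiv q _ = _
        rw [MvPolynomial.pderiv_monomial, Nat.descFactorial_succ, tsub_tsub, ← Finsupp.single_add,
          Finsupp.tsub_apply, Finsupp.single_eq_same]
        push_cast
        ring_nf
    rw [shiftHom, twist_eq_sum δ _ _ x (K := m q + 1), shiftMulPoly_monomial]
    · refine Finset.sum_congr rfl fun l _ => ?_
      rw [key, MvPolynomial.smul_monomial, ← map_nsmul, dpow_iterate]
      congr 1
      rw [Nat.descFactorial_eq_factorial_mul_choose, smul_eq_mul, smul_mul_assoc]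
      rw [inv_smul_eq_iff₀ (by exact_mod_cast l.factorial_ne_zero), Nat.cast_smul_eq_nsmul]
      simp only [nsmul_eq_mul]
      push_cast
      ring
    · intro l hl
      rw [key, Nat.descFactorial_of_lt (by omega), Nat.cast_zero, zero_mul, map_zero]

theorem dcoeff_shiftMulPoly (δ : Derivation k B B) (q : Fin n) (x : B) (m : Fin n →₀ ℕ)
    (p : MvPolynomial (Fin n) B) {K : ℕ} (hK : ∀ l, K ≤ l → dcoeff (m + Finsupp.single q l) p = 0) :
    dcoeff m (shiftMulPoly δ q x p) =
      ∑ l ∈ Finset.range K, dpow δ l x * dcoeff (m + Finsupp.single q l) p := by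
  rw [← shiftHom_apply, dcoeff_shiftHom δ q x m p hK]

theorem shiftMul_mk (δ : Derivation k B B) (q : Fin n) (x : B) (p : MvPolynomial (Fin n) B) :
    shiftMul δ q x (Submodule.Quotient.mk p) = Submodule.Quotient.mk (shiftMulPoly δ q x p) := rfl

/-- The operators `shiftMul δ q x` form an action of `B`. -/
def shiftQuotHom (δ : Derivation k B B) (q : Fin n) : B →ₐ[k] Module.End k (LamQuot δ n) := by
  have h0 : ∀ (x : B) (p : MvPolynomial (Fin n) B),
      shiftMul δ q x (Submodule.Quotient.mk p) = Submodule.Quotient.mk (shiftHom δ q x p) :=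
    fun x p => by rw [shiftHom_apply, shiftMul_mk]
  refine AlgHom.ofLinearMap
    { toFun := shiftMul δ q
      map_add' := fun x y => LinearMap.ext fun v => ?_
      map_smul' := fun c x => LinearMap.ext fun v => ?_ } (LinearMap.ext fun v => ?_)
      fun x y => LinearMap.ext fun v => ?_ <;>
    obtain ⟨p, rfl⟩ := Submodule.Quotient.mk_surjective _ v
  · simp only [LinearMap.add_apply, h0, map_add, Submodule.Quotient.mk_add]
  · simp only [LinearMap.smul_apply, h0, map_smul, RingHom.id_apply, Submodule.Quotient.mk_smul]
  · simp only [LinearMap.coe_mk, AddHom.coe_mk, h0, map_one, Module.End.one_apply]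
  · simp only [LinearMap.coe_mk, AddHom.coe_mk, h0, map_mul, Module.End.mul_apply]

/-! ### Injectivity of the total operator -/

theorem totalOp_injective (δ : Derivation k B B) : Function.Injective (totalOp δ (n + 1)) := by
  rw [← LinearMap.ker_eq_bot, LinearMap.ker_eq_bot']
  intro p hp
  have hp' : ∀ m, δ (dcoeff m p) + ∑ q, m q • dcoeff (m - Finsupp.single q 1) p = 0 := fun m => by
    rw [← dcoeff_totalOp, hp, map_zero]
  have step : ∀ e s (m : Fin (n + 1) →₀ ℕ), p.totalDegree + 1 ≤ m.degree + e → m.degree ≤ s + m 0 →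
      dcoeff m p = 0 := by
    intro e
    induction e with
    | zero =>
      intro s m hm _
      rw [dcoeff_apply, MvPolynomial.coeff_eq_zero_of_totalDegree_lt, smul_zero]
      rw [Finsupp.degree_apply] at hm
      omega
    | succ e ihe =>
      intro s
      induction s using Nat.strong_induction_on with
      | _ s ihs =>
        intro m hm hs
        have hd : (m + Finsupp.single 0 1).degree = m.degree + 1 := by
          rw [map_add, Finsupp.degree_single]
        have h1 := hp' (m + Finsupp.single 0 1)
        rw [ihe _ _ (by omega) (Nat.le_add_right (m + Finsupp.single 0 1).degree _), map_zero, zero_add,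
          Fin.sum_univ_succ, add_tsub_cancel_right, Finset.sum_eq_zero, add_zero, Finsupp.add_apply,
          Finsupp.single_eq_same, ← Nat.cast_smul_eq_nsmul k] at h1
        · exact (smul_eq_zero.mp h1).resolve_left (by exact_mod_cast Nat.succ_ne_zero (m 0))
        · intro q _
          rw [Finsupp.add_apply, Finsupp.single_eq_of_ne (Fin.succ_ne_zero q), add_zero]
          rcases Nat.eq_zero_or_pos (m q.succ) with h0 | h0
          · rw [h0, zero_smul]
          · have hle : (Finsupp.single q.succ 1 : Fin (n + 1) →₀ ℕ) ≤ m + Finsupp.single 0 1 :=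
              Finsupp.single_le_iff.mpr (by rw [Finsupp.add_apply]; omega)
            have hd2 := congrArg Finsupp.degree (tsub_add_cancel_of_le hle)
            rw [map_add, Finsupp.degree_single, hd] at hd2
            have hz : (m + Finsupp.single 0 1 - Finsupp.single q.succ 1 : Fin (n + 1) →₀ ℕ) 0 =
                m 0 + 1 := by
              simp [Finsupp.single_apply, Fin.succ_ne_zero]
            have hs1 : m q.succ + m 0 ≤ m.degree := by
              rw [Finsupp.degree_eq_sum, Fin.sum_univ_succ]
              have := Finset.single_le_sum (f := fun i : Fin n => m i.succ) (fun i _ => Nat.zero_le _)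
                (Finset.mem_univ q)
              omega
            rw [ihs (s - 1) (by omega) _ (by omega) (by omega), smul_zero]
  refine dcoeff_ext k fun m => ?_
  rw [map_zero]
  exact step (p.totalDegree + 1) m.degree m (by omega) (by omega)

end DividedCoefficients

/-! ## The universal property of the algebra of jets -/

section JetUniversal

variable {k A B : Type u} [Field k] [CommRing A] [CommRing B] [Algebra k A] [Algebra k B]

/-- The infinitesimal form of the universal property of the arc space: homomorphisms out of `B` are
determined by their values on the jets, and deformations of `ev` lift along nilpotent thickenings
of `B`. -/
structure JetUniversal (ev : A →ₐ[k] PowerSeries B) : Prop where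
  uniq : ∀ (R : Type u) [CommRing R] [Algebra k R] (f g : B →ₐ[k] R),
    (∀ a i, f (jet ev i a) = g (jet ev i a)) → f = g
  exist : ∀ (R : Type u) [CommRing R] [Algebra k R] (π : R →ₐ[k] B), Function.Surjective π →
    (∀ x, π x = 0 → IsNilpotent x) → ∀ h : A →ₐ[k] PowerSeries R,
    (∀ a i, π (PowerSeries.coeff i (h a)) = jet ev i a) →
    ∃ f : B →ₐ[k] R, (∀ b, π (f b) = b) ∧ ∀ a i, f (jet ev i a) = PowerSeries.coeff i (h a)

variable {ev : A →ₐ[k] PowerSeries B}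

theorem JetUniversal.der_uniq (hev : JetUniversal ev) {N : Type u} [AddCommGroup N] [Module k N]
    (act : B →ₐ[k] Module.End k N) (D D' : B →ₗ[k] N)
    (hD : ∀ x y, D (x * y) = act x (D y) + act y (D x))
    (hD' : ∀ x y, D' (x * y) = act x (D' y) + act y (D' x))
    (h : ∀ a i, D (jet ev i a) = D' (jet ev i a)) : D = D' := by
  let _ : Module B N := Module.compHom N (act : B →+* Module.End k N)
  have _ : IsScalarTower k B N := ⟨fun c x v => by
    change act (c • x) v = c • act x v
    rw [map_smul, LinearMap.smul_apply]⟩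
  let _ : Module Bᵐᵒᵖ N := Module.compHom N ((RingHom.id B).fromOpposite mul_comm)
  have _ : IsCentralScalar B N := ⟨fun _ _ => rfl⟩
  have key : ∀ E : B →ₗ[k] N, (∀ x y, E (x * y) = act x (E y) + act y (E x)) →
      ∃ f : B →ₐ[k] TrivSqZeroExt B N, ∀ x, f x = TrivSqZeroExt.inl x + TrivSqZeroExt.inr (E x) := by
    intro E hE
    have h1 : E 1 = 0 := by
      have := hE 1 1
      rw [mul_one, map_one act, Module.End.one_apply] at this
      simpa using this
    refine ⟨AlgHom.ofLinearMap
      { toFun := fun x => TrivSqZeroExt.inl x + TrivSqZeroExt.inr (E x)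
        map_add' := fun x y => ?_
        map_smul' := fun c x => ?_ } ?_ fun x y => ?_, fun x => rfl⟩
    · rw [map_add, TrivSqZeroExt.inl_add, TrivSqZeroExt.inr_add]; abel
    · ext <;> simp
    · change (TrivSqZeroExt.inl (1 : B) + TrivSqZeroExt.inr (E 1) : TrivSqZeroExt B N) = 1
      rw [h1]; ext <;> simp
    · change TrivSqZeroExt.inl (x * y) + TrivSqZeroExt.inr (E (x * y)) = _
      rw [hE]
      ext
      · simp
      · simp only [LinearMap.coe_mk, AddHom.coe_mk, TrivSqZeroExt.snd_add, TrivSqZeroExt.snd_inl,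
          TrivSqZeroExt.snd_inr, TrivSqZeroExt.snd_mul, TrivSqZeroExt.fst_add,
          TrivSqZeroExt.fst_inl, TrivSqZeroExt.fst_inr, zero_add, add_zero]
        rfl
  obtain ⟨f, hf⟩ := key D hD
  obtain ⟨f', hf'⟩ := key D' hD'
  have e : f = f' := hev.uniq _ f f' fun a i => by rw [hf, hf', h]
  refine LinearMap.ext fun x => ?_
  have := congrArg TrivSqZeroExt.snd (congrArg (fun g => g x) e)
  simpa [hf, hf'] using this

theorem JetUniversal.der_exist (hev : JetUniversal ev) {N : Type u} [AddCommGroup N] [Module k N]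
    (act : B →ₐ[k] Module.End k N) (d : A →ₗ[k] (ℕ → N))
    (hd : ∀ a b i, d (a * b) i = ∑ p ∈ Finset.HasAntidiagonal.antidiagonal i,
      (act (jet ev p.1 a) (d b p.2) + act (jet ev p.1 b) (d a p.2))) :
    ∃ D : B →ₗ[k] N, (∀ x y, D (x * y) = act x (D y) + act y (D x)) ∧
      ∀ a i, D (jet ev i a) = d a i := by
  let _ : Module B N := Module.compHom N (act : B →+* Module.End k N)
  have _ : IsScalarTower k B N := ⟨fun c x v => by
    change act (c • x) v = c • act x v
    rw [map_smul, LinearMap.smul_apply]⟩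
  let _ : Module Bᵐᵒᵖ N := Module.compHom N ((RingHom.id B).fromOpposite mul_comm)
  have _ : IsCentralScalar B N := ⟨fun _ _ => rfl⟩
  have hd1 : d 1 = 0 := by
    have hj : ∀ i, jet ev i (1 : A) = if i = 0 then 1 else 0 := fun i => by
      rw [jet, map_one, PowerSeries.coeff_one]
    funext i
    have h1 := hd 1 1 i
    rw [mul_one, Finset.Nat.sum_antidiagonal_eq_sum_range_succ_mk, Finset.sum_eq_single 0] at h1
    · simpa [hj] using h1
    · intro j _ hj0
      simp [hj, hj0]
    · simp
  let H : A →ₐ[k] PowerSeries (TrivSqZeroExt B N) := AlgHom.ofLinearMap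
    { toFun := fun a => PowerSeries.mk fun i =>
        TrivSqZeroExt.inl (jet ev i a) + TrivSqZeroExt.inr (d a i)
      map_add' := fun a b => PowerSeries.ext fun i => by
        simp only [jet, map_add, PowerSeries.coeff_mk, Pi.add_apply, TrivSqZeroExt.inl_add,
          TrivSqZeroExt.inr_add]
        abel
      map_smul' := fun c a => PowerSeries.ext fun i => by
        have hs : (PowerSeries.coeff i) (c • ev a) = c • (PowerSeries.coeff i) (ev a) := rfl
        have hs' : ∀ f : PowerSeries (TrivSqZeroExt B N),
          (PowerSeries.coeff i) (c • f) = c • (PowerSeries.coeff i) f := fun f => rfl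
        rw [RingHom.id_apply, hs']
        simp only [jet, map_smul, PowerSeries.coeff_mk, Pi.smul_apply, hs]
        ext <;> simp }
    (PowerSeries.ext fun i => by
      simp only [LinearMap.coe_mk, AddHom.coe_mk, PowerSeries.coeff_mk, jet, map_one, hd1,
        PowerSeries.coeff_one, Pi.zero_apply, TrivSqZeroExt.inr_zero, add_zero]
      split_ifs <;> simp)
    fun a b => PowerSeries.ext fun i => by
      simp only [LinearMap.coe_mk, AddHom.coe_mk, PowerSeries.coeff_mk, PowerSeries.coeff_mul, jet,
        map_mul, hd]
      ext
      · simp [TrivSqZeroExt.fst_sum]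
      · simp only [TrivSqZeroExt.snd_add, TrivSqZeroExt.snd_inl, TrivSqZeroExt.snd_inr, zero_add,
          TrivSqZeroExt.snd_sum, TrivSqZeroExt.snd_mul, TrivSqZeroExt.fst_add,
          TrivSqZeroExt.fst_inl, TrivSqZeroExt.fst_inr, add_zero]
        rw [Finset.sum_add_distrib, Finset.sum_add_distrib]
        congr 1
        rw [← Finset.Nat.sum_antidiagonal_swap]
        rfl
  have hH : ∀ a i, PowerSeries.coeff i (H a) =
      TrivSqZeroExt.inl (jet ev i a) + TrivSqZeroExt.inr (d a i) := fun a i =>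
    PowerSeries.coeff_mk i fun i => TrivSqZeroExt.inl (jet ev i a) + TrivSqZeroExt.inr (d a i)
  obtain ⟨f, hf, hf'⟩ := hev.exist (TrivSqZeroExt B N) (TrivSqZeroExt.fstHom k B N)
    (fun b => ⟨TrivSqZeroExt.inl b, rfl⟩)
    (fun x hx => ⟨2, by
      have hx' : x.fst = 0 := hx
      rw [pow_two]
      ext <;> simp [hx']⟩) H fun a i => by
        rw [hH]
        simp
  have hf1 : ∀ b, (f b).fst = b := hf
  refine ⟨(TrivSqZeroExt.sndHom B N).restrictScalars k ∘ₗ f.toLinearMap, fun x y => ?_, fun a i => ?_⟩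
  · simp only [LinearMap.comp_apply, LinearMap.restrictScalars_apply, AlgHom.toLinearMap_apply, map_mul]
    change (f x * f y).snd = _
    rw [TrivSqZeroExt.snd_mul, hf1, hf1]
    rfl
  · simp only [LinearMap.comp_apply, LinearMap.restrictScalars_apply, AlgHom.toLinearMap_apply, hf', hH]
    simp

/-- `δ^p a_0 / p! = a_p`. -/
theorem dpow_jet [CharZero k] {δ : Derivation k B B} (hδ : IsArcDerivation ev δ) (p : ℕ) (a : A) :
    dpow δ p (jet ev 0 a) = jet ev p a := by
  induction p with
  | zero => simp
  | succ p ih =>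
    rw [dpow, dpw_succ, ← dpow, ih]
    change _ • δ _ = _
    rw [hδ, inv_smul_eq_iff₀ (by exact_mod_cast Nat.succ_ne_zero p), Nat.cast_smul_eq_nsmul,
      nsmul_eq_mul, Nat.cast_succ]

/-- Twisted derivations that are compatible with `δ` and an operator `ℓ` are determined by their
values on `A`. -/
theorem JetUniversal.sesq_uniq [CharZero k] (hev : JetUniversal ev) {δ : Derivation k B B}
    (hδ : IsArcDerivation ev δ) {N : Type u} [AddCommGroup N] [Module k N]
    (act : B →ₐ[k] Module.End k N) (ℓ : Module.End k N) (D D' : B →ₗ[k] N)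
    (hD : ∀ x y, D (x * y) = act x (D y) + act y (D x))
    (hD' : ∀ x y, D' (x * y) = act x (D' y) + act y (D' x))
    (hs : ∀ x, D (δ x) = ℓ (D x)) (hs' : ∀ x, D' (δ x) = ℓ (D' x))
    (h : ∀ a, D (jet ev 0 a) = D' (jet ev 0 a)) : D = D' := by
  refine hev.der_uniq act D D' hD hD' fun a i => ?_
  rw [← dpow_jet hδ]
  induction i with
  | zero => simpa using h a
  | succ i ih =>
    rw [dpow, dpw_succ, map_smul, map_smul]
    congr 1
    exact (hs _).trans ((congrArg ℓ ih).trans (hs' _).symm)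

/-- The extension of a twisted derivation on `A` to a twisted derivation on `B` that is compatible
with `δ` and an operator `ℓ`. -/
theorem JetUniversal.sesq_exist [CharZero k] (hev : JetUniversal ev) {δ : Derivation k B B}
    (hδ : IsArcDerivation ev δ) {N : Type u} [AddCommGroup N] [Module k N]
    (act : B →ₐ[k] Module.End k N) (ℓ : Module.End k N)
    (hℓ : ∀ x v, ℓ (act x v) = act (δ x) v + act x (ℓ v)) (T : A →ₗ[k] N)
    (hT : ∀ a b, T (a * b) = act (jet ev 0 a) (T b) + act (jet ev 0 b) (T a)) :
    ∃ D : B →ₗ[k] N, (∀ x y, D (x * y) = act x (D y) + act y (D x)) ∧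
      (∀ x, D (δ x) = ℓ (D x)) ∧ ∀ a, D (jet ev 0 a) = T a := by
  obtain ⟨D, hD, hDT⟩ := hev.der_exist act (LinearMap.pi fun i => dpw ℓ i ∘ₗ T) fun a b i => by
    have hl : ∀ x v, dpw ℓ i (act x v) = ∑ p ∈ Finset.HasAntidiagonal.antidiagonal i,
        act (dpow δ p.1 x) (dpw ℓ p.2 v) :=
      dpw_leibniz δ.toLinearMap ℓ ℓ act.toLinearMap hℓ i
    simp only [LinearMap.pi_apply, LinearMap.comp_apply, hT, map_add]
    rw [hl, hl, ← Finset.sum_add_distrib]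
    refine Finset.sum_congr rfl fun p _ => ?_
    rw [dpow_jet hδ p.1 a, dpow_jet hδ p.1 b]
  refine ⟨D, hD, fun x => ?_, fun a => by rw [hDT]; simp⟩
  have hδl : ∀ x y, δ (x * y) = x * δ y + δ x * y := fun x y => by
    rw [Derivation.leibniz, smul_eq_mul, smul_eq_mul, mul_comm y]
  have := hev.der_uniq act (D ∘ₗ δ.toLinearMap - ℓ ∘ₗ D) 0 (fun x y => by
      have e : δ.toLinearMap (x * y) = x * δ y + δ x * y := hδl x y
      simp only [LinearMap.sub_apply, LinearMap.comp_apply, e, map_add, hD, hℓ, map_sub]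
      change _ = act x (D (δ y)) - _ + (act y (D (δ x)) - _)
      abel)
    (by simp) fun a i => by
      rw [LinearMap.sub_apply, LinearMap.comp_apply, LinearMap.comp_apply, LinearMap.zero_apply, hDT]
      change D (δ _) - _ = 0
      rw [hδ, ← Nat.cast_succ, ← nsmul_eq_mul, map_nsmul, hDT, LinearMap.pi_apply,
        LinearMap.comp_apply, LinearMap.pi_apply, LinearMap.comp_apply, succ_smul_dpw_succ, sub_self]
  exact sub_eq_zero.mp (LinearMap.congr_fun this x)

end JetUniversal

/-! ## Forms on the formal disc -/

section Forms

variable {k A B : Type u} [Field k] [CommRing A] [CommRing B] [Algebra k A] [Algebra k B]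
variable {ev : A →ₐ[k] PowerSeries B}

theorem ArcRing.ext {f g : ArcRing ev} (h : ∀ i, ArcRing.coeff ev i f = ArcRing.coeff ev i g) : f = g :=
  PowerSeries.ext h

theorem ArcRing.coeff_mul (i : ℕ) (f g : ArcRing ev) : ArcRing.coeff ev i (f * g) =
    ∑ p ∈ Finset.HasAntidiagonal.antidiagonal i, ArcRing.coeff ev p.1 f * ArcRing.coeff ev p.2 g :=
  PowerSeries.coeff_mul i f g

theorem ArcRing.coeff_algebraMap (i : ℕ) (a : A) :
    ArcRing.coeff ev i (algebraMap A (ArcRing ev) a) = jet ev i a := rfl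

theorem ArcRing.coeff_z_pow_mul (N i : ℕ) (f : ArcRing ev) : ArcRing.coeff ev i (ArcRing.z ev ^ N * f) =
    if N ≤ i then ArcRing.coeff ev (i - N) f else 0 :=
  PowerSeries.coeff_X_pow_mul' f N i

theorem ArcRing.exists_z_pow_mul {N : ℕ} {f : ArcRing ev} (h : ∀ i < N, ArcRing.coeff ev i f = 0) :
    ∃ g, f = ArcRing.z ev ^ N * g :=
  (PowerSeries.X_pow_dvd_iff.mpr h)

/-- The series with given coefficients. -/
def ArcRing.mk (ev : A →ₐ[k] PowerSeries B) (c : ℕ → B) : ArcRing ev := PowerSeries.mk c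

theorem ArcRing.coeff_mk (i : ℕ) (c : ℕ → B) : ArcRing.coeff ev i (ArcRing.mk ev c) = c i :=
  PowerSeries.coeff_mk i c

theorem ArcRing.algebraMap_smul_forms (b : B) (v : LoopForms ev) :
    algebraMap B (ArcRing ev) b • v = b • v := algebraMap_smul _ _ _

theorem smul_formGen (g f : ArcRing ev) (a : A) : g • formGen ev f a = formGen ev (g * f) a := rfl

theorem smul_formGen' (b : B) (f : ArcRing ev) (a : A) : b • formGen ev f a = formGen ev (b • f) a := rfl

theorem formGen_add (f g : ArcRing ev) (a : A) :
    formGen ev (f + g) a = formGen ev f a + formGen ev g a := TensorProduct.add_tmul _ _ _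

theorem forms_sub_smul (f g : ArcRing ev) (v : LoopForms ev) : (f - g) • v = f • v - g • v :=
  sub_smul f g v

theorem forms_neg_smul (f : ArcRing ev) (v : LoopForms ev) : (-f) • v = -(f • v) :=
  neg_smul f v

theorem formGen_mul (f : ArcRing ev) (a b : A) : formGen ev f (a * b) =
    formGen ev (f * algebraMap A _ a) b + formGen ev (f * algebraMap A _ b) a := by
  rw [formGen, Derivation.leibniz, TensorProduct.tmul_add, TensorProduct.tmul_smul,
    TensorProduct.tmul_smul, TensorProduct.smul_tmul', TensorProduct.smul_tmul', Algebra.smul_def,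
    Algebra.smul_def, mul_comm f, mul_comm f]
  rfl

theorem forms_induction {p : LoopForms ev → Prop} (h : ∀ f a, p (formGen ev f a))
    (hadd : ∀ v w, p v → p w → p (v + w)) (v : LoopForms ev) : p v := by
  have h0 : p 0 := by simpa [formGen] using h 0 0
  induction v using TensorProduct.induction_on with
  | zero => exact h0
  | add v w hv hw => exact hadd v w hv hw
  | tmul f ω =>
    have hω : ω ∈ Submodule.span A (Set.range (KaehlerDifferential.D k A)) := by
      rw [KaehlerDifferential.span_range_derivation]; trivial
    induction hω using Submodule.span_induction generalizing f with
    | mem ω h' => obtain ⟨a, rfl⟩ := h'; exact h f a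
    | zero => simpa using h0
    | add x y _ _ hx hy => rw [TensorProduct.tmul_add]; exact hadd _ _ (hx f) (hy f)
    | smul c x _ hx => rw [← TensorProduct.smul_tmul]; exact hx _

theorem contract_formGen (η : Derivation k A A) (f : ArcRing ev) (a : A) :
    contract ev η (formGen ev f a) = f * algebraMap A _ (η a) := by
  simp [contract, formGen, Algebra.smul_def, mul_comm]

theorem contract_smul (η : Derivation k A A) (g : ArcRing ev) (v : LoopForms ev) :
    contract ev η (g • v) = g * contract ev η v := by
  induction v using forms_induction with
  | h f a => rw [smul_formGen, contract_formGen, contract_formGen, mul_assoc]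
  | hadd v w hv hw => rw [smul_add, map_add, map_add, hv, hw, mul_add]

theorem contract_smul' (η : Derivation k A A) (b : B) (v : LoopForms ev) :
    contract ev η (b • v) = b • contract ev η v := by
  rw [← ArcRing.algebraMap_smul_forms, contract_smul, Algebra.smul_def]

theorem contract_derivation_mul (η η₁ η₂ : Derivation k A A) (a₁ a₂ : A)
    (h : ∀ a, η a = a₁ * η₁ a + a₂ * η₂ a) (v : LoopForms ev) :
    contract ev η v = algebraMap A _ a₁ * contract ev η₁ v + algebraMap A _ a₂ * contract ev η₂ v := by
  induction v using forms_induction with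
  | h f a => simp only [contract_formGen, h, map_add, map_mul]; ring
  | hadd v w hv hw => rw [map_add, map_add, map_add, hv, hw]; ring

/-- `thetaForm` as a linear form. -/
def thetaLin (ev : A →ₐ[k] PowerSeries B) (η : Derivation k A A) (i : ℕ) : LoopForms ev →ₗ[B] B where
  toFun := thetaForm ev η i
  map_add' v w := by simp only [thetaForm, map_add]
  map_smul' b v := by simp only [thetaForm, contract_smul', map_smul, RingHom.id_apply]

theorem thetaLin_apply (η : Derivation k A A) (i : ℕ) (v : LoopForms ev) :
    thetaLin ev η i v = ArcRing.coeff ev i (contract ev η v) := rfl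

/-- Continuity of a linear map from the forms to a discrete module. -/
def IsCont {N : Type*} [AddCommGroup N] [Module B N] (θ : LoopForms ev →ₗ[B] N) : Prop :=
  ∃ K, ∀ v ∈ loopFilt ev K, θ v = 0

theorem thetaLin_isCont (η : Derivation k A A) (i : ℕ) : IsCont (thetaLin ev η i) := by
  refine ⟨i + 1, ?_⟩
  rintro _ ⟨w, rfl⟩
  simp only
  rw [thetaLin_apply, contract_smul, ArcRing.coeff_z_pow_mul, if_neg (by omega)]

theorem add_mem_loopFilt {N : ℕ} {v w : LoopForms ev} (hv : v ∈ loopFilt ev N) (hw : w ∈ loopFilt ev N) :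
    v + w ∈ loopFilt ev N := by
  obtain ⟨v, rfl⟩ := hv
  obtain ⟨w, rfl⟩ := hw
  exact ⟨v + w, smul_add _ _ _⟩

theorem smul_mem_loopFilt {N : ℕ} {v : LoopForms ev} (g : ArcRing ev) (hv : v ∈ loopFilt ev N) :
    g • v ∈ loopFilt ev N := by
  obtain ⟨v, rfl⟩ := hv
  exact ⟨g • v, smul_comm _ _ _⟩

theorem neg_mem_loopFilt {N : ℕ} {v : LoopForms ev} (hv : v ∈ loopFilt ev N) : -v ∈ loopFilt ev N := by
  have h := smul_mem_loopFilt (-1) hv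
  rwa [forms_neg_smul, one_smul] at h

theorem sum_mem_loopFilt {N : ℕ} {ι : Type*} (s : Finset ι) (v : ι → LoopForms ev)
    (h : ∀ i ∈ s, v i ∈ loopFilt ev N) : ∑ i ∈ s, v i ∈ loopFilt ev N := by
  classical
  induction s using Finset.induction_on with
  | empty => exact ⟨0, by simp⟩
  | insert i s hi ih =>
    rw [Finset.sum_insert hi]
    exact add_mem_loopFilt (h i (Finset.mem_insert_self i s))
      (ih fun j hj => h j (Finset.mem_insert_of_mem hj))

theorem mul_smul_mem_loopFilt {N : ℕ} {f : ArcRing ev} (h : ∀ i < N, ArcRing.coeff ev i f = 0)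
    (v : LoopForms ev) : f • v ∈ loopFilt ev N := by
  obtain ⟨g, rfl⟩ := ArcRing.exists_z_pow_mul h
  exact ⟨g • v, smul_smul _ _ _⟩

theorem coeff_contract_of_mem {N : ℕ} {v : LoopForms ev} (hv : v ∈ loopFilt ev N)
    (η : Derivation k A A) {i : ℕ} (hi : i < N) : ArcRing.coeff ev i (contract ev η v) = 0 := by
  obtain ⟨w, rfl⟩ := hv
  simp only
  rw [contract_smul, ArcRing.coeff_z_pow_mul, if_neg (by omega)]

/-- Continuous linear forms. -/
def contDual (ev : A →ₐ[k] PowerSeries B) : Submodule B (LoopForms ev →ₗ[B] B) where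
  carrier := {θ | IsCont θ}
  add_mem' := by
    rintro θ θ' ⟨K, hK⟩ ⟨K', hK'⟩
    exact ⟨max K K', fun v hv => by
      rw [LinearMap.add_apply, hK v (loopFilt_mono (le_max_left _ _) hv),
        hK' v (loopFilt_mono (le_max_right _ _) hv), add_zero]⟩
  zero_mem' := ⟨0, fun _ _ => rfl⟩
  smul_mem' := by
    rintro b θ ⟨K, hK⟩
    exact ⟨K, fun v hv => by rw [LinearMap.smul_apply, hK v hv, smul_zero]⟩

/-- A `k`-linear map applied to the coefficients of a series. -/
def hat (ev : A →ₐ[k] PowerSeries B) (D : B →ₗ[k] B) : ArcRing ev →ₗ[k] ArcRing ev where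
  toFun f := ArcRing.mk ev fun i => D (ArcRing.coeff ev i f)
  map_add' f g := ArcRing.ext fun i => by
    simp only [ArcRing.coeff_mk, map_add]
  map_smul' c f := ArcRing.ext fun i => by
    have h : ∀ g : ArcRing ev, ArcRing.coeff ev i (c • g) = c • ArcRing.coeff ev i g := fun g => rfl
    simp only [ArcRing.coeff_mk, h, map_smul, RingHom.id_apply]

theorem coeff_hat (D : B →ₗ[k] B) (i : ℕ) (f : ArcRing ev) :
    ArcRing.coeff ev i (hat ev D f) = D (ArcRing.coeff ev i f) :=
  ArcRing.coeff_mk i fun i => D (ArcRing.coeff ev i f)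

theorem hat_mul (D : Derivation k B B) (f g : ArcRing ev) :
    hat ev D.toLinearMap (f * g) = f * hat ev D.toLinearMap g + g * hat ev D.toLinearMap f := by
  refine ArcRing.ext fun i => ?_
  rw [coeff_hat, mul_comm g, map_add, ArcRing.coeff_mul, ArcRing.coeff_mul, ArcRing.coeff_mul, map_sum,
    ← Finset.sum_add_distrib]
  refine Finset.sum_congr rfl fun p _ => ?_
  rw [coeff_hat, coeff_hat]
  change D _ = _ * D _ + D _ * _
  rw [Derivation.leibniz, smul_eq_mul, smul_eq_mul, mul_comm (ArcRing.coeff ev p.2 g)]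

theorem hat_smul (D : Derivation k B B) (b : B) (f : ArcRing ev) :
    hat ev D.toLinearMap (b • f) = b • hat ev D.toLinearMap f + D b • f := by
  refine ArcRing.ext fun i => ?_
  rw [coeff_hat, map_add, LinearMap.map_smul, LinearMap.map_smul, LinearMap.map_smul, coeff_hat]
  change D _ = _ • D _ + _
  rw [smul_eq_mul, Derivation.leibniz, smul_eq_mul, smul_eq_mul, smul_eq_mul]
  ring

end Forms

/-! ### A basis of vector fields and functions -/

section Basis

/-- Functions `x_j` and vector fields `η_j` with `da = ∑ η_j(a) dx_j`. -/
structure FormBasis (k A : Type u) [Field k] [CommRing A] [Algebra k A] where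
  r : ℕ
  x : Fin r → A
  η : Fin r → Derivation k A A
  d_eq : ∀ a, KaehlerDifferential.D k A a = ∑ j, η j a • KaehlerDifferential.D k A (x j)

variable {k A B : Type u} [Field k] [CommRing A] [CommRing B] [Algebra k A] [Algebra k B]
variable {ev : A →ₐ[k] PowerSeries B} (𝒳 : FormBasis k A)

theorem FormBasis.derivation_eq {N : Type*} [AddCommGroup N] [Module k N] [Module A N]
    [IsScalarTower k A N] (E : Derivation k A N) (a : A) : E a = ∑ j, 𝒳.η j a • E (𝒳.x j) := by
  have h := congrArg E.liftKaehlerDifferential (𝒳.d_eq a)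
  simpa using h

/-- The form `dx_j`. -/
def FormBasis.dx (ev : A →ₐ[k] PowerSeries B) (j : Fin 𝒳.r) : LoopForms ev := formGen ev 1 (𝒳.x j)

theorem FormBasis.formGen_eq (f : ArcRing ev) (a : A) :
    formGen ev f a = ∑ j, (f * algebraMap A _ (𝒳.η j a)) • 𝒳.dx ev j := by
  rw [formGen, 𝒳.d_eq, TensorProduct.tmul_sum]
  refine Finset.sum_congr rfl fun j _ => ?_
  rw [FormBasis.dx, smul_formGen, mul_one, formGen, TensorProduct.tmul_smul, TensorProduct.smul_tmul',
    Algebra.smul_def, mul_comm]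

theorem FormBasis.forms_eq (v : LoopForms ev) : v = ∑ j, contract ev (𝒳.η j) v • 𝒳.dx ev j := by
  induction v using forms_induction with
  | h f a => simp only [contract_formGen, ← 𝒳.formGen_eq]
  | hadd v w hv hw =>
    conv_lhs => rw [hv, hw]
    simp only [map_add, add_smul, Finset.sum_add_distrib]

theorem FormBasis.separated (𝒳 : FormBasis k A) {v : LoopForms ev} (h : ∀ N, v ∈ loopFilt ev N) : v = 0 := by
  rw [𝒳.forms_eq v]
  refine Finset.sum_eq_zero fun j _ => ?_
  have : contract ev (𝒳.η j) v = 0 := ArcRing.ext fun i => by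
    rw [coeff_contract_of_mem (h (i + 1)) _ (Nat.lt_succ_self i), map_zero]
  rw [this, zero_smul]

theorem FormBasis.ext_theta {v w : LoopForms ev}
    (h : ∀ j i, thetaLin ev (𝒳.η j) i v = thetaLin ev (𝒳.η j) i w) : v = w := by
  rw [𝒳.forms_eq v, 𝒳.forms_eq w]
  refine Finset.sum_congr rfl fun j _ => ?_
  have e : contract ev (𝒳.η j) v = contract ev (𝒳.η j) w := ArcRing.ext (h j)
  rw [e]

/-- Modulo `z^N`, a form is a combination over `B` of the `z^i dx_j`. -/
theorem FormBasis.exists_approx (N : ℕ) (v : LoopForms ev) : ∃ w ∈ loopFilt ev N,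
    v = (∑ j, ∑ i ∈ Finset.range N, ArcRing.coeff ev i (contract ev (𝒳.η j) v) •
      formGen ev (ArcRing.z ev ^ i) (𝒳.x j)) + w := by
  refine ⟨v - ∑ j, ∑ i ∈ Finset.range N, ArcRing.coeff ev i (contract ev (𝒳.η j) v) •
      formGen ev (ArcRing.z ev ^ i) (𝒳.x j), ?_, by abel⟩
  have h : ∀ f : ArcRing ev, ∀ i < N, ArcRing.coeff ev i
      (f - ∑ i ∈ Finset.range N, ArcRing.coeff ev i f • ArcRing.z ev ^ i) = 0 := by
    intro f i hi
    have hz : ∀ j, ArcRing.coeff ev i (ArcRing.z ev ^ j) = if i = j then 1 else 0 := fun j =>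
      PowerSeries.coeff_X_pow i j
    rw [map_sub, map_sum]
    simp only [map_smul, hz, smul_eq_mul, mul_ite, mul_one, mul_zero]
    rw [Finset.sum_ite_eq, if_pos (Finset.mem_range.mpr hi), sub_self]
  conv => arg 2; arg 1; rw [𝒳.forms_eq v]
  rw [← Finset.sum_sub_distrib]
  refine sum_mem_loopFilt _ _ fun j _ => ?_
  have e : contract ev (𝒳.η j) v • 𝒳.dx ev j - ∑ i ∈ Finset.range N,
      ArcRing.coeff ev i (contract ev (𝒳.η j) v) • formGen ev (ArcRing.z ev ^ i) (𝒳.x j) =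
      (contract ev (𝒳.η j) v - ∑ i ∈ Finset.range N,
        ArcRing.coeff ev i (contract ev (𝒳.η j) v) • ArcRing.z ev ^ i) • 𝒳.dx ev j := by
    rw [forms_sub_smul, Finset.sum_smul]
    congr 1
    refine Finset.sum_congr rfl fun i _ => ?_
    rw [smul_formGen', FormBasis.dx, smul_formGen, mul_one]
  rw [e]
  exact mul_smul_mem_loopFilt (h _) _

/-- A continuous linear map is determined by its values on the `z^i da`. -/
theorem FormBasis.cont_eq {N : Type*} [AddCommGroup N] [Module B N] {θ : LoopForms ev →ₗ[B] N} {K : ℕ}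
    (hθ : ∀ v ∈ loopFilt ev K, θ v = 0) (v : LoopForms ev) : θ v = ∑ j, ∑ i ∈ Finset.range K,
      thetaLin ev (𝒳.η j) i v • θ (formGen ev (ArcRing.z ev ^ i) (𝒳.x j)) := by
  obtain ⟨w, hw, e⟩ := 𝒳.exists_approx K v
  conv_lhs => rw [e]
  rw [map_add, hθ w hw, add_zero, map_sum]
  simp only [map_sum, map_smul]
  rfl

end Basis

/-! ## The Lie algebroid of forms on the formal disc -/

section Poisson

variable {k A : Type u} [Field k] [CommRing A] [Algebra k A] (P : PoissonBracket k A)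

theorem PoissonBracket.skew (a b : A) : P.br a b = -P.br b a := by
  have h := P.self (a + b)
  simp only [map_add, LinearMap.add_apply, P.self, zero_add, add_zero] at h
  exact eq_neg_of_add_eq_zero_right h

theorem PoissonBracket.leibniz_left (a b c : A) : P.br (a * b) c = P.br a c * b + a * P.br b c := by
  rw [P.skew, P.leibniz, P.skew c a, P.skew c b]; ring

/-- The vector field `{·, c}`. -/
def PoissonBracket.ham (c : A) : Derivation k A A :=
  Derivation.mk' (P.br.flip c) fun a b => by
    simp only [LinearMap.flip_apply, P.leibniz_left, smul_eq_mul]; ring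

theorem PoissonBracket.ham_apply (c a : A) : P.ham c a = P.br a c := rfl

end Poisson

section Anchor

variable {k A B : Type u} [Field k] [CommRing A] [CommRing B] [Algebra k A] [Algebra k B]
variable {ev : A →ₐ[k] PowerSeries B} (hev : JetUniversal ev) (P : PoissonBracket k A)

theorem JetUniversal.exists_anchorForm (hev : JetUniversal ev) : ∃ E : B →ₗ[k] contDual ev,
    (∀ x y, E (x * y) = x • E y + y • E x) ∧
    ∀ a i, (E (jet ev i a)).1 = thetaLin ev (P.ham a) i := by
  let d : A →ₗ[k] (ℕ → contDual ev) := LinearMap.pi fun i =>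
    { toFun := fun a => ⟨thetaLin ev (P.ham a) i, thetaLin_isCont _ i⟩
      map_add' := fun a b => Subtype.ext (LinearMap.ext fun v => by
        change thetaLin ev _ i v = thetaLin ev _ i v + thetaLin ev _ i v
        simp only [thetaLin_apply]
        rw [contract_derivation_mul _ (P.ham a) (P.ham b) 1 1 fun c => by simp [P.ham_apply]]
        simp)
      map_smul' := fun c a => Subtype.ext (LinearMap.ext fun v => by
        change thetaLin ev _ i v = c • thetaLin ev _ i v
        simp only [thetaLin_apply]
        rw [contract_derivation_mul _ (P.ham a) 0 (algebraMap k A c) 0 fun b => by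
          simp [P.ham_apply, ← Algebra.smul_def]]
        have e : algebraMap A (ArcRing ev) (algebraMap k A c) * contract ev (P.ham a) v =
            algebraMap k B c • contract ev (P.ham a) v := by
          rw [Algebra.smul_def]
          congr 1
          exact (ev.commutes c).trans (IsScalarTower.algebraMap_apply k B (PowerSeries B) c)
        rw [map_zero, zero_mul, add_zero, e, map_smul, algebraMap_smul]) }
  obtain ⟨D, hD, hD'⟩ := hev.der_exist (N := contDual ev) (Algebra.lsmul k k (contDual ev)) d fun a b i =>
    Subtype.ext (LinearMap.ext fun v => by
      have h1 : (d (a * b) i).1 v = ArcRing.coeff ev i (contract ev (P.ham (a * b)) v) := rfl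
      rw [h1, contract_derivation_mul _ (P.ham b) (P.ham a) a b fun c => by
        simp only [P.ham_apply, P.leibniz]; ring, map_add, ArcRing.coeff_mul, ArcRing.coeff_mul,
        ← Finset.sum_add_distrib, Submodule.coe_sum, LinearMap.sum_apply]
      rfl)
  exact ⟨D, hD, fun a i => congrArg Subtype.val (hD' a i)⟩

/-- The linear form `v ↦ ρ(v)(x)` on the forms, for a function `x`; here `ρ` is the anchor. -/
def JetUniversal.anchorForm : B →ₗ[k] contDual ev := (hev.exists_anchorForm P).choose

theorem JetUniversal.anchorForm_mul (x y : B) :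
    hev.anchorForm P (x * y) = x • hev.anchorForm P y + y • hev.anchorForm P x :=
  (hev.exists_anchorForm P).choose_spec.1 x y

theorem JetUniversal.anchorForm_jet (a : A) (i : ℕ) (v : LoopForms ev) :
    (hev.anchorForm P (jet ev i a)).1 v = ArcRing.coeff ev i (contract ev (P.ham a) v) :=
  LinearMap.congr_fun ((hev.exists_anchorForm P).choose_spec.2 a i) v

/-- The anchor. -/
def JetUniversal.anchor : LoopForms ev →ₗ[B] Derivation k B B where
  toFun v := Derivation.mk'
    { toFun := fun x => (hev.anchorForm P x).1 v
      map_add' := fun x y => by rw [map_add]; rfl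
      map_smul' := fun c x => by rw [map_smul]; rfl }
    fun x y => by
      simp only [LinearMap.coe_mk, AddHom.coe_mk]
      rw [hev.anchorForm_mul P]; rfl
  map_add' v w := Derivation.ext fun x => map_add (hev.anchorForm P x).1 v w
  map_smul' b v := Derivation.ext fun x => map_smul (hev.anchorForm P x).1 b v

theorem JetUniversal.anchor_apply (v : LoopForms ev) (x : B) :
    hev.anchor P v x = (hev.anchorForm P x).1 v := rfl

theorem JetUniversal.anchor_formGen_jet (f : ArcRing ev) (a b : A) (i : ℕ) :
    hev.anchor P (formGen ev f a) (jet ev i b) =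
      ArcRing.coeff ev i (f * algebraMap A (ArcRing ev) (P.br a b)) := by
  rw [hev.anchor_apply, hev.anchorForm_jet, contract_formGen, P.ham_apply]

theorem JetUniversal.derivation_ext (hev : JetUniversal ev) {D D' : Derivation k B B}
    (h : ∀ a i, D (jet ev i a) = D' (jet ev i a)) : D = D' := by
  have e := hev.der_uniq (Algebra.lmul k B) D.toLinearMap D'.toLinearMap
    (fun x y => D.leibniz x y) (fun x y => D'.leibniz x y) h
  exact Derivation.ext fun x => LinearMap.congr_fun e x

/-- The action of the vector field `ρ(v)` on the coefficients of a series. -/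
def JetUniversal.act (v : LoopForms ev) : ArcRing ev →ₗ[k] ArcRing ev := hat ev (hev.anchor P v).toLinearMap

theorem JetUniversal.coeff_act (v : LoopForms ev) (f : ArcRing ev) (i : ℕ) :
    ArcRing.coeff ev i (hev.act P v f) = hev.anchor P v (ArcRing.coeff ev i f) := coeff_hat _ _ _

theorem JetUniversal.act_add (v w : LoopForms ev) (f : ArcRing ev) :
    hev.act P (v + w) f = hev.act P v f + hev.act P w f :=
  ArcRing.ext fun i => by simp only [map_add, hev.coeff_act, Derivation.add_apply]

theorem JetUniversal.act_smul (b : B) (v : LoopForms ev) (f : ArcRing ev) :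
    hev.act P (b • v) f = b • hev.act P v f :=
  ArcRing.ext fun i => by rw [map_smul, hev.coeff_act, hev.coeff_act, map_smul, Derivation.smul_apply]

theorem JetUniversal.act_mul (v : LoopForms ev) (f g : ArcRing ev) :
    hev.act P v (f * g) = f * hev.act P v g + g * hev.act P v f := hat_mul _ _ _

theorem JetUniversal.act_algebraMap (f : ArcRing ev) (a c : A) :
    hev.act P (formGen ev f a) (algebraMap A _ c) = f * algebraMap A _ (P.br a c) :=
  ArcRing.ext fun i => by
    rw [hev.coeff_act, ArcRing.coeff_algebraMap, hev.anchor_formGen_jet]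

theorem JetUniversal.act_z (v : LoopForms ev) (N : ℕ) (f : ArcRing ev) :
    hev.act P v (ArcRing.z ev ^ N * f) = ArcRing.z ev ^ N * hev.act P v f :=
  ArcRing.ext fun i => by
    rw [hev.coeff_act, ArcRing.coeff_z_pow_mul, ArcRing.coeff_z_pow_mul, apply_ite (hev.anchor P v),
      map_zero, hev.coeff_act]

end Anchor

section Bracket

variable {k A B : Type u} [Field k] [CommRing A] [CommRing B] [Algebra k A] [Algebra k B]
variable {ev : A →ₐ[k] PowerSeries B} (hev : JetUniversal ev) (P : PoissonBracket k A)
  (𝒳 : FormBasis k A)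

/-- The torsion `d{a, b} - ∇_a db + ∇_b da` of the flat connection given by the forms `dx_j`. -/
def FormBasis.torsion (a b : A) : Ω[A⁄k] :=
  KaehlerDifferential.D k A (P.br a b) -
    ∑ j, P.br a (𝒳.η j b) • KaehlerDifferential.D k A (𝒳.x j) +
    ∑ j, P.br b (𝒳.η j a) • KaehlerDifferential.D k A (𝒳.x j)

theorem FormBasis.torsion_skew (a b : A) : 𝒳.torsion P a b = -𝒳.torsion P b a := by
  rw [torsion, torsion, P.skew a b, map_neg]
  abel

/-- The torsion as a derivation in its second argument. -/
def FormBasis.torsionDer (a : A) : Derivation k A Ω[A⁄k] :=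
  Derivation.mk'
    ({ toFun := fun b => 𝒳.torsion P a b
       map_add' := fun b c => by
        simp only [torsion, map_add, LinearMap.add_apply, add_smul, Finset.sum_add_distrib]; abel
       map_smul' := fun t b => by
        simp only [torsion, map_smul, LinearMap.smul_apply, smul_assoc, ← Finset.smul_sum,
          Derivation.map_smul, RingHom.id_apply, smul_add, smul_sub] })
    fun b c => by
      have h1 : ∀ d e : A, ∑ j, (d * 𝒳.η j e) • KaehlerDifferential.D k A (𝒳.x j) =
          d • KaehlerDifferential.D k A e := fun d e => by
        conv_rhs => rw [𝒳.d_eq e, Finset.smul_sum]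
        simp only [smul_smul]
      have h2 : ∑ j, P.br a (𝒳.η j (b * c)) • KaehlerDifferential.D k A (𝒳.x j) =
          b • ∑ j, P.br a (𝒳.η j c) • KaehlerDifferential.D k A (𝒳.x j) +
          c • ∑ j, P.br a (𝒳.η j b) • KaehlerDifferential.D k A (𝒳.x j) +
          P.br a b • KaehlerDifferential.D k A c + P.br a c • KaehlerDifferential.D k A b := by
        rw [← h1, ← h1, Finset.smul_sum, Finset.smul_sum, ← Finset.sum_add_distrib,
          ← Finset.sum_add_distrib, ← Finset.sum_add_distrib]
        refine Finset.sum_congr rfl fun j _ => ?_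
        rw [smul_smul, smul_smul, ← add_smul, ← add_smul, ← add_smul, Derivation.leibniz, map_add,
          smul_eq_mul, smul_eq_mul, P.leibniz, P.leibniz]
        congr 1
        ring
      have h3 : ∑ j, P.br (b * c) (𝒳.η j a) • KaehlerDifferential.D k A (𝒳.x j) =
          b • ∑ j, P.br c (𝒳.η j a) • KaehlerDifferential.D k A (𝒳.x j) +
          c • ∑ j, P.br b (𝒳.η j a) • KaehlerDifferential.D k A (𝒳.x j) := by
        rw [Finset.smul_sum, Finset.smul_sum, ← Finset.sum_add_distrib]
        refine Finset.sum_congr rfl fun j _ => ?_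
        rw [smul_smul, smul_smul, ← add_smul, P.leibniz_left]
        congr 1
        ring
      simp only [LinearMap.coe_mk, AddHom.coe_mk, torsion]
      rw [h2, h3, P.leibniz, map_add, Derivation.leibniz, Derivation.leibniz]
      simp only [smul_add, smul_sub]
      abel

theorem FormBasis.torsion_eq (a b : A) : 𝒳.torsion P a b =
    ∑ i, ∑ j, (𝒳.η i a * 𝒳.η j b) • 𝒳.torsion P (𝒳.x i) (𝒳.x j) := by
  have h : ∀ a b, 𝒳.torsion P a b = ∑ j, 𝒳.η j b • 𝒳.torsion P a (𝒳.x j) := fun a b =>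
    𝒳.derivation_eq (𝒳.torsionDer P a) b
  rw [h, Finset.sum_comm]
  refine Finset.sum_congr rfl fun j _ => ?_
  rw [𝒳.torsion_skew, h, ← Finset.sum_neg_distrib, Finset.smul_sum]
  refine Finset.sum_congr rfl fun i _ => ?_
  rw [𝒳.torsion_skew P (𝒳.x i), smul_neg, ← smul_neg, ← smul_neg, smul_smul, mul_comm]

/-- The bracket of forms. -/
def JetUniversal.brk (v w : LoopForms ev) : LoopForms ev :=
  ∑ j, hev.act P v (contract ev (𝒳.η j) w) • 𝒳.dx ev j -
    ∑ j, hev.act P w (contract ev (𝒳.η j) v) • 𝒳.dx ev j +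
    ∑ i, ∑ j, (contract ev (𝒳.η i) v * contract ev (𝒳.η j) w) •
      ((1 : ArcRing ev) ⊗ₜ[A] 𝒳.torsion P (𝒳.x i) (𝒳.x j))

theorem JetUniversal.brk_add_right (v w w' : LoopForms ev) :
    hev.brk P 𝒳 v (w + w') = hev.brk P 𝒳 v w + hev.brk P 𝒳 v w' := by
  simp only [brk, map_add, add_smul, mul_add, Finset.sum_add_distrib, act_add]
  abel

theorem JetUniversal.brk_skew (v w : LoopForms ev) : hev.brk P 𝒳 v w = -hev.brk P 𝒳 w v := by
  have h : ∑ i, ∑ j, (contract ev (𝒳.η i) v * contract ev (𝒳.η j) w) •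
      ((1 : ArcRing ev) ⊗ₜ[A] 𝒳.torsion P (𝒳.x i) (𝒳.x j)) = -∑ i, ∑ j, (contract ev (𝒳.η i) w *
      contract ev (𝒳.η j) v) • ((1 : ArcRing ev) ⊗ₜ[A] 𝒳.torsion P (𝒳.x i) (𝒳.x j)) := by
    rw [Finset.sum_comm, ← Finset.sum_neg_distrib]
    refine Finset.sum_congr rfl fun i _ => ?_
    rw [← Finset.sum_neg_distrib]
    refine Finset.sum_congr rfl fun j _ => ?_
    rw [𝒳.torsion_skew, TensorProduct.tmul_neg, smul_neg, mul_comm]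
  rw [brk, brk, h]
  abel

theorem JetUniversal.brk_add_left (v v' w : LoopForms ev) :
    hev.brk P 𝒳 (v + v') w = hev.brk P 𝒳 v w + hev.brk P 𝒳 v' w := by
  rw [brk_skew, brk_add_right, brk_skew hev P 𝒳 v, brk_skew hev P 𝒳 v']
  abel

theorem JetUniversal.brk_self [CharZero k] (v : LoopForms ev) : hev.brk P 𝒳 v v = 0 := by
  have h : (2 : k) • hev.brk P 𝒳 v v = 0 := by
    rw [two_smul]
    exact add_eq_zero_iff_eq_neg.mpr (hev.brk_skew P 𝒳 v v)
  exact (smul_eq_zero.mp h).resolve_left two_ne_zero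

theorem JetUniversal.brk_smul (v w : LoopForms ev) (b : B) :
    hev.brk P 𝒳 v (b • w) = b • hev.brk P 𝒳 v w + hev.anchor P v b • w := by
  have h : ∀ j, hev.act P v (b • contract ev (𝒳.η j) w) =
      b • hev.act P v (contract ev (𝒳.η j) w) + hev.anchor P v b • contract ev (𝒳.η j) w :=
    fun j => hat_smul _ _ _
  conv_rhs => rw [add_comm]; arg 1; rw [𝒳.forms_eq w, Finset.smul_sum]
  simp only [brk, contract_smul', h, act_smul, add_smul, Finset.sum_add_distrib, smul_add, smul_sub,
    Finset.smul_sum, smul_assoc, mul_smul_comm]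
  abel

theorem JetUniversal.brk_formGen (f g : ArcRing ev) (a b : A) :
    hev.brk P 𝒳 (formGen ev f a) (formGen ev g b) = formGen ev (f * g) (P.br a b) +
      formGen ev (hev.act P (formGen ev f a) g) b - formGen ev (hev.act P (formGen ev g b) f) a := by
  have h1 : ∀ (f g : ArcRing ev) (a b : A),
      ∑ j, hev.act P (formGen ev f a) (contract ev (𝒳.η j) (formGen ev g b)) • 𝒳.dx ev j =
        formGen ev (hev.act P (formGen ev f a) g) b + (f * g) • ((1 : ArcRing ev) ⊗ₜ[A]
          ∑ j, P.br a (𝒳.η j b) • KaehlerDifferential.D k A (𝒳.x j)) := by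
    intro f g a b
    rw [𝒳.formGen_eq (hev.act P (formGen ev f a) g), TensorProduct.tmul_sum, Finset.smul_sum,
      ← Finset.sum_add_distrib]
    refine Finset.sum_congr rfl fun j _ => ?_
    rw [contract_formGen, act_mul, act_algebraMap, add_smul, add_comm, mul_comm (hev.act P _ g)]
    congr 1
    rw [TensorProduct.tmul_smul, TensorProduct.smul_tmul', Algebra.smul_def, mul_one]
    change formGen ev _ _ = formGen ev _ _
    congr 1
    ring
  have h2 : ∑ i, ∑ j, (contract ev (𝒳.η i) (formGen ev f a) * contract ev (𝒳.η j) (formGen ev g b)) •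
      ((1 : ArcRing ev) ⊗ₜ[A] 𝒳.torsion P (𝒳.x i) (𝒳.x j)) =
      (f * g) • ((1 : ArcRing ev) ⊗ₜ[A] 𝒳.torsion P a b) := by
    rw [𝒳.torsion_eq P a b]
    simp only [TensorProduct.tmul_sum, Finset.smul_sum]
    refine Finset.sum_congr rfl fun i _ => Finset.sum_congr rfl fun j _ => ?_
    rw [contract_formGen, contract_formGen, TensorProduct.tmul_smul,
      ← algebraMap_smul (ArcRing ev) (𝒳.η i a * 𝒳.η j b), smul_smul, map_mul]
    congr 1
    ring
  rw [brk, h1, h1, h2, mul_comm g f, FormBasis.torsion, TensorProduct.tmul_add, TensorProduct.tmul_sub, smul_add,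
    smul_sub]
  have h3 : (f * g) • ((1 : ArcRing ev) ⊗ₜ[A] KaehlerDifferential.D k A (P.br a b)) =
      formGen ev (f * g) (P.br a b) := by
    rw [TensorProduct.smul_tmul', smul_eq_mul, mul_one]; rfl
  rw [h3]
  abel

end Bracket

section Algebroid

variable {k A B : Type u} [Field k] [CommRing A] [CommRing B] [Algebra k A] [Algebra k B]
variable {ev : A →ₐ[k] PowerSeries B} (hev : JetUniversal ev) (P : PoissonBracket k A)
  (𝒳 : FormBasis k A)

theorem JetUniversal.act_brk (v w : LoopForms ev) (f : ArcRing ev) :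
    hev.act P (hev.brk P 𝒳 v w) f = hev.act P v (hev.act P w f) - hev.act P w (hev.act P v f) := by
  suffices h : hev.anchor P (hev.brk P 𝒳 v w) = ⁅hev.anchor P v, hev.anchor P w⁆ by
    refine ArcRing.ext fun i => ?_
    rw [map_sub, coeff_act, coeff_act, coeff_act, coeff_act, coeff_act, h, Derivation.commutator_apply]
  refine hev.derivation_ext fun c i => ?_
  have e : ∀ v : LoopForms ev, hev.anchor P v (jet ev i c) =
      ArcRing.coeff ev i (hev.act P v (algebraMap A _ c)) := fun v => by
    rw [coeff_act, ArcRing.coeff_algebraMap]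
  rw [Derivation.commutator_apply, e, e, e, ← coeff_act, ← coeff_act, ← map_sub]
  congr 1
  induction v using forms_induction with
  | hadd v v' hv hv' => simp only [brk_add_left, act_add, hv, hv', map_add]; abel
  | h f a =>
    induction w using forms_induction with
    | hadd w w' hw hw' => simp only [brk_add_right, act_add, hw, hw', map_add]; abel
    | h g b =>
      have hneg : ∀ (v w : LoopForms ev) (f : ArcRing ev),
          hev.act P (v - w) f = hev.act P v f - hev.act P w f := fun v w f =>
        eq_sub_of_add_eq (by rw [← act_add, sub_add_cancel])
      rw [brk_formGen, hneg, act_add, act_algebraMap, act_algebraMap, act_algebraMap, act_algebraMap,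
        act_algebraMap, act_mul, act_mul, act_algebraMap, act_algebraMap, P.jacobi a b c, map_add]
      ring

theorem JetUniversal.anchor_brk (v w : LoopForms ev) (x : B) : hev.anchor P (hev.brk P 𝒳 v w) x =
    hev.anchor P v (hev.anchor P w x) - hev.anchor P w (hev.anchor P v x) := by
  have h := congrArg (ArcRing.coeff ev 0) (hev.act_brk P 𝒳 v w (ArcRing.mk ev fun _ => x))
  simpa only [map_sub, coeff_act, ArcRing.coeff_mk] using h

theorem formGen_sub (f g : ArcRing ev) (a : A) :
    formGen ev (f - g) a = formGen ev f a - formGen ev g a :=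
  eq_sub_of_add_eq (by rw [← formGen_add, sub_add_cancel])

theorem formGen_add' (f : ArcRing ev) (a b : A) :
    formGen ev f (a + b) = formGen ev f a + formGen ev f b := by
  rw [formGen, map_add, TensorProduct.tmul_add]; rfl

theorem JetUniversal.brk_sub_right (u v w : LoopForms ev) :
    hev.brk P 𝒳 u (v - w) = hev.brk P 𝒳 u v - hev.brk P 𝒳 u w :=
  eq_sub_of_add_eq (by rw [← brk_add_right, sub_add_cancel])

theorem JetUniversal.brk_jacobi (u v w : LoopForms ev) : hev.brk P 𝒳 u (hev.brk P 𝒳 v w) =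
    hev.brk P 𝒳 (hev.brk P 𝒳 u v) w + hev.brk P 𝒳 v (hev.brk P 𝒳 u w) := by
  induction u using forms_induction with
  | hadd u u' hu hu' => simp only [brk_add_left, brk_add_right, hu, hu']; abel
  | h f a =>
  induction v using forms_induction with
  | hadd v v' hv hv' => simp only [brk_add_left, brk_add_right, hv, hv']; abel
  | h g b =>
  induction w using forms_induction with
  | hadd w w' hw hw' => simp only [brk_add_right, hw, hw']; abel
  | h e c =>
    have key : ∀ (f g e : ArcRing ev) (a b c : A),
        hev.brk P 𝒳 (formGen ev f a) (hev.brk P 𝒳 (formGen ev g b) (formGen ev e c)) =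
          formGen ev (f * (g * e)) (P.br a (P.br b c)) +
          formGen ev (hev.act P (formGen ev f a) (g * e)) (P.br b c) +
          formGen ev (f * hev.act P (formGen ev g b) e) (P.br a c) +
          formGen ev (hev.act P (formGen ev f a) (hev.act P (formGen ev g b) e)) c -
          formGen ev (f * hev.act P (formGen ev e c) g) (P.br a b) -
          formGen ev (hev.act P (formGen ev f a) (hev.act P (formGen ev e c) g)) b -
          (formGen ev (hev.act P (formGen ev g b) (hev.act P (formGen ev e c) f)) a -
          formGen ev (hev.act P (formGen ev e c) (hev.act P (formGen ev g b) f)) a) := by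
      intro f g e a b c
      rw [← formGen_sub _ _ a, ← act_brk hev P 𝒳, brk_formGen hev P 𝒳 g e b c]
      have hneg : ∀ (v w : LoopForms ev) (f : ArcRing ev),
          hev.act P (v - w) f = hev.act P v f - hev.act P w f := fun v w f =>
        eq_sub_of_add_eq (by rw [← act_add, sub_add_cancel])
      rw [brk_sub_right, brk_add_right, brk_formGen, brk_formGen, brk_formGen, hneg, act_add,
        formGen_sub, formGen_add]
      abel
    rw [brk_skew hev P 𝒳 (hev.brk P 𝒳 (formGen ev f a) (formGen ev g b)), key, key, key]
    simp only [act_mul, formGen_add]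
    have hn : ∀ (f : ArcRing ev) (a : A), formGen ev f (-a) = -formGen ev f a := fun f a => by
      rw [formGen, map_neg, TensorProduct.tmul_neg]; rfl
    have e1 : g * (f * e) = f * (g * e) := by ring
    have e2 : e * (f * g) = f * (g * e) := by ring
    rw [P.jacobi a b c, P.skew (P.br a b) c, formGen_add', P.skew c a, P.skew c b, P.skew b a, e1, e2]
    simp only [hn]
    abel

theorem JetUniversal.anchor_continuous (x : B) :
    ∃ K, ∀ v ∈ loopFilt ev K, hev.anchor P v x = 0 := (hev.anchorForm P x).2

theorem JetUniversal.brk_continuous (w : LoopForms ev) (N : ℕ) :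
    ∃ N', ∀ v ∈ loopFilt ev N', hev.brk P 𝒳 v w ∈ loopFilt ev N := by
  choose K hK using fun x => hev.anchor_continuous P x
  refine ⟨max N (Finset.univ.sup fun j => (Finset.range N).sup fun i =>
    K (ArcRing.coeff ev i (contract ev (𝒳.η j) w))), fun v hv => ?_⟩
  have hvN : v ∈ loopFilt ev N := loopFilt_mono (le_max_left _ _) hv
  have hc : ∀ η, ∃ g, contract ev η v = ArcRing.z ev ^ N * g := fun η =>
    ArcRing.exists_z_pow_mul fun i hi => coeff_contract_of_mem hvN η hi
  rw [brk, sub_eq_add_neg]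
  refine add_mem_loopFilt (add_mem_loopFilt (sum_mem_loopFilt _ _ fun j _ =>
    mul_smul_mem_loopFilt (fun i hi => ?_) _) (neg_mem_loopFilt (sum_mem_loopFilt _ _ fun j _ => ?_)))
    (sum_mem_loopFilt _ _ fun i _ => sum_mem_loopFilt _ _ fun j _ => ?_)
  · rw [coeff_act]
    refine hK _ v (loopFilt_mono (le_trans ?_ (le_max_right _ _)) hv)
    exact (Finset.le_sup (f := fun i => K (ArcRing.coeff ev i (contract ev (𝒳.η j) w)))
      (Finset.mem_range.mpr hi)).trans (Finset.le_sup (f := fun j => (Finset.range N).sup fun i =>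
        K (ArcRing.coeff ev i (contract ev (𝒳.η j) w))) (Finset.mem_univ j))
  · obtain ⟨g, hg⟩ := hc (𝒳.η j)
    exact ⟨hev.act P w g • 𝒳.dx ev j, by rw [hg, act_z]; exact smul_smul _ _ _⟩
  · obtain ⟨g, hg⟩ := hc (𝒳.η i)
    rw [hg, mul_assoc]
    exact ⟨_, smul_smul _ _ _⟩

theorem JetUniversal.brk_smul_scalar (v w : LoopForms ev) (c : k) :
    hev.brk P 𝒳 v (c • w) = c • hev.brk P 𝒳 v w := by
  rw [← algebraMap_smul B c w, brk_smul, Derivation.map_algebraMap, zero_smul, add_zero,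
    algebraMap_smul]

/-- The Lie algebroid of forms. -/
def JetUniversal.algebroid [CharZero k] : TopLieAlgebroid ev where
  anchor := hev.anchor P
  br := LinearMap.mk₂ k (hev.brk P 𝒳) (hev.brk_add_left P 𝒳)
    (fun c v w => by rw [brk_skew, brk_smul_scalar, brk_skew hev P 𝒳 w, smul_neg, neg_neg])
    (hev.brk_add_right P 𝒳) (fun c v w => hev.brk_smul_scalar P 𝒳 v w c)
  self := hev.brk_self P 𝒳
  jacobi := hev.brk_jacobi P 𝒳
  leibniz v w b := hev.brk_smul P 𝒳 v w b
  continuous := hev.brk_continuous P 𝒳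

theorem JetUniversal.algebroid_br [CharZero k] (v w : LoopForms ev) :
    (hev.algebroid P 𝒳).br v w = hev.brk P 𝒳 v w := rfl

theorem ArcRing.coeff_z_pow (N i : ℕ) : ArcRing.coeff ev i (ArcRing.z ev ^ N) = if i = N then 1 else 0 :=
  PowerSeries.coeff_X_pow i N

theorem JetUniversal.act_z_pow (v : LoopForms ev) (N : ℕ) : hev.act P v (ArcRing.z ev ^ N) = 0 :=
  ArcRing.ext fun i => by
    rw [coeff_act, ArcRing.coeff_z_pow, map_zero]
    split_ifs
    · exact Derivation.map_one_eq_zero _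
    · exact map_zero _

theorem formGen_zero (a : A) : formGen ev 0 a = 0 := TensorProduct.zero_tmul _ _

theorem JetUniversal.algebroid_isCotangent [CharZero k] : (hev.algebroid P 𝒳).IsCotangent P where
  anchor f a b i := hev.anchor_formGen_jet P f a b i
  br i j a b := by
    rw [algebroid_br, brk_formGen, act_z_pow, act_z_pow, formGen_zero, formGen_zero, add_zero, sub_zero,
      pow_add]

theorem TopLieAlgebroid.skew (L : TopLieAlgebroid ev) (v w : LoopForms ev) :
    L.br v w = -L.br w v := by
  have h := L.self (v + w)
  simp only [map_add, LinearMap.add_apply, L.self, zero_add, add_zero] at h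
  exact eq_neg_of_add_eq_zero_right h

theorem TopLieAlgebroid.IsCotangent.anchor_eq {L : TopLieAlgebroid ev} (hL : L.IsCotangent P) :
    L.anchor = hev.anchor P := by
  refine LinearMap.ext fun v => ?_
  induction v using forms_induction with
  | hadd v w hv hw => rw [map_add, map_add, hv, hw]
  | h f a => exact hev.derivation_ext fun b i => by rw [hL.anchor, hev.anchor_formGen_jet]

theorem JetUniversal.isCotangent_unique (hev : JetUniversal ev) (P : PoissonBracket k A) (𝒳 : FormBasis k A) {L L' : TopLieAlgebroid ev}
    (hL : L.IsCotangent P) (hL' : L'.IsCotangent P) : L = L' := by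
  have ha : L.anchor = L'.anchor := (hL.anchor_eq hev P).trans (hL'.anchor_eq hev P).symm
  have step : ∀ w, (∀ i a, L.br w (formGen ev (ArcRing.z ev ^ i) a) =
      L'.br w (formGen ev (ArcRing.z ev ^ i) a)) → ∀ v, L.br v w = L'.br v w := by
    intro w hw v
    refine sub_eq_zero.mp (𝒳.separated fun N => ?_)
    obtain ⟨N₁, h₁⟩ := L.continuous w N
    obtain ⟨N₂, h₂⟩ := L'.continuous w N
    obtain ⟨u, hu, e⟩ := 𝒳.exists_approx (max N₁ N₂) v
    have h0 : ∀ (L : TopLieAlgebroid ev), L.br v w = -(∑ j, ∑ i ∈ Finset.range (max N₁ N₂),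
        L.br w (ArcRing.coeff ev i (contract ev (𝒳.η j) v) •
          formGen ev (ArcRing.z ev ^ i) (𝒳.x j))) + L.br u w := by
      intro L
      conv_lhs => rw [e]
      rw [map_add, LinearMap.add_apply, L.skew (∑ j, _) w, map_sum]
      simp only [map_sum]
    rw [h0 L, h0 L']
    have h3 : ∀ j i, L.br w (ArcRing.coeff ev i (contract ev (𝒳.η j) v) •
          formGen ev (ArcRing.z ev ^ i) (𝒳.x j)) = L'.br w (ArcRing.coeff ev i (contract ev (𝒳.η j) v) •
          formGen ev (ArcRing.z ev ^ i) (𝒳.x j)) := by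
      intro j i
      rw [L.leibniz, L'.leibniz, hw, ha]
    simp only [h3, add_sub_add_left_eq_sub]
    rw [sub_eq_add_neg]
    exact add_mem_loopFilt (h₁ u (loopFilt_mono (le_max_left _ _) hu))
      (neg_mem_loopFilt (h₂ u (loopFilt_mono (le_max_right _ _) hu)))
  have hb : L.br = L'.br := by
    refine LinearMap.ext₂ fun v w => step w (fun i a => ?_) v
    refine step _ (fun j b => ?_) w
    rw [hL.br, hL'.br]
  cases L
  cases L'
  simp only at ha hb
  subst ha hb
  rfl

/-! ### The derivation `δ` of the Lie algebroid -/

variable {δ : Derivation k B B} (hδ : IsArcDerivation ev δ)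

theorem loopDelta_formGen (f : ArcRing ev) (a : A) :
    loopDelta ev δ hδ (formGen ev f a) = formGen ev (arcDelta ev δ hδ f) a := rfl

theorem coeff_seriesDelta (f : PowerSeries B) (i : ℕ) : PowerSeries.coeff i (seriesDelta δ f) =
    δ (PowerSeries.coeff i f) - (i + 1) * PowerSeries.coeff (i + 1) f := by
  rw [seriesDelta, map_sub, PowerSeries.coeff_mk, PowerSeries.coeff_derivative, mul_comm]

theorem coeff_arcDelta (f : ArcRing ev) (i : ℕ) : ArcRing.coeff ev i (arcDelta ev δ hδ f) =
    δ (ArcRing.coeff ev i f) - (i + 1) * ArcRing.coeff ev (i + 1) f := coeff_seriesDelta f i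

theorem arcDelta_mul (f g : ArcRing ev) : arcDelta ev δ hδ (f * g) =
    arcDelta ev δ hδ f * g + f * arcDelta ev δ hδ g := seriesDelta_mul δ f g

theorem arcDelta_algebraMap (a : A) : arcDelta ev δ hδ (algebraMap A _ a) = 0 := seriesDelta_ev ev δ hδ a

theorem JetUniversal.anchor_loopDelta (v : LoopForms ev) (x : B) :
    hev.anchor P (loopDelta ev δ hδ v) x = δ (hev.anchor P v x) - hev.anchor P v (δ x) := by
  suffices h : hev.anchor P (loopDelta ev δ hδ v) = ⁅δ, hev.anchor P v⁆ by
    rw [h, Derivation.commutator_apply]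
  refine hev.derivation_ext fun b i => ?_
  rw [Derivation.commutator_apply]
  induction v using forms_induction with
  | hadd v w hv hw => simp only [map_add, Derivation.add_apply, hv, hw]; abel
  | h f a =>
    rw [loopDelta_formGen, anchor_formGen_jet, anchor_formGen_jet, hδ, ← Nat.cast_succ, ← nsmul_eq_mul,
      map_nsmul, anchor_formGen_jet, nsmul_eq_mul, Nat.cast_succ, ← coeff_arcDelta hδ, arcDelta_mul,
      arcDelta_algebraMap, mul_zero, add_zero]

theorem JetUniversal.act_loopDelta (v : LoopForms ev) (f : ArcRing ev) :
    hev.act P (loopDelta ev δ hδ v) f =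
      arcDelta ev δ hδ (hev.act P v f) - hev.act P v (arcDelta ev δ hδ f) :=
  ArcRing.ext fun i => by
    have h : ∀ x : B, hev.anchor P v ((i + 1) * x) = (i + 1) * hev.anchor P v x := fun x => by
      rw [← Nat.cast_succ, ← nsmul_eq_mul, map_nsmul, nsmul_eq_mul]
    rw [coeff_act, anchor_loopDelta, map_sub, coeff_arcDelta, coeff_act, coeff_act, coeff_act,
      coeff_arcDelta, map_sub, h]
    ring

theorem JetUniversal.loopDelta_brk (v w : LoopForms ev) :
    loopDelta ev δ hδ (hev.brk P 𝒳 v w) =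
      hev.brk P 𝒳 (loopDelta ev δ hδ v) w + hev.brk P 𝒳 v (loopDelta ev δ hδ w) := by
  induction v using forms_induction with
  | hadd v v' hv hv' => simp only [brk_add_left, map_add, hv, hv']; abel
  | h f a =>
    induction w using forms_induction with
    | hadd w w' hw hw' => simp only [brk_add_right, map_add, hw, hw']; abel
    | h g b =>
      have h1 := hev.act_loopDelta P hδ (formGen ev f a) g
      have h2 := hev.act_loopDelta P hδ (formGen ev g b) f
      rw [loopDelta_formGen] at h1 h2
      simp only [brk_formGen, map_add, map_sub, loopDelta_formGen, arcDelta_mul, h1, h2, formGen_sub,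
        formGen_add]
      abel

theorem loopDelta_smul (b : B) (v : LoopForms ev) :
    loopDelta ev δ hδ (b • v) = b • loopDelta ev δ hδ v + δ b • v := by
  induction v using forms_induction with
  | hadd v w hv hw => simp only [smul_add, map_add, hv, hw]; abel
  | h f a =>
    rw [smul_formGen', loopDelta_formGen, loopDelta_formGen, smul_formGen', smul_formGen', ← formGen_add]
    congr 1
    refine ArcRing.ext fun i => ?_
    simp only [map_add, map_smul, coeff_arcDelta, smul_eq_mul, Derivation.leibniz]
    ring

theorem arcDelta_z_pow (N : ℕ) : arcDelta ev δ hδ (ArcRing.z ev ^ N) = -(N • ArcRing.z ev ^ (N - 1)) :=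
  ArcRing.ext fun i => by
    have h0 : δ (if i = N then 1 else 0) = 0 := by
      split_ifs
      · exact δ.map_one_eq_zero
      · exact map_zero _
    rw [coeff_arcDelta, ArcRing.coeff_z_pow, h0, map_neg, map_nsmul, ArcRing.coeff_z_pow,
      ArcRing.coeff_z_pow]
    rcases N with _ | N
    · simp
    · by_cases h : i = N
      · subst h; simp
      · simp [h]

theorem loopDelta_mem (N : ℕ) {v : LoopForms ev} (hv : v ∈ loopFilt ev (N + 1)) :
    loopDelta ev δ hδ v ∈ loopFilt ev N := by
  obtain ⟨w, rfl⟩ := hv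
  simp only
  induction w using forms_induction with
  | hadd v w hv hw => rw [smul_add, map_add]; exact add_mem_loopFilt hv hw
  | h f a =>
    rw [smul_formGen, loopDelta_formGen, arcDelta_mul, arcDelta_z_pow, formGen_add]
    refine add_mem_loopFilt ⟨formGen ev (-((N + 1) • f)) a, ?_⟩
      ⟨ArcRing.z ev • formGen ev (arcDelta ev δ hδ f) a, ?_⟩ <;>
      simp only [smul_formGen] <;> congr 1
    · simp only [Nat.add_sub_cancel, nsmul_eq_mul]; ring
    · ring

end Algebroid

/-! ## Polynomials in one variable by their divided coefficients -/

section OneVariable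

variable {k B : Type*} [Field k] [CommRing B] [Algebra k B]

/-- The coefficient of `λ^m / m!`. -/
def pcoeff (m : ℕ) : Polynomial B →ₗ[B] B := m.factorial • Polynomial.lcoeff B m

theorem pcoeff_apply (m : ℕ) (p : Polynomial B) : pcoeff m p = m.factorial • p.coeff m := rfl

theorem pcoeff_smul (m : ℕ) (c : k) (p : Polynomial B) : pcoeff m (c • p) = c • pcoeff m p := by
  rw [pcoeff_apply, pcoeff_apply, Polynomial.coeff_smul, smul_comm]

theorem pcoeff_C_mul (m : ℕ) (b : B) (p : Polynomial B) :
    pcoeff m (Polynomial.C b * p) = b * pcoeff m p := by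
  rw [← Polynomial.smul_eq_C_mul, map_smul, smul_eq_mul]

theorem pcoeff_C (m : ℕ) (b : B) : pcoeff m (Polynomial.C b) = if m = 0 then b else 0 := by
  rw [pcoeff_apply, Polynomial.coeff_C]
  split_ifs with h
  · subst h; simp
  · simp

theorem pcoeff_X_mul (m : ℕ) (p : Polynomial B) :
    pcoeff m (Polynomial.X * p) = m • pcoeff (m - 1) p := by
  rw [pcoeff_apply, pcoeff_apply]
  rcases m with _ | m
  · simp
  · rw [Polynomial.coeff_X_mul, Nat.factorial_succ, mul_smul, Nat.add_sub_cancel]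

theorem pcoeff_derivative_pow (m l : ℕ) (p : Polynomial B) :
    pcoeff m ((Polynomial.derivative ^ l : Module.End B (Polynomial B)) p) = pcoeff (m + l) p := by
  induction l generalizing m with
  | zero => simp
  | succ l ih =>
    rw [pow_succ', Module.End.mul_apply, pcoeff_apply, Polynomial.coeff_derivative, ← Nat.cast_succ,
      mul_comm, ← nsmul_eq_mul, smul_smul, mul_comm, ← Nat.factorial_succ, ← pcoeff_apply, ih]
    congr 1
    ring_nf

theorem coeff_polyCoefMap (m : ℕ) (D : B →ₗ[k] B) (p : Polynomial B) :
    (polyCoefMap D p).coeff m = D (p.coeff m) := by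
  induction p using Polynomial.induction_on' with
  | add p q hp hq => simp only [map_add, Polynomial.coeff_add, hp, hq]
  | monomial n b =>
    rw [polyCoefMap_monomial, Polynomial.coeff_monomial, Polynomial.coeff_monomial]
    split_ifs <;> simp

theorem pcoeff_polyCoefMap (m : ℕ) (D : B →ₗ[k] B) (p : Polynomial B) :
    pcoeff m (polyCoefMap D p) = D (pcoeff m p) := by
  rw [pcoeff_apply, pcoeff_apply, map_nsmul, coeff_polyCoefMap]

theorem pcoeff_map {B' : Type*} [CommRing B'] [Algebra k B'] (f : B →ₐ[k] B') (m : ℕ)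
    (p : Polynomial B) : pcoeff m (p.map (f : B →+* B')) = f (pcoeff m p) := by
  rw [pcoeff_apply, pcoeff_apply, map_nsmul, Polynomial.coeff_map]
  rfl

theorem pcoeff_eventually (p : Polynomial B) : ∃ K, ∀ m, K ≤ m → pcoeff m p = 0 :=
  ⟨p.natDegree + 1, fun m hm => by
    rw [pcoeff_apply, Polynomial.coeff_eq_zero_of_natDegree_lt (by omega), smul_zero]⟩

variable [CharZero k]

theorem pcoeff_ext (k : Type*) {B : Type*} [Field k] [CommRing B] [Algebra k B] [CharZero k]
    {p p' : Polynomial B} (h : ∀ m, pcoeff m p = pcoeff m p') : p = p' := by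
  refine Polynomial.ext fun m => ?_
  have h1 := h m
  rw [pcoeff_apply, pcoeff_apply, ← Nat.cast_smul_eq_nsmul k, ← Nat.cast_smul_eq_nsmul k] at h1
  exact smul_right_injective B (show (m.factorial : k) ≠ 0 by exact_mod_cast m.factorial_ne_zero) h1

theorem derivative_pow_eq_zero (p : Polynomial B) : ∃ K,
    (Polynomial.derivative ^ K : Module.End B (Polynomial B)) p = 0 :=
  ⟨p.natDegree + 1, by
    rw [Module.End.pow_apply]
    exact Polynomial.iterate_derivative_eq_zero (Nat.lt_succ_self _)⟩

variable (k) in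
/-- The polynomial `∑ f_m λ^m / m!`. -/
def pgen (f : ℕ → B) : Polynomial B := ∑ᶠ m, Polynomial.monomial m ((m.factorial : k)⁻¹ • f m)

theorem pcoeff_pgen {f : ℕ → B} (hf : ∃ K, ∀ m, K ≤ m → f m = 0) (m : ℕ) :
    pcoeff m (pgen k f) = f m := by
  obtain ⟨K, hK⟩ := hf
  have h : pgen k f = ∑ m ∈ Finset.range K, Polynomial.monomial m ((m.factorial : k)⁻¹ • f m) := by
    refine finsum_eq_sum_of_support_subset _ fun m hm => ?_
    rw [Finset.mem_coe, Finset.mem_range]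
    by_contra h
    exact hm (by simp only [hK m (not_lt.mp h), smul_zero, map_zero])
  rw [pcoeff_apply, h, Polynomial.finsetSum_coeff]
  simp only [Polynomial.coeff_monomial]
  rw [Finset.sum_ite_eq']
  split_ifs with hm
  · rw [← Nat.cast_smul_eq_nsmul k, smul_smul, mul_inv_cancel₀, one_smul]
    exact_mod_cast m.factorial_ne_zero
  · rw [hK m (by simpa using hm), smul_zero]

/-- The action of `B` on `B[λ]` by `x ↦ (p(λ) ↦ p(λ + δ) x)`. -/
def pshift (δ : Derivation k B B) : B →ₐ[k] Module.End k (Polynomial B) :=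
  twist δ Polynomial.derivative derivative_pow_eq_zero

theorem pcoeff_pshift (δ : Derivation k B B) (x : B) (m : ℕ) (p : Polynomial B) {K : ℕ}
    (hK : ∀ l, K ≤ l → pcoeff (m + l) p = 0) :
    pcoeff m (pshift δ x p) = ∑ l ∈ Finset.range K, dpow δ l x * pcoeff (m + l) p := by
  obtain ⟨K', hK'⟩ := derivative_pow_eq_zero p
  have h1 : ∀ l, max K K' ≤ l → (Polynomial.derivative ^ l : Module.End B (Polynomial B)) p = 0 :=
    fun l hl => by
      obtain ⟨j, rfl⟩ := Nat.exists_eq_add_of_le' ((le_max_right K K').trans hl)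
      rw [pow_add, Module.End.mul_apply, hK', map_zero]
  rw [pshift, twist_eq_sum δ _ _ x h1, map_sum]
  simp only [map_smul, pcoeff_derivative_pow, smul_eq_mul]
  symm
  refine Finset.sum_subset (Finset.range_mono (le_max_left _ _)) fun l _ hl => ?_
  rw [hK l (by simpa using hl), mul_zero]

theorem dpow_zero (δ : Derivation k B B) (x : B) : dpow δ 0 x = x := dpw_zero _ _

theorem pshift_C (δ : Derivation k B B) (x b : B) :
    pshift δ x (Polynomial.C b) = Polynomial.C (x * b) := by
  refine pcoeff_ext k fun m => ?_
  rw [pcoeff_pshift δ x m _ (K := 1) (fun l hl => by rw [pcoeff_C, if_neg (by omega)]),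
    Finset.sum_range_one, add_zero, dpow_zero, pcoeff_C, pcoeff_C, mul_ite, mul_zero]

theorem delta_dpow (δ : Derivation k B B) (l : ℕ) (x : B) : δ (dpow δ l x) = dpow δ l (δ x) :=
  dpw_comm δ.toLinearMap l x

theorem succ_nsmul_dpow (δ : Derivation k B B) (l : ℕ) (x : B) :
    (l + 1) • dpow δ (l + 1) x = dpow δ l (δ x) := by
  rw [dpow, succ_smul_dpw_succ, dpw_comm]; rfl

theorem X_mul_pshift (δ : Derivation k B B) (x : B) (p : Polynomial B) :
    pshift δ x (Polynomial.X * p) = Polynomial.X * pshift δ x p + pshift δ (δ x) p := by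
  refine pcoeff_ext k fun m => ?_
  obtain ⟨K, hK⟩ := pcoeff_eventually p
  have hK' : ∀ m l, K ≤ l → pcoeff (m + l) p = 0 := fun m l hl => hK _ (by omega)
  rw [map_add, pcoeff_X_mul, pcoeff_pshift δ x m _ (K := K + 1) (fun l hl => by
    rw [pcoeff_X_mul, hK _ (by omega), smul_zero]), pcoeff_pshift δ x _ p (K := K + 1) (fun l hl => hK' _ l (by omega)),
    pcoeff_pshift δ _ m p (hK' m), Finset.smul_sum, Finset.sum_range_succ', Finset.sum_range_succ']
  have h : ∀ l, dpow δ (l + 1) x * pcoeff (m + (l + 1)) (Polynomial.X * p) =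
      m • (dpow δ (l + 1) x * pcoeff (m - 1 + (l + 1)) p) + dpow δ l (δ x) * pcoeff (m + l) p := by
    intro l
    rw [← succ_nsmul_dpow, pcoeff_X_mul, ← add_assoc, Nat.add_sub_cancel]
    rcases m with _ | m
    · simp only [zero_add, zero_smul, nsmul_eq_mul]; push_cast; ring
    · rw [Nat.add_sub_cancel, show m + (l + 1) = m + 1 + l by ring]
      simp only [nsmul_eq_mul]; push_cast; ring
  rw [Finset.sum_congr rfl fun l _ => h l, Finset.sum_add_distrib, add_zero, add_zero, pcoeff_X_mul]
  simp only [nsmul_eq_mul]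
  ring

theorem polyCoefMap_pshift (δ : Derivation k B B) (x : B) (p : Polynomial B) :
    polyCoefMap δ.toLinearMap (pshift δ x p) =
      pshift δ (δ x) p + pshift δ x (polyCoefMap δ.toLinearMap p) := by
  refine pcoeff_ext k fun m => ?_
  obtain ⟨K, hK⟩ := pcoeff_eventually p
  have hK' : ∀ l, K ≤ l → pcoeff (m + l) p = 0 := fun l hl => hK _ (by omega)
  rw [pcoeff_polyCoefMap, map_add, pcoeff_pshift δ x m p hK', pcoeff_pshift δ (δ x) m p hK',
    pcoeff_pshift δ x m _ (K := K) (fun l hl => by rw [pcoeff_polyCoefMap, hK' l hl, map_zero]), map_sum,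
    ← Finset.sum_add_distrib]
  refine Finset.sum_congr rfl fun l _ => ?_
  rw [pcoeff_polyCoefMap]
  change δ (_ * _) = _ + _ * δ _
  rw [Derivation.leibniz, smul_eq_mul, smul_eq_mul, delta_dpow]
  ring

/-- The substitution `λ ↦ -λ - δ`. -/
def pflip (δ : Derivation k B B) : Polynomial B →ₗ[k] Polynomial B where
  toFun p := p.sum fun m c =>
    ((-(polyCoefMap δ.toLinearMap + LinearMap.mulLeft k Polynomial.X) : Module.End k (Polynomial B)) ^ m)
      (Polynomial.C c)
  map_add' p q := Polynomial.sum_add_index _ _ _ (by simp) (by simp)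
  map_smul' c p := by
    rw [Polynomial.sum_smul_index' _ _ _ (by simp), RingHom.id_apply, Polynomial.smul_sum]
    refine Finset.sum_congr rfl fun m _ => ?_
    simp only [← Polynomial.smul_C, map_smul]

/-- The operator `-λ - δ`. -/
def pneg (δ : Derivation k B B) : Module.End k (Polynomial B) :=
  -(polyCoefMap δ.toLinearMap + LinearMap.mulLeft k Polynomial.X)

theorem pneg_apply (δ : Derivation k B B) (p : Polynomial B) :
    pneg δ p = -(polyCoefMap δ.toLinearMap p + Polynomial.X * p) := rfl

theorem pflip_monomial (δ : Derivation k B B) (m : ℕ) (c : B) :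
    pflip δ (Polynomial.monomial m c) = (pneg δ ^ m) (Polynomial.C c) :=
  Polynomial.sum_monomial_index c (fun m c => (pneg δ ^ m) (Polynomial.C c)) (by simp)

theorem pflip_C (δ : Derivation k B B) (c : B) : pflip δ (Polynomial.C c) = Polynomial.C c :=
  (pflip_monomial δ 0 c).trans (by simp)

theorem pneg_pshift (δ : Derivation k B B) (x : B) (p : Polynomial B) :
    pneg δ (pshift δ x p) = pshift δ x (pneg δ p) := by
  rw [pneg_apply, pneg_apply, map_neg, map_add, X_mul_pshift, polyCoefMap_pshift]
  abel

theorem pneg_pow_pshift (δ : Derivation k B B) (x : B) (m : ℕ) (p : Polynomial B) :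
    (pneg δ ^ m) (pshift δ x p) = pshift δ x ((pneg δ ^ m) p) := by
  induction m with
  | zero => simp
  | succ m ih => rw [pow_succ', Module.End.mul_apply, Module.End.mul_apply, ih, pneg_pshift]

theorem pflip_C_mul (δ : Derivation k B B) (x : B) (p : Polynomial B) :
    pflip δ (Polynomial.C x * p) = pshift δ x (pflip δ p) := by
  induction p using Polynomial.induction_on' with
  | add p q hp hq => simp only [mul_add, map_add, hp, hq]
  | monomial m c =>
    rw [Polynomial.C_mul_monomial, pflip_monomial, pflip_monomial, ← pneg_pow_pshift, pshift_C]

theorem polyCoefMap_X_mul (δ : B →ₗ[k] B) (p : Polynomial B) :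
    polyCoefMap δ (Polynomial.X * p) = Polynomial.X * polyCoefMap δ p := by
  refine Polynomial.ext fun m => ?_
  rw [coeff_polyCoefMap]
  rcases m with _ | m
  · simp
  · rw [Polynomial.coeff_X_mul, Polynomial.coeff_X_mul, coeff_polyCoefMap]

theorem pflip_X_mul (δ : Derivation k B B) (p : Polynomial B) :
    pflip δ (Polynomial.X * p) = pneg δ (pflip δ p) := by
  induction p using Polynomial.induction_on' with
  | add p q hp hq => simp only [mul_add, map_add, hp, hq]
  | monomial m c =>
    rw [Polynomial.X_mul_monomial, pflip_monomial, pflip_monomial, pow_succ', Module.End.mul_apply]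

theorem pflip_polyCoefMap (δ : Derivation k B B) (p : Polynomial B) :
    pflip δ (polyCoefMap δ.toLinearMap p) = polyCoefMap δ.toLinearMap (pflip δ p) := by
  induction p using Polynomial.induction_on' with
  | add p q hp hq => simp only [map_add, hp, hq]
  | monomial m c =>
    rw [polyCoefMap_monomial, pflip_monomial, pflip_monomial]
    induction m with
    | zero => exact (polyCoefMap_monomial δ.toLinearMap 0 c).symm
    | succ m ih =>
      rw [pow_succ', Module.End.mul_apply, Module.End.mul_apply, ih, pneg_apply, pneg_apply, map_neg,
        map_add, polyCoefMap_X_mul]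

theorem pflip_pneg (δ : Derivation k B B) (p : Polynomial B) :
    pflip δ (pneg δ p) = Polynomial.X * pflip δ p := by
  rw [pneg_apply, map_neg, map_add, pflip_X_mul, pflip_polyCoefMap, pneg_apply]
  ring

theorem pflip_pflip (δ : Derivation k B B) (p : Polynomial B) : pflip δ (pflip δ p) = p := by
  induction p using Polynomial.induction_on' with
  | add p q hp hq => simp only [map_add, hp, hq]
  | monomial m c =>
    rw [pflip_monomial]
    induction m with
    | zero => simp [pflip_C]
    | succ m ih =>
      rw [pow_succ', Module.End.mul_apply, pflip_pneg, ih, Polynomial.X_mul_monomial]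

end OneVariable

/-! ## The forms `e^{λz} dx` -/

section ExpForm

variable {k A B : Type u} [Field k] [CommRing A] [CommRing B] [Algebra k A] [Algebra k B]
variable {ev : A →ₐ[k] PowerSeries B}

instance : IsScalarTower k A (ArcRing ev) := IsScalarTower.of_algebraMap_eq fun c => (ev.commutes c).symm

theorem ArcRing.coeff_smul (i : ℕ) (c : k) (f : ArcRing ev) :
    ArcRing.coeff ev i (c • f) = c • ArcRing.coeff ev i f := rfl

theorem cont_smul_eq {N : Type*} [AddCommGroup N] [Module B N] {θ : LoopForms ev →ₗ[B] N} {K : ℕ}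
    (hθ : ∀ v ∈ loopFilt ev K, θ v = 0) {T : ℕ} (hT : K ≤ T) (f : ArcRing ev) (v : LoopForms ev) :
    θ (f • v) = ∑ t ∈ Finset.range T, ArcRing.coeff ev t f • θ (ArcRing.z ev ^ t • v) := by
  have h : ∀ i < T, ArcRing.coeff ev i
      (f - ∑ t ∈ Finset.range T, ArcRing.coeff ev t f • ArcRing.z ev ^ t) = 0 := by
    intro i hi
    rw [map_sub, map_sum]
    simp only [map_smul, ArcRing.coeff_z_pow, smul_eq_mul, mul_ite, mul_one, mul_zero]
    rw [Finset.sum_ite_eq, if_pos (Finset.mem_range.mpr hi), sub_self]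
  have h1 := hθ _ (loopFilt_mono hT (mul_smul_mem_loopFilt h v))
  rw [forms_sub_smul, map_sub, sub_eq_zero, Finset.sum_smul, map_sum] at h1
  rw [h1]
  exact Finset.sum_congr rfl fun t _ => by rw [smul_assoc, map_smul]

variable [CharZero k]

/-- A family of functionals with the Leibniz rule and the sesquilinearity of `x ↦ e^{λz} dx` is
determined by its values on `A`. -/
theorem JetUniversal.seq_zero {B' : Type u} [CommRing B'] [Algebra k B'] (hev : JetUniversal ev)
    {δ : Derivation k B B} (hδ : IsArcDerivation ev δ) {δ' : Derivation k B' B'} (f : B →ₐ[k] B')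
    (hf : ∀ x, f (δ x) = δ' (f x)) (F : B → ℕ → B')
    (hadd : ∀ x y m, F (x + y) m = F x m + F y m) (hsmul : ∀ (c : k) x m, F (c • x) m = c • F x m)
    (hfin : ∀ x, ∃ K, ∀ m, K ≤ m → F x m = 0)
    (hmul : ∀ x y m, ∃ T₀, ∀ T, T₀ ≤ T → F (x * y) m = ∑ t ∈ Finset.range T,
      (dpow δ' t (f x) * F y (m + t) + dpow δ' t (f y) * F x (m + t)))
    (hses : ∀ x m, F (δ x) m = -(m • F x (m - 1))) (h0 : ∀ a m, F (jet ev 0 a) m = 0) (x : B) (m : ℕ) :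
    F x m = 0 := by
  let D : B →ₗ[k] Polynomial B' :=
    { toFun := fun x => pgen k (F x)
      map_add' := fun x y => pcoeff_ext k fun m => by
        rw [map_add, pcoeff_pgen (hfin _), pcoeff_pgen (hfin _), pcoeff_pgen (hfin _), hadd]
      map_smul' := fun c x => pcoeff_ext k fun m => by
        rw [RingHom.id_apply, pcoeff_smul, pcoeff_pgen (hfin _), pcoeff_pgen (hfin _), hsmul] }
  have hD : ∀ x m, pcoeff m (D x) = F x m := fun x m => pcoeff_pgen (hfin x) m
  have e := hev.sesq_uniq hδ ((pshift δ').comp f) (-LinearMap.mulLeft k Polynomial.X) D 0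
    (fun x y => pcoeff_ext k fun m => by
      obtain ⟨T₀, hT₀⟩ := hmul x y m
      obtain ⟨Kx, hKx⟩ := hfin x
      obtain ⟨Ky, hKy⟩ := hfin y
      rw [map_add, hD, hT₀ (max T₀ (max Kx Ky)) (le_max_left _ _), Finset.sum_add_distrib]
      congr 1
      · exact (Finset.sum_congr rfl fun l _ => by rw [hD]).trans (pcoeff_pshift δ' (f x) m (D y)
          (K := max T₀ (max Kx Ky)) fun l hl => by rw [hD]; exact hKy _ (by omega)).symm
      · exact (Finset.sum_congr rfl fun l _ => by rw [hD]).trans (pcoeff_pshift δ' (f y) m (D x)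
          (K := max T₀ (max Kx Ky)) fun l hl => by rw [hD]; exact hKx _ (by omega)).symm)
    (by simp)
    (fun x => pcoeff_ext k fun m => by
      rw [hD, hses, LinearMap.neg_apply, map_neg, LinearMap.mulLeft_apply, pcoeff_X_mul, hD])
    (by simp) (fun a => pcoeff_ext k fun m => by rw [hD, h0]; simp)
  rw [← hD, e]
  simp

variable (hev : JetUniversal ev) {δ : Derivation k B B} (hδ : IsArcDerivation ev δ)

theorem thetaLin_eventually (η : Derivation k A A) (i : ℕ) (a : A) :
    ∃ K, ∀ m, K ≤ m → thetaLin ev η i (formGen ev (ArcRing.z ev ^ m) a) = 0 :=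
  ⟨i + 1, fun m hm => by
    rw [thetaLin_apply, contract_formGen, ArcRing.coeff_z_pow_mul, if_neg (by omega)]⟩

theorem z_pow_smul_formGen (t m : ℕ) (a : A) : ArcRing.z ev ^ t • formGen ev (ArcRing.z ev ^ m) a =
    formGen ev (ArcRing.z ev ^ (m + t)) a := by
  rw [smul_formGen, pow_add, mul_comm]

theorem JetUniversal.exists_formPoly (hev : JetUniversal ev) {δ : Derivation k B B}
    (hδ : IsArcDerivation ev δ) (η : Derivation k A A) (i : ℕ) :
    ∃ D : B →ₗ[k] Polynomial B, (∀ x y, D (x * y) = pshift δ x (D y) + pshift δ y (D x)) ∧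
      (∀ x, D (δ x) = -(Polynomial.X * D x)) ∧
      ∀ a m, pcoeff m (D (jet ev 0 a)) = thetaLin ev η i (formGen ev (ArcRing.z ev ^ m) a) := by
  have hfin := thetaLin_eventually (ev := ev) η i
  let T : A →ₗ[k] Polynomial B :=
    { toFun := fun a => pgen k fun m => thetaLin ev η i (formGen ev (ArcRing.z ev ^ m) a)
      map_add' := fun a b => pcoeff_ext k fun m => by
        rw [map_add, pcoeff_pgen (hfin _), pcoeff_pgen (hfin _), pcoeff_pgen (hfin _), formGen_add',
          map_add]
      map_smul' := fun c a => pcoeff_ext k fun m => by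
        rw [RingHom.id_apply, pcoeff_smul, pcoeff_pgen (hfin _), pcoeff_pgen (hfin _), formGen,
          Derivation.map_smul, TensorProduct.tmul_smul, ← algebraMap_smul B c, map_smul, algebraMap_smul]
        rfl }
  have hT : ∀ a m, pcoeff m (T a) = thetaLin ev η i (formGen ev (ArcRing.z ev ^ m) a) :=
    fun a m => pcoeff_pgen (hfin a) m
  obtain ⟨K, hK⟩ := thetaLin_isCont (ev := ev) η i
  have hz : ∀ m l a, K ≤ l → pcoeff (m + l) (T a) = 0 := fun m l a hl => by
    rw [hT, ← z_pow_smul_formGen]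
    exact hK _ (loopFilt_mono hl ⟨_, rfl⟩)
  obtain ⟨D, h1, h2, h3⟩ := hev.sesq_exist hδ (pshift δ) (-LinearMap.mulLeft k Polynomial.X)
    (fun x v => by
      simp only [LinearMap.neg_apply, LinearMap.mulLeft_apply, map_neg, X_mul_pshift]; abel) T
    (fun a b => pcoeff_ext k fun m => by
      rw [map_add, hT, formGen_mul, map_add, mul_comm _ (algebraMap A _ a),
        mul_comm _ (algebraMap A _ b), ← smul_formGen, ← smul_formGen, cont_smul_eq hK le_rfl,
        cont_smul_eq hK le_rfl, pcoeff_pshift δ _ m (T b) (fun l hl => hz m l b hl),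
        pcoeff_pshift δ _ m (T a) (fun l hl => hz m l a hl)]
      simp only [dpow_jet hδ, hT, z_pow_smul_formGen, ArcRing.coeff_algebraMap, smul_eq_mul])
  exact ⟨D, h1, fun x => h2 x, fun a m => by rw [h3, hT]⟩

/-- The polynomial `η_i(e^{λz} dx)`. -/
def JetUniversal.formPoly (η : Derivation k A A) (i : ℕ) : B →ₗ[k] Polynomial B :=
  (hev.exists_formPoly hδ η i).choose

theorem JetUniversal.formPoly_mul (η : Derivation k A A) (i : ℕ) (x y : B) :
    hev.formPoly hδ η i (x * y) =
      pshift δ x (hev.formPoly hδ η i y) + pshift δ y (hev.formPoly hδ η i x) :=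
  (hev.exists_formPoly hδ η i).choose_spec.1 x y

theorem JetUniversal.formPoly_delta (η : Derivation k A A) (i : ℕ) (x : B) :
    hev.formPoly hδ η i (δ x) = -(Polynomial.X * hev.formPoly hδ η i x) :=
  (hev.exists_formPoly hδ η i).choose_spec.2.1 x

theorem JetUniversal.formPoly_jet (η : Derivation k A A) (i : ℕ) (a : A) (m : ℕ) :
    pcoeff m (hev.formPoly hδ η i (jet ev 0 a)) = thetaLin ev η i (formGen ev (ArcRing.z ev ^ m) a) :=
  (hev.exists_formPoly hδ η i).choose_spec.2.2 a m

variable (𝒳 : FormBasis k A)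

/-- The coefficient of `λ^m / m!` in `e^{λz} dx`. -/
def JetUniversal.expForm (m : ℕ) : B →ₗ[k] LoopForms ev where
  toFun x := ∑ j, ArcRing.mk ev (fun i => pcoeff m (hev.formPoly hδ (𝒳.η j) i x)) • 𝒳.dx ev j
  map_add' x y := by
    rw [← Finset.sum_add_distrib]
    refine Finset.sum_congr rfl fun j _ => ?_
    rw [← add_smul]
    congr 1
    exact ArcRing.ext fun i => by simp only [map_add, ArcRing.coeff_mk]
  map_smul' c x := by
    rw [RingHom.id_apply, Finset.smul_sum]
    refine Finset.sum_congr rfl fun j _ => ?_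
    rw [← algebraMap_smul B c (_ : LoopForms ev), ← smul_assoc]
    congr 1
    exact ArcRing.ext fun i => by
      simp only [map_smul, ArcRing.coeff_mk, pcoeff_smul, algebraMap_smul, ArcRing.coeff_smul]

theorem JetUniversal.expForm_apply (m : ℕ) (x : B) : hev.expForm hδ 𝒳 m x =
    ∑ j, ArcRing.mk ev (fun i => pcoeff m (hev.formPoly hδ (𝒳.η j) i x)) • 𝒳.dx ev j := rfl

theorem JetUniversal.expForm_jet (m : ℕ) (a : A) :
    hev.expForm hδ 𝒳 m (jet ev 0 a) = formGen ev (ArcRing.z ev ^ m) a := by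
  rw [expForm_apply, 𝒳.forms_eq (formGen ev (ArcRing.z ev ^ m) a)]
  refine Finset.sum_congr rfl fun j _ => ?_
  congr 1
  exact ArcRing.ext fun i => by rw [ArcRing.coeff_mk, formPoly_jet, thetaLin_apply]

theorem JetUniversal.expForm_delta (m : ℕ) (x : B) :
    hev.expForm hδ 𝒳 m (δ x) = -(m • hev.expForm hδ 𝒳 (m - 1) x) := by
  rw [expForm_apply, expForm_apply, Finset.smul_sum, ← Finset.sum_neg_distrib]
  refine Finset.sum_congr rfl fun j _ => ?_
  rw [← Nat.cast_smul_eq_nsmul (ArcRing ev), smul_smul, ← forms_neg_smul]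
  congr 1
  refine ArcRing.ext fun i => ?_
  rw [← nsmul_eq_mul, map_neg, map_nsmul, ArcRing.coeff_mk, ArcRing.coeff_mk, formPoly_delta, map_neg,
    pcoeff_X_mul]

theorem exists_bound {ι : Type*} [Fintype ι] {p : ι → ℕ → Prop} (h : ∀ j, ∃ K, ∀ m, K ≤ m → p j m) :
    ∃ K, ∀ m, K ≤ m → ∀ j, p j m := by
  choose K hK using h
  exact ⟨Finset.univ.sup K, fun m hm j => hK j m ((Finset.le_sup (Finset.mem_univ j)).trans hm)⟩

theorem JetUniversal.formPoly_bound (x : B) (N : ℕ) : ∃ K, ∀ m, K ≤ m → ∀ (j : Fin 𝒳.r) (i : Fin N),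
    pcoeff m (hev.formPoly hδ (𝒳.η j) i x) = 0 :=
  exists_bound fun _ => exists_bound fun _ => pcoeff_eventually _

theorem JetUniversal.expForm_mem (x : B) (N : ℕ) :
    ∃ K, ∀ m, K ≤ m → hev.expForm hδ 𝒳 m x ∈ loopFilt ev N := by
  obtain ⟨K, hK⟩ := hev.formPoly_bound hδ 𝒳 x N
  refine ⟨K, fun m hm => ?_⟩
  rw [expForm_apply]
  refine sum_mem_loopFilt _ _ fun j _ => mul_smul_mem_loopFilt (fun i hi => ?_) _
  rw [ArcRing.coeff_mk]
  exact hK m hm j ⟨i, hi⟩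

theorem JetUniversal.expForm_mul_mem (x y : B) (m N : ℕ) : ∃ T₀, ∀ T, T₀ ≤ T →
    hev.expForm hδ 𝒳 m (x * y) - ∑ t ∈ Finset.range T, (dpow δ t x • hev.expForm hδ 𝒳 (m + t) y +
      dpow δ t y • hev.expForm hδ 𝒳 (m + t) x) ∈ loopFilt ev N := by
  obtain ⟨K, hK⟩ := hev.formPoly_bound hδ 𝒳 x N
  obtain ⟨K', hK'⟩ := hev.formPoly_bound hδ 𝒳 y N
  refine ⟨max K K', fun T hT => ?_⟩
  have e : hev.expForm hδ 𝒳 m (x * y) - ∑ t ∈ Finset.range T, (dpow δ t x • hev.expForm hδ 𝒳 (m + t) y +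
      dpow δ t y • hev.expForm hδ 𝒳 (m + t) x) = ∑ j, ArcRing.mk ev (fun i =>
      pcoeff m (hev.formPoly hδ (𝒳.η j) i (x * y)) - ∑ t ∈ Finset.range T,
        (dpow δ t x * pcoeff (m + t) (hev.formPoly hδ (𝒳.η j) i y) +
          dpow δ t y * pcoeff (m + t) (hev.formPoly hδ (𝒳.η j) i x))) • 𝒳.dx ev j := by
    simp only [expForm_apply, Finset.smul_sum]
    simp only [← Finset.sum_add_distrib]
    rw [Finset.sum_comm, ← Finset.sum_sub_distrib]
    refine Finset.sum_congr rfl fun j _ => ?_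
    simp only [← smul_assoc, ← add_smul, ← Finset.sum_smul]
    rw [← forms_sub_smul]
    congr 1
    refine ArcRing.ext fun i => ?_
    simp only [map_sub, map_sum, map_add, map_smul, ArcRing.coeff_mk, smul_eq_mul]
  rw [e]
  refine sum_mem_loopFilt _ _ fun j _ => mul_smul_mem_loopFilt (fun i hi => ?_) _
  rw [ArcRing.coeff_mk, formPoly_mul, map_add, Finset.sum_add_distrib,
    pcoeff_pshift δ x m _ (K := T) (fun l hl => hK' _ (by omega) j ⟨i, hi⟩),
    pcoeff_pshift δ y m _ (K := T) (fun l hl => hK _ (by omega) j ⟨i, hi⟩), sub_self]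

theorem JetUniversal.expForm_mul {N : Type*} [AddCommGroup N] [Module B N] {θ : LoopForms ev →ₗ[B] N}
    (hθ : IsCont θ) (x y : B) (m : ℕ) : ∃ T₀, ∀ T, T₀ ≤ T →
    θ (hev.expForm hδ 𝒳 m (x * y)) = ∑ t ∈ Finset.range T, (dpow δ t x • θ (hev.expForm hδ 𝒳 (m + t) y) +
      dpow δ t y • θ (hev.expForm hδ 𝒳 (m + t) x)) := by
  obtain ⟨K, hK⟩ := hθ
  obtain ⟨T₀, hT₀⟩ := hev.expForm_mul_mem hδ 𝒳 x y m K
  refine ⟨T₀, fun T hT => ?_⟩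
  have h := hK _ (hT₀ T hT)
  rw [map_sub, sub_eq_zero] at h
  rw [h, map_sum]
  simp only [map_add, map_smul]

theorem JetUniversal.expForm_eventually {N : Type*} [AddCommGroup N] [Module B N] {θ : LoopForms ev →ₗ[B] N}
    (hθ : IsCont θ) (x : B) : ∃ K, ∀ m, K ≤ m → θ (hev.expForm hδ 𝒳 m x) = 0 := by
  obtain ⟨N, hN⟩ := hθ
  obtain ⟨K, hK⟩ := hev.expForm_mem hδ 𝒳 x N
  exact ⟨K, fun m hm => hN _ (hK m hm)⟩

theorem JetUniversal.loopDelta_expForm (m : ℕ) (x : B) :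
    loopDelta ev δ hδ (hev.expForm hδ 𝒳 m x) = -(m • hev.expForm hδ 𝒳 (m - 1) x) := by
  rw [← add_eq_zero_iff_eq_neg]
  refine 𝒳.ext_theta fun j i => ?_
  rw [map_zero]
  set θ := thetaLin ev (𝒳.η j) i with hθ
  have hc : IsCont θ := thetaLin_isCont _ _
  have hc' := hc
  obtain ⟨N, hN⟩ := hc'
  have hl : ∀ v ∈ loopFilt ev (N + 1), θ (loopDelta ev δ hδ v) = 0 := fun v hv =>
    hN _ (loopDelta_mem hδ N hv)
  have hs : ∀ (c : k) (v : LoopForms ev), θ (c • v) = c • θ v := fun c v => by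
    rw [← algebraMap_smul B c v, map_smul, algebraMap_smul]
  refine hev.seq_zero hδ (AlgHom.id k B) (δ' := δ) (fun _ => rfl)
    (fun x m => θ (loopDelta ev δ hδ (hev.expForm hδ 𝒳 m x) + m • hev.expForm hδ 𝒳 (m - 1) x))
    (fun x y m => ?_) (fun c x m => ?_) (fun x => ?_) (fun x y m => ?_) (fun x m => ?_) (fun a m => ?_) x m
  · simp only [map_add, smul_add]; abel
  · have h : loopDelta ev δ hδ (c • hev.expForm hδ 𝒳 m x) =
        c • loopDelta ev δ hδ (hev.expForm hδ 𝒳 m x) := by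
      rw [← algebraMap_smul B c (_ : LoopForms ev), loopDelta_smul, Derivation.map_algebraMap, zero_smul,
        add_zero, algebraMap_smul]
    simp only [map_smul, h]
    rw [smul_comm m c, ← smul_add, hs]
  · obtain ⟨K, hK⟩ := hev.expForm_mem hδ 𝒳 x (N + 1)
    refine ⟨K + 1, fun m hm => ?_⟩
    rw [map_add, map_nsmul, hl _ (hK m (by omega)), hN _ (loopFilt_mono (Nat.le_succ N) (hK _ (by omega))),
      smul_zero, add_zero]
  · obtain ⟨T₁, h₁⟩ := hev.expForm_mul_mem hδ 𝒳 x y m (N + 1)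
    obtain ⟨T₂, h₂⟩ := hev.expForm_mul_mem hδ 𝒳 x y (m - 1) (N + 1)
    obtain ⟨Kx, hx⟩ := hev.expForm_eventually hδ 𝒳 hc x
    obtain ⟨Ky, hy⟩ := hev.expForm_eventually hδ 𝒳 hc y
    refine ⟨max (max T₁ T₂) (max Kx Ky + 1), fun T hT => ?_⟩
    have e₁ := hl _ (h₁ T (by omega))
    have e₂ := hN _ (loopFilt_mono (Nat.le_succ N) (h₂ T (by omega)))
    rw [map_sub, map_sub, sub_eq_zero] at e₁
    rw [map_sub, sub_eq_zero] at e₂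
    rw [map_add, map_nsmul, e₁, e₂]
    simp only [map_sum, map_add, loopDelta_smul, map_smul, map_nsmul, AlgHom.id_apply, smul_eq_mul]
    rw [Finset.smul_sum, ← Finset.sum_add_distrib]
    rw [← sub_eq_zero, ← Finset.sum_sub_distrib]
    obtain ⟨T, rfl⟩ : ∃ T', T = T' + 1 := ⟨T - 1, by omega⟩
    have hg : ∀ t, dpow δ t x * θ (loopDelta ev δ hδ (hev.expForm hδ 𝒳 (m + t) y)) +
        δ (dpow δ t x) * θ (hev.expForm hδ 𝒳 (m + t) y) +
        (dpow δ t y * θ (loopDelta ev δ hδ (hev.expForm hδ 𝒳 (m + t) x)) +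
        δ (dpow δ t y) * θ (hev.expForm hδ 𝒳 (m + t) x)) +
        m • (dpow δ t x * θ (hev.expForm hδ 𝒳 (m - 1 + t) y) +
          dpow δ t y * θ (hev.expForm hδ 𝒳 (m - 1 + t) x)) -
        (dpow δ t x * (θ (loopDelta ev δ hδ (hev.expForm hδ 𝒳 (m + t) y)) +
          (m + t) • θ (hev.expForm hδ 𝒳 (m + t - 1) y)) +
        dpow δ t y * (θ (loopDelta ev δ hδ (hev.expForm hδ 𝒳 (m + t) x)) +
          (m + t) • θ (hev.expForm hδ 𝒳 (m + t - 1) x))) =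
        ((t + 1) • (dpow δ (t + 1) x * θ (hev.expForm hδ 𝒳 (m + t) y)) +
          (t + 1) • (dpow δ (t + 1) y * θ (hev.expForm hδ 𝒳 (m + t) x))) -
        (t • (dpow δ t x * θ (hev.expForm hδ 𝒳 (m + t - 1) y)) +
          t • (dpow δ t y * θ (hev.expForm hδ 𝒳 (m + t - 1) x))) := by
      intro t
      have hm : ∀ z, m • θ (hev.expForm hδ 𝒳 (m - 1 + t) z) = m • θ (hev.expForm hδ 𝒳 (m + t - 1) z) := by
        intro z
        rcases m with _ | m
        · simp
        · congr 4; omega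
      have hx := hm x
      have hy := hm y
      rw [delta_dpow, delta_dpow, ← succ_nsmul_dpow, ← succ_nsmul_dpow]
      simp only [nsmul_eq_mul] at hx hy ⊢
      push_cast
      linear_combination dpow δ t x * hy + dpow δ t y * hx
    rw [Finset.sum_congr rfl fun t _ => hg t]
    have hg' := Finset.sum_range_sub (fun t => t • (dpow δ t x * θ (hev.expForm hδ 𝒳 (m + t - 1) y)) +
          t • (dpow δ t y * θ (hev.expForm hδ 𝒳 (m + t - 1) x))) (T + 1)
    simp only [← add_assoc, Nat.add_sub_cancel] at hg' ⊢
    rw [hg', hx _ (by omega), hy _ (by omega)]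
    simp
  · simp only [expForm_delta, map_add, map_neg, map_nsmul, smul_add, smul_neg, neg_add_rev]
    rcases m with _ | m
    · simp
    · simp only [Nat.add_sub_cancel]
      abel
  · simp only [expForm_jet]
    rw [loopDelta_formGen, arcDelta_z_pow]
    have : formGen ev (-(m • ArcRing.z ev ^ (m - 1))) a + m • formGen ev (ArcRing.z ev ^ (m - 1)) a = 0 := by
      rw [← Nat.cast_smul_eq_nsmul (ArcRing ev) m (formGen ev _ a), smul_formGen, ← formGen_add,
        nsmul_eq_mul, neg_add_cancel, formGen_zero]
    rw [this, map_zero]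

end ExpForm

/-! ## The Poisson vertex algebra structure -/

section VertexCombinatorics

theorem sum_alternating_choose (n m i : ℕ) : ∑ j ∈ Finset.range (i + 1),
    (-1 : ℤ) ^ j * (n.choose j * (m + n - j).choose (i - j)) = m.choose i := by
  induction n generalizing m i with
  | zero => rw [Finset.sum_range_succ']; simp
  | succ n ih =>
    rcases i with _ | i
    · simp
    · have h1 := ih (m + 1) (i + 1)
      have h2 := ih m i
      rw [Finset.sum_range_succ'] at h1 ⊢
      have h3 : ∀ j, (-1 : ℤ) ^ (j + 1) * (((n + 1).choose (j + 1) : ℕ) *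
          ((m + (n + 1) - (j + 1)).choose (i + 1 - (j + 1)) : ℕ)) =
          (-1 : ℤ) ^ (j + 1) * ((n.choose (j + 1) : ℕ) * ((m + 1 + n - (j + 1)).choose (i + 1 - (j + 1)) : ℕ)) -
          (-1 : ℤ) ^ j * ((n.choose j : ℕ) * ((m + n - j).choose (i - j) : ℕ)) := by
        intro j
        rw [Nat.choose_succ_succ, show m + (n + 1) - (j + 1) = m + n - j by omega,
          show m + 1 + n - (j + 1) = m + n - j by omega, show i + 1 - (j + 1) = i - j by omega]
        push_cast
        ring
      rw [Finset.sum_congr rfl fun j _ => h3 j, Finset.sum_sub_distrib, h2]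
      have h4 : (m + 1).choose (i + 1) = m.choose i + m.choose (i + 1) := Nat.choose_succ_succ _ _
      have h5 : m + (n + 1) = m + 1 + n := by ring
      simp only [Nat.choose_zero_right, Nat.sub_zero, h4, h5] at h1 ⊢
      push_cast at h1 ⊢
      linear_combination h1

theorem sum_range_antidiagonal {N : Type*} [AddCommMonoid N] (g : ℕ → ℕ → N) {M T : ℕ}
    (h1 : ∀ t s, M ≤ t → g t s = 0) (h2 : ∀ t s, T ≤ t + s → g t s = 0) :
    ∑ l ∈ Finset.range T, ∑ t ∈ Finset.range (l + 1), g t (l - t) =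
      ∑ t ∈ Finset.range M, ∑ s ∈ Finset.range T, g t s := by
  rw [Finset.sum_range_diag_flip]
  have h3 : ∀ t, ∑ s ∈ Finset.range (T - t), g t s = ∑ s ∈ Finset.range T, g t s := fun t =>
    Finset.sum_subset (Finset.range_mono (Nat.sub_le _ _)) fun s _ hs => h2 t s (by
      have := Finset.mem_range.not.mp hs; omega)
  simp only [h3]
  rcases le_total M T with h | h
  · exact (Finset.sum_subset (Finset.range_mono h) fun t _ ht =>
      Finset.sum_eq_zero fun s _ => h1 t s (by simpa using ht)).symm
  · exact Finset.sum_subset (Finset.range_mono h) fun t _ ht =>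
      Finset.sum_eq_zero fun s _ => h2 t s (by have := Finset.mem_range.not.mp ht; omega)

variable {k B : Type*} [Field k] [CommRing B] [Algebra k B] [CharZero k]

theorem dpow_map_zero (δ : Derivation k B B) (l : ℕ) : dpow δ l (0 : B) = 0 := map_zero _

theorem dpow_map_nsmul (δ : Derivation k B B) (l n : ℕ) (x : B) :
    dpow δ l (n • x) = n • dpow δ l x := map_nsmul _ _ _

theorem pcoeff_pneg_pow (δ : Derivation k B B) (c : B) (m j : ℕ) :
    pcoeff j ((pneg δ ^ m) (Polynomial.C c)) =
      if j ≤ m then (-1 : ℤ) ^ m • m.factorial • dpow δ (m - j) c else 0 := by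
  induction m generalizing j with
  | zero =>
    rw [pow_zero, Module.End.one_apply, pcoeff_C]
    rcases j with _ | j
    · simp
    · simp
  | succ m ih =>
    rw [pow_succ', Module.End.mul_apply, pneg_apply, map_neg, map_add, pcoeff_polyCoefMap, pcoeff_X_mul,
      ih, ih]
    rcases lt_trichotomy j (m + 1) with h | h | h
    · obtain ⟨i, rfl⟩ := Nat.exists_eq_add_of_lt h |>.imp fun i hi => (by omega : m = j + i)
      rw [if_pos (by omega), if_pos (by omega), if_pos (by omega), Nat.add_sub_cancel_left,
        show j + i + 1 - j = i + 1 by omega]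
      change -(δ _ + _) = _
      rw [map_zsmul, map_nsmul, delta_dpow, ← succ_nsmul_dpow, pow_succ, Nat.factorial_succ]
      rcases j with _ | j
      · simp only [zsmul_eq_mul, nsmul_eq_mul, Nat.cast_zero]; push_cast; ring
      · rw [show j + 1 + i - (j + 1 - 1) = i + 1 by omega]
        simp only [zsmul_eq_mul, nsmul_eq_mul]; push_cast; ring
    · subst h
      rw [if_neg (by omega), if_pos (by omega), if_pos le_rfl, Nat.add_sub_cancel, Nat.sub_self,
        Nat.sub_self, pow_succ, Nat.factorial_succ, map_zero]
      simp only [zsmul_eq_mul, nsmul_eq_mul]; push_cast; ring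
    · rw [if_neg (by omega), if_neg (by omega), if_neg (by omega), map_zero, smul_zero, add_zero, neg_zero]

theorem pcoeff_pflip (δ : Derivation k B B) (p : Polynomial B) (j : ℕ) {K : ℕ}
    (hK : ∀ m, K ≤ m → pcoeff m p = 0) : pcoeff j (pflip δ p) =
      ∑ s ∈ Finset.range K, (-1 : ℤ) ^ (j + s) • dpow δ s (pcoeff (j + s) p) := by
  have key : ∀ p : Polynomial B, ∃ L, ∀ K, L ≤ K → pcoeff j (pflip δ p) =
      ∑ s ∈ Finset.range K, (-1 : ℤ) ^ (j + s) • dpow δ s (pcoeff (j + s) p) := by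
    intro p
    induction p using Polynomial.induction_on' with
    | add p q hp hq =>
      obtain ⟨L, hL⟩ := hp
      obtain ⟨L', hL'⟩ := hq
      refine ⟨max L L', fun K hK => ?_⟩
      rw [map_add, map_add, hL K (le_trans (le_max_left _ _) hK), hL' K (le_trans (le_max_right _ _) hK),
        ← Finset.sum_add_distrib]
      simp only [map_add, smul_add]
    | monomial m c =>
      refine ⟨m + 1, fun K hK => ?_⟩
      rw [pflip_monomial, pcoeff_pneg_pow]
      split_ifs with h
      · rw [Finset.sum_eq_single (m - j)]
        · rw [Nat.add_sub_cancel' h, pcoeff_apply, Polynomial.coeff_monomial, if_pos rfl, dpow_map_nsmul]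
        · intro s _ hs
          rw [pcoeff_apply, Polynomial.coeff_monomial, if_neg (by omega), smul_zero, dpow_map_zero, smul_zero]
        · intro h'
          exact absurd (Finset.mem_range.mpr (by omega)) h'
      · refine (Finset.sum_eq_zero fun s _ => ?_).symm
        rw [pcoeff_apply, Polynomial.coeff_monomial, if_neg (by omega), smul_zero, dpow_map_zero, smul_zero]
  obtain ⟨L, hL⟩ := key p
  rw [hL _ (le_max_left L K)]
  symm
  refine Finset.sum_subset (Finset.range_mono (le_max_right _ _)) fun s _ hs => ?_
  rw [hK _ (by have := Finset.mem_range.not.mp hs; omega), dpow_map_zero, smul_zero]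

end VertexCombinatorics

section Star

variable {k A B : Type u} [Field k] [CommRing A] [CommRing B] [Algebra k A] [Algebra k B] [CharZero k]
variable {ev : A →ₐ[k] PowerSeries B} (hev : JetUniversal ev) {δ : Derivation k B B}
  (hδ : IsArcDerivation ev δ) (𝒳 : FormBasis k A) (P : PoissonBracket k A)
  {L : TopLieAlgebroid ev} (hL : L.IsCotangent P)

theorem JetUniversal.anchor_isCont (y : B) : IsCont (hev.anchorForm P y).1 := (hev.anchorForm P y).2

/-- The operation `y ↦ x_(m) y`, which gives the coefficient of `λ^m / m!` in `{x_λ y}`. -/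
def JetUniversal.nprod (m : ℕ) (x : B) : Derivation k B B := hev.anchor P (hev.expForm hδ 𝒳 m x)

theorem JetUniversal.nprod_apply (m : ℕ) (x y : B) :
    hev.nprod hδ 𝒳 P m x y = (hev.anchorForm P y).1 (hev.expForm hδ 𝒳 m x) := rfl

theorem JetUniversal.nprod_eventually (x y : B) :
    ∃ K, ∀ m, K ≤ m → hev.nprod hδ 𝒳 P m x y = 0 :=
  hev.expForm_eventually hδ 𝒳 (hev.anchor_isCont P y) x

theorem JetUniversal.nprod_mul_left (x x' y : B) (m : ℕ) : ∃ T₀, ∀ T, T₀ ≤ T →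
    hev.nprod hδ 𝒳 P m (x * x') y = ∑ t ∈ Finset.range T, (dpow δ t x * hev.nprod hδ 𝒳 P (m + t) x' y +
      dpow δ t x' * hev.nprod hδ 𝒳 P (m + t) x y) :=
  hev.expForm_mul hδ 𝒳 (hev.anchor_isCont P y) x x' m

theorem JetUniversal.nprod_delta_left (m : ℕ) (x y : B) :
    hev.nprod hδ 𝒳 P m (δ x) y = -(m • hev.nprod hδ 𝒳 P (m - 1) x y) := by
  rw [nprod_apply, expForm_delta, map_neg, map_nsmul]; rfl

theorem JetUniversal.nprod_delta_right (m : ℕ) (x y : B) : hev.nprod hδ 𝒳 P m x (δ y) =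
    δ (hev.nprod hδ 𝒳 P m x y) + m • hev.nprod hδ 𝒳 P (m - 1) x y := by
  have h := hev.anchor_loopDelta P hδ (hev.expForm hδ 𝒳 m x) y
  rw [loopDelta_expForm, map_neg, map_nsmul] at h
  have h' : -(m • hev.nprod hδ 𝒳 P (m - 1) x y) =
    δ (hev.nprod hδ 𝒳 P m x y) - hev.nprod hδ 𝒳 P m x (δ y) := h
  linear_combination h'

theorem JetUniversal.nprod_dpow (l m : ℕ) (x y : B) : hev.nprod hδ 𝒳 P m x (dpow δ l y) =
    ∑ t ∈ Finset.range (l + 1), m.choose t • dpow δ (l - t) (hev.nprod hδ 𝒳 P (m - t) x y) := by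
  induction l generalizing m with
  | zero => simp
  | succ l ih =>
    have h0 : ((l + 1 : ℕ) : k) ≠ 0 := by exact_mod_cast Nat.succ_ne_zero l
    refine smul_right_injective B h0 ?_
    simp only [Nat.cast_smul_eq_nsmul]
    rw [← map_nsmul, succ_nsmul_dpow, ← delta_dpow, nprod_delta_right, ih, ih, map_sum]
    have h1 : ∀ t ∈ Finset.range (l + 1), δ (m.choose t • dpow δ (l - t) (hev.nprod hδ 𝒳 P (m - t) x y)) =
        (l + 1 - t) • (m.choose t • dpow δ (l + 1 - t) (hev.nprod hδ 𝒳 P (m - t) x y)) := by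
      intro t ht
      rw [map_nsmul, delta_dpow, ← succ_nsmul_dpow, smul_comm]
      have := Finset.mem_range.mp ht
      rw [show l - t + 1 = l + 1 - t by omega]
    have h2 : ∀ t, m • ((m - 1).choose t • dpow δ (l - t) (hev.nprod hδ 𝒳 P (m - 1 - t) x y)) =
        (t + 1) • (m.choose (t + 1) • dpow δ (l + 1 - (t + 1)) (hev.nprod hδ 𝒳 P (m - (t + 1)) x y)) := by
      intro t
      rw [smul_smul, smul_smul, show l + 1 - (t + 1) = l - t by omega,
        show m - (t + 1) = m - 1 - t by omega]
      congr 1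
      rcases m with _ | m
      · simp
      · rw [Nat.add_sub_cancel, Nat.add_one_mul_choose_eq, mul_comm]
    rw [Finset.sum_congr rfl h1, Finset.smul_sum, Finset.sum_congr rfl fun t _ => h2 t,
      Finset.smul_sum]
    have h3 := Finset.sum_range_succ' (fun t => t • (m.choose t • dpow δ (l + 1 - t)
      (hev.nprod hδ 𝒳 P (m - t) x y))) (l + 1)
    rw [zero_smul, add_zero] at h3
    have h4 := Finset.sum_range_succ (fun t => (l + 1 - t) • (m.choose t • dpow δ (l + 1 - t)
      (hev.nprod hδ 𝒳 P (m - t) x y))) (l + 1)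
    rw [Nat.sub_self, zero_smul, add_zero] at h4
    rw [← h3, ← h4, ← Finset.sum_add_distrib]
    refine Finset.sum_congr rfl fun t ht => ?_
    rw [← add_smul]
    congr 1
    have := Finset.mem_range.mp ht
    omega

theorem forms_map_smul (θ : LoopForms ev →ₗ[B] B) (c : k)
    (v : LoopForms ev) : θ (c • v) = c • θ v := by
  rw [← algebraMap_smul B c v, map_smul, algebraMap_smul]

/-- The formula for `[e^{λz} dx, e^{μz} dy]`, coefficient of `λ^m μ^n / m! n!`. -/
def JetUniversal.Star (L : TopLieAlgebroid ev) (m n : ℕ) (x y : B) : Prop :=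
  L.br (hev.expForm hδ 𝒳 m x) (hev.expForm hδ 𝒳 n y) = ∑ t ∈ Finset.range (m + 1),
    m.choose t • hev.expForm hδ 𝒳 (n + t) (hev.nprod hδ 𝒳 P (m - t) x y)

theorem JetUniversal.star_mixed (m n : ℕ) (x y y' : B) (θ : LoopForms ev →ₗ[B] B) (hθ : IsCont θ) :
    ∃ T₀, ∀ T, T₀ ≤ T → ∑ l ∈ Finset.range T, hev.nprod hδ 𝒳 P m x (dpow δ l y) *
      θ (hev.expForm hδ 𝒳 (n + l) y') = ∑ t ∈ Finset.range (m + 1), m.choose t •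
        ∑ s ∈ Finset.range T, dpow δ s (hev.nprod hδ 𝒳 P (m - t) x y) *
          θ (hev.expForm hδ 𝒳 (n + t + s) y') := by
  obtain ⟨K, hK⟩ := hev.expForm_eventually hδ 𝒳 hθ y'
  refine ⟨K, fun T hT => ?_⟩
  have h := sum_range_antidiagonal (fun t s => m.choose t • (dpow δ s (hev.nprod hδ 𝒳 P (m - t) x y) *
          θ (hev.expForm hδ 𝒳 (n + t + s) y'))) (M := m + 1) (T := T)
    (fun t s ht => by rw [Nat.choose_eq_zero_of_lt (by omega), zero_smul])
    (fun t s hts => by rw [hK _ (by omega), mul_zero, smul_zero])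
  simp only [Finset.smul_sum]
  rw [← h]
  refine Finset.sum_congr rfl fun l _ => ?_
  rw [nprod_dpow, Finset.sum_mul]
  refine Finset.sum_congr rfl fun t ht => ?_
  rw [smul_mul_assoc, show n + t + (l - t) = n + l by have := Finset.mem_range.mp ht; omega]

theorem JetUniversal.star_step (m : ℕ) (x : B)
    (h : ∀ n b, hev.Star hδ 𝒳 P L m n x (jet ev 0 b)) (hL : L.IsCotangent P) (n : ℕ) (y : B) :
    hev.Star hδ 𝒳 P L m n x y := by
  refine 𝒳.ext_theta fun j i => ?_
  set θ := thetaLin ev (𝒳.η j) i with hθ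
  have hc : IsCont θ := thetaLin_isCont _ _
  set v := hev.expForm hδ 𝒳 m x with hv
  have hcv : ∃ N, ∀ w ∈ loopFilt ev N, θ (L.br v w) = 0 ∧ θ w = 0 := by
    obtain ⟨K, hK⟩ := hc
    obtain ⟨N, hN⟩ := L.continuous v K
    refine ⟨max K N, fun w hw => ⟨?_, hK _ (loopFilt_mono (le_max_left _ _) hw)⟩⟩
    rw [L.skew, map_neg, hK _ (hN w (loopFilt_mono (le_max_right _ _) hw)), neg_zero]
  obtain ⟨N, hN⟩ := hcv
  have hs := forms_map_smul (k := k) θ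
  rw [← sub_eq_zero]
  refine hev.seq_zero hδ (AlgHom.id k B) (δ' := δ) (fun _ => rfl) (fun y n =>
    θ (L.br v (hev.expForm hδ 𝒳 n y)) - θ (∑ t ∈ Finset.range (m + 1),
      m.choose t • hev.expForm hδ 𝒳 (n + t) (hev.nprod hδ 𝒳 P (m - t) x y)))
    (fun y y' n => ?_) (fun c y n => ?_) (fun y => ?_) (fun y y' n => ?_) (fun y n => ?_)
    (fun b n => ?_) y n
  · simp only [map_add, smul_add, Finset.sum_add_distrib]; abel
  · simp only [map_smul, Derivation.map_smul, hs, smul_sub]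
    congr 1
    simp only [map_sum, Finset.smul_sum, map_nsmul, hs]
    exact Finset.sum_congr rfl fun t _ => smul_comm _ _ _
  · obtain ⟨K, hK⟩ := hev.expForm_mem hδ 𝒳 y N
    obtain ⟨K', hK'⟩ := exists_bound (ι := Fin (m + 1)) fun t =>
      hev.expForm_eventually hδ 𝒳 hc (hev.nprod hδ 𝒳 P (m - t) x y)
    refine ⟨max K K', fun n hn => ?_⟩
    rw [(hN _ (hK n (by omega))).1, map_sum, zero_sub, neg_eq_zero]
    refine Finset.sum_eq_zero fun t ht => ?_
    rw [map_nsmul, hK' (n + t) (by omega) ⟨t, Finset.mem_range.mp ht⟩, smul_zero]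
  · obtain ⟨T₁, h₁⟩ := hev.expForm_mul_mem hδ 𝒳 y y' n N
    have h₂ := fun t : Fin (m + 1) => hev.expForm_mul hδ 𝒳 hc y (hev.nprod hδ 𝒳 P (m - t) x y') (n + t)
    have h₃ := fun t : Fin (m + 1) => hev.expForm_mul hδ 𝒳 hc y' (hev.nprod hδ 𝒳 P (m - t) x y) (n + t)
    obtain ⟨T₂, h₂⟩ := exists_bound h₂
    obtain ⟨T₃, h₃⟩ := exists_bound h₃
    obtain ⟨T₄, h₄⟩ := hev.star_mixed hδ 𝒳 P m n x y y' θ hc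
    obtain ⟨T₅, h₅⟩ := hev.star_mixed hδ 𝒳 P m n x y' y θ hc
    refine ⟨max (max T₁ T₂) (max T₃ (max T₄ T₅)), fun T hT => ?_⟩
    have e₁ := (hN _ (h₁ T (by omega))).1
    have e₄ := h₄ T (by omega)
    have e₅ := h₅ T (by omega)
    rw [map_sub, map_sub, sub_eq_zero] at e₁
    have e₆ : θ (∑ t ∈ Finset.range (m + 1), m.choose t • hev.expForm hδ 𝒳 (n + t)
        (hev.nprod hδ 𝒳 P (m - t) x (y * y'))) = ∑ t ∈ Finset.range (m + 1), m.choose t •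
        ((∑ s ∈ Finset.range T, (dpow δ s y * θ (hev.expForm hδ 𝒳 (n + t + s) (hev.nprod hδ 𝒳 P (m - t) x y'))
          + dpow δ s (hev.nprod hδ 𝒳 P (m - t) x y') * θ (hev.expForm hδ 𝒳 (n + t + s) y))) +
        ∑ s ∈ Finset.range T, (dpow δ s y' * θ (hev.expForm hδ 𝒳 (n + t + s) (hev.nprod hδ 𝒳 P (m - t) x y))
          + dpow δ s (hev.nprod hδ 𝒳 P (m - t) x y) * θ (hev.expForm hδ 𝒳 (n + t + s) y'))) := by
      rw [map_sum]
      refine Finset.sum_congr rfl fun t ht => ?_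
      have ht' := Finset.mem_range.mp ht
      rw [map_nsmul, Derivation.leibniz, smul_eq_mul, smul_eq_mul, map_add, map_add,
        h₂ T (by omega) ⟨t, ht'⟩, h₃ T (by omega) ⟨t, ht'⟩]
      rfl
    rw [e₁, e₆]
    simp only [map_sum, map_add, L.leibniz, map_smul, AlgHom.id_apply, smul_eq_mul, map_nsmul,
      hL.anchor_eq hev P, Finset.sum_add_distrib, smul_add, mul_sub, Finset.sum_sub_distrib, Finset.mul_sum]
    have e₄' : ∑ l ∈ Finset.range T, hev.anchor P v (dpow δ l y) * θ (hev.expForm hδ 𝒳 (n + l) y') = _ := e₄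
    have e₅' : ∑ l ∈ Finset.range T, hev.anchor P v (dpow δ l y') * θ (hev.expForm hδ 𝒳 (n + l) y) = _ := e₅
    rw [e₄', e₅']
    have e₇ : ∀ (z : ℕ → B) (y : B), ∑ s ∈ Finset.range T, ∑ t ∈ Finset.range (m + 1),
        dpow δ s y * m.choose t • θ (hev.expForm hδ 𝒳 (n + s + t) (z t)) =
        ∑ t ∈ Finset.range (m + 1), m.choose t •
          ∑ s ∈ Finset.range T, dpow δ s y * θ (hev.expForm hδ 𝒳 (n + t + s) (z t)) := fun z y => by
      rw [Finset.sum_comm]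
      refine Finset.sum_congr rfl fun t _ => ?_
      rw [Finset.smul_sum]
      exact Finset.sum_congr rfl fun s _ => by rw [mul_smul_comm, add_right_comm]
    rw [e₇, e₇]
    ring
  · have e : ∀ t, θ (m.choose t • hev.expForm hδ 𝒳 (n + t) (hev.nprod hδ 𝒳 P (m - t) x (δ y))) =
        -(n • θ (m.choose t • hev.expForm hδ 𝒳 (n - 1 + t) (hev.nprod hδ 𝒳 P (m - t) x y))) +
        (((t + 1) • θ (m.choose (t + 1) • hev.expForm hδ 𝒳 (n + t) (hev.nprod hδ 𝒳 P (m - (t + 1)) x y))) -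
        (t • θ (m.choose t • hev.expForm hδ 𝒳 (n + t - 1) (hev.nprod hδ 𝒳 P (m - t) x y)))) := by
      intro t
      have e1 : (m - t) * m.choose t = (t + 1) * m.choose (t + 1) := by
        rw [mul_comm (t + 1), Nat.choose_succ_right_eq, mul_comm]
      have e2 : ∀ z, n • θ (hev.expForm hδ 𝒳 (n - 1 + t) z) = n • θ (hev.expForm hδ 𝒳 (n + t - 1) z) := by
        intro z
        rcases n with _ | n
        · simp
        · congr 4; omega
      have e2' := e2 (hev.nprod hδ 𝒳 P (m - t) x y)
      have e1' : ((m - t : ℕ) : B) * m.choose t = ((t + 1 : ℕ) : B) * m.choose (t + 1) := by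
        exact_mod_cast congrArg (Nat.cast (R := B)) e1
      rw [nprod_delta_right, map_add, expForm_delta, show m - (t + 1) = m - t - 1 by omega]
      simp only [map_nsmul, map_add, map_neg]
      simp only [nsmul_eq_mul] at e2' ⊢
      push_cast at e1' ⊢
      linear_combination (m.choose t : B) * e2' +
        θ (hev.expForm hδ 𝒳 (n + t) (hev.nprod hδ 𝒳 P (m - t - 1) x y)) * e1'
    have e' := Finset.sum_range_sub (fun t => t • θ (m.choose t • hev.expForm hδ 𝒳 (n + t - 1)
      (hev.nprod hδ 𝒳 P (m - t) x y))) (m + 1)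
    rw [Nat.choose_succ_self, zero_smul, map_zero, smul_zero, zero_smul, sub_zero] at e'
    rw [expForm_delta, map_neg, map_neg, map_nsmul, map_nsmul, map_sum, Finset.sum_congr rfl fun t _ => e t,
      Finset.sum_add_distrib]
    have e'' : ∑ t ∈ Finset.range (m + 1), (((t + 1) • θ (m.choose (t + 1) • hev.expForm hδ 𝒳 (n + t)
        (hev.nprod hδ 𝒳 P (m - (t + 1)) x y))) - (t • θ (m.choose t • hev.expForm hδ 𝒳 (n + t - 1)
        (hev.nprod hδ 𝒳 P (m - t) x y)))) = 0 := e'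
    rw [e'', add_zero, Finset.sum_neg_distrib, ← Finset.smul_sum, map_sum, smul_sub]
    ring
  · rw [h n b, sub_self]

end Star

section Substitution

variable {k B : Type*} [Field k] [CommRing B] [Algebra k B] {n : ℕ}

theorem dcoeff_X_pow_mul (m : Fin n →₀ ℕ) (i : Fin n) (r : ℕ) (p : MvPolynomial (Fin n) B) :
    dcoeff m (MvPolynomial.X i ^ r * p) =
      (m i).descFactorial r • dcoeff (m - Finsupp.single i r) p := by
  induction r generalizing m with
  | zero => simp
  | succ r ih =>
    rw [pow_succ', mul_assoc, dcoeff_X_mul, ih, smul_smul]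
    have h1 : (m - Finsupp.single i 1 : Fin n →₀ ℕ) i = m i - 1 := by simp
    rw [h1, tsub_tsub, ← Finsupp.single_add, add_comm 1 r]
    congr 1
    rcases hm : m i with _ | l
    · simp
    · rw [Nat.add_sub_cancel, Nat.succ_descFactorial_succ]

theorem dcoeff_sum_X_pow_mul (m : Fin n →₀ ℕ) (i : Fin n) (p : Polynomial B)
    (F : B →ₗ[k] MvPolynomial (Fin n) B) :
    dcoeff m (p.sum fun r c => MvPolynomial.X i ^ r * F c) = ∑ r ∈ Finset.range (m i + 1),
      (m i).choose r • dcoeff (m - Finsupp.single i r) (F (pcoeff r p)) := by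
  have h : ∀ r, dcoeff m (MvPolynomial.X i ^ r * F (p.coeff r)) =
      (m i).choose r • dcoeff (m - Finsupp.single i r) (F (pcoeff r p)) := fun r => by
    rw [dcoeff_X_pow_mul, pcoeff_apply, map_nsmul, map_nsmul, smul_smul,
      Nat.descFactorial_eq_factorial_mul_choose, mul_comm]
  rw [Polynomial.sum_over_range' p (by simp) (max (p.natDegree + 1) (m i + 1))
    (lt_of_lt_of_le (Nat.lt_succ_self _) (le_max_left _ _)), map_sum, Finset.sum_congr rfl fun r _ => h r]
  symm
  refine Finset.sum_subset (Finset.range_mono (le_max_right _ _)) fun r _ hr => ?_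
  rw [Nat.choose_eq_zero_of_lt (by simpa using hr), zero_smul]

theorem dcoeff_C (m : Fin n →₀ ℕ) (b : B) :
    dcoeff m (MvPolynomial.C b) = if m = 0 then b else 0 := by
  rw [MvPolynomial.C_apply, dcoeff_monomial]
  by_cases h : m = 0
  · subst h; simp [mfact]
  · rw [if_neg (Ne.symm h), if_neg h]

open Classical in
theorem dcoeff_aeval_sum (s : Finset (Fin n)) (m : Fin n →₀ ℕ) (r : Polynomial B) :
    dcoeff m (Polynomial.aeval (∑ q ∈ s, MvPolynomial.X q : MvPolynomial (Fin n) B) r) =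
      if ∀ q, q ∉ s → m q = 0 then pcoeff (∑ q ∈ s, m q) r else 0 := by
  induction r using Polynomial.induction_on' with
  | add p q hp hq => rw [map_add, map_add, hp, hq, map_add]; split_ifs <;> simp
  | monomial d b =>
    rw [← Polynomial.C_mul_X_pow_eq_monomial]
    induction d generalizing m with
    | zero =>
      rw [pow_zero, mul_one, Polynomial.aeval_C, MvPolynomial.algebraMap_eq, dcoeff_C, pcoeff_C]
      by_cases h : m = 0
      · subst h; simp
      · rw [if_neg h]
        split_ifs with h1 h2
        · exfalso
          refine h (Finsupp.ext fun q => ?_)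
          by_cases hq : q ∈ s
          · exact Finset.sum_eq_zero_iff.mp h2 q hq
          · exact h1 q hq
        · rfl
        · rfl
    | succ d ih =>
      rw [pow_succ', mul_left_comm, map_mul, Polynomial.aeval_X, Finset.sum_mul, map_sum, pcoeff_X_mul]
      simp only [dcoeff_X_mul, ih]
      have hq : ∀ q ∈ s, (m q • if ∀ q', q' ∉ s → (m - Finsupp.single q 1 : Fin n →₀ ℕ) q' = 0 then
          pcoeff (∑ q' ∈ s, (m - Finsupp.single q 1 : Fin n →₀ ℕ) q') (Polynomial.C b * Polynomial.X ^ d)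
          else 0) = m q • if ∀ q', q' ∉ s → m q' = 0 then
          pcoeff (∑ q ∈ s, m q - 1) (Polynomial.C b * Polynomial.X ^ d) else 0 := by
        intro q hq
        by_cases h0 : m q = 0
        · rw [h0, zero_smul, zero_smul]
        have e : (∀ q', q' ∉ s → (m - Finsupp.single q 1 : Fin n →₀ ℕ) q' = 0) ↔
            ∀ q', q' ∉ s → m q' = 0 := by
          refine forall₂_congr fun q' hq' => ?_
          have : q ≠ q' := fun h => hq' (h ▸ hq)
          rw [Finsupp.tsub_apply, Finsupp.single_eq_of_ne' this, tsub_zero]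
        have e' : ∑ q' ∈ s, (m - Finsupp.single q 1 : Fin n →₀ ℕ) q' = ∑ q ∈ s, m q - 1 := by
          rw [← Finset.add_sum_erase s _ hq, ← Finset.add_sum_erase s (fun q => m q) hq]
          have : ∑ x ∈ s.erase q, (m - Finsupp.single q 1 : Fin n →₀ ℕ) x = ∑ x ∈ s.erase q, m x :=
            Finset.sum_congr rfl fun x hx => by
              rw [Finsupp.tsub_apply, Finsupp.single_eq_of_ne (Finset.ne_of_mem_erase hx), tsub_zero]
          rw [this, Finsupp.tsub_apply, Finsupp.single_eq_same]
          omega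
        simp only [e, e']
      rw [Finset.sum_congr rfl hq, ← Finset.sum_smul]
      split_ifs <;> simp

theorem dcoeff_aeval_X (i : Fin n) (m : Fin n →₀ ℕ) (r : Polynomial B) :
    dcoeff m (Polynomial.aeval (MvPolynomial.X i : MvPolynomial (Fin n) B) r) =
      if ∀ q, q ≠ i → m q = 0 then pcoeff (m i) r else 0 := by
  classical
  have h := dcoeff_aeval_sum {i} m r
  simp only [Finset.sum_singleton, Finset.mem_singleton] at h
  rw [h]

end Substitution

section ChartPVA

variable {k A B : Type u} [Field k] [CommRing A] [CommRing B] [Algebra k A] [Algebra k B] [CharZero k]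
variable {ev : A →ₐ[k] PowerSeries B} (hev : JetUniversal ev) {δ : Derivation k B B}
  (hδ : IsArcDerivation ev δ) (𝒳 : FormBasis k A) (P : PoissonBracket k A)

/-- The bracket `{x_λ y}`. -/
def JetUniversal.brPoly : B →ₗ[k] B →ₗ[k] Polynomial B :=
  LinearMap.mk₂ k (fun x y => pgen k fun m => hev.nprod hδ 𝒳 P m x y)
    (fun x x' y => pcoeff_ext k fun m => by
      rw [map_add]; simp only [pcoeff_pgen (hev.nprod_eventually hδ 𝒳 P _ _)]
      simp only [nprod_apply, map_add])
    (fun c x y => pcoeff_ext k fun m => by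
      rw [pcoeff_smul]; simp only [pcoeff_pgen (hev.nprod_eventually hδ 𝒳 P _ _)]
      simp only [nprod_apply, map_smul]
      rw [← algebraMap_smul B c (_ : LoopForms ev), map_smul, algebraMap_smul])
    (fun x y y' => pcoeff_ext k fun m => by
      rw [map_add, pcoeff_pgen (hev.nprod_eventually hδ 𝒳 P _ _),
        pcoeff_pgen (hev.nprod_eventually hδ 𝒳 P _ _), pcoeff_pgen (hev.nprod_eventually hδ 𝒳 P _ _),
        map_add])
    (fun c x y => pcoeff_ext k fun m => by
      rw [pcoeff_smul, pcoeff_pgen (hev.nprod_eventually hδ 𝒳 P _ _),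
        pcoeff_pgen (hev.nprod_eventually hδ 𝒳 P _ _), Derivation.map_smul])

theorem JetUniversal.pcoeff_brPoly (m : ℕ) (x y : B) :
    pcoeff m (hev.brPoly hδ 𝒳 P x y) = hev.nprod hδ 𝒳 P m x y :=
  pcoeff_pgen (hev.nprod_eventually hδ 𝒳 P x y) m

theorem JetUniversal.brPoly_delta_left (x y : B) :
    hev.brPoly hδ 𝒳 P (δ x) y = -(Polynomial.X * hev.brPoly hδ 𝒳 P x y) := pcoeff_ext k fun m => by
  rw [map_neg, pcoeff_X_mul, pcoeff_brPoly, pcoeff_brPoly, nprod_delta_left]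

theorem JetUniversal.brPoly_delta_right (x y : B) :
    hev.brPoly hδ 𝒳 P x (δ y) = -pneg δ (hev.brPoly hδ 𝒳 P x y) := pcoeff_ext k fun m => by
  rw [pneg_apply, neg_neg, map_add, pcoeff_X_mul, pcoeff_polyCoefMap, pcoeff_brPoly, pcoeff_brPoly,
    pcoeff_brPoly, nprod_delta_right]
  rfl

theorem JetUniversal.brPoly_mul_right (x y y' : B) : hev.brPoly hδ 𝒳 P x (y * y') =
    Polynomial.C y * hev.brPoly hδ 𝒳 P x y' + Polynomial.C y' * hev.brPoly hδ 𝒳 P x y :=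
  pcoeff_ext k fun m => by
    rw [map_add, pcoeff_C_mul, pcoeff_C_mul, pcoeff_brPoly, pcoeff_brPoly, pcoeff_brPoly,
      Derivation.leibniz, smul_eq_mul, smul_eq_mul]

theorem JetUniversal.brPoly_mul_left (x x' y : B) : hev.brPoly hδ 𝒳 P (x * x') y =
    pshift δ x (hev.brPoly hδ 𝒳 P x' y) + pshift δ x' (hev.brPoly hδ 𝒳 P x y) :=
  pcoeff_ext k fun m => by
    obtain ⟨T₀, hT₀⟩ := hev.nprod_mul_left hδ 𝒳 P x x' y m
    obtain ⟨K, hK⟩ := hev.nprod_eventually hδ 𝒳 P x y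
    obtain ⟨K', hK'⟩ := hev.nprod_eventually hδ 𝒳 P x' y
    rw [map_add, pcoeff_brPoly, hT₀ (max T₀ (max K K')) (le_max_left _ _),
      pcoeff_pshift δ x m _ (K := max T₀ (max K K')) (fun l hl => by
        rw [pcoeff_brPoly, hK' _ (by omega)]),
      pcoeff_pshift δ x' m _ (K := max T₀ (max K K')) (fun l hl => by
        rw [pcoeff_brPoly, hK _ (by omega)]), ← Finset.sum_add_distrib]
    simp only [pcoeff_brPoly]

theorem JetUniversal.nprod_jet (m : ℕ) (a b : A) : hev.nprod hδ 𝒳 P m (jet ev 0 a) (jet ev 0 b) =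
    if m = 0 then jet ev 0 (P.br a b) else 0 := by
  rw [nprod, expForm_jet, anchor_formGen_jet, ArcRing.coeff_z_pow_mul]
  rcases m with _ | m
  · simp [ArcRing.coeff_algebraMap]
  · simp

theorem JetUniversal.brPoly_jet (a b : A) : hev.brPoly hδ 𝒳 P (jet ev 0 a) (jet ev 0 b) =
    Polynomial.C (jet ev 0 (P.br a b)) := pcoeff_ext k fun m => by
  rw [pcoeff_brPoly, nprod_jet, pcoeff_C]

theorem JetUniversal.brPoly_skew_of_jet (y : B) (h : ∀ a, hev.brPoly hδ 𝒳 P (jet ev 0 a) y =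
    -pflip δ (hev.brPoly hδ 𝒳 P y (jet ev 0 a))) (x : B) :
    hev.brPoly hδ 𝒳 P x y = -pflip δ (hev.brPoly hδ 𝒳 P y x) := by
  have e := hev.sesq_uniq hδ (pshift δ) (-LinearMap.mulLeft k Polynomial.X)
    ((hev.brPoly hδ 𝒳 P).flip y) (-(pflip δ ∘ₗ hev.brPoly hδ 𝒳 P y))
    (fun x x' => hev.brPoly_mul_left hδ 𝒳 P x x' y)
    (fun x x' => by
      simp only [LinearMap.neg_apply, LinearMap.comp_apply, brPoly_mul_right, map_add, pflip_C_mul, map_neg]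
      abel)
    (fun x => hev.brPoly_delta_left hδ 𝒳 P x y)
    (fun x => by
      simp only [LinearMap.neg_apply, LinearMap.comp_apply, brPoly_delta_right, map_neg, pflip_pneg,
        LinearMap.mulLeft_apply])
    h
  exact LinearMap.congr_fun e x

theorem JetUniversal.brPoly_skew (x y : B) :
    hev.brPoly hδ 𝒳 P x y = -pflip δ (hev.brPoly hδ 𝒳 P y x) := by
  refine hev.brPoly_skew_of_jet hδ 𝒳 P y (fun a => ?_) x
  rw [hev.brPoly_skew_of_jet hδ 𝒳 P (jet ev 0 a) (fun b => ?_) y, map_neg, pflip_pflip, neg_neg]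
  rw [brPoly_jet, brPoly_jet, pflip_C, ← map_neg, P.skew b a, jet, map_neg, map_neg]
  rfl

theorem JetUniversal.nprod_skew (j : ℕ) (x y : B) {K : ℕ}
    (hK : ∀ m, K ≤ m → hev.nprod hδ 𝒳 P m x y = 0) : hev.nprod hδ 𝒳 P j y x =
    -∑ s ∈ Finset.range K, (-1 : ℤ) ^ (j + s) • dpow δ s (hev.nprod hδ 𝒳 P (j + s) x y) := by
  rw [← pcoeff_brPoly, brPoly_skew, map_neg, pcoeff_pflip δ _ j (K := K) fun m hm => by
    rw [pcoeff_brPoly, hK m hm]]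
  simp only [pcoeff_brPoly]

variable {P} {L : TopLieAlgebroid ev} (hL : L.IsCotangent P)

theorem JetUniversal.star_jet (hL : L.IsCotangent P) (m n : ℕ) (a b : A) :
    hev.Star hδ 𝒳 P L m n (jet ev 0 a) (jet ev 0 b) := by
  rw [Star, expForm_jet, expForm_jet, hL.br, Finset.sum_eq_single m]
  · rw [Nat.choose_self, one_smul, Nat.sub_self, nprod_jet, if_pos rfl, expForm_jet, add_comm]
  · intro t ht htm
    have := Finset.mem_range.mp ht
    rw [nprod_jet, if_neg (by omega), map_zero, smul_zero]
  · intro h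
    exact absurd (Finset.mem_range.mpr (Nat.lt_succ_self m)) h

theorem JetUniversal.expForm_dpow (m s : ℕ) (x : B) : hev.expForm hδ 𝒳 m (dpow δ s x) =
    (-1 : ℤ) ^ s • m.choose s • hev.expForm hδ 𝒳 (m - s) x := by
  induction s generalizing m with
  | zero => simp
  | succ s ih =>
    have h0 : ((s + 1 : ℕ) : k) ≠ 0 := by exact_mod_cast Nat.succ_ne_zero s
    refine smul_right_injective (LoopForms ev) h0 ?_
    simp only [Nat.cast_smul_eq_nsmul]
    have e : m * (m - 1).choose s = (s + 1) * m.choose (s + 1) := by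
      rcases m with _ | m
      · simp
      · rw [Nat.add_sub_cancel, Nat.add_one_mul_choose_eq, mul_comm]
    have e' : (m : ℤ) * (m - 1).choose s = ((s + 1 : ℕ) : ℤ) * m.choose (s + 1) := by exact_mod_cast e
    rw [← map_nsmul, succ_nsmul_dpow, ← delta_dpow, expForm_delta, ih,
      show m - 1 - s = m - (s + 1) by omega]
    simp only [← natCast_zsmul, smul_smul, ← neg_smul]
    congr 1
    rw [pow_succ]
    linear_combination (-(-1) ^ s : ℤ) * e'

theorem JetUniversal.star_swap (x y : B) (h : ∀ m n, hev.Star hδ 𝒳 P L m n x y) (n m : ℕ) :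
    hev.Star hδ 𝒳 P L n m y x := by
  obtain ⟨K, hK⟩ := hev.nprod_eventually hδ 𝒳 P x y
  set G : ℕ → LoopForms ev := fun i => hev.expForm hδ 𝒳 (m + n - i) (hev.nprod hδ 𝒳 P i x y) with hG
  have hG0 : ∀ i, K ≤ i → G i = 0 := fun i hi => by rw [hG]; simp only [hK i hi, map_zero]
  set T := max K (m + 1) with hT
  have h1 : L.br (hev.expForm hδ 𝒳 n y) (hev.expForm hδ 𝒳 m x) =
      -∑ i ∈ Finset.range T, (m.choose i : ℤ) • G i := by
    rw [L.skew, h m n, neg_inj, ← Finset.sum_range_reflect]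
    refine Eq.trans (Finset.sum_congr rfl fun i hi => ?_) (Finset.sum_subset
      (Finset.range_mono (le_max_right K (m + 1))) fun i _ hi => by
        rw [Nat.choose_eq_zero_of_lt (by have := Finset.mem_range.not.mp hi; omega), Nat.cast_zero, zero_smul])
    have := Finset.mem_range.mp hi
    rw [show m + 1 - 1 - i = m - i by omega, Nat.choose_symm (by omega), show m - (m - i) = i by omega,
      natCast_zsmul, hG]
    simp only
    rw [show n + (m - i) = m + n - i by omega]
  have h2 : ∀ j ∈ Finset.range (n + 1), (n.choose (n - j)) • hev.expForm hδ 𝒳 (m + (n - j))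
      (hev.nprod hδ 𝒳 P (n - (n - j)) y x) = -∑ s ∈ Finset.range T,
        ((-1 : ℤ) ^ j * (n.choose j * (m + n - j).choose s)) • G (j + s) := by
    intro j hj
    have hj' := Finset.mem_range.mp hj
    rw [show n - (n - j) = j by omega, Nat.choose_symm (by omega),
      hev.nprod_skew hδ 𝒳 P j x y (K := T) (fun m hm => hK m (le_trans (le_max_left _ _) hm)), map_neg, smul_neg, map_sum,
      Finset.smul_sum, neg_inj]
    refine Finset.sum_congr rfl fun s _ => ?_
    rw [map_zsmul, expForm_dpow, hG]
    simp only
    rw [show m + (n - j) = m + n - j by omega, show m + n - j - s = m + n - (j + s) by omega,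
      ← natCast_zsmul, ← natCast_zsmul, smul_smul, smul_smul, smul_smul]
    congr 1
    rw [pow_add]
    have : (-1 : ℤ) ^ s * (-1) ^ s = 1 := by rw [← mul_pow]; simp
    linear_combination (n.choose j * (-1) ^ j * (m + n - j).choose s : ℤ) * this
  rw [Star, h1, ← Finset.sum_range_reflect _ (n + 1)]
  simp only [Nat.add_sub_cancel]
  rw [Finset.sum_congr rfl h2, Finset.sum_neg_distrib, neg_inj,
    ← sum_range_antidiagonal (fun j s => ((-1 : ℤ) ^ j * (n.choose j * (m + n - j).choose s)) • G (j + s))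
      (fun j s hj => by rw [Nat.choose_eq_zero_of_lt hj, Nat.cast_zero, zero_mul, mul_zero, zero_smul])
      (fun j s hjs => by rw [hG0 _ (le_trans (le_max_left _ _) hjs), smul_zero])]
  refine Finset.sum_congr rfl fun i _ => ?_
  rw [← sum_alternating_choose n m i, Finset.sum_smul]
  refine Finset.sum_congr rfl fun j hj => ?_
  rw [Nat.add_sub_cancel' (by have := Finset.mem_range.mp hj; omega)]

theorem JetUniversal.star (hL : L.IsCotangent P) (m n : ℕ) (x y : B) : hev.Star hδ 𝒳 P L m n x y := by
  refine hev.star_step hδ 𝒳 P m x (fun n b => ?_) hL n y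
  refine hev.star_swap hδ 𝒳 (jet ev 0 b) x (fun m n => ?_) m n
  exact hev.star_step hδ 𝒳 P m _ (fun n b' => hev.star_jet hδ 𝒳 hL m n b b') hL n x

end ChartPVA

section TwoVariables

variable {k B : Type*} [Field k] [CommRing B] [Algebra k B]

theorem dcoeff_sum_aeval_X (m : Fin 2 →₀ ℕ) {i j : Fin 2} (hij : i ≠ j) (p : Polynomial B)
    (F : B →ₗ[k] Polynomial B) :
    dcoeff m (p.sum fun r c => (MvPolynomial.X i : MvPolynomial (Fin 2) B) ^ r *
      Polynomial.aeval (MvPolynomial.X j : MvPolynomial (Fin 2) B) (F c)) =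
      pcoeff (m j) (F (pcoeff (m i) p)) := by
  refine (dcoeff_sum_X_pow_mul m i p (((Polynomial.aeval (MvPolynomial.X j :
    MvPolynomial (Fin 2) B)).toLinearMap.restrictScalars k) ∘ₗ F)).trans ?_
  simp only [LinearMap.comp_apply, LinearMap.restrictScalars_apply, AlgHom.toLinearMap_apply,
    dcoeff_aeval_X]
  rw [Finset.sum_eq_single (m i)]
  · rw [if_pos, Nat.choose_self, one_smul, Finsupp.tsub_apply, Finsupp.single_eq_of_ne hij.symm, tsub_zero]
    intro q hq
    have : q = i := by omega
    rw [this, Finsupp.tsub_apply, Finsupp.single_eq_same, Nat.sub_self]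
  · intro r hr hrm
    rw [if_neg, smul_zero]
    intro h
    have h4 := h i hij
    have := Finset.mem_range.mp hr
    rw [Finsupp.tsub_apply, Finsupp.single_eq_same] at h4
    omega
  · exact fun h => absurd (Finset.mem_range.mpr (Nat.lt_succ_self _)) h

theorem dcoeff_sum_aeval_add (m : Fin 2 →₀ ℕ) (p : Polynomial B) (F : B →ₗ[k] Polynomial B) :
    dcoeff m (p.sum fun r c => (MvPolynomial.X 0 : MvPolynomial (Fin 2) B) ^ r *
      Polynomial.aeval (MvPolynomial.X 0 + MvPolynomial.X 1 : MvPolynomial (Fin 2) B) (F c)) =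
      ∑ r ∈ Finset.range (m 0 + 1), (m 0).choose r • pcoeff (m 0 - r + m 1) (F (pcoeff r p)) := by
  refine (dcoeff_sum_X_pow_mul m 0 p (((Polynomial.aeval (MvPolynomial.X 0 + MvPolynomial.X 1 :
    MvPolynomial (Fin 2) B)).toLinearMap.restrictScalars k) ∘ₗ F)).trans ?_
  refine Finset.sum_congr rfl fun r _ => ?_
  have hX : (MvPolynomial.X 0 + MvPolynomial.X 1 : MvPolynomial (Fin 2) B) =
      ∑ q ∈ Finset.univ, MvPolynomial.X q := by rw [Fin.sum_univ_two]
  rw [LinearMap.comp_apply, LinearMap.restrictScalars_apply, AlgHom.toLinearMap_apply, hX,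
    dcoeff_aeval_sum, if_pos fun q hq => absurd (Finset.mem_univ q) hq, Fin.sum_univ_two,
    Finsupp.tsub_apply, Finsupp.tsub_apply, Finsupp.single_eq_same,
    Finsupp.single_eq_of_ne (by decide), tsub_zero]

end TwoVariables

section PVAConstruction

variable {k A B : Type u} [Field k] [CommRing A] [CommRing B] [Algebra k A] [Algebra k B] [CharZero k]
variable {ev : A →ₐ[k] PowerSeries B} (hev : JetUniversal ev) {δ : Derivation k B B}
  (hδ : IsArcDerivation ev δ) (𝒳 : FormBasis k A) (P : PoissonBracket k A)

theorem JetUniversal.nprod_star (m n : ℕ) (x y c : B) :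
    ∑ r ∈ Finset.range (m + 1), m.choose r • hev.nprod hδ 𝒳 P (m - r + n) (hev.nprod hδ 𝒳 P r x y) c =
      hev.nprod hδ 𝒳 P m x (hev.nprod hδ 𝒳 P n y c) - hev.nprod hδ 𝒳 P n y (hev.nprod hδ 𝒳 P m x c) := by
  have h : hev.brk P 𝒳 _ _ = _ := hev.star hδ 𝒳 (hev.algebroid_isCotangent P 𝒳) m n x y
  have h' := hev.anchor_brk P 𝒳 (hev.expForm hδ 𝒳 m x) (hev.expForm hδ 𝒳 n y) c
  rw [h, anchor_apply, map_sum] at h'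
  refine Eq.trans ?_ h'
  rw [← Finset.sum_range_reflect]
  refine Finset.sum_congr rfl fun t ht => ?_
  have := Finset.mem_range.mp ht
  rw [map_nsmul, show m + 1 - 1 - t = m - t by omega, Nat.choose_symm (by omega),
    show m - (m - t) + n = n + t by omega]
  rfl

/-- The Poisson vertex algebra structure on the functions on a chart. -/
def JetUniversal.pva : PVA k B where
  δ := δ
  br := hev.brPoly hδ 𝒳 P
  δ_br a b := by
    rw [brPoly_delta_left, brPoly_delta_right, pneg_apply]; ring
  sesq a b := hev.brPoly_delta_left hδ 𝒳 P a b
  skew a b := hev.brPoly_skew hδ 𝒳 P a b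
  leibniz a b c := hev.brPoly_mul_right hδ 𝒳 P a b c
  jacobi a b c := by
    refine dcoeff_ext k fun m => ?_
    rw [map_sub]
    refine (dcoeff_sum_aeval_add m (hev.brPoly hδ 𝒳 P a b) ((hev.brPoly hδ 𝒳 P).flip c)).trans
      (Eq.trans ?_ (congrArg₂ (fun x y => x - y)
        (dcoeff_sum_aeval_X m one_ne_zero (hev.brPoly hδ 𝒳 P b c) (hev.brPoly hδ 𝒳 P a))
        (dcoeff_sum_aeval_X m zero_ne_one (hev.brPoly hδ 𝒳 P a c) (hev.brPoly hδ 𝒳 P b))).symm)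
    simp only [LinearMap.flip_apply, pcoeff_brPoly]
    exact hev.nprod_star hδ 𝒳 P (m 0) (m 1) a b c

theorem JetUniversal.pva_br_jet (a b : A) : (hev.pva hδ 𝒳 P).br (jet ev 0 a) (jet ev 0 b) =
    Polynomial.C (jet ev 0 (P.br a b)) := hev.brPoly_jet hδ 𝒳 P a b

end PVAConstruction

section ArcDerivation

variable {k A B : Type u} [Field k] [CommRing A] [CommRing B] [Algebra k A] [Algebra k B]
variable {ev : A →ₐ[k] PowerSeries B} (hev : JetUniversal ev)

theorem JetUniversal.exists_arcDerivation (hev : JetUniversal ev) :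
    ∃ δ : Derivation k B B, IsArcDerivation ev δ := by
  obtain ⟨D, hD, hD'⟩ := hev.der_exist (Algebra.lmul k B)
    (LinearMap.pi fun i =>
      { toFun := fun a => ((i : B) + 1) * jet ev (i + 1) a
        map_add' := fun a b => by simp only [jet, map_add, mul_add]
        map_smul' := fun c a => by
          have hs : (PowerSeries.coeff (i + 1)) (c • ev a) = c • (PowerSeries.coeff (i + 1)) (ev a) := rfl
          rw [jet, map_smul, hs, RingHom.id_apply, mul_smul_comm]; rfl })
    (fun a b i => by
      have h1 : ∀ a, ((i : B) + 1) * jet ev (i + 1) a =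
          PowerSeries.coeff i (PowerSeries.derivative B (ev a)) := fun a => by
        rw [PowerSeries.coeff_derivative, mul_comm]; rfl
      change ((i : B) + 1) * jet ev (i + 1) (a * b) = _
      rw [h1, map_mul, Derivation.leibniz, smul_eq_mul, smul_eq_mul, map_add, PowerSeries.coeff_mul,
        PowerSeries.coeff_mul, ← Finset.sum_add_distrib]
      refine Finset.sum_congr rfl fun p _ => ?_
      rw [PowerSeries.coeff_derivative, PowerSeries.coeff_derivative, mul_comm _ ((p.2 : B) + 1),
        mul_comm _ ((p.2 : B) + 1)]
      rfl)
  exact ⟨Derivation.mk' D hD, hD'⟩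

theorem JetUniversal.delta_compat {B' : Type u} [CommRing B'] [Algebra k B'] (hev : JetUniversal ev)
    (f : B →ₐ[k] B') (D : Derivation k B B) (D' : Derivation k B' B')
    (h : ∀ a i, f (D (jet ev i a)) = D' (f (jet ev i a))) (x : B) : f (D x) = D' (f x) := by
  have e := hev.der_uniq ((Algebra.lmul k B').comp f) (f.toLinearMap ∘ₗ D.toLinearMap)
    (D'.toLinearMap ∘ₗ f.toLinearMap)
    (fun x y => by
      change f (D (x * y)) = f x * f (D y) + f y * f (D x)
      rw [Derivation.leibniz, smul_eq_mul, smul_eq_mul, map_add, map_mul, map_mul])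
    (fun x y => by
      change D' (f (x * y)) = f x * D' (f y) + f y * D' (f x)
      rw [map_mul, Derivation.leibniz, smul_eq_mul, smul_eq_mul])
    h
  exact LinearMap.congr_fun e x

end ArcDerivation

section PVACompat

variable {k A B B' : Type u} [Field k] [CommRing A] [CommRing B] [Algebra k A] [Algebra k B] [CharZero k]
  [CommRing B'] [Algebra k B'] {ev : A →ₐ[k] PowerSeries B} (hev : JetUniversal ev)

theorem PVA.br_delta_right (𝒱 : PVA k B) (x y : B) : 𝒱.br x (𝒱.δ y) = -pneg 𝒱.δ (𝒱.br x y) := by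
  rw [pneg_apply, neg_neg, 𝒱.δ_br, 𝒱.sesq]; ring

theorem PVA.br_skew (𝒱 : PVA k B) (x y : B) : 𝒱.br x y = -pflip 𝒱.δ (𝒱.br y x) := 𝒱.skew x y

theorem polyCoefMap_map (f : B →ₐ[k] B') {D : B →ₗ[k] B} {D' : B' →ₗ[k] B'} (h : ∀ x, f (D x) = D' (f x))
    (p : Polynomial B) : (polyCoefMap D p).map (f : B →+* B') = polyCoefMap D' (p.map (f : B →+* B')) :=
  Polynomial.ext fun m => by
    rw [Polynomial.coeff_map, coeff_polyCoefMap, coeff_polyCoefMap, Polynomial.coeff_map]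
    exact h _

theorem pneg_map (f : B →ₐ[k] B') {δ : Derivation k B B} {δ' : Derivation k B' B'}
    (h : ∀ x, f (δ x) = δ' (f x)) (p : Polynomial B) :
    (pneg δ p).map (f : B →+* B') = pneg δ' (p.map (f : B →+* B')) := by
  rw [pneg_apply, pneg_apply, Polynomial.map_neg, Polynomial.map_add, Polynomial.map_mul,
    Polynomial.map_X, polyCoefMap_map f (D' := δ'.toLinearMap) h]

theorem pflip_map (f : B →ₐ[k] B') {δ : Derivation k B B} {δ' : Derivation k B' B'}
    (h : ∀ x, f (δ x) = δ' (f x)) (p : Polynomial B) :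
    (pflip δ p).map (f : B →+* B') = pflip δ' (p.map (f : B →+* B')) := by
  induction p using Polynomial.induction_on' with
  | add p q hp hq => simp only [map_add, Polynomial.map_add, hp, hq]
  | monomial m c =>
    rw [Polynomial.map_monomial, pflip_monomial, pflip_monomial]
    induction m with
    | zero => simp
    | succ m ih => rw [pow_succ', pow_succ', Module.End.mul_apply, Module.End.mul_apply, ← ih, pneg_map f h]

theorem JetUniversal.br_compat (hev : JetUniversal ev) (𝒱 : PVA k B) (𝒱' : PVA k B')
    (hδ : IsArcDerivation ev 𝒱.δ) (f : B →ₐ[k] B') (hf : ∀ x, f (𝒱.δ x) = 𝒱'.δ (f x))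
    (h : ∀ a b, 𝒱'.br (f (jet ev 0 a)) (f (jet ev 0 b)) =
      (𝒱.br (jet ev 0 a) (jet ev 0 b)).map (f : B →+* B')) (x y : B) :
    𝒱'.br (f x) (f y) = (𝒱.br x y).map (f : B →+* B') := by
  have step : ∀ x, (∀ b, 𝒱'.br (f x) (f (jet ev 0 b)) = (𝒱.br x (jet ev 0 b)).map (f : B →+* B')) →
      ∀ y, 𝒱'.br (f x) (f y) = (𝒱.br x y).map (f : B →+* B') := by
    intro x hx y
    let act : B →ₐ[k] Module.End k (Polynomial B') := (Algebra.lsmul k k (Polynomial B')).comp f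
    have hact : ∀ x p, act x p = Polynomial.C (f x) * p := fun x p => Polynomial.smul_eq_C_mul _
    have e := hev.sesq_uniq hδ act (-pneg 𝒱'.δ) (𝒱'.br (f x) ∘ₗ f.toLinearMap)
      ((Polynomial.mapAlgHom f).toLinearMap ∘ₗ 𝒱.br x)
      (fun y y' => by
        simp only [LinearMap.comp_apply, AlgHom.toLinearMap_apply, map_mul, 𝒱'.leibniz, hact])
      (fun y y' => by
        simp only [LinearMap.comp_apply, AlgHom.toLinearMap_apply, 𝒱.leibniz, hact, map_add, map_mul]
        simp)
      (fun y => by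
        simp only [LinearMap.comp_apply, AlgHom.toLinearMap_apply, hf, 𝒱'.br_delta_right, LinearMap.neg_apply])
      (fun y => by
        simp only [LinearMap.comp_apply, AlgHom.toLinearMap_apply, 𝒱.br_delta_right, LinearMap.neg_apply,
          map_neg]
        rw [Polynomial.coe_mapAlgHom, ← pneg_map f hf])
      (fun b => hx b)
    exact LinearMap.congr_fun e y
  refine step x (fun b => ?_) y
  rw [𝒱'.br_skew, 𝒱.br_skew, step _ (h b), Polynomial.map_neg, pflip_map f hf]

theorem JetUniversal.pva_unique (hev : JetUniversal ev) {𝒱 𝒱' : PVA k B} (hδ : IsArcDerivation ev 𝒱.δ)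
    (hδ' : IsArcDerivation ev 𝒱'.δ) (h : ∀ a b, 𝒱'.br (jet ev 0 a) (jet ev 0 b) =
      𝒱.br (jet ev 0 a) (jet ev 0 b)) : 𝒱 = 𝒱' := by
  have e : 𝒱.δ = 𝒱'.δ := hev.derivation_ext fun a i => by rw [hδ, hδ']
  have e' : 𝒱.br = 𝒱'.br := LinearMap.ext₂ fun x y => by
    have := hev.br_compat 𝒱 𝒱' hδ (AlgHom.id k B) (fun x => by rw [e]; rfl)
      (fun a b => by simpa using h a b) x y
    simpa using this.symm
  cases 𝒱
  cases 𝒱'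
  simp only at e e'
  subst e e'
  rfl

end PVACompat

/-! ## Cartan calculus for the de Rham–Lie complex -/

section Cartan

variable {k A B : Type u} [Field k] [CommRing A] [CommRing B] [Algebra k A] [Algebra k B]
variable {ev : A →ₐ[k] PowerSeries B}

/-- Alternating `B`-multilinear functions. -/
def IsAlt {n : ℕ} (φ : (Fin n → LoopForms ev) → B) : Prop :=
  ∃ ψ : LoopForms ev [⋀^Fin n]→ₗ[B] B, ⇑ψ = φ

/-- The contraction with `v` in the first argument. -/
def ins {n : ℕ} (v : LoopForms ev) (φ : (Fin (n + 1) → LoopForms ev) → B)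
    (u : Fin n → LoopForms ev) : B := φ (Fin.cons v u)

theorem ins_apply {n : ℕ} (v : LoopForms ev) (φ : (Fin (n + 1) → LoopForms ev) → B)
    (u : Fin n → LoopForms ev) : ins v φ u = φ (Fin.cons v u) := rfl

theorem fun_cons_ext {n : ℕ} {φ ψ : (Fin (n + 1) → LoopForms ev) → B}
    (h : ∀ v u, φ (Fin.cons v u) = ψ (Fin.cons v u)) : φ = ψ := by
  funext w
  rw [← Fin.cons_self_tail w]
  exact h _ _

namespace IsAlt

variable {n : ℕ}

theorem sub {φ ψ : (Fin n → LoopForms ev) → B} (hφ : IsAlt φ) (hψ : IsAlt ψ) : IsAlt (φ - ψ) := by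
  obtain ⟨f, rfl⟩ := hφ
  obtain ⟨g, rfl⟩ := hψ
  exact ⟨f - g, rfl⟩

theorem ins (v : LoopForms ev) {φ : (Fin (n + 1) → LoopForms ev) → B} (hφ : IsAlt φ) :
    IsAlt (ins v φ) := by
  obtain ⟨f, rfl⟩ := hφ
  exact ⟨f.curryLeft v, rfl⟩

theorem ins_add {φ : (Fin (n + 1) → LoopForms ev) → B} (hφ : IsAlt φ) (v w : LoopForms ev) :
    LoopPoisson.ins (v + w) φ = LoopPoisson.ins v φ + LoopPoisson.ins w φ := by
  obtain ⟨f, rfl⟩ := hφ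
  funext u
  exact f.map_vecCons_add u v w

theorem ins_smul {φ : (Fin (n + 1) → LoopForms ev) → B} (hφ : IsAlt φ) (b : B) (v : LoopForms ev) :
    LoopPoisson.ins (b • v) φ = b • LoopPoisson.ins v φ := by
  obtain ⟨f, rfl⟩ := hφ
  funext u
  exact f.map_vecCons_smul u b v

theorem ins_self {φ : (Fin (n + 2) → LoopForms ev) → B} (hφ : IsAlt φ) (v : LoopForms ev) :
    LoopPoisson.ins v (LoopPoisson.ins v φ) = 0 := by
  obtain ⟨f, rfl⟩ := hφ
  funext u
  exact f.map_eq_zero_of_eq _ (i := 0) (j := 1) rfl (by simp)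

theorem cons_self {φ : (Fin (n + 2) → LoopForms ev) → B} (hφ : IsAlt φ) (v : LoopForms ev)
    (u : Fin n → LoopForms ev) : φ (Fin.cons v (Fin.cons v u)) = 0 := congrFun (hφ.ins_self v) u

theorem cons_add {φ : (Fin (n + 1) → LoopForms ev) → B} (hφ : IsAlt φ) (v w : LoopForms ev)
    (u : Fin n → LoopForms ev) : φ (Fin.cons (v + w) u) = φ (Fin.cons v u) + φ (Fin.cons w u) :=
  congrFun (hφ.ins_add v w) u

theorem cons_smul {φ : (Fin (n + 1) → LoopForms ev) → B} (hφ : IsAlt φ) (b : B) (v : LoopForms ev)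
    (u : Fin n → LoopForms ev) : φ (Fin.cons (b • v) u) = b * φ (Fin.cons v u) :=
  congrFun (hφ.ins_smul b v) u

theorem cons_sub {φ : (Fin (n + 1) → LoopForms ev) → B} (hφ : IsAlt φ) (v w : LoopForms ev)
    (u : Fin n → LoopForms ev) : φ (Fin.cons (v - w) u) = φ (Fin.cons v u) - φ (Fin.cons w u) :=
  eq_sub_of_add_eq (by rw [← hφ.cons_add, sub_add_cancel])

theorem cons_swap {φ : (Fin (n + 2) → LoopForms ev) → B} (hφ : IsAlt φ) (v w : LoopForms ev)
    (u : Fin n → LoopForms ev) : φ (Fin.cons v (Fin.cons w u)) = -φ (Fin.cons w (Fin.cons v u)) := by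
  have h := hφ.cons_self (v + w) u
  have h1 : φ (Fin.cons v (Fin.cons (v + w) u)) =
    φ (Fin.cons v (Fin.cons v u)) + φ (Fin.cons v (Fin.cons w u)) := (hφ.ins v).cons_add v w u
  have h2 : φ (Fin.cons w (Fin.cons (v + w) u)) =
    φ (Fin.cons w (Fin.cons v u)) + φ (Fin.cons w (Fin.cons w u)) := (hφ.ins w).cons_add v w u
  rw [hφ.cons_add, h1, h2, hφ.cons_self, hφ.cons_self, zero_add, add_zero] at h
  exact eq_neg_of_add_eq_zero_left h

theorem insert {φ : (Fin (n + 1) → LoopForms ev) → B} (hφ : IsAlt φ) (p : Fin (n + 1))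
    (x : LoopForms ev) (w : Fin (n + 1) → LoopForms ev) :
    φ (Function.update w p x) = (-1 : ℤ) ^ (p : ℕ) • φ (Fin.cons x fun q => w (p.succAbove q)) := by
  obtain ⟨f, rfl⟩ := hφ
  have h : Function.update w p x = p.insertNth x (p.removeNth w) := by
    rw [Fin.insertNth_removeNth]
  have h' : (fun q => w (p.succAbove q)) = p.removeNth w := rfl
  rw [h, f.map_insertNth, h']
  rcases neg_one_pow_eq_or ℤ (p : ℕ) with h0 | h0 <;> simp [h0, Matrix.vecCons]

theorem of_cons {F : (Fin (n + 1) → LoopForms ev) → B} (h : ∀ v, IsAlt (LoopPoisson.ins v F))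
    (hadd : ∀ v w u, F (Fin.cons (v + w) u) = F (Fin.cons v u) + F (Fin.cons w u))
    (hsmul : ∀ (b : B) v u, F (Fin.cons (b • v) u) = b * F (Fin.cons v u))
    (hself : ∀ (v : LoopForms ev) (w : Fin n → LoopForms ev) (j : Fin n), w j = v → F (Fin.cons v w) = 0) :
    IsAlt F := by
  choose ψ hψ using h
  let G : LoopForms ev →ₗ[B] MultilinearMap B (fun _ : Fin n => LoopForms ev) B :=
    { toFun := fun v => (ψ v).toMultilinearMap
      map_add' := fun v w => MultilinearMap.ext fun u => by
        change (ψ (v + w)) u = (ψ v) u + (ψ w) u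
        rw [hψ, hψ, hψ]; exact hadd v w u
      map_smul' := fun b v => MultilinearMap.ext fun u => by
        change (ψ (b • v)) u = b • (ψ v) u
        rw [hψ, hψ]; exact hsmul b v u }
  let G' : MultilinearMap B (fun _ : Fin (n + 1) => LoopForms ev) B :=
    LinearMap.uncurryLeft (R := B) (M := fun _ : Fin (n + 1) => LoopForms ev) (M₂ := B) G
  have hG : ∀ w, G' w = F w := fun w => by
    change (ψ (w 0)) (Fin.tail w) = F w
    rw [hψ, ins_apply, Fin.cons_self_tail]
  refine ⟨{ G' with
    map_eq_zero_of_eq' := fun w i j hw hij => ?_ }, funext hG⟩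
  change G' w = 0
  rw [hG, ← Fin.cons_self_tail w]
  induction i using Fin.cases with
  | zero =>
    induction j using Fin.cases with
    | zero => exact absurd rfl hij
    | succ j => exact hself _ _ j hw.symm
  | succ i =>
    induction j using Fin.cases with
    | zero => exact hself _ _ i hw
    | succ j =>
      change LoopPoisson.ins (w 0) F (Fin.tail w) = 0
      rw [← hψ]
      exact (ψ (w 0)).map_eq_zero_of_eq (Fin.tail w) hw fun h => hij (congrArg _ h)

theorem of_cons_cons {F : (Fin (n + 2) → LoopForms ev) → B} (h : ∀ v, IsAlt (LoopPoisson.ins v F))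
    (hadd : ∀ v w u, F (Fin.cons (v + w) u) = F (Fin.cons v u) + F (Fin.cons w u))
    (hself : ∀ v u, F (Fin.cons v (Fin.cons v u)) = 0) : IsAlt F := by
  have hswap : ∀ v w u, F (Fin.cons v (Fin.cons w u)) = -F (Fin.cons w (Fin.cons v u)) := by
    intro v w u
    have h0 := hself (v + w) u
    have h1 : F (Fin.cons v (Fin.cons (v + w) u)) =
      F (Fin.cons v (Fin.cons v u)) + F (Fin.cons v (Fin.cons w u)) := (h v).cons_add v w u
    have h2 : F (Fin.cons w (Fin.cons (v + w) u)) =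
      F (Fin.cons w (Fin.cons v u)) + F (Fin.cons w (Fin.cons w u)) := (h w).cons_add v w u
    rw [hadd, h1, h2, hself, hself, zero_add, add_zero] at h0
    exact eq_neg_of_add_eq_zero_left h0
  refine of_cons h hadd (fun b v u => ?_) fun v w j hj => ?_
  · rw [← Fin.cons_self_tail u, hswap, hswap v, mul_neg]
    exact congrArg Neg.neg ((h (u 0)).cons_smul b v (Fin.tail u))
  · have h1 : LoopPoisson.ins v F (w ∘ Equiv.swap 0 j) = 0 := by
      rw [← Fin.cons_self_tail (w ∘ Equiv.swap 0 j)]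
      change F (Fin.cons v (Fin.cons ((w ∘ Equiv.swap 0 j) 0) _)) = 0
      have : (w ∘ Equiv.swap 0 j) 0 = v := by simp [hj]
      rw [this, hself]
    obtain ⟨f, hf⟩ := h v
    rw [← hf] at h1
    by_cases h0 : j = 0
    · subst h0
      rw [Equiv.swap_self] at h1
      exact (congrFun hf w).symm.trans h1
    · rw [f.map_swap _ (Ne.symm h0), neg_eq_zero, hf] at h1
      exact h1

end IsAlt

/-- The Lie derivative `φ ↦ D φ - ∑ φ(…, T w_i, …)`. -/
def lieD (D : Derivation k B B) (T : LoopForms ev → LoopForms ev) {n : ℕ}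
    (φ : (Fin n → LoopForms ev) → B) (w : Fin n → LoopForms ev) : B :=
  D (φ w) - ∑ q, φ (Function.update w q (T (w q)))

section LieD

variable (D : Derivation k B B) (T : LoopForms ev → LoopForms ev) {n : ℕ}

theorem lieD_cons (φ : (Fin (n + 1) → LoopForms ev) → B) (v : LoopForms ev) (w : Fin n → LoopForms ev) :
    lieD D T φ (Fin.cons v w) = lieD D T (ins v φ) w - φ (Fin.cons (T v) w) := by
  simp only [lieD, Fin.sum_univ_succ, Fin.cons_zero, Fin.cons_succ, Fin.update_cons_zero,
    ← Fin.cons_update, ins_apply]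
  ring

theorem ins_lieD (φ : (Fin (n + 1) → LoopForms ev) → B) (v : LoopForms ev) :
    ins v (lieD D T φ) = lieD D T (ins v φ) - ins (T v) φ :=
  funext fun w => lieD_cons D T φ v w

theorem lieD_add (φ ψ : (Fin n → LoopForms ev) → B) : lieD D T (φ + ψ) = lieD D T φ + lieD D T ψ := by
  funext w
  simp only [lieD, Pi.add_apply, map_add, Finset.sum_add_distrib]; ring

theorem lieD_sub (φ ψ : (Fin n → LoopForms ev) → B) : lieD D T (φ - ψ) = lieD D T φ - lieD D T ψ := by
  funext w
  simp only [lieD, Pi.sub_apply, map_sub, Finset.sum_sub_distrib]; ring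

theorem lieD_smul (b : B) (φ : (Fin n → LoopForms ev) → B) :
    lieD D T (b • φ) = b • lieD D T φ + D b • φ := by
  funext w
  simp only [lieD, Pi.add_apply, Pi.smul_apply, smul_eq_mul, Derivation.leibniz, ← Finset.mul_sum]; ring

theorem lieD_zero : lieD D T (0 : (Fin n → LoopForms ev) → B) = 0 := by
  funext w
  simp [lieD]

variable {D T}

theorem lieD_isAlt (hT : ∀ v w, T (v + w) = T v + T w) (hs : ∀ (b : B) v, T (b • v) = b • T v + D b • v)
    {φ : (Fin n → LoopForms ev) → B} (hφ : IsAlt φ) : IsAlt (lieD D T φ) := by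
  induction n with
  | zero =>
    have h : lieD D T φ = fun w => D (φ w) := by funext w; simp [lieD]
    rw [h]
    exact ⟨AlternatingMap.constOfIsEmpty B (LoopForms ev) (Fin 0) (D (φ default)), by
      funext w; rw [Subsingleton.elim w default]; rfl⟩
  | succ n ih =>
    have h1 : ∀ v, IsAlt (ins v (lieD D T φ)) := fun v => by
      rw [ins_lieD]; exact (ih (hφ.ins v)).sub (hφ.ins _)
    have h2 : ∀ v w u, lieD D T φ (Fin.cons (v + w) u) =
        lieD D T φ (Fin.cons v u) + lieD D T φ (Fin.cons w u) := fun v w u => by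
      rw [lieD_cons, lieD_cons, lieD_cons, hφ.ins_add, lieD_add, hT, hφ.cons_add, Pi.add_apply]; ring
    rcases n with _ | n
    · refine IsAlt.of_cons h1 h2 (fun b v u => ?_) fun v w j => j.elim0
      rw [lieD_cons, lieD_cons, hs, hφ.cons_add, hφ.cons_smul, hφ.cons_smul, hφ.ins_smul, lieD_smul,
        Pi.add_apply, Pi.smul_apply, Pi.smul_apply, smul_eq_mul, smul_eq_mul, ins_apply]
      ring
    · refine IsAlt.of_cons_cons h1 h2 fun v u => ?_
      rw [lieD_cons, lieD_cons, hφ.ins_self, lieD_zero, ins_apply, hφ.cons_swap (T v)]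
      simp

theorem lieD_comm {D' D'' : Derivation k B B} {T' T'' : LoopForms ev → LoopForms ev}
    (hD : ∀ x, D'' x = D (D' x) - D' (D x)) (hT : ∀ v, T'' v = T (T' v) - T' (T v))
    {φ : (Fin n → LoopForms ev) → B} (hφ : IsAlt φ) :
    lieD D T (lieD D' T' φ) - lieD D' T' (lieD D T φ) = lieD D'' T'' φ := by
  induction n with
  | zero => funext w; simp [lieD, hD]
  | succ n ih =>
    refine fun_cons_ext fun v u => ?_
    have h := congrFun (ih (hφ.ins v)) u
    rw [Pi.sub_apply] at h ⊢
    rw [lieD_cons, lieD_cons, lieD_cons, lieD_cons, lieD_cons, ins_lieD, ins_lieD, lieD_sub, lieD_sub,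
      Pi.sub_apply, Pi.sub_apply, ← h, hT, hφ.cons_sub]
    ring

end LieD

namespace TopLieAlgebroid

variable (L : TopLieAlgebroid ev) {n : ℕ}

theorem d_sub (φ ψ : (Fin n → LoopForms ev) → B) : L.d (φ - ψ) = L.d φ - L.d ψ := by
  refine eq_sub_of_add_eq (funext fun w => ?_)
  rw [Pi.add_apply, ← d_add, sub_add_cancel]

theorem d_zero_map : L.d (0 : (Fin n → LoopForms ev) → B) = 0 := by
  have := L.d_sub (0 : (Fin n → LoopForms ev) → B) 0
  rwa [sub_self, sub_self] at this

theorem d_add' (φ ψ : (Fin n → LoopForms ev) → B) : L.d (φ + ψ) = L.d φ + L.d ψ :=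
  funext fun w => L.d_add φ ψ w

theorem d_degree_zero (φ : (Fin 0 → LoopForms ev) → B) (v : LoopForms ev) (u : Fin 0 → LoopForms ev) :
    L.d φ (Fin.cons v u) = L.anchor v (φ u) := by
  simp [d, dInsert]

/-- The Lie derivative along `v`. -/
abbrev lie (v : LoopForms ev) (φ : (Fin n → LoopForms ev) → B) : (Fin n → LoopForms ev) → B :=
  lieD (L.anchor v) (L.br v) φ

theorem cons_comp_succAbove (v : LoopForms ev) (w : Fin (n + 1) → LoopForms ev) (i : Fin (n + 1)) :
    (Fin.cons v w : Fin (n + 2) → LoopForms ev) ∘ i.succ.succAbove = Fin.cons v (w ∘ i.succAbove) := by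
  funext q
  induction q using Fin.cases <;> simp

theorem dInsert_cons {φ : (Fin (n + 1) → LoopForms ev) → B} (hφ : IsAlt φ) (v : LoopForms ev)
    (w : Fin (n + 1) → LoopForms ev) : L.dInsert φ (Fin.cons v w) =
      -(∑ j : Fin (n + 1), (-1 : ℤ) ^ (j : ℕ) • φ (Fin.cons (L.br v (w j)) fun q => w (j.succAbove q))) -
        L.dInsert (ins v φ) w := by
  have h0 : ∀ j : Fin (n + 1), (if (0 : Fin (n + 1)).castSucc < j.succ then
      (-1 : ℤ) ^ (((0 : Fin (n + 1)) : ℕ) + (j.succ : ℕ)) • φ (Fin.cons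
        (L.br ((Fin.cons v w : Fin (n + 2) → LoopForms ev) (0 : Fin (n + 1)).castSucc)
          ((Fin.cons v w : Fin (n + 2) → LoopForms ev) j.succ))
        fun q => (Fin.cons v w : Fin (n + 2) → LoopForms ev)
          (j.succ.succAbove ((0 : Fin (n + 1)).succAbove q))) else 0) =
      -((-1 : ℤ) ^ (j : ℕ) • φ (Fin.cons (L.br v (w j)) fun q => w (j.succAbove q))) := by
    intro j
    rw [if_pos (by simp)]
    simp [pow_succ]
  rcases n with _ | n
  · simp only [dInsert]
    rw [Fin.sum_univ_one, Fin.sum_univ_succ, if_neg (by simp), zero_add, sub_zero,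
      ← Finset.sum_neg_distrib]
    exact Finset.sum_congr rfl fun j _ => h0 j
  · have hs : ∀ (i : Fin (n + 1)) (j : Fin (n + 2)), (if i.succ.castSucc < j.succ then
        (-1 : ℤ) ^ ((i.succ : ℕ) + (j.succ : ℕ)) • φ (Fin.cons
          (L.br ((Fin.cons v w : Fin (n + 3) → LoopForms ev) i.succ.castSucc)
            ((Fin.cons v w : Fin (n + 3) → LoopForms ev) j.succ))
          fun q => (Fin.cons v w : Fin (n + 3) → LoopForms ev)
            (j.succ.succAbove (i.succ.succAbove q))) else 0) =
        -(if i.castSucc < j then (-1 : ℤ) ^ ((i : ℕ) + (j : ℕ)) • ins v φ (Fin.cons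
          (L.br (w i.castSucc) (w j)) fun q => w (j.succAbove (i.succAbove q))) else 0) := by
      intro i j
      by_cases hij : i.castSucc < j
      · rw [if_pos hij, if_pos (by simpa using hij)]
        have e : (fun q => (Fin.cons v w : Fin (n + 3) → LoopForms ev)
            (j.succ.succAbove (i.succ.succAbove q))) =
            Fin.cons v fun q => w (j.succAbove (i.succAbove q)) := by
          funext q
          induction q using Fin.cases <;> simp
        rw [e, hφ.cons_swap, ins_apply, Fin.castSucc_succ, Fin.cons_succ, Fin.cons_succ, smul_neg,
          Fin.val_succ, Fin.val_succ, show (i : ℕ) + 1 + (j + 1) = i + j + 2 by ring, pow_add]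
        simp
      · rw [if_neg hij, if_neg (by simpa using hij), neg_zero]
    simp only [dInsert]
    rw [Fin.sum_univ_succ]
    simp only [Fin.sum_univ_succ (n := n + 2) _]
    simp only [h0, hs]
    simp only [Fin.not_lt_zero, if_false, zero_add, Finset.sum_neg_distrib]
    ring

theorem cartan {φ : (Fin (n + 1) → LoopForms ev) → B} (hφ : IsAlt φ) (v : LoopForms ev)
    (w : Fin (n + 1) → LoopForms ev) :
    L.d φ (Fin.cons v w) = L.lie v φ w - L.d (ins v φ) w := by
  have e1 : ∀ j : Fin (n + 1), φ (Function.update w j (L.br v (w j))) =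
      (-1 : ℤ) ^ (j : ℕ) • φ (Fin.cons (L.br v (w j)) fun q => w (j.succAbove q)) :=
    fun j => hφ.insert _ _ _
  have e2 : (Fin.cons v w : Fin (n + 2) → LoopForms ev) ∘ Fin.succAbove 0 = w := by
    funext q; simp
  rw [d, dInsert_cons L hφ, Fin.sum_univ_succ, e2]
  simp only [lie, lieD, e1, cons_comp_succAbove, Fin.cons_zero, Fin.cons_succ, Fin.val_zero, pow_zero,
    one_smul, Fin.val_succ, pow_succ, mul_neg, mul_one, neg_smul, Finset.sum_neg_distrib, d, ins_apply]
  ring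

end TopLieAlgebroid

end Cartan

/-! ## The de Rham–Lie complex of a chart -/

section CartanComplex

variable {k A B : Type u} [Field k] [CommRing A] [CommRing B] [Algebra k A] [Algebra k B]
variable {ev : A →ₐ[k] PowerSeries B}

theorem IsAlt.update_add {n : ℕ} {φ : (Fin n → LoopForms ev) → B} (hφ : IsAlt φ)
    (w : Fin n → LoopForms ev) (q : Fin n) (x y : LoopForms ev) :
    φ (Function.update w q (x + y)) = φ (Function.update w q x) + φ (Function.update w q y) := by
  obtain ⟨f, rfl⟩ := hφ
  exact f.map_update_add w q x y

theorem lieD_degree_zero (D : Derivation k B B) (T : LoopForms ev → LoopForms ev)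
    (φ : (Fin 0 → LoopForms ev) → B) (w : Fin 0 → LoopForms ev) : lieD D T φ w = D (φ w) := by
  simp [lieD]

namespace TopLieAlgebroid

variable (L : TopLieAlgebroid ev) {n : ℕ}

theorem lie_add {φ : (Fin n → LoopForms ev) → B} (hφ : IsAlt φ) (v w : LoopForms ev) :
    L.lie (v + w) φ = L.lie v φ + L.lie w φ := by
  funext u
  simp only [lie, lieD, map_add, LinearMap.add_apply, Derivation.add_apply, hφ.update_add,
    Finset.sum_add_distrib, Pi.add_apply]
  ring

theorem lie_isAlt {φ : (Fin n → LoopForms ev) → B} (hφ : IsAlt φ) (v : LoopForms ev) :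
    IsAlt (L.lie v φ) :=
  lieD_isAlt (fun w w' => map_add _ w w') (fun b w => L.leibniz v w b) hφ

theorem ins_d_zero (φ : (Fin 0 → LoopForms ev) → B) (v : LoopForms ev) :
    ins v (L.d φ) = L.lie v φ := by
  funext u
  rw [ins_apply, d_degree_zero, lie, lieD_degree_zero]

theorem ins_d {φ : (Fin (n + 1) → LoopForms ev) → B} (hφ : IsAlt φ) (v : LoopForms ev) :
    ins v (L.d φ) = L.lie v φ - L.d (ins v φ) :=
  funext fun w => L.cartan hφ v w

theorem d_isAlt {φ : (Fin n → LoopForms ev) → B} (hφ : IsAlt φ) : IsAlt (L.d φ) := by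
  induction n with
  | zero =>
    refine IsAlt.of_cons (fun v => ?_) (fun v w u => ?_) (fun b v u => ?_) fun v w j => j.elim0
    · rw [ins_d_zero]; exact L.lie_isAlt hφ v
    · simp only [d_degree_zero, map_add, Derivation.add_apply]
    · simp only [d_degree_zero, map_smul, Derivation.smul_apply, smul_eq_mul]
  | succ n ih =>
    refine IsAlt.of_cons_cons (fun v => ?_) (fun v w u => ?_) fun v u => ?_
    · rw [ins_d L hφ]; exact (L.lie_isAlt hφ v).sub (ih (hφ.ins v))
    · simp only [L.cartan hφ, L.lie_add hφ, hφ.ins_add, L.d_add', Pi.add_apply]; ring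
    · have h : L.d (ins v φ) (Fin.cons v u) = L.lie v (ins v φ) u := by
        rcases n with _ | n
        · exact congrFun (L.ins_d_zero (ins v φ) v) u
        · rw [L.cartan (hφ.ins v), hφ.ins_self, L.d_zero_map, Pi.zero_apply, sub_zero]
      rw [L.cartan hφ, lie, lieD_cons, h, L.self, ← zero_smul B (0 : LoopForms ev), hφ.cons_smul]
      simp

theorem lieD_d_comm {D : Derivation k B B} {T : LoopForms ev → LoopForms ev}
    (hadd : ∀ v w, T (v + w) = T v + T w) (hsmul : ∀ (b : B) v, T (b • v) = b • T v + D b • v)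
    (hbr : ∀ v w, T (L.br v w) = L.br (T v) w + L.br v (T w))
    (hanch : ∀ v x, L.anchor (T v) x = D (L.anchor v x) - L.anchor v (D x))
    {φ : (Fin n → LoopForms ev) → B} (hφ : IsAlt φ) : L.d (lieD D T φ) = lieD D T (L.d φ) := by
  have hc : ∀ {n : ℕ} {φ : (Fin n → LoopForms ev) → B} (_ : IsAlt φ) (v : LoopForms ev),
      lieD D T (L.lie v φ) - L.lie v (lieD D T φ) = L.lie (T v) φ := fun h v =>
    lieD_comm (fun x => hanch v x) (fun w => eq_sub_of_add_eq (hbr v w).symm) h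
  induction n with
  | zero =>
    refine fun_cons_ext fun v u => ?_
    have h := congrFun (hc hφ v) u
    simp only [Pi.sub_apply] at h
    have h1 : L.d φ (Fin.cons (T v) u) = L.lie (T v) φ u := congrFun (L.ins_d_zero φ (T v)) u
    have h2 : L.d (lieD D T φ) (Fin.cons v u) = L.lie v (lieD D T φ) u :=
      congrFun (L.ins_d_zero (lieD D T φ) v) u
    rw [lieD_cons, ins_d_zero, h1, h2, ← h]
    ring
  | succ n ih =>
    refine fun_cons_ext fun v u => ?_
    have h := congrFun (hc hφ v) u
    simp only [Pi.sub_apply] at h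
    rw [L.cartan (lieD_isAlt hadd hsmul hφ), lieD_cons, ins_d L hφ, lieD_sub, L.cartan hφ, ins_lieD,
      d_sub, Pi.sub_apply, Pi.sub_apply, ih (hφ.ins v), ← h]
    ring

theorem d_d (hanch : ∀ v w x, L.anchor (L.br v w) x =
      L.anchor v (L.anchor w x) - L.anchor w (L.anchor v x))
    {φ : (Fin n → LoopForms ev) → B} (hφ : IsAlt φ) : L.d (L.d φ) = 0 := by
  have hc : ∀ {n : ℕ} {φ : (Fin n → LoopForms ev) → B} (_ : IsAlt φ) (v : LoopForms ev),
      L.d (L.lie v φ) = L.lie v (L.d φ) := fun h v =>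
    L.lieD_d_comm (fun w w' => map_add _ w w') (fun b w => L.leibniz v w b) (L.jacobi v) (hanch v) h
  induction n with
  | zero =>
    refine fun_cons_ext fun v u => ?_
    rw [L.cartan (L.d_isAlt hφ), ins_d_zero, hc hφ, sub_self, Pi.zero_apply]
  | succ n ih =>
    refine fun_cons_ext fun v u => ?_
    rw [L.cartan (L.d_isAlt hφ), ins_d L hφ, d_sub, hc hφ, ih (hφ.ins v), sub_zero, sub_self,
      Pi.zero_apply]

end TopLieAlgebroid

/-- An alternating cochain that vanishes on `z^N ∫ Ω¹` and on the generators `z^i dx_j`, `i < N`, is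
zero. -/
theorem IsAlt.eq_zero_of_generators (𝒳 : FormBasis k A) {n : ℕ} {φ : (Fin n → LoopForms ev) → B}
    (hφ : IsAlt φ) {N : ℕ} (h : ∀ v, (∃ i, v i ∈ loopFilt ev N) → φ v = 0)
    (hg : ∀ s : Fin n → Fin 𝒳.r × Fin N,
      φ (fun q => formGen ev (ArcRing.z ev ^ ((s q).2 : ℕ)) (𝒳.x (s q).1)) = 0) : φ = 0 := by
  induction n with
  | zero =>
    funext v
    rw [Subsingleton.elim v _]
    exact hg Fin.elim0
  | succ n ih =>
    refine fun_cons_ext fun v u => ?_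
    obtain ⟨f, rfl⟩ := id hφ
    let θ : LoopForms ev →ₗ[B] B :=
      { toFun := fun v => f (Fin.cons v u)
        map_add' := fun v w => hφ.cons_add v w u
        map_smul' := fun b v => hφ.cons_smul b v u }
    have hθ : ∀ v ∈ loopFilt ev N, θ v = 0 := fun v hv => h _ ⟨0, hv⟩
    change θ v = 0
    rw [𝒳.cont_eq hθ]
    refine Finset.sum_eq_zero fun j _ => Finset.sum_eq_zero fun i hi => ?_
    have e : LoopPoisson.ins (formGen ev (ArcRing.z ev ^ i) (𝒳.x j)) f = 0 := by
      refine ih (hφ.ins _) (fun w ⟨q, hq⟩ => h _ ⟨q.succ, by rwa [Fin.cons_succ]⟩) fun s => ?_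
      rw [ins_apply, ← hg (Fin.cons (j, ⟨i, Finset.mem_range.mp hi⟩) s)]
      congr 1
      funext q
      induction q using Fin.cases <;> rfl
    have e' : θ (formGen ev (ArcRing.z ev ^ i) (𝒳.x j)) = 0 := congrFun e u
    rw [e', smul_zero]

theorem IsAlt.vanish {n : ℕ} {φ : (Fin (n + 1) → LoopForms ev) → B} (hφ : IsAlt φ) {N : ℕ}
    (h : ∀ v ∈ loopFilt ev N, LoopPoisson.ins v φ = 0) (v : Fin (n + 1) → LoopForms ev)
    (hv : ∃ i, v i ∈ loopFilt ev N) : φ v = 0 := by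
  obtain ⟨i, hi⟩ := hv
  rw [← Function.update_eq_self i v, hφ.insert]
  have h1 : φ (Fin.cons (v i) fun q => v (i.succAbove q)) = 0 := congrFun (h _ hi) _
  rw [h1, smul_zero]

theorem JetUniversal.brk_mem (hev : JetUniversal ev) (P : PoissonBracket k A) (𝒳 : FormBasis k A) {N : ℕ}
    {v w : LoopForms ev} (hv : v ∈ loopFilt ev N) (hw : w ∈ loopFilt ev N) :
    hev.brk P 𝒳 v w ∈ loopFilt ev N := by
  have h : ∀ {v w : LoopForms ev}, w ∈ loopFilt ev N → ∀ j,
      hev.act P v (contract ev (𝒳.η j) w) • 𝒳.dx ev j ∈ loopFilt ev N := by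
    intro v w hw j
    refine mul_smul_mem_loopFilt (fun i hi => ?_) _
    rw [hev.coeff_act, coeff_contract_of_mem hw _ hi, map_zero]
  rw [brk, sub_eq_add_neg]
  refine add_mem_loopFilt (add_mem_loopFilt (sum_mem_loopFilt _ _ fun j _ => h hw j)
    (neg_mem_loopFilt (sum_mem_loopFilt _ _ fun j _ => h hv j)))
    (sum_mem_loopFilt _ _ fun i _ => sum_mem_loopFilt _ _ fun j _ => ?_)
  refine mul_smul_mem_loopFilt (fun l hl => ?_) _
  rw [ArcRing.coeff_mul]
  refine Finset.sum_eq_zero fun p hp => ?_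
  rw [coeff_contract_of_mem hv _ (by
    have := Finset.HasAntidiagonal.mem_antidiagonal.mp hp
    omega), zero_mul]

theorem TopLieAlgebroid.IsCotangent.eq_algebroid [CharZero k] (hev : JetUniversal ev) {P : PoissonBracket k A} (𝒳 : FormBasis k A)
    {L : TopLieAlgebroid ev} (hL : L.IsCotangent P) : L = hev.algebroid P 𝒳 :=
  hev.isCotangent_unique P 𝒳 hL (hev.algebroid_isCotangent P 𝒳)

theorem TopLieAlgebroid.IsCotangent.d_d [CharZero k] (hev : JetUniversal ev) {P : PoissonBracket k A} (𝒳 : FormBasis k A)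
    {L : TopLieAlgebroid ev} (hL : L.IsCotangent P) {n : ℕ} {φ : (Fin n → LoopForms ev) → B}
    (hφ : IsLoopCochain φ) : L.d (L.d φ) = 0 := by
  rw [hL.eq_algebroid hev 𝒳]
  exact TopLieAlgebroid.d_d _ (fun v w x => hev.anchor_brk P 𝒳 v w x) hφ.alternating

theorem cochainDelta_eq {δ : Derivation k B B} (hδ : IsArcDerivation ev δ) {n : ℕ}
    (φ : (Fin n → LoopForms ev) → B) : cochainDelta δ hδ φ = lieD δ (loopDelta ev δ hδ) φ := rfl

theorem TopLieAlgebroid.IsCotangent.d_cochainDelta [CharZero k] (hev : JetUniversal ev) {P : PoissonBracket k A}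
    (𝒳 : FormBasis k A) {L : TopLieAlgebroid ev} (hL : L.IsCotangent P) {δ : Derivation k B B}
    (hδ : IsArcDerivation ev δ) {n : ℕ} {φ : (Fin n → LoopForms ev) → B} (hφ : IsLoopCochain φ) :
    L.d (cochainDelta δ hδ φ) = cochainDelta δ hδ (L.d φ) := by
  rw [hL.eq_algebroid hev 𝒳, cochainDelta_eq, cochainDelta_eq]
  exact TopLieAlgebroid.lieD_d_comm _ (map_add _) (loopDelta_smul hδ)
    (fun v w => hev.loopDelta_brk P 𝒳 hδ v w) (fun v x => hev.anchor_loopDelta P hδ v x) hφ.alternating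

theorem IsLoopCochain.cochainDelta {δ : Derivation k B B} (hδ : IsArcDerivation ev δ) {n : ℕ}
    {φ : (Fin n → LoopForms ev) → B} (hφ : IsLoopCochain φ) :
    IsLoopCochain (LoopPoisson.cochainDelta δ hδ φ) where
  alternating := by
    rw [cochainDelta_eq]
    exact lieD_isAlt (map_add _) (loopDelta_smul hδ) hφ.alternating
  continuous := by
    obtain ⟨N, hN⟩ := hφ.continuous
    refine ⟨N + 1, fun v ⟨i, hi⟩ => ?_⟩
    have h : ∀ q, φ (Function.update v q (loopDelta ev δ hδ (v q))) = 0 := by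
      intro q
      refine hN _ ⟨i, ?_⟩
      by_cases hq : i = q
      · subst hq
        rw [Function.update_self]
        exact loopDelta_mem hδ N hi
      · rw [Function.update_of_ne hq]
        exact loopFilt_mono (Nat.le_succ N) hi
    rw [LoopPoisson.cochainDelta, hN v ⟨i, loopFilt_mono (Nat.le_succ N) hi⟩, map_zero,
      Finset.sum_eq_zero fun q _ => h q, sub_zero]

theorem TopLieAlgebroid.IsCotangent.d_isLoopCochain [CharZero k] (hev : JetUniversal ev) {P : PoissonBracket k A}
    (𝒳 : FormBasis k A) {L : TopLieAlgebroid ev} (hL : L.IsCotangent P) {n : ℕ}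
    {φ : (Fin n → LoopForms ev) → B} (hφ : IsLoopCochain φ) : IsLoopCochain (L.d φ) := by
  have hA : IsAlt φ := hφ.alternating
  refine ⟨L.d_isAlt hA, ?_⟩
  suffices h : ∃ M, ∀ v ∈ loopFilt ev M, ins v (L.d φ) = 0 by
    obtain ⟨M, hM⟩ := h
    exact ⟨M, IsAlt.vanish (L.d_isAlt hA) hM⟩
  have hbr : ∀ {N : ℕ} {v w : LoopForms ev}, v ∈ loopFilt ev N → w ∈ loopFilt ev N →
      L.br v w ∈ loopFilt ev N := by
    rw [hL.eq_algebroid hev 𝒳]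
    exact fun hv hw => hev.brk_mem P 𝒳 hv hw
  have hanch : ∀ x, ∃ K, ∀ v ∈ loopFilt ev K, L.anchor v x = 0 := by
    rw [hL.anchor_eq hev P]
    exact hev.anchor_continuous P
  obtain ⟨N, hN⟩ := hφ.continuous
  suffices h : ∃ M, N ≤ M ∧ ∀ v ∈ loopFilt ev M, L.lie v φ = 0 by
    obtain ⟨M, hNM, hM⟩ := h
    refine ⟨M, fun v hv => ?_⟩
    rcases n with _ | n
    · rw [L.ins_d_zero, hM v hv]
    · have h0 : ins v φ = 0 := funext fun u => hN _ ⟨0, loopFilt_mono hNM hv⟩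
      rw [L.ins_d hA, hM v hv, h0, L.d_zero_map, sub_zero]
  let g : Fin 𝒳.r × Fin N → LoopForms ev := fun s => formGen ev (ArcRing.z ev ^ (s.2 : ℕ)) (𝒳.x s.1)
  obtain ⟨K₁, hK₁⟩ := exists_bound (p := fun (s : Fin n → Fin 𝒳.r × Fin N) m =>
      ∀ v ∈ loopFilt ev m, L.anchor v (φ fun q => g (s q)) = 0) fun s => by
    obtain ⟨K, hK⟩ := hanch (φ fun q => g (s q))
    exact ⟨K, fun m hm v hv => hK v (loopFilt_mono hm hv)⟩
  obtain ⟨K₂, hK₂⟩ := exists_bound (p := fun s m =>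
      ∀ v ∈ loopFilt ev m, L.br v (g s) ∈ loopFilt ev N) fun s => by
    obtain ⟨K, hK⟩ := L.continuous (g s) N
    exact ⟨K, fun m hm v hv => hK v (loopFilt_mono hm hv)⟩
  refine ⟨max N (max K₁ K₂), le_max_left _ _, fun v hv => ?_⟩
  have hvN : v ∈ loopFilt ev N := loopFilt_mono (le_max_left _ _) hv
  refine IsAlt.eq_zero_of_generators 𝒳 (L.lie_isAlt hA v) (N := N) (fun w ⟨i, hi⟩ => ?_) fun s => ?_
  · rw [TopLieAlgebroid.lie, lieD, hN w ⟨i, hi⟩, map_zero, Finset.sum_eq_zero fun q _ => ?_, sub_zero]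
    refine hN _ ⟨i, ?_⟩
    by_cases hq : i = q
    · subst hq
      rw [Function.update_self]
      exact hbr hvN hi
    · rwa [Function.update_of_ne hq]
  · rw [TopLieAlgebroid.lie, lieD, Finset.sum_eq_zero fun q _ => ?_, sub_zero]
    · exact hK₁ _ ((le_max_left _ _).trans (le_max_right _ _)) s v hv
    · refine hN _ ⟨q, ?_⟩
      rw [Function.update_self]
      exact hK₂ _ ((le_max_right _ _).trans (le_max_right _ _)) (s q) v hv

end CartanComplex

/-! ## The differential on polynomial-valued cochains -/

section PolyCochains

variable {k B : Type*} [Field k] [CommRing B] [Algebra k B] {n : ℕ}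

/-- Exponents as a finitely supported function. -/
abbrev expo (m : Fin n → ℕ) : Fin n →₀ ℕ := Finsupp.equivFunOnFinite.symm m

theorem dcoeff_brOpPoly (𝒱 : PVA k B) (i : Fin (n + 1)) (a : B) (p : MvPolynomial (Fin n) B)
    (m : Fin (n + 1) →₀ ℕ) : dcoeff m (𝒱.brOpPoly i a p) =
      pcoeff (m i) (𝒱.br a (dcoeff (expo fun q => m (i.succAbove q)) p)) := by
  have hC : ∀ b, 𝒱.brOpPoly i a (MvPolynomial.C b) =
      Polynomial.aeval (MvPolynomial.X i : MvPolynomial (Fin (n + 1)) B) (𝒱.br a b) := fun b => by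
    rw [MvPolynomial.C_apply, PVA.brOpPoly, mvLift_monomial]
    simp
  have hX : ∀ (j : Fin n) p, 𝒱.brOpPoly i a (MvPolynomial.X j * p) =
      MvPolynomial.X (i.succAbove j) * 𝒱.brOpPoly i a p := by
    intro j p
    induction p using MvPolynomial.induction_on' with
    | add p q hp hq => simp only [mul_add, map_add, hp, hq]
    | monomial m b =>
      rw [MvPolynomial.X, MvPolynomial.monomial_mul, one_mul, PVA.brOpPoly, mvLift_monomial,
        mvLift_monomial]
      simp only [LinearMap.comp_apply, LinearMap.mulLeft_apply, MvPolynomial.rename_monomial,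
        MvPolynomial.X, ← mul_assoc, MvPolynomial.monomial_mul, one_mul, Finsupp.mapDomain_add,
        Finsupp.mapDomain_single]
  induction p using MvPolynomial.induction_on generalizing m with
  | C b =>
    rw [hC, dcoeff_aeval_X, dcoeff_C]
    have h : (∀ q, q ≠ i → m q = 0) ↔ (expo fun q => m (i.succAbove q)) = 0 := by
      constructor
      · intro h
        ext q
        exact h _ (Fin.succAbove_ne i q)
      · intro h q hq
        obtain ⟨q, rfl⟩ := Fin.exists_succAbove_eq hq
        exact DFunLike.congr_fun h q
    by_cases h0 : ∀ q, q ≠ i → m q = 0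
    · rw [if_pos h0, if_pos (h.mp h0)]
    · rw [if_neg h0, if_neg (fun e => h0 (h.mpr e)), map_zero, map_zero]
  | add p q hp hq => simp only [map_add, hp, hq]
  | mul_X p j hp =>
    rw [mul_comm, hX, dcoeff_X_mul, dcoeff_X_mul, hp, map_nsmul, map_nsmul]
    have e1 : (m - Finsupp.single (i.succAbove j) 1 : Fin (n + 1) →₀ ℕ) i = m i := by
      simp [Finsupp.single_apply, Fin.succAbove_ne]
    have e2 : (expo fun q => (m - Finsupp.single (i.succAbove j) 1 : Fin (n + 1) →₀ ℕ) (i.succAbove q)) =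
        expo (fun q => m (i.succAbove q)) - Finsupp.single j 1 := by
      ext q
      simp [Finsupp.single_apply, Fin.succAbove_right_inj]
    rw [e1, e2]
    rfl

/-- The substitution of variables in `lamInsert`. -/
def insertVars (B : Type*) [CommRing B] (i' : Fin (n + 1)) (j : Fin (n + 2)) :
    Fin (n + 1) → MvPolynomial (Fin (n + 2)) B :=
  Fin.cons (α := fun _ => MvPolynomial (Fin (n + 2)) B)
    (MvPolynomial.X i'.castSucc + MvPolynomial.X j)
    (fun q => MvPolynomial.X (j.succAbove (i'.succAbove q)))

/-- The exponents that correspond to `m` under `insertVars`. -/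
abbrev insertExpo (i' : Fin (n + 1)) (j : Fin (n + 2)) (m : Fin (n + 2) →₀ ℕ) : Fin (n + 1) →₀ ℕ :=
  expo (Fin.cons (α := fun _ => ℕ) (m i'.castSucc + m j) fun q => m (j.succAbove (i'.succAbove q)))

theorem exists_insert_index {i' : Fin (n + 1)} {j : Fin (n + 2)} (h : i'.castSucc < j) (s : Fin (n + 2)) :
    s = i'.castSucc ∨ s = j ∨ ∃ q, s = j.succAbove (i'.succAbove q) := by
  by_cases hs : s = j
  · exact Or.inr (Or.inl hs)
  · obtain ⟨t, rfl⟩ := Fin.exists_succAbove_eq hs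
    by_cases ht : t = i'
    · left
      rw [ht, Fin.succAbove_of_castSucc_lt _ _ h]
    · obtain ⟨q, rfl⟩ := Fin.exists_succAbove_eq ht
      exact Or.inr (Or.inr ⟨q, rfl⟩)

theorem dcoeff_aeval_insertVars {i' : Fin (n + 1)} {j : Fin (n + 2)} (h : i'.castSucc < j)
    (m : Fin (n + 2) →₀ ℕ) (p : MvPolynomial (Fin (n + 1)) B) :
    dcoeff m (MvPolynomial.aeval (insertVars B i' j) p) = dcoeff (insertExpo i' j m) p := by
  have hji : ∀ q, j.succAbove (i'.succAbove q) ≠ i'.castSucc := fun q hq =>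
    Fin.succAbove_ne i' q (Fin.succAbove_right_injective
      (hq.trans (Fin.succAbove_of_castSucc_lt _ _ h).symm))
  have hjj : ∀ q, j.succAbove (i'.succAbove q) ≠ j := fun q => Fin.succAbove_ne j _
  induction p using MvPolynomial.induction_on generalizing m with
  | C b =>
    rw [MvPolynomial.aeval_C, MvPolynomial.algebraMap_eq, dcoeff_C, dcoeff_C]
    congr 1
    refine propext ⟨fun h0 => ?_, fun h0 => ?_⟩
    · ext q
      induction q using Fin.cases <;> simp [h0]
    · ext s
      have h1 : ∀ q, insertExpo i' j m q = 0 := fun q => by rw [h0]; rfl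
      have h2 : m i'.castSucc + m j = 0 := h1 0
      rcases exists_insert_index h s with rfl | rfl | ⟨q, rfl⟩
      · simp only [Finsupp.coe_zero, Pi.zero_apply]; omega
      · simp only [Finsupp.coe_zero, Pi.zero_apply]; omega
      · exact h1 q.succ
  | add p q hp hq => simp only [map_add, hp, hq]
  | mul_X p s hp =>
    rw [mul_comm, map_mul, MvPolynomial.aeval_X, dcoeff_X_mul]
    induction s using Fin.cases with
    | zero =>
      have e : ∀ s, s = i'.castSucc ∨ s = j → m s ≠ 0 → insertExpo i' j (m - Finsupp.single s 1) =
          insertExpo i' j m - Finsupp.single 0 1 := by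
        rintro s hs hm
        ext q
        induction q using Fin.cases with
        | zero =>
          rcases hs with rfl | rfl
          · simp [Finsupp.single_apply, h.ne]; omega
          · simp [Finsupp.single_apply, h.ne']; omega
        | succ q =>
          have hne : s ≠ j.succAbove (i'.succAbove q) := by
            rcases hs with rfl | rfl
            exacts [(hji q).symm, (hjj q).symm]
          simp [Finsupp.single_apply, hne, (Fin.succ_ne_zero q).symm]
      have e' : ∀ s, s = i'.castSucc ∨ s = j → m s • dcoeff (insertExpo i' j (m - Finsupp.single s 1)) p =
          m s • dcoeff (insertExpo i' j m - Finsupp.single 0 1) p := fun s hs => by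
        by_cases hm : m s = 0
        · rw [hm, zero_smul, zero_smul]
        · rw [e s hs hm]
      rw [insertVars, Fin.cons_zero, add_mul, map_add, dcoeff_X_mul, dcoeff_X_mul, ← insertVars, hp, hp,
        e' _ (Or.inl rfl), e' _ (Or.inr rfl), ← add_smul]
      rfl
    | succ q =>
      rw [insertVars, Fin.cons_succ, ← insertVars, dcoeff_X_mul, hp]
      have e : insertExpo i' j (m - Finsupp.single (j.succAbove (i'.succAbove q)) 1) =
          insertExpo i' j m - Finsupp.single q.succ 1 := by
        ext s
        induction s using Fin.cases with
        | zero => simp [Finsupp.single_apply, hji q, hjj q, Fin.succ_ne_zero]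
        | succ s => simp [Finsupp.single_apply, Fin.succAbove_right_inj]
      rw [e]
      rfl

/-- A polynomial-valued cochain: a representative of a cochain before passing to the quotient by
`δ + ∑ λ_i`. -/
structure IsPolyCochain (δ : Derivation k B B) (F : (Fin n → B) → MvPolynomial (Fin n) B) : Prop where
  add : ∀ (a : Fin n → B) i b c, F (Function.update a i (b + c)) =
    F (Function.update a i b) + F (Function.update a i c)
  smul : ∀ (a : Fin n → B) i (t : k) b, F (Function.update a i (t • b)) = t • F (Function.update a i b)
  sesq : ∀ a i, F (Function.update a i (δ (a i))) = -(MvPolynomial.X i * F a)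
  antisymm : ∀ a (τ : Equiv.Perm (Fin n)),
    MvPolynomial.rename τ (F (a ∘ τ)) = (Equiv.Perm.sign τ : ℤ) • F a
  leibniz : ∀ a i b c, F (Function.update a i (b * c)) =
    shiftMulPoly δ i b (F (Function.update a i c)) + shiftMulPoly δ i c (F (Function.update a i b))

variable {δ : Derivation k B B} {F : (Fin n → B) → MvPolynomial (Fin n) B}

/-- The linear map given by the dependence on one argument. -/
def IsPolyCochain.slot (hF : IsPolyCochain δ F) (a : Fin n → B) (i : Fin n) :
    B →ₗ[k] MvPolynomial (Fin n) B where
  toFun b := F (Function.update a i b)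
  map_add' := hF.add a i
  map_smul' := hF.smul a i

theorem exists_multilinear {N : Type*} [AddCommGroup N] [Module k N] {Y : (Fin n → B) → N}
    (hadd : ∀ (a : Fin n → B) i b c, Y (Function.update a i (b + c)) =
      Y (Function.update a i b) + Y (Function.update a i c))
    (hsmul : ∀ (a : Fin n → B) i (t : k) b, Y (Function.update a i (t • b)) =
      t • Y (Function.update a i b)) :
    ∃ f : MultilinearMap k (fun _ : Fin n => B) N, ⇑f = Y :=
  ⟨{ toFun := Y
     map_update_add' := @fun inst a i b c => by
       obtain rfl := Subsingleton.elim inst (instDecidableEqFin n)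
       exact hadd a i b c
     map_update_smul' := @fun inst a i t b => by
       obtain rfl := Subsingleton.elim inst (instDecidableEqFin n)
       exact hsmul a i t b }, rfl⟩

variable (𝒱 : PVA k B)

/-- The cochain with values in the quotient. -/
def quotCochain (δ : Derivation k B B) (F : (Fin n → B) → MvPolynomial (Fin n) B) (a : Fin n → B) :
    LamQuot δ n := Submodule.Quotient.mk (F a)

theorem IsPolyCochain.isCochain (hF : IsPolyCochain 𝒱.δ F) : 𝒱.IsCochain (quotCochain 𝒱.δ F) where
  multilinear := exists_multilinear
    (fun a i b c => by rw [quotCochain, hF.add]; rfl) (fun a i t b => by rw [quotCochain, hF.smul]; rfl)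
  sesq a i := by rw [quotCochain, hF.sesq]; rfl
  antisymm a τ := by
    have h : lamPerm 𝒱.δ τ (quotCochain 𝒱.δ F (a ∘ τ)) =
      Submodule.Quotient.mk (MvPolynomial.rename τ (F (a ∘ τ))) := rfl
    rw [h, hF.antisymm, quotCochain]
    exact map_zsmul (LinearMap.range (totalOp 𝒱.δ n)).mkQ _ _
  leibniz a i b c := by rw [quotCochain, hF.leibniz]; rfl

/-- The bracket terms of the differential of a polynomial-valued cochain. -/
def PVA.dInsertPoly : ∀ {n : ℕ}, ((Fin n → B) → MvPolynomial (Fin n) B) → (Fin (n + 1) → B) →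
    MvPolynomial (Fin (n + 1)) B
  | 0, _, _ => 0
  | n + 1, F, a => ∑ i' : Fin (n + 1), ∑ j : Fin (n + 2), if i'.castSucc < j then
      (-1 : ℤ) ^ ((i' : ℕ) + (j : ℕ)) • ((𝒱.br (a i'.castSucc) (a j)).sum fun r c =>
        MvPolynomial.X i'.castSucc ^ r * MvPolynomial.aeval (insertVars B i' j)
          (F (Fin.cons c fun q => a (j.succAbove (i'.succAbove q))))) else 0

/-- The differential of a polynomial-valued cochain. -/
def PVA.dPoly (F : (Fin n → B) → MvPolynomial (Fin n) B) (a : Fin (n + 1) → B) :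
    MvPolynomial (Fin (n + 1)) B :=
  (∑ i : Fin (n + 1), (-1 : ℤ) ^ (i : ℕ) • 𝒱.brOpPoly i (a i) (F (a ∘ i.succAbove))) + 𝒱.dInsertPoly F a

theorem lamMul_pow_mk (δ : Derivation k B B) (i : Fin n) (r : ℕ) (p : MvPolynomial (Fin n) B) :
    (lamMul δ i ^ r) (Submodule.Quotient.mk p) = Submodule.Quotient.mk (MvPolynomial.X i ^ r * p) := by
  induction r with
  | zero => simp
  | succ r ih =>
    rw [pow_succ', Module.End.mul_apply, ih, pow_succ', mul_assoc]
    rfl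

theorem PVA.d_quotCochain (F : (Fin n → B) → MvPolynomial (Fin n) B) :
    𝒱.d (quotCochain 𝒱.δ F) = quotCochain 𝒱.δ (𝒱.dPoly F) := by
  have hz : ∀ (n r : ℕ) (p : MvPolynomial (Fin n) B),
      ((-1 : ℤ) ^ r • Submodule.Quotient.mk p : LamQuot 𝒱.δ n) = Submodule.Quotient.mk ((-1 : ℤ) ^ r • p) :=
    fun n r p => (map_zsmul (LinearMap.range (totalOp 𝒱.δ n)).mkQ _ _).symm
  funext a
  rw [quotCochain, PVA.dPoly, Submodule.Quotient.mk_add, PVA.d]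
  refine congrArg₂ (· + ·) ?_ ?_
  · rw [← Submodule.mkQ_apply, map_sum]
    refine Finset.sum_congr rfl fun i _ => ?_
    rw [Submodule.mkQ_apply, ← hz]
    rfl
  · rcases n with _ | n
    · rfl
    · rw [PVA.dInsert, PVA.dInsertPoly, ← Submodule.mkQ_apply, map_sum]
      refine Finset.sum_congr rfl fun i' _ => ?_
      rw [map_sum]
      refine Finset.sum_congr rfl fun j _ => ?_
      by_cases h : i'.castSucc < j
      · rw [dif_pos h, if_pos h, Submodule.mkQ_apply, ← hz, Polynomial.sum, Polynomial.sum,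
          ← Submodule.mkQ_apply, map_sum]
        congr 1
        refine Finset.sum_congr rfl fun r _ => ?_
        exact lamMul_pow_mk _ _ _ _
      · rw [dif_neg h, if_neg h, map_zero]

/-- The bracket terms of a coefficient of `dPoly`. -/
def PVA.dInsertCoeff : ∀ {n : ℕ}, ((Fin n → B) → MvPolynomial (Fin n) B) → (Fin (n + 1) → B) →
    (Fin (n + 1) →₀ ℕ) → B
  | 0, _, _, _ => 0
  | n + 1, F, a, m => ∑ i' : Fin (n + 1), ∑ j : Fin (n + 2), if i'.castSucc < j then
      (-1 : ℤ) ^ ((i' : ℕ) + (j : ℕ)) • ∑ r ∈ Finset.range (m i'.castSucc + 1),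
        (m i'.castSucc).choose r • dcoeff (insertExpo i' j (m - Finsupp.single i'.castSucc r))
          (F (Fin.cons (pcoeff r (𝒱.br (a i'.castSucc) (a j))) fun q =>
            a (j.succAbove (i'.succAbove q)))) else 0

theorem PVA.dcoeff_dPoly (hF : IsPolyCochain δ F) (a : Fin (n + 1) → B) (m : Fin (n + 1) →₀ ℕ) :
    dcoeff m (𝒱.dPoly F a) = (∑ i : Fin (n + 1), (-1 : ℤ) ^ (i : ℕ) •
      pcoeff (m i) (𝒱.br (a i) (dcoeff (expo fun q => m (i.succAbove q)) (F (a ∘ i.succAbove))))) +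
      𝒱.dInsertCoeff F a m := by
  rw [PVA.dPoly, map_add, map_sum]
  congr 1
  · exact Finset.sum_congr rfl fun i _ => by rw [map_zsmul, dcoeff_brOpPoly]
  · rcases n with _ | n
    · exact map_zero _
    · rw [PVA.dInsertPoly, PVA.dInsertCoeff, map_sum]
      refine Finset.sum_congr rfl fun i' _ => ?_
      rw [map_sum]
      refine Finset.sum_congr rfl fun j _ => ?_
      by_cases h : i'.castSucc < j
      · rw [if_pos h, if_pos h, map_zsmul]
        congr 1
        have e := dcoeff_sum_X_pow_mul (k := k) m i'.castSucc (𝒱.br (a i'.castSucc) (a j))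
          (((MvPolynomial.aeval (R := B) (insertVars B i' j)).toLinearMap.restrictScalars k) ∘ₗ
            hF.slot (Fin.cons 0 fun q => a (j.succAbove (i'.succAbove q))) 0)
        have e0 : ∀ c, hF.slot (Fin.cons 0 fun q => a (j.succAbove (i'.succAbove q))) 0 c =
            F (Fin.cons c fun q => a (j.succAbove (i'.succAbove q))) := fun c => by
          change F _ = _
          rw [Fin.update_cons_zero]
        simp only [LinearMap.comp_apply, e0, LinearMap.restrictScalars_apply, AlgHom.toLinearMap_apply,
          dcoeff_aeval_insertVars h] at e
        exact e
      · rw [if_neg h, if_neg h, map_zero]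

end PolyCochains

/-! ## From de Rham–Lie cochains to polynomial-valued cochains -/

section ExpPoly

variable {k A B : Type u} [Field k] [CommRing A] [CommRing B] [Algebra k A] [Algebra k B]
variable {ev : A →ₐ[k] PowerSeries B} {n : ℕ}

namespace IsLoopCochain

theorem isAlt {φ : (Fin n → LoopForms ev) → B} (hφ : IsLoopCochain φ) : IsAlt φ := hφ.alternating

/-- The dependence on one argument. -/
def slot {φ : (Fin n → LoopForms ev) → B} (hφ : IsLoopCochain φ) (w : Fin n → LoopForms ev) (i : Fin n) :
    LoopForms ev →ₗ[B] B where
  toFun v := φ (Function.update w i v)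
  map_add' v v' := hφ.isAlt.update_add w i v v'
  map_smul' b v := by
    obtain ⟨f, rfl⟩ := hφ.alternating
    exact f.map_update_smul w i b v

theorem slot_apply {φ : (Fin n → LoopForms ev) → B} (hφ : IsLoopCochain φ) (w : Fin n → LoopForms ev)
    (i : Fin n) (v : LoopForms ev) : hφ.slot w i v = φ (Function.update w i v) := rfl

theorem slot_cons {φ : (Fin (n + 1) → LoopForms ev) → B} (hφ : IsLoopCochain φ) (u : Fin n → LoopForms ev)
    (v : LoopForms ev) : hφ.slot (Fin.cons 0 u) 0 v = φ (Fin.cons v u) := by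
  rw [slot_apply, Fin.update_cons_zero]

theorem slot_isCont {φ : (Fin n → LoopForms ev) → B} (hφ : IsLoopCochain φ) (w : Fin n → LoopForms ev)
    (i : Fin n) : IsCont (hφ.slot w i) := by
  obtain ⟨N, hN⟩ := hφ.continuous
  exact ⟨N, fun v hv => hN _ ⟨i, by rwa [Function.update_self]⟩⟩

theorem map_perm {φ : (Fin n → LoopForms ev) → B} (hφ : IsLoopCochain φ) (w : Fin n → LoopForms ev)
    (τ : Equiv.Perm (Fin n)) : φ (w ∘ τ) = (Equiv.Perm.sign τ : ℤ) • φ w := by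
  obtain ⟨f, rfl⟩ := hφ.alternating
  rw [f.map_perm]
  rfl

end IsLoopCochain

variable [CharZero k] (hev : JetUniversal ev) {δ : Derivation k B B} (hδ : IsArcDerivation ev δ)
  (𝒳 : FormBasis k A)

/-- The tuple of the coefficients of `e^{λ_q z} dx_q`. -/
def JetUniversal.expTuple (m : Fin n →₀ ℕ) (x : Fin n → B) (q : Fin n) : LoopForms ev :=
  hev.expForm hδ 𝒳 (m q) (x q)

/-- The polynomial `φ(e^{λ_1 z} dx_1, …, e^{λ_n z} dx_n)`, for functions `x_1, …, x_n` on the arc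
space. -/
def JetUniversal.expPoly (φ : (Fin n → LoopForms ev) → B) (x : Fin n → B) : MvPolynomial (Fin n) B :=
  genPoly k fun m => φ (hev.expTuple hδ 𝒳 m x)

theorem JetUniversal.expPoly_support {φ : (Fin n → LoopForms ev) → B} (hφ : IsLoopCochain φ) (x : Fin n → B) :
    (Function.support fun m => φ (hev.expTuple hδ 𝒳 m x)).Finite := by
  obtain ⟨N, hN⟩ := hφ.continuous
  choose K hK using fun q => hev.expForm_mem hδ 𝒳 (x q) N
  refine (Set.finite_Iic (expo K)).subset fun m hm q => ?_
  by_contra h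
  exact hm (hN _ ⟨q, hK q _ (le_of_not_ge h)⟩)

theorem JetUniversal.dcoeff_expPoly {φ : (Fin n → LoopForms ev) → B} (hφ : IsLoopCochain φ) (x : Fin n → B)
    (m : Fin n →₀ ℕ) : dcoeff m (hev.expPoly hδ 𝒳 φ x) = φ (hev.expTuple hδ 𝒳 m x) :=
  dcoeff_genPoly (hev.expPoly_support hδ 𝒳 hφ x) m

theorem JetUniversal.expPoly_jet (φ : (Fin n → LoopForms ev) → B) (a : Fin n → A) :
    hev.expPoly hδ 𝒳 φ (fun q => jet ev 0 (a q)) = expEval ev φ a := by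
  have h : ∀ m, hev.expTuple hδ 𝒳 m (fun q => jet ev 0 (a q)) =
      fun q => formGen ev (ArcRing.z ev ^ m q) (a q) := fun m => funext fun q => hev.expForm_jet hδ 𝒳 _ _
  simp only [expPoly, genPoly, h, expEval]

theorem JetUniversal.expTuple_update (m : Fin n →₀ ℕ) (x : Fin n → B) (i : Fin n) (y : B) :
    hev.expTuple hδ 𝒳 m (Function.update x i y) =
      Function.update (hev.expTuple hδ 𝒳 m x) i (hev.expForm hδ 𝒳 (m i) y) :=
  funext fun q => Function.apply_update (fun q => hev.expForm hδ 𝒳 (m q)) x i y q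

theorem JetUniversal.dcoeff_expPoly_update {φ : (Fin n → LoopForms ev) → B} (hφ : IsLoopCochain φ)
    (x : Fin n → B) (i : Fin n) (y : B) (m : Fin n →₀ ℕ) :
    dcoeff m (hev.expPoly hδ 𝒳 φ (Function.update x i y)) =
      hφ.slot (hev.expTuple hδ 𝒳 m x) i (hev.expForm hδ 𝒳 (m i) y) := by
  rw [dcoeff_expPoly hev hδ 𝒳 hφ, expTuple_update, hφ.slot_apply]

theorem JetUniversal.update_expTuple (m : Fin n →₀ ℕ) (x : Fin n → B) (i : Fin n) (l : ℕ) :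
    Function.update (hev.expTuple hδ 𝒳 m x) i (hev.expForm hδ 𝒳 l (x i)) =
      hev.expTuple hδ 𝒳 (m.update i l) x := by
  funext q
  by_cases h : q = i
  · subst h; simp [expTuple]
  · simp [expTuple, h]

theorem JetUniversal.expPoly_isPolyCochain {φ : (Fin n → LoopForms ev) → B} (hφ : IsLoopCochain φ) :
    IsPolyCochain δ (hev.expPoly hδ 𝒳 φ) where
  add a i b c := dcoeff_ext k fun m => by
    simp only [map_add, dcoeff_expPoly_update hev hδ 𝒳 hφ]
  smul a i t b := dcoeff_ext k fun m => by
    rw [dcoeff_smul, dcoeff_expPoly_update hev hδ 𝒳 hφ, dcoeff_expPoly_update hev hδ 𝒳 hφ, map_smul,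
      ← algebraMap_smul B t (hev.expForm hδ 𝒳 (m i) b), map_smul, algebraMap_smul]
  sesq a i := dcoeff_ext k fun m => by
    have e : m.update i (m i - 1) = m - Finsupp.single i 1 := by
      ext q
      by_cases h : q = i
      · subst h; simp
      · simp [h]
    rw [dcoeff_expPoly_update hev hδ 𝒳 hφ, expForm_delta, map_neg, map_nsmul, hφ.slot_apply,
      update_expTuple, e, map_neg, dcoeff_X_mul, dcoeff_expPoly hev hδ 𝒳 hφ]
  antisymm a τ := dcoeff_ext k fun m => by
    rw [dcoeff_rename, dcoeff_expPoly hev hδ 𝒳 hφ, map_zsmul, dcoeff_expPoly hev hδ 𝒳 hφ,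
      ← hφ.map_perm]
    congr 1
  leibniz a i b c := dcoeff_ext k fun m => by
    have hc := hφ.slot_isCont (hev.expTuple hδ 𝒳 m a) i
    obtain ⟨T₀, hT₀⟩ := hev.expForm_mul hδ 𝒳 hc b c (m i)
    have h : ∀ y l, dcoeff (m + Finsupp.single i l) (hev.expPoly hδ 𝒳 φ (Function.update a i y)) =
        hφ.slot (hev.expTuple hδ 𝒳 m a) i (hev.expForm hδ 𝒳 (m i + l) y) := by
      intro y l
      rw [dcoeff_expPoly_update hev hδ 𝒳 hφ, hφ.slot_apply, hφ.slot_apply]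
      congr 1
      funext q
      by_cases h : q = i
      · subst h; simp
      · simp [h, expTuple]
    obtain ⟨K, hK⟩ := hev.expForm_eventually hδ 𝒳 hc b
    obtain ⟨K', hK'⟩ := hev.expForm_eventually hδ 𝒳 hc c
    set T := max T₀ (max K K') with hT
    rw [map_add, dcoeff_shiftMulPoly δ i b m _ (K := T) fun l hl => by
        rw [h]; exact hK' _ (by omega),
      dcoeff_shiftMulPoly δ i c m _ (K := T) fun l hl => by
        rw [h]; exact hK _ (by omega),
      dcoeff_expPoly_update hev hδ 𝒳 hφ, hT₀ T (le_max_left _ _), Finset.sum_add_distrib]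
    simp only [h, smul_eq_mul]

theorem JetUniversal.expPoly_cochainDelta {φ : (Fin n → LoopForms ev) → B} (hφ : IsLoopCochain φ)
    (x : Fin n → B) : hev.expPoly hδ 𝒳 (cochainDelta δ hδ φ) x = totalOp δ n (hev.expPoly hδ 𝒳 φ x) :=
  dcoeff_ext k fun m => by
    rw [dcoeff_expPoly hev hδ 𝒳 (hφ.cochainDelta hδ), dcoeff_totalOp, cochainDelta,
      dcoeff_expPoly hev hδ 𝒳 hφ, sub_eq_add_neg, ← Finset.sum_neg_distrib]
    congr 1
    refine Finset.sum_congr rfl fun q _ => ?_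
    have e : m.update q (m q - 1) = m - Finsupp.single q 1 := by
      ext q'
      by_cases h : q' = q
      · subst h; simp
      · simp [h]
    have e1 : loopDelta ev δ hδ (hev.expTuple hδ 𝒳 m x q) =
      -(m q • hev.expForm hδ 𝒳 (m q - 1) (x q)) := hev.loopDelta_expForm hδ 𝒳 _ _
    rw [e1, ← hφ.slot_apply, map_neg, map_nsmul, hφ.slot_apply, update_expTuple, e, neg_neg,
      dcoeff_expPoly hev hδ 𝒳 hφ]

theorem JetUniversal.expPoly_d {P : PoissonBracket k A} {L : TopLieAlgebroid ev} (hL : L.IsCotangent P)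
    (𝒱 : PVA k B) (hbr : ∀ m x y, pcoeff m (𝒱.br x y) = hev.nprod hδ 𝒳 P m x y)
    {φ : (Fin n → LoopForms ev) → B} (hφ : IsLoopCochain φ) (x : Fin (n + 1) → B) :
    hev.expPoly hδ 𝒳 (L.d φ) x = 𝒱.dPoly (hev.expPoly hδ 𝒳 φ) x :=
  dcoeff_ext k fun m => by
    rw [dcoeff_expPoly hev hδ 𝒳 (hL.d_isLoopCochain hev 𝒳 hφ),
      𝒱.dcoeff_dPoly (hev.expPoly_isPolyCochain hδ 𝒳 hφ), TopLieAlgebroid.d]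
    congr 1
    · refine Finset.sum_congr rfl fun i _ => ?_
      rw [dcoeff_expPoly hev hδ 𝒳 hφ, hbr, nprod, hL.anchor_eq hev P]
      rfl
    · rcases n with _ | n
      · rfl
      · rw [TopLieAlgebroid.dInsert, PVA.dInsertCoeff]
        refine Finset.sum_congr rfl fun i' _ => Finset.sum_congr rfl fun j _ => ?_
        by_cases h : i'.castSucc < j
        · rw [if_pos h, if_pos h]
          congr 1
          have hs : L.br (hev.expTuple hδ 𝒳 m x i'.castSucc) (hev.expTuple hδ 𝒳 m x j) = _ :=
            hev.star hδ 𝒳 hL (m i'.castSucc) (m j) (x i'.castSucc) (x j)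
          rw [hs, ← hφ.slot_cons, map_sum, ← Finset.sum_range_reflect]
          refine Finset.sum_congr rfl fun r hr => ?_
          have hr' : r ≤ m i'.castSucc := Nat.lt_succ_iff.mp (Finset.mem_range.mp hr)
          rw [map_nsmul, hφ.slot_cons, dcoeff_expPoly hev hδ 𝒳 hφ, hbr, Nat.add_sub_cancel,
            Nat.choose_symm hr', Nat.sub_sub_self hr']
          congr 2
          funext q
          have hji : ∀ q, i'.castSucc ≠ j.succAbove (i'.succAbove q) := fun q hq =>
            Fin.succAbove_ne i' q (Fin.succAbove_right_injective
              (hq.symm.trans (Fin.succAbove_of_castSucc_lt _ _ h).symm))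
          induction q using Fin.cases with
          | zero =>
            have e : insertExpo i' j (m - Finsupp.single i'.castSucc r) 0 =
                m j + (m i'.castSucc - r) := by
              simp [Finsupp.single_apply, h.ne, add_comm]
            rw [expTuple, e]
            rfl
          | succ q =>
            have e : insertExpo i' j (m - Finsupp.single i'.castSucc r) q.succ =
                m (j.succAbove (i'.succAbove q)) := by
              simp [Finsupp.single_apply, hji]
            rw [expTuple, e]
            rfl
        · rw [if_neg h, if_neg h]

end ExpPoly

/-! ## Cochains are determined by their values on coordinates -/

section Slotwise

/-- Maps `B^n → N` that are sesquilinear derivations in each argument. -/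
structure IsSlotwise {k B N : Type*} [Field k] [CommRing B] [Algebra k B] [AddCommGroup N] [Module k N]
    {n : ℕ} (δ : Derivation k B B) (act : Fin n → B →ₐ[k] Module.End k N) (ℓ : Fin n → Module.End k N)
    (Y : (Fin n → B) → N) : Prop where
  add : ∀ (a : Fin n → B) i b c, Y (Function.update a i (b + c)) =
    Y (Function.update a i b) + Y (Function.update a i c)
  smul : ∀ (a : Fin n → B) i (t : k) b, Y (Function.update a i (t • b)) = t • Y (Function.update a i b)
  sesq : ∀ a i, Y (Function.update a i (δ (a i))) = ℓ i (Y a)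
  leibniz : ∀ a i b c, Y (Function.update a i (b * c)) =
    act i b (Y (Function.update a i c)) + act i c (Y (Function.update a i b))

variable {k A B : Type u} [Field k] [CommRing A] [CommRing B] [Algebra k A] [Algebra k B]
variable {ev : A →ₐ[k] PowerSeries B} {n : ℕ}

/-- The homomorphism `a ↦ a_0`. -/
def jetHom (ev : A →ₐ[k] PowerSeries B) : A →ₐ[k] B where
  toRingHom := (PowerSeries.constantCoeff).comp (ev : A →+* PowerSeries B)
  commutes' c := by
    change PowerSeries.constantCoeff (ev (algebraMap k A c)) = _
    rw [ev.commutes]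
    exact PowerSeries.constantCoeff_C _

theorem jetHom_apply (a : A) : jetHom ev a = jet ev 0 a := (PowerSeries.coeff_zero_eq_constantCoeff_apply _).symm

theorem JetUniversal.sesq_ext [CharZero k] (hev : JetUniversal ev) {δ : Derivation k B B}
    (hδ : IsArcDerivation ev δ) (𝒳 : FormBasis k A) {N : Type u} [AddCommGroup N] [Module k N]
    (act : B →ₐ[k] Module.End k N) (ℓ : Module.End k N) (D D' : B →ₗ[k] N)
    (hD : ∀ x y, D (x * y) = act x (D y) + act y (D x))
    (hD' : ∀ x y, D' (x * y) = act x (D' y) + act y (D' x))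
    (hs : ∀ x, D (δ x) = ℓ (D x)) (hs' : ∀ x, D' (δ x) = ℓ (D' x))
    (h : ∀ j, D (jet ev 0 (𝒳.x j)) = D' (jet ev 0 (𝒳.x j))) : D = D' := by
  refine hev.sesq_uniq hδ act ℓ D D' hD hD' hs hs' fun a => ?_
  let _ : Module A N := Module.compHom N (act.comp (jetHom ev)).toRingHom
  have hsm : ∀ (a : A) (v : N), a • v = act (jetHom ev a) v := fun _ _ => rfl
  have _ : IsScalarTower k A N := IsScalarTower.of_algebraMap_smul fun c v => by
    rw [hsm, AlgHom.commutes, AlgHom.commutes]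
    rfl
  have hE : ∀ E : B →ₗ[k] N, (∀ x y, E (x * y) = act x (E y) + act y (E x)) →
      E (jetHom ev a) = ∑ j, 𝒳.η j a • E (jetHom ev (𝒳.x j)) := fun E hE =>
    𝒳.derivation_eq (Derivation.mk' (E ∘ₗ (jetHom ev).toLinearMap) fun a b => by
      change E (jetHom ev (a * b)) = _
      rw [map_mul, hE]
      rfl) a
  simp only [← jetHom_apply] at h ⊢
  rw [hE D hD, hE D' hD']
  exact Finset.sum_congr rfl fun j _ => by rw [h]

theorem IsSlotwise.ext [CharZero k] (hev : JetUniversal ev) {δ : Derivation k B B}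
    (hδ : IsArcDerivation ev δ) (𝒳 : FormBasis k A) {N : Type u} [AddCommGroup N] [Module k N]
    {act : Fin n → B →ₐ[k] Module.End k N} {ℓ : Fin n → Module.End k N} {Y Y' : (Fin n → B) → N}
    (hY : IsSlotwise δ act ℓ Y) (hY' : IsSlotwise δ act ℓ Y')
    (h : ∀ J : Fin n → Fin 𝒳.r, Y (fun q => jet ev 0 (𝒳.x (J q))) = Y' fun q => jet ev 0 (𝒳.x (J q))) :
    Y = Y' := by
  have key : ∀ (s : Finset (Fin n)) (x : Fin n → B), (∀ q, q ∉ s → ∃ j, x q = jet ev 0 (𝒳.x j)) →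
      Y x = Y' x := by
    intro s
    induction s using Finset.induction_on with
    | empty =>
      intro x hx
      choose J hJ using fun q => hx q (Finset.notMem_empty q)
      rw [funext hJ]
      exact h J
    | insert i s _ ih =>
      intro x hx
      let lin : ∀ {Z : (Fin n → B) → N}, IsSlotwise δ act ℓ Z → B →ₗ[k] N := fun {Z} hZ =>
        { toFun := fun b => Z (Function.update x i b)
          map_add' := hZ.add x i
          map_smul' := hZ.smul x i }
      have hsesq : ∀ {Z : (Fin n → B) → N} (hZ : IsSlotwise δ act ℓ Z) b,
          lin hZ (δ b) = ℓ i (lin hZ b) := fun {Z} hZ b => by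
        have := hZ.sesq (Function.update x i b) i
        rwa [Function.update_idem, Function.update_self] at this
      have e := hev.sesq_ext hδ 𝒳 (act i) (ℓ i) (lin hY) (lin hY') (hY.leibniz x i) (hY'.leibniz x i)
        (hsesq hY) (hsesq hY') fun j => ih _ fun q hq => by
          by_cases hqi : q = i
          · subst hqi
            exact ⟨j, Function.update_self _ _ _⟩
          · rw [Function.update_of_ne hqi]
            exact hx q (by simp [hqi, hq])
      have e' : Y (Function.update x i (x i)) = Y' (Function.update x i (x i)) := LinearMap.congr_fun e (x i)
      rwa [Function.update_eq_self] at e'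
  exact funext fun x => key Finset.univ x fun q hq => absurd (Finset.mem_univ q) hq

end Slotwise

/-! ## Change of the algebra -/

section ChangeAlgebra

variable {k B B' : Type*} [Field k] [CommRing B] [Algebra k B] [CommRing B'] [Algebra k B'] {n : ℕ}
  (f : B →ₐ[k] B') {δ : Derivation k B B} {δ' : Derivation k B' B'}

theorem shiftMulPoly_map (hf : ∀ x, f (δ x) = δ' (f x)) (i : Fin n) (a : B) (p : MvPolynomial (Fin n) B) :
    MvPolynomial.mapAlgHom f (shiftMulPoly δ i a p) =
      shiftMulPoly δ' i (f a) (MvPolynomial.mapAlgHom f p) := by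
  have h : ∀ l, f ((δ^[l]) a) = (δ'^[l]) (f a) := fun l => by
    induction l with
    | zero => rfl
    | succ l ih => rw [Function.iterate_succ_apply', Function.iterate_succ_apply', hf, ih]
  induction p using MvPolynomial.induction_on' with
  | add p q hp hq => simp only [map_add, hp, hq]
  | monomial m b =>
    have hm : ∀ (m : Fin n →₀ ℕ) b, MvPolynomial.mapAlgHom f (MvPolynomial.monomial m b) =
        MvPolynomial.monomial m (f b) := fun m b => MvPolynomial.map_monomial _ _ _
    rw [shiftMulPoly_monomial, map_sum, hm, shiftMulPoly_monomial]
    exact Finset.sum_congr rfl fun l _ => by rw [map_nsmul, hm, map_mul, h]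

/-- The map of quotients given by a homomorphism of differential algebras. -/
def lamMap (hf : ∀ x, f (δ x) = δ' (f x)) (n : ℕ) : LamQuot δ n →ₗ[k] LamQuot δ' n :=
  LamQuot.map (MvPolynomial.mapAlgHom f).toLinearMap (by
    refine mv_ext fun m b => ?_
    have h1 : δ'.toLinearMap (f b) = f (δ.toLinearMap b) := (hf b).symm
    simp [totalOp, coefMap_monomial, MvPolynomial.map_monomial, h1])

theorem lamMap_lamMul (hf : ∀ x, f (δ x) = δ' (f x)) (i : Fin n) (v : LamQuot δ n) :
    lamMap f hf n (lamMul δ i v) = lamMul δ' i (lamMap f hf n v) := by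
  obtain ⟨p, rfl⟩ := Submodule.Quotient.mk_surjective _ v
  refine congrArg Submodule.Quotient.mk ((map_mul (MvPolynomial.mapAlgHom f) _ _).trans ?_)
  simp

theorem lamMap_lamMul_pow (hf : ∀ x, f (δ x) = δ' (f x)) (i : Fin n) (r : ℕ) (v : LamQuot δ n) :
    lamMap f hf n ((lamMul δ i ^ r) v) = (lamMul δ' i ^ r) (lamMap f hf n v) := by
  induction r with
  | zero => simp
  | succ r ih => rw [pow_succ', pow_succ', Module.End.mul_apply, Module.End.mul_apply, lamMap_lamMul, ih]

theorem lamMap_lamPerm (hf : ∀ x, f (δ x) = δ' (f x)) (τ : Equiv.Perm (Fin n)) (v : LamQuot δ n) :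
    lamMap f hf n (lamPerm δ τ v) = lamPerm δ' τ (lamMap f hf n v) := by
  obtain ⟨p, rfl⟩ := Submodule.Quotient.mk_surjective _ v
  refine congrArg Submodule.Quotient.mk ?_
  exact MvPolynomial.map_rename (f : B →+* B') τ p

theorem lamMap_shiftMul (hf : ∀ x, f (δ x) = δ' (f x)) (i : Fin n) (a : B) (v : LamQuot δ n) :
    lamMap f hf n (shiftMul δ i a v) = shiftMul δ' i (f a) (lamMap f hf n v) := by
  obtain ⟨p, rfl⟩ := Submodule.Quotient.mk_surjective _ v
  exact congrArg Submodule.Quotient.mk (shiftMulPoly_map f hf i a p)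

theorem lamMap_lamInsert (hf : ∀ x, f (δ x) = δ' (f x)) {i' : Fin (n + 1)} {j : Fin (n + 2)}
    (h : i'.castSucc < j) (v : LamQuot δ (n + 1)) :
    lamMap f hf _ (lamInsert δ i' j h v) = lamInsert δ' i' j h (lamMap f hf _ v) := by
  obtain ⟨p, rfl⟩ := Submodule.Quotient.mk_surjective _ v
  refine congrArg Submodule.Quotient.mk ?_
  change MvPolynomial.mapAlgHom f (MvPolynomial.aeval (insertVars B i' j) p) =
    MvPolynomial.aeval (insertVars B' i' j) (MvPolynomial.mapAlgHom f p)
  induction p using MvPolynomial.induction_on with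
  | C b => simp [MvPolynomial.algebraMap_eq]
  | add p q hp hq => simp only [map_add, hp, hq]
  | mul_X p s hp =>
    rw [map_mul, map_mul, map_mul, map_mul, hp]
    congr 1
    rw [MvPolynomial.aeval_X]
    induction s using Fin.cases <;> simp [insertVars]

variable {𝒱 : PVA k B} {𝒱' : PVA k B'}

theorem lamMap_brOp [CharZero k] (hf : ∀ x, f (𝒱.δ x) = 𝒱'.δ (f x))
    (hbr : ∀ x y, 𝒱'.br (f x) (f y) = (𝒱.br x y).map (f : B →+* B')) (i : Fin (n + 1)) (a : B)
    (v : LamQuot 𝒱.δ n) : lamMap f hf _ (𝒱.brOp i a v) = 𝒱'.brOp i (f a) (lamMap f hf _ v) := by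
  obtain ⟨p, rfl⟩ := Submodule.Quotient.mk_surjective _ v
  refine congrArg Submodule.Quotient.mk (dcoeff_ext k fun m => ?_)
  change dcoeff m (MvPolynomial.mapAlgHom f (𝒱.brOpPoly i a p)) =
    dcoeff m (𝒱'.brOpPoly i (f a) (MvPolynomial.mapAlgHom f p))
  rw [dcoeff_mapAlgHom, dcoeff_brOpPoly, dcoeff_brOpPoly, dcoeff_mapAlgHom, hbr, pcoeff_map]

/-- The differential is natural. -/
theorem lamMap_d [CharZero k] (hf : ∀ x, f (𝒱.δ x) = 𝒱'.δ (f x))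
    (hbr : ∀ x y, 𝒱'.br (f x) (f y) = (𝒱.br x y).map (f : B →+* B'))
    {Y : (Fin n → B) → LamQuot 𝒱.δ n} {Y' : (Fin n → B') → LamQuot 𝒱'.δ n} (hY' : 𝒱'.IsCochain Y')
    (h : ∀ a, Y' (fun q => f (a q)) = lamMap f hf n (Y a)) (a : Fin (n + 1) → B) :
    𝒱'.d Y' (fun q => f (a q)) = lamMap f hf _ (𝒱.d Y a) := by
  rw [PVA.d, PVA.d, map_add, map_sum]
  congr 1
  · refine Finset.sum_congr rfl fun i _ => ?_
    rw [map_zsmul, lamMap_brOp f hf hbr, ← h]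
    rfl
  · rcases n with _ | n
    · exact (map_zero _).symm
    · rw [PVA.dInsert, PVA.dInsert, map_sum]
      refine Finset.sum_congr rfl fun i' _ => ?_
      rw [map_sum]
      refine Finset.sum_congr rfl fun j _ => ?_
      by_cases hij : i'.castSucc < j
      · rw [dif_pos hij, dif_pos hij, map_zsmul, hbr, Polynomial.sum_eq_of_subset _ (fun r => ?_)
          (Polynomial.support_map_subset _ _), Polynomial.sum, map_sum]
        · congr 1
          refine Finset.sum_congr rfl fun r _ => ?_
          rw [lamMap_lamMul_pow, lamMap_lamInsert, ← h, Polynomial.coeff_map]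
          congr 3
          funext q
          induction q using Fin.cases <;> rfl
        · obtain ⟨g, hg⟩ := hY'.multilinear
          rw [← hg, g.map_coord_zero 0 (by simp), map_zero, map_zero]
      · rw [dif_neg hij, dif_neg hij, map_zero]

end ChangeAlgebra

/-! ## Naturality of cochains -/

section Naturality

variable {k A B B' : Type u} [Field k] [CommRing A] [CommRing B] [CommRing B'] [Algebra k A] [Algebra k B]
  [Algebra k B'] [CharZero k] {ev : A →ₐ[k] PowerSeries B} {n : ℕ}
variable {δ : Derivation k B B} {δ' : Derivation k B' B'} (f : B →ₐ[k] B')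

theorem map_update_comp (f : B → B') (a : Fin n → B) (i : Fin n) (b : B) :
    (fun q => f (Function.update a i b q)) = Function.update (fun q => f (a q)) i (f b) :=
  funext fun q => Function.apply_update (fun _ => f) a i b q

/-- A polynomial-valued cochain on `B'`, restricted to `B`. -/
theorem IsPolyCochain.isSlotwise (hf : ∀ x, f (δ x) = δ' (f x))
    {F : (Fin n → B') → MvPolynomial (Fin n) B'} (hF : IsPolyCochain δ' F) :
    IsSlotwise δ (fun i => (shiftHom δ' i).comp f) (fun i : Fin n => -LinearMap.mulLeft k (MvPolynomial.X i : MvPolynomial (Fin n) B'))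
      (fun a : Fin n → B => F fun q => f (a q)) where
  add a i b c := by simp only [map_update_comp, map_add, hF.add]
  smul a i t b := by simp only [map_update_comp, map_smul, hF.smul]
  sesq a i := by
    rw [map_update_comp, hf, hF.sesq]
    rfl
  leibniz a i b c := by
    simp only [map_update_comp, map_mul, hF.leibniz, AlgHom.comp_apply, shiftHom_apply]

/-- The image in `B'` of a polynomial-valued cochain on `B`. -/
theorem IsPolyCochain.isSlotwise_map (hf : ∀ x, f (δ x) = δ' (f x))
    {F : (Fin n → B) → MvPolynomial (Fin n) B} (hF : IsPolyCochain δ F) :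
    IsSlotwise δ (fun i => (shiftHom δ' i).comp f) (fun i : Fin n => -LinearMap.mulLeft k (MvPolynomial.X i : MvPolynomial (Fin n) B'))
      (fun a : Fin n → B => MvPolynomial.mapAlgHom f (F a)) where
  add a i b c := by rw [hF.add, map_add]
  smul a i t b := by rw [hF.smul, map_smul]
  sesq a i := by
    rw [hF.sesq, map_neg, map_mul, MvPolynomial.mapAlgHom_apply, MvPolynomial.mapAlgHom_apply,
      MvPolynomial.map_X]
    rfl
  leibniz a i b c := by
    rw [hF.leibniz, map_add, shiftMulPoly_map f hf, shiftMulPoly_map f hf]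
    simp only [AlgHom.comp_apply, shiftHom_apply]

theorem IsPolyCochain.natural (hev : JetUniversal ev) (hδ : IsArcDerivation ev δ) (𝒳 : FormBasis k A)
    (hf : ∀ x, f (δ x) = δ' (f x)) {F : (Fin n → B) → MvPolynomial (Fin n) B}
    {F' : (Fin n → B') → MvPolynomial (Fin n) B'} (hF : IsPolyCochain δ F) (hF' : IsPolyCochain δ' F')
    (h : ∀ a : Fin n → A, F' (fun q => f (jet ev 0 (a q))) =
      MvPolynomial.mapAlgHom f (F fun q => jet ev 0 (a q))) (x : Fin n → B) :
    F' (fun q => f (x q)) = MvPolynomial.mapAlgHom f (F x) :=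
  congrFun (IsSlotwise.ext hev hδ 𝒳 (hF'.isSlotwise f hf) (hF.isSlotwise_map f hf) fun _ => h _) x

theorem PVA.IsCochain.isSlotwise {𝒱 : PVA k B} {Y : (Fin n → B) → LamQuot 𝒱.δ n} (hY : 𝒱.IsCochain Y) :
    IsSlotwise 𝒱.δ (shiftQuotHom 𝒱.δ) (fun i => -lamMul 𝒱.δ i) Y where
  add a i b c := by
    obtain ⟨g, rfl⟩ := hY.multilinear
    exact g.map_update_add a i b c
  smul a i t b := by
    obtain ⟨g, rfl⟩ := hY.multilinear
    exact g.map_update_smul a i t b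
  sesq a i := hY.sesq a i
  leibniz a i b c := hY.leibniz a i b c

theorem PVA.IsCochain.ext (hev : JetUniversal ev) {𝒱 : PVA k B} (hδ : IsArcDerivation ev 𝒱.δ)
    (𝒳 : FormBasis k A) {Y Y' : (Fin n → B) → LamQuot 𝒱.δ n} (hY : 𝒱.IsCochain Y) (hY' : 𝒱.IsCochain Y')
    (h : ∀ J : Fin n → Fin 𝒳.r, Y (fun q => jet ev 0 (𝒳.x (J q))) = Y' fun q => jet ev 0 (𝒳.x (J q))) :
    Y = Y' := IsSlotwise.ext hev hδ 𝒳 hY.isSlotwise hY'.isSlotwise h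

end Naturality

/-! ## Lifting cochains -/

section Alternation

variable {k B : Type*} [Field k] [CommRing B] [Algebra k B] {n r : ℕ}

/-- The average over the symmetric group of a family of polynomials indexed by tuples. -/
def altPoly (k : Type*) [Field k] [Algebra k B] (P : (Fin n → Fin r) → MvPolynomial (Fin n) B)
    (J : Fin n → Fin r) : MvPolynomial (Fin n) B :=
  ((n.factorial : k)⁻¹) • ∑ τ : Equiv.Perm (Fin n), (Equiv.Perm.sign τ : ℤ) •
    MvPolynomial.rename τ (P (J ∘ τ))

theorem average_sign [CharZero k] {N : Type*} [AddCommGroup N] [Module k N] {g : Equiv.Perm (Fin n) → N}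
    {v : N} (h : ∀ τ, g τ = (Equiv.Perm.sign τ : ℤ) • v) :
    ((n.factorial : k)⁻¹) • ∑ τ : Equiv.Perm (Fin n), (Equiv.Perm.sign τ : ℤ) • g τ = v := by
  have h1 : ∀ τ : Equiv.Perm (Fin n), (Equiv.Perm.sign τ : ℤ) • g τ = v := fun τ => by
    rw [h, smul_smul, ← Units.val_mul, Int.units_mul_self, Units.val_one, one_smul]
  simp only [h1, Finset.sum_const, Finset.card_univ, Fintype.card_perm, Fintype.card_fin]
  rw [← Nat.cast_smul_eq_nsmul k, smul_smul, inv_mul_cancel₀ (by exact_mod_cast n.factorial_ne_zero),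
    one_smul]

theorem totalOp_rename (δ : Derivation k B B) (τ : Equiv.Perm (Fin n)) (p : MvPolynomial (Fin n) B) :
    totalOp δ n (MvPolynomial.rename τ p) = MvPolynomial.rename τ (totalOp δ n p) := by
  induction p using MvPolynomial.induction_on' with
  | add p q hp hq => simp only [map_add, hp, hq]
  | monomial m b =>
    simp only [totalOp, LinearMap.add_apply, LinearMap.mulLeft_apply, coefMap_monomial, map_add, map_mul,
      map_sum, MvPolynomial.rename_X, MvPolynomial.rename_monomial]
    rw [Equiv.sum_comp τ (fun i => (MvPolynomial.X i : MvPolynomial (Fin n) B))]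

theorem totalOp_altPoly [CharZero k] (δ : Derivation k B B) (P G : (Fin n → Fin r) → MvPolynomial (Fin n) B)
    (hP : ∀ J, totalOp δ n (P J) = G J) (J : Fin n → Fin r)
    (hG : ∀ τ : Equiv.Perm (Fin n), MvPolynomial.rename τ (G (J ∘ τ)) = (Equiv.Perm.sign τ : ℤ) • G J) :
    totalOp δ n (altPoly k P J) = G J := by
  rw [altPoly, map_smul, map_sum]
  simp only [map_zsmul, totalOp_rename, hP]
  exact average_sign hG

theorem mk_altPoly [CharZero k] (δ : Derivation k B B) (P : (Fin n → Fin r) → MvPolynomial (Fin n) B)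
    (Y : (Fin n → Fin r) → LamQuot δ n) (hP : ∀ J, Submodule.Quotient.mk (P J) = Y J) (J : Fin n → Fin r)
    (hY : ∀ τ : Equiv.Perm (Fin n), lamPerm δ τ (Y (J ∘ τ)) = (Equiv.Perm.sign τ : ℤ) • Y J) :
    Submodule.Quotient.mk (altPoly k P J) = Y J := by
  rw [altPoly, ← Submodule.mkQ_apply, map_smul, map_sum]
  simp only [map_zsmul]
  refine average_sign fun τ => ?_
  rw [← hY, ← hP]
  rfl

theorem dcoeff_altPoly (P : (Fin n → Fin r) → MvPolynomial (Fin n) B) (J : Fin n → Fin r)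
    (m : Fin n →₀ ℕ) : dcoeff m (altPoly k P J) = ((n.factorial : k)⁻¹) •
      ∑ τ : Equiv.Perm (Fin n), (Equiv.Perm.sign τ : ℤ) • dcoeff (expo fun q => m (τ q)) (P (J ∘ τ)) := by
  rw [altPoly, dcoeff_smul, map_sum]
  congr 1
  refine Finset.sum_congr rfl fun τ _ => ?_
  have e : Finsupp.equivMapDomain τ.symm m = expo fun q => m (τ q) := by
    ext q
    simp
  rw [map_zsmul, dcoeff_rename, e]

end Alternation

section Lift

variable {k A B : Type u} [Field k] [CommRing A] [CommRing B] [Algebra k A] [Algebra k B]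
variable {ev : A →ₐ[k] PowerSeries B} {n r : ℕ}

/-- The pairing of `∫ Ω¹` with a derivation of `B`, `f da ↦ f · D(ev a)`. -/
def derContract (ev : A →ₐ[k] PowerSeries B) (D : Derivation k B B) : LoopForms ev →ₗ[A] ArcRing ev :=
  LinearMap.mul' A (ArcRing ev) ∘ₗ LinearMap.lTensor (ArcRing ev) (Derivation.liftKaehlerDifferential
    (Derivation.mk' (hat ev D.toLinearMap ∘ₗ (Algebra.linearMap A (ArcRing ev)).restrictScalars k) fun a b => by
      change hat ev D.toLinearMap (algebraMap A _ (a * b)) = a • hat ev D.toLinearMap (algebraMap A _ b) +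
        b • hat ev D.toLinearMap (algebraMap A _ a)
      rw [map_mul, hat_mul, Algebra.smul_def, Algebra.smul_def]))

theorem derContract_formGen (D : Derivation k B B) (f : ArcRing ev) (a : A) :
    derContract ev D (formGen ev f a) = f * hat ev D.toLinearMap (algebraMap A _ a) := by
  simp [derContract, formGen]

theorem derContract_smul (D : Derivation k B B) (g : ArcRing ev) (v : LoopForms ev) :
    derContract ev D (g • v) = g * derContract ev D v := by
  induction v using forms_induction with
  | h f a => rw [smul_formGen, derContract_formGen, derContract_formGen, mul_assoc]
  | hadd v w hv hw => rw [smul_add, map_add, map_add, hv, hw, mul_add]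

/-- The coefficient of `z^i` in `derContract`. -/
def derForm (ev : A →ₐ[k] PowerSeries B) (D : Derivation k B B) (i : ℕ) : LoopForms ev →ₗ[B] B where
  toFun v := ArcRing.coeff ev i (derContract ev D v)
  map_add' v w := by simp only [map_add]
  map_smul' b v := by
    rw [← ArcRing.algebraMap_smul_forms, derContract_smul, ← Algebra.smul_def, map_smul]
    rfl

theorem derForm_apply (D : Derivation k B B) (i : ℕ) (v : LoopForms ev) :
    derForm ev D i v = ArcRing.coeff ev i (derContract ev D v) := rfl

theorem derForm_formGen (D : Derivation k B B) (i m : ℕ) (a : A) :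
    derForm ev D i (formGen ev (ArcRing.z ev ^ m) a) = if m ≤ i then D (jet ev (i - m) a) else 0 := by
  rw [derForm_apply, derContract_formGen, ArcRing.coeff_z_pow_mul, coeff_hat]
  rfl

theorem derForm_of_mem (D : Derivation k B B) {i N : ℕ} (h : i < N) {v : LoopForms ev}
    (hv : v ∈ loopFilt ev N) : derForm ev D i v = 0 := by
  obtain ⟨w, rfl⟩ := hv
  simp only
  rw [derForm_apply, derContract_smul, ArcRing.coeff_z_pow_mul, if_neg (by omega)]

variable (D : Fin r → Derivation k B B) (P : (Fin n → Fin r) → MvPolynomial (Fin n) B)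

/-- The multilinear form `∑_J ∑_m m! p_{J,m} ∏ (D_{J_q})_{m_q}`. -/
def liftMulti (ev : A →ₐ[k] PowerSeries B) (D : Fin r → Derivation k B B)
    (P : (Fin n → Fin r) → MvPolynomial (Fin n) B) :
    MultilinearMap B (fun _ : Fin n => LoopForms ev) B :=
  ∑ J, ∑ m ∈ (P J).support, dcoeff m (P J) •
    (MultilinearMap.mkPiAlgebra B (Fin n) B).compLinearMap fun q => derForm ev (D (J q)) (m q)

theorem liftMulti_apply (v : Fin n → LoopForms ev) : liftMulti ev D P v =
    ∑ J, ∑ m ∈ (P J).support, dcoeff m (P J) * ∏ q, derForm ev (D (J q)) (m q) (v q) := by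
  simp [liftMulti]

/-- The alternating cochain with given values on coordinates. -/
def liftCochain (ev : A →ₐ[k] PowerSeries B) (D : Fin r → Derivation k B B)
    (P : (Fin n → Fin r) → MvPolynomial (Fin n) B) (v : Fin n → LoopForms ev) : B :=
  ((n.factorial : k)⁻¹) • ∑ τ : Equiv.Perm (Fin n), (Equiv.Perm.sign τ : ℤ) •
    liftMulti ev D P (v ∘ τ)

theorem liftCochain_isLoopCochain : IsLoopCochain (liftCochain ev D P) where
  alternating := by
    refine ⟨algebraMap k B (n.factorial : k)⁻¹ • MultilinearMap.alternatization (liftMulti ev D P), ?_⟩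
    funext v
    rw [liftCochain, Algebra.smul_def, AlternatingMap.smul_apply, smul_eq_mul,
      MultilinearMap.alternatization_apply]
    rfl
  continuous := by
    refine ⟨(Finset.univ.sup fun J => (P J).support.sup fun m => m.degree) + 1, fun v ⟨i, hi⟩ => ?_⟩
    have h : ∀ τ : Equiv.Perm (Fin n), liftMulti ev D P (v ∘ τ) = 0 := by
      intro τ
      rw [liftMulti_apply]
      refine Finset.sum_eq_zero fun J _ => Finset.sum_eq_zero fun m hm => ?_
      rw [Finset.prod_eq_zero (Finset.mem_univ (τ.symm i)), mul_zero]
      refine derForm_of_mem _ (Nat.lt_succ_of_le ?_) (by simpa using hi)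
      exact ((Finsupp.le_degree _ m).trans (Finset.le_sup (f := fun m : Fin n →₀ ℕ => m.degree) hm)).trans
        (Finset.le_sup (f := fun J => (P J).support.sup fun m => m.degree) (Finset.mem_univ J))
    rw [liftCochain, Finset.sum_eq_zero fun τ _ => by rw [h, smul_zero], smul_zero]

variable (𝒳 : FormBasis k A)

/-- The `x_j` form a system of coordinates. -/
def FormBasis.IsCoord : Prop := ∀ i j, 𝒳.η j (𝒳.x i) = if i = j then 1 else 0

theorem JetUniversal.exists_jetDerivation (hev : JetUniversal ev) (η : Derivation k A A) :
    ∃ D : Derivation k B B, ∀ a i, D (jet ev i a) = jet ev i (η a) := by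
  obtain ⟨D, hD, hD'⟩ := hev.der_exist (Algebra.lmul k B)
    (LinearMap.pi fun i =>
      { toFun := fun a => jet ev i (η a)
        map_add' := fun a b => by simp only [jet, map_add]
        map_smul' := fun c a => by
          rw [jet, η.map_smul, map_smul]
          rfl })
    (fun a b i => by
      change jet ev i (η (a * b)) = ∑ p ∈ Finset.HasAntidiagonal.antidiagonal i,
        (jet ev p.1 a * jet ev p.2 (η b) + jet ev p.1 b * jet ev p.2 (η a))
      rw [Derivation.leibniz, smul_eq_mul, smul_eq_mul, Finset.sum_add_distrib]
      simp only [jet, map_add, map_mul, PowerSeries.coeff_mul])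
  exact ⟨Derivation.mk' D fun x y => hD x y, hD'⟩

theorem liftMulti_coord (h𝒳 : 𝒳.IsCoord) {D : Fin 𝒳.r → Derivation k B B}
    (hD : ∀ j a i, D j (jet ev i a) = jet ev i (𝒳.η j a))
    (P : (Fin n → Fin 𝒳.r) → MvPolynomial (Fin n) B) (J : Fin n → Fin 𝒳.r) (m : Fin n →₀ ℕ) :
    liftMulti ev D P (fun q => formGen ev (ArcRing.z ev ^ m q) (𝒳.x (J q))) = dcoeff m (P J) := by
  have h : ∀ i j l s, derForm ev (D j) l (formGen ev (ArcRing.z ev ^ s) (𝒳.x i)) =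
      if i = j ∧ s = l then 1 else 0 := by
    intro i j l s
    have h1 : ∀ t, jet ev t (1 : A) = if t = 0 then 1 else 0 := fun t => by
      rw [jet, map_one, PowerSeries.coeff_one]
    rw [derForm_formGen, hD, h𝒳]
    by_cases hij : i = j
    · simp only [hij, if_true, true_and, h1]
      split_ifs <;> first | rfl | omega
    · simp [hij, jet]
  rw [liftMulti_apply, Finset.sum_eq_single J]
  · have e : ∀ m' : Fin n →₀ ℕ, m' ≠ m → ∏ q, derForm ev (D (J q)) (m' q)
        (formGen ev (ArcRing.z ev ^ m q) (𝒳.x (J q))) = 0 := by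
      intro m' hm
      obtain ⟨q, hq⟩ := Finsupp.ne_iff.mp hm
      exact Finset.prod_eq_zero (Finset.mem_univ q) (by rw [h, if_neg fun e => hq e.2.symm])
    rw [Finset.sum_eq_single m]
    · rw [Finset.prod_eq_one fun q _ => by rw [h, if_pos ⟨rfl, rfl⟩], mul_one]
    · exact fun m' _ hm => by rw [e m' hm, mul_zero]
    · intro hm
      rw [dcoeff_apply, MvPolynomial.notMem_support_iff.mp hm, smul_zero, zero_mul]
  · intro J' _ hJ
    obtain ⟨q, hq⟩ := Function.ne_iff.mp hJ
    refine Finset.sum_eq_zero fun m' _ => ?_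
    rw [Finset.prod_eq_zero (Finset.mem_univ q) (by rw [h, if_neg fun e => hq e.1.symm]), mul_zero]
  · exact fun hJ => absurd (Finset.mem_univ J) hJ

theorem liftCochain_coord (h𝒳 : 𝒳.IsCoord) {D : Fin 𝒳.r → Derivation k B B}
    (hD : ∀ j a i, D j (jet ev i a) = jet ev i (𝒳.η j a))
    (P : (Fin n → Fin 𝒳.r) → MvPolynomial (Fin n) B) (J : Fin n → Fin 𝒳.r) (m : Fin n →₀ ℕ) :
    liftCochain ev D P (fun q => formGen ev (ArcRing.z ev ^ m q) (𝒳.x (J q))) =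
      dcoeff m (altPoly k P J) := by
  rw [dcoeff_altPoly, liftCochain]
  congr 1
  refine Finset.sum_congr rfl fun τ _ => ?_
  rw [← liftMulti_coord 𝒳 h𝒳 hD]
  rfl

theorem JetUniversal.expPoly_liftCochain [CharZero k] (hev : JetUniversal ev) {δ : Derivation k B B}
    (hδ : IsArcDerivation ev δ) (h𝒳 : 𝒳.IsCoord) {D : Fin 𝒳.r → Derivation k B B}
    (hD : ∀ j a i, D j (jet ev i a) = jet ev i (𝒳.η j a))
    (P : (Fin n → Fin 𝒳.r) → MvPolynomial (Fin n) B) (J : Fin n → Fin 𝒳.r) :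
    hev.expPoly hδ 𝒳 (liftCochain ev D P) (fun q => jet ev 0 (𝒳.x (J q))) = altPoly k P J :=
  dcoeff_ext k fun m => by
    rw [dcoeff_expPoly hev hδ 𝒳 (liftCochain_isLoopCochain D P), ← liftCochain_coord 𝒳 h𝒳 hD]
    congr 1
    exact funext fun q => hev.expForm_jet hδ 𝒳 _ _

/-- The lifted cochains are compatible with restriction. -/
theorem liftCochain_map {A' B' : Type u} [CommRing A'] [CommRing B'] [Algebra k A'] [Algebra k B']
    {ev' : A' →ₐ[k] PowerSeries B'} (g : A → A') (f : B →ₐ[k] B')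
    (hgf : ∀ a i, jet ev' i (g a) = f (jet ev i a)) (D' : Fin r → Derivation k B' B')
    (hD : ∀ j x, D' j (f x) = f (D j x)) (m : Fin n → ℕ) (a : Fin n → A) :
    liftCochain ev' D' (fun J => MvPolynomial.mapAlgHom f (P J))
      (fun q => formGen ev' (ArcRing.z ev' ^ m q) (g (a q))) =
      f (liftCochain ev D P fun q => formGen ev (ArcRing.z ev ^ m q) (a q)) := by
  rw [liftCochain, liftCochain, map_smul, map_sum]
  congr 1
  refine Finset.sum_congr rfl fun τ _ => ?_
  rw [map_zsmul, liftMulti_apply, liftMulti_apply, map_sum]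
  congr 1
  refine Finset.sum_congr rfl fun J _ => ?_
  have hs : (MvPolynomial.mapAlgHom f (P J)).support ⊆ (P J).support :=
    MvPolynomial.support_map_subset (f : B →+* B') (P J)
  rw [map_sum, Finset.sum_subset hs fun l _ hl => by
    rw [dcoeff_apply, MvPolynomial.notMem_support_iff.mp hl, smul_zero, zero_mul]]
  refine Finset.sum_congr rfl fun l _ => ?_
  rw [map_mul, map_prod, dcoeff_mapAlgHom]
  congr 1
  refine Finset.prod_congr rfl fun q _ => ?_
  simp only [Function.comp_apply]
  rw [derForm_formGen, derForm_formGen, hgf, hD, apply_ite f, map_zero]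

end Lift

/-! ## Affine opens and points with values in algebras -/

section Points

variable {k : Type u} [Field k]

instance {X : SchOver k} (V : X.left.affineOpens) : IsOpenImmersion (affineIncl X V).left :=
  IsAffineOpen.isOpenImmersion_fromSpec V.2

theorem specOverMap_injective {R S : Type u} [CommRing R] [Algebra k R] [CommRing S] [Algebra k S]
    {f g : R →ₐ[k] S} (h : specOverMap f = specOverMap g) : f = g := by
  have h1 : Spec.map (CommRingCat.ofHom (f : R →+* S)) = Spec.map (CommRingCat.ofHom (g : R →+* S)) :=
    congrArg CommaMorphism.left h
  have h2 : (f : R →+* S) = g := by simpa using congrArg CommRingCat.Hom.hom (Spec.map_injective h1)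
  exact AlgHom.ext fun x => RingHom.congr_fun h2 x

theorem specOverMap_comp {R S T : Type u} [CommRing R] [Algebra k R] [CommRing S] [Algebra k S]
    [CommRing T] [Algebra k T] (f : R →ₐ[k] S) (g : S →ₐ[k] T) :
    specOverMap (g.comp f) = specOverMap g ≫ specOverMap f := by
  apply Over.OverMorphism.ext
  change Spec.map _ = Spec.map _ ≫ Spec.map _
  rw [← Spec.map_comp]
  rfl

theorem affineIncl_injective {X : SchOver k} (V : X.left.affineOpens) {Y : SchOver k}
    {f g : Y ⟶ specOver k (Sec X V)} (h : f ≫ affineIncl X V = g ≫ affineIncl X V) : f = g := by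
  apply Over.OverMorphism.ext
  have h1 : f.left ≫ (affineIncl X V).left = g.left ≫ (affineIncl X V).left :=
    congrArg CommaMorphism.left h
  exact (cancel_mono _).mp h1

theorem affineIncl_hom_injective {X : SchOver k} (V : X.left.affineOpens) {R : Type u} [CommRing R]
    [Algebra k R] {f g : Sec X V →ₐ[k] R}
    (h : specOverMap f ≫ affineIncl X V = specOverMap g ≫ affineIncl X V) : f = g :=
  specOverMap_injective (affineIncl_injective V h)

theorem range_affineIncl (X : SchOver k) (V : X.left.affineOpens) :
    Set.range (affineIncl X V).left = V.1 := V.2.range_fromSpec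

/-- A point with values in an algebra that lies in an affine open is given by a homomorphism. -/
theorem exists_eq_specOverMap {X : SchOver k} (V : X.left.affineOpens) {R : Type u} [CommRing R]
    [Algebra k R] (g : specOver k R ⟶ X) (hg : Set.range g.left ⊆ (V.1 : Set X.left)) :
    ∃ f : Sec X V →ₐ[k] R, specOverMap f ≫ affineIncl X V = g := by
  have hg' : Set.range g.left ⊆ Set.range (affineIncl X V).left := by rwa [range_affineIncl]
  have hi : IsOpenImmersion (affineIncl X V).left := inferInstance
  have hfac := @IsOpenImmersion.lift_fac _ _ _ (affineIncl X V).left g.left hi hg'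
  generalize @IsOpenImmersion.lift _ _ _ (affineIncl X V).left g.left hi hg' = l at hfac
  have hw : l ≫ (specOver k (Sec X V)).hom = (specOver k R).hom := by
    have h1 := Over.w (affineIncl X V)
    have h2 := Over.w g
    rw [← h2, ← h1, ← hfac]
    exact (Category.assoc _ _ _).symm
  obtain ⟨φ, hφ⟩ : ∃ φ : CommRingCat.of (Sec X V) ⟶ CommRingCat.of R, Spec.map φ = l :=
    ⟨Spec.preimage l, Spec.map_preimage l⟩
  subst hφ
  have h1 : CommRingCat.ofHom (algebraMap k (Sec X V)) ≫ φ = CommRingCat.ofHom (algebraMap k R) := by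
    apply Spec.map_injective
    rw [Spec.map_comp]
    exact hw
  refine ⟨{ toRingHom := φ.hom,
            commutes' := fun c => RingHom.congr_fun (congrArg CommRingCat.Hom.hom h1) c }, ?_⟩
  apply Over.OverMorphism.ext
  exact hfac

theorem specOverMap_secRes (X : SchOver k) {V' V : X.left.affineOpens} (h : V'.1 ≤ V.1) :
    specOverMap (secRes X h) ≫ affineIncl X V = affineIncl X V' := by
  apply Over.OverMorphism.ext
  exact V.2.map_fromSpec V'.2 (homOfLE h).op

theorem secRes_comp (X : SchOver k) {V'' V' V : X.left.affineOpens} (h : V'.1 ≤ V.1) (h' : V''.1 ≤ V'.1)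
    (x : Sec X V) : secRes X h' (secRes X h x) = secRes X (h'.trans h) x := by
  have h1 := X.left.presheaf.map_comp (homOfLE h).op (homOfLE h').op
  exact (RingHom.congr_fun (congrArg CommRingCat.Hom.hom h1) x).symm

theorem secRes_self (X : SchOver k) {V : X.left.affineOpens} (h : V.1 ≤ V.1) (x : Sec X V) :
    secRes X h x = x := by
  change (X.left.presheaf.map (𝟙 (op V.1))).hom x = x
  rw [CategoryTheory.Functor.map_id]
  rfl

end Points

/-! ## Charts of the arc space -/

section Charts

variable {k : Type u} [Field k] {M : SchOver k} {L : ArcSpace M}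

theorem Chart.rep_specOverMap (c : Chart L) {R : Type u} [CommRing R] [Algebra k R]
    (f : Sec L.X c.V →ₐ[k] R) : L.rep R (specOverMap f ≫ affineIncl L.X c.V) =
      specOverMap ((PowerSeries.mapAlgHom f).comp c.ev) ≫ affineIncl M c.U := by
  rw [L.natural, ← c.fac, specOverMap_comp, Category.assoc]

theorem mapAlgHom_comp_eq_iff {A B R : Type*} [CommRing A] [CommRing B] [CommRing R] [Algebra k A]
    [Algebra k B] [Algebra k R] {ev : A →ₐ[k] PowerSeries B} {f : B →ₐ[k] R} {h : A →ₐ[k] PowerSeries R} :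
    (PowerSeries.mapAlgHom f).comp ev = h ↔ ∀ a i, f (jet ev i a) = PowerSeries.coeff i (h a) := by
  constructor
  · rintro rfl a i
    exact (PowerSeries.coeff_map (f : B →+* R) i (ev a)).symm
  · intro H
    refine AlgHom.ext fun a => PowerSeries.ext fun i => ?_
    rw [← H]
    exact PowerSeries.coeff_map (f : B →+* R) i (ev a)

theorem Chart.jetUniversal (c : Chart L) : JetUniversal c.ev where
  uniq R _ _ f g h := by
    apply affineIncl_hom_injective c.V
    apply (L.rep R).injective
    rw [c.rep_specOverMap, c.rep_specOverMap]
    congr 2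
    rw [mapAlgHom_comp_eq_iff]
    intro a i
    rw [h]
    exact (PowerSeries.coeff_map (g : _ →+* R) i (c.ev a)).symm
  exist R _ _ π hπ hnil h hh := by
    have hh' : (PowerSeries.mapAlgHom π).comp h = c.ev := by
      refine AlgHom.ext fun a => PowerSeries.ext fun i => ?_
      exact (PowerSeries.coeff_map (π : R →+* Sec L.X c.V) i (h a)).trans (hh a i)
    set g := (L.rep R).symm (specOverMap h ≫ affineIncl M c.U) with hg
    have hgπ : specOverMap π ≫ g = affineIncl L.X c.V := by
      apply (L.rep _).injective
      rw [L.natural, hg, Equiv.apply_symm_apply, ← c.fac, ← hh', specOverMap_comp, Category.assoc]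
    have hsurj : Function.Surjective (PrimeSpectrum.comap (π : R →+* Sec L.X c.V)) :=
      (PrimeSpectrum.isHomeomorph_comap (π : R →+* Sec L.X c.V)
        (fun x => ⟨1, one_pos, by obtain ⟨y, hy⟩ := hπ x; exact ⟨y, by simpa using hy⟩⟩)
        (fun x hx => hnil x hx)).surjective
    have hrange : Set.range g.left ⊆ (c.V.1 : Set L.X.left) := by
      rintro _ ⟨x, rfl⟩
      obtain ⟨y, rfl⟩ := hsurj x
      rw [← range_affineIncl, ← hgπ]
      exact ⟨y, rfl⟩
    obtain ⟨f, hf⟩ := exists_eq_specOverMap c.V g hrange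
    refine ⟨f, fun b => ?_, ?_⟩
    · have h1 : π.comp f = AlgHom.id k _ := by
        apply affineIncl_hom_injective c.V
        rw [specOverMap_comp, Category.assoc, hf, hgπ]
        have : specOverMap (AlgHom.id k (Sec L.X c.V)) = 𝟙 _ := by
          apply Over.OverMorphism.ext
          exact Spec.map_id _
        rw [this, Category.id_comp]
      exact AlgHom.congr_fun h1 b
    · rw [← mapAlgHom_comp_eq_iff]
      apply affineIncl_hom_injective c.U
      rw [← c.rep_specOverMap, hf, hg, Equiv.apply_symm_apply]

/-- The evaluation homomorphisms are compatible with restriction. -/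
theorem Chart.jet_res (c c' : Chart L) (hU : c'.U.1 ≤ c.U.1) (hV : c'.V.1 ≤ c.V.1) (a : Sec M c.U) (i : ℕ) :
    jet c'.ev i (secRes M hU a) = secRes L.X hV (jet c.ev i a) := by
  have h : (PowerSeries.mapAlgHom (secRes L.X hV)).comp c.ev = c'.ev.comp (secRes M hU) := by
    apply affineIncl_hom_injective c.U
    rw [← c.rep_specOverMap, specOverMap_secRes, ← c'.fac, specOverMap_comp, Category.assoc,
      specOverMap_secRes]
  exact ((mapAlgHom_comp_eq_iff.mp h) a i).symm

/-- The chart with a smaller open of the arc space. -/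
def Chart.shrink (c : Chart L) (V : L.X.left.affineOpens) (h : V.1 ≤ c.V.1) : Chart L where
  U := c.U
  V := V
  ev := (PowerSeries.mapAlgHom (secRes L.X h)).comp c.ev
  fac := by rw [← c.rep_specOverMap, specOverMap_secRes]

/-- The evaluation at `z = 0` of an affine open of the arc space. -/
def baseMap (L : ArcSpace M) (V : L.X.left.affineOpens) : specOver k (Sec L.X V) ⟶ M :=
  specOverMap (jetHom (AlgHom.id k (PowerSeries (Sec L.X V)))) ≫ L.rep _ (affineIncl L.X V)

/-- The base point of an arc. -/
def arcCenter (L : ArcSpace M) (V : L.X.left.affineOpens) (x : V.1) : M.left :=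
  (baseMap L V).left (V.2.primeIdealOf x)

theorem arcCenter_mem (c : Chart L) (x : c.V.1) : arcCenter L c.V x ∈ c.U.1 := by
  rw [arcCenter, baseMap, ← c.fac, ← Category.assoc, Over.comp_left]
  have h := range_affineIncl M c.U
  have h1 := Set.mem_range_self (f := (affineIncl M c.U).left)
    ((specOverMap (jetHom (AlgHom.id k (PowerSeries (Sec L.X c.V)))) ≫ specOverMap c.ev).left
      (c.V.2.primeIdealOf x))
  rw [h] at h1
  exact h1

theorem baseMap_res {V V' : L.X.left.affineOpens} (h : V'.1 ≤ V.1) :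
    specOverMap (secRes L.X h) ≫ baseMap L V = baseMap L V' := by
  rw [baseMap, baseMap, ← specOverMap_secRes L.X h, L.natural, ← Category.assoc, ← Category.assoc,
    ← specOverMap_comp, ← specOverMap_comp]
  congr 2

theorem arcCenter_res {V V' : L.X.left.affineOpens} (h : V'.1 ≤ V.1) (x : V'.1) :
    arcCenter L V' x = arcCenter L V ⟨x.1, h x.2⟩ := by
  rw [arcCenter, arcCenter, ← baseMap_res h, Over.comp_left]
  have h1 : (specOverMap (k := k) (secRes L.X h)).left (V'.2.primeIdealOf x) =
      V.2.primeIdealOf ⟨x.1, h x.2⟩ := by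
    apply (affineIncl L.X V).left.isOpenEmbedding.injective
    have h2 : ((specOverMap (k := k) (secRes L.X h)) ≫ affineIncl L.X V).left (V'.2.primeIdealOf x) = x.1 := by
      rw [specOverMap_secRes]
      exact V'.2.fromSpec_primeIdealOf x
    exact h2.trans (V.2.fromSpec_primeIdealOf ⟨x.1, h x.2⟩).symm
  rw [← h1]
  rfl

/-- Around a point of the arc space there are small charts over a given neighbourhood of the base
point. -/
theorem exists_chart (V : L.X.left.affineOpens) (x : V.1) (U : M.left.affineOpens)
    (hU : arcCenter L V x ∈ U.1) (W : Opens L.X.left) (hW : x.1 ∈ W) :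
    ∃ c : Chart L, c.U = U ∧ x.1 ∈ c.V.1 ∧ c.V.1 ≤ V.1 ∧ c.V.1 ≤ W := by
  obtain ⟨s, hs, hxs⟩ := V.2.exists_basicOpen_le ⟨x.1, hW⟩ x.2
  set V₁ : L.X.left.affineOpens := ⟨_, V.2.basicOpen s⟩ with hV₁
  have hV₁V : V₁.1 ≤ V.1 := L.X.left.basicOpen_le s
  have hxV₁ : x.1 ∈ V₁.1 := hxs
  set γ := (L.rep _ (affineIncl L.X V₁)).left with hγ
  set p := V₁.2.primeIdealOf ⟨x.1, hxV₁⟩ with hp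
  set p₀ : PrimeSpectrum (PowerSeries (Sec L.X V₁)) :=
    PrimeSpectrum.comap ((jetHom (AlgHom.id k (PowerSeries (Sec L.X V₁)))) : PowerSeries (Sec L.X V₁) →+* Sec L.X V₁) p with hp₀
  have hp₀U : p₀ ∈ γ ⁻¹ᵁ U.1 := by
    rw [← arcCenter_res hV₁V ⟨x.1, hxV₁⟩] at hU
    exact hU
  obtain ⟨_, ⟨g, rfl⟩, hg, hgU⟩ := PrimeSpectrum.isTopologicalBasis_basic_opens.exists_subset_of_mem_open
    hp₀U (γ ⁻¹ᵁ U.1).2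
  set b : Sec L.X V₁ := PowerSeries.constantCoeff g with hb
  set V₂ : L.X.left.affineOpens := ⟨_, V₁.2.basicOpen b⟩ with hV₂
  have hV₂V₁ : V₂.1 ≤ V₁.1 := L.X.left.basicOpen_le b
  have hx₂ : x.1 ∈ V₂.1 := by
    have h1 : b ∉ p.asIdeal := hg
    have h2 : V₁.2.fromSpec p ∈ L.X.left.basicOpen b := by
      have h3 : V₁.2.fromSpec ⁻¹ᵁ L.X.left.basicOpen b = PrimeSpectrum.basicOpen b :=
        V₁.2.fromSpec_preimage_basicOpen b
      have h4 : p ∈ (PrimeSpectrum.basicOpen b : Set (PrimeSpectrum (Sec L.X V₁))) := h1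
      exact (SetLike.ext_iff.mp h3 p).mpr h4
    rwa [hp, V₁.2.fromSpec_primeIdealOf] at h2
  have hunit : IsUnit (PowerSeries.mapAlgHom (secRes L.X hV₂V₁) g) := by
    rw [PowerSeries.isUnit_iff_constantCoeff]
    have h1 : PowerSeries.constantCoeff (PowerSeries.mapAlgHom (secRes L.X hV₂V₁) g) =
      secRes L.X hV₂V₁ b := by
      have h2 := PowerSeries.coeff_map (secRes L.X hV₂V₁ : Sec L.X V₁ →+* Sec L.X V₂) 0 g
      rwa [PowerSeries.coeff_zero_eq_constantCoeff_apply, PowerSeries.coeff_zero_eq_constantCoeff_apply] at h2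
    rw [h1]
    exact RingedSpace.isUnit_res_basicOpen L.X.left.toRingedSpace b
  have hrange : Set.range (L.rep _ (affineIncl L.X V₂)).left ⊆ (U.1 : Set M.left) := by
    rintro _ ⟨y, rfl⟩
    rw [← specOverMap_secRes L.X hV₂V₁, L.natural]
    refine hgU (a := (specOverMap (k := k) (PowerSeries.mapAlgHom (secRes L.X hV₂V₁))).left y) ?_
    intro h
    exact y.2.ne_top (Ideal.eq_top_of_isUnit_mem _ h hunit)
  obtain ⟨ev, hev⟩ := exists_eq_specOverMap U _ hrange
  exact ⟨⟨U, V₂, ev, hev⟩, rfl, hx₂, hV₂V₁.trans hV₁V, hV₂V₁.trans hs⟩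

end Charts

/-! ## Forms on smooth affine schemes -/

section SmoothForms

variable {k : Type u} [Field k]

theorem FormBasis.nonempty (A : Type u) [CommRing A] [Algebra k A] [Module.Finite A Ω[A⁄k]]
    [Module.Projective A Ω[A⁄k]] : Nonempty (FormBasis k A) := by
  have hfg : (Submodule.span A (Set.range (KaehlerDifferential.D k A))).FG := by
    rw [KaehlerDifferential.span_range_derivation]
    exact Module.Finite.fg_top
  obtain ⟨s, hs, hspan⟩ := (Submodule.fg_span_iff_fg_span_finset_subset _).mp hfg
  rw [KaehlerDifferential.span_range_derivation] at hspan
  have h1 : ∀ j, ∃ a, KaehlerDifferential.D k A a = (s.equivFin.symm j : Ω[A⁄k]) :=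
    fun j => hs (s.equivFin.symm j).2
  choose x hx using h1
  have hsurj : Function.Surjective (Fintype.linearCombination A fun j => KaehlerDifferential.D k A (x j)) := by
    rw [← LinearMap.range_eq_top, Fintype.range_linearCombination, eq_top_iff, hspan]
    refine Submodule.span_mono fun v hv => ⟨s.equivFin ⟨v, hv⟩, ?_⟩
    change KaehlerDifferential.D k A (x _) = v
    rw [hx, Equiv.symm_apply_apply]
  obtain ⟨σ, hσ⟩ := Module.projective_lifting_property
    (Fintype.linearCombination A fun j => KaehlerDifferential.D k A (x j)) LinearMap.id hsurj
  refine ⟨⟨_, x, fun j => (LinearMap.proj j ∘ₗ σ).compDer (KaehlerDifferential.D k A), fun a => ?_⟩⟩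
  exact (LinearMap.congr_fun hσ (KaehlerDifferential.D k A a)).symm

theorem FormBasis.exists_isCoord (A : Type u) [CommRing A] [Algebra k A] [Module.Finite A Ω[A⁄k]]
    {I : Type*} (b : Module.Basis I A Ω[A⁄k]) (hb : Set.range b ⊆ Set.range (KaehlerDifferential.D k A)) :
    ∃ 𝒳 : FormBasis k A, 𝒳.IsCoord := by
  rcases subsingleton_or_nontrivial A with hA | hA
  · have : Subsingleton Ω[A⁄k] := Module.subsingleton A _
    exact ⟨⟨0, Fin.elim0, Fin.elim0, fun a => Subsingleton.elim _ _⟩, fun i => i.elim0⟩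
  have : Finite I := Module.Finite.finite_basis b
  have h1 : ∀ j, ∃ a, KaehlerDifferential.D k A a = b ((Finite.equivFin I).symm j) := fun j => hb ⟨_, rfl⟩
  choose x hx using h1
  refine ⟨⟨_, x, fun j => (b.coord ((Finite.equivFin I).symm j)).compDer (KaehlerDifferential.D k A),
    fun a => ?_⟩, fun i j => ?_⟩
  · have := Fintype.ofFinite I
    rw [← b.sum_repr (KaehlerDifferential.D k A a), ← (Finite.equivFin I).symm.sum_comp]
    simp only [hx]
    simp
  · classical
    change b.coord _ (KaehlerDifferential.D k A (x i)) = _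
    rw [hx, Module.Basis.coord_apply, Module.Basis.repr_self, Finsupp.single_apply]
    simp

variable {M : SchOver k}

theorem smooth_sec [Smooth M.hom] (U : M.left.affineOpens) : Algebra.Smooth k (Sec M U) := by
  have h1 : Smooth ((affineIncl M U).left ≫ M.hom) := inferInstance
  have h2 : (affineIncl M U).left ≫ M.hom = Spec.map (CommRingCat.ofHom (algebraMap k (Sec M U))) :=
    Over.w (affineIncl M U)
  rw [h2] at h1
  exact RingHom.smooth_algebraMap.mp ((HasRingHomProperty.Spec_iff (P := @Smooth)
    (φ := CommRingCat.ofHom (algebraMap k (Sec M U)))).mp h1)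

theorem exists_formBasis [Smooth M.hom] (U : M.left.affineOpens) : Nonempty (FormBasis k (Sec M U)) := by
  have := smooth_sec U
  exact FormBasis.nonempty _

theorem exists_coord [Smooth M.hom] (x : M.left) :
    ∃ U : M.left.affineOpens, x ∈ U.1 ∧ ∃ 𝒳 : FormBasis k (Sec M U), 𝒳.IsCoord := by
  obtain ⟨U₀, hx⟩ : ∃ U₀ : M.left.affineOpens, x ∈ U₀.1 := by
    obtain ⟨_, ⟨U, hU, rfl⟩, hxU, -⟩ :=
      M.left.isBasis_affineOpens.exists_subset_of_mem_open (Set.mem_univ x) isOpen_univ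
    exact ⟨⟨U, hU⟩, hxU⟩
  have hsm := smooth_sec U₀
  obtain ⟨𝔭, h𝔭⟩ : ∃ 𝔭 : PrimeSpectrum (Sec M U₀), 𝔭 = U₀.2.primeIdealOf ⟨x, hx⟩ := ⟨_, rfl⟩
  obtain ⟨f, hf, hst⟩ := Algebra.IsSmoothAt.exists_notMem_isStandardSmooth k 𝔭.asIdeal
  obtain ⟨U₁, hU₁⟩ : ∃ U₁ : M.left.affineOpens, U₁.1 = M.left.basicOpen f := ⟨⟨_, U₀.2.basicOpen f⟩, rfl⟩
  have hle : U₁.1 ≤ U₀.1 := hU₁.le.trans (M.left.basicOpen_le f)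
  letI : Algebra (Sec M U₀) (Sec M U₁) := (secRes M hle).toRingHom.toAlgebra
  have : IsScalarTower k (Sec M U₀) (Sec M U₁) := IsScalarTower.of_algebraMap_eq fun c =>
    ((secRes M hle).commutes c).symm
  have hloc : IsLocalization.Away f (Sec M U₁) := by
    obtain ⟨U₁, hU₁'⟩ := U₁
    subst hU₁
    exact U₀.2.isLocalization_basicOpen f
  have e : Localization.Away f ≃ₐ[k] Sec M U₁ :=
    (IsLocalization.algEquiv (Submonoid.powers f) (Localization.Away f) (Sec M U₁)).restrictScalars k
  have hst₁ : Algebra.IsStandardSmooth k (Sec M U₁) := Algebra.IsStandardSmooth.of_algEquiv e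
  obtain ⟨-, I, b, hb⟩ := Algebra.IsStandardSmooth.iff_exists_basis_kaehlerDifferential.mp hst₁
  refine ⟨U₁, ?_, FormBasis.exists_isCoord _ b hb⟩
  have h4 : U₀.2.primeIdealOf ⟨x, hx⟩ ∈ U₀.2.fromSpec ⁻¹ᵁ M.left.basicOpen f :=
    (SetLike.ext_iff.mp (U₀.2.fromSpec_preimage_basicOpen f) _).mpr (h𝔭 ▸ hf)
  have h5 : U₀.2.fromSpec (U₀.2.primeIdealOf ⟨x, hx⟩) ∈ M.left.basicOpen f := h4
  rwa [U₀.2.fromSpec_primeIdealOf, ← hU₁] at h5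

end SmoothForms

/-! ## Gluing functions -/

section Gluing

variable {k : Type u} [Field k] {X : SchOver k}

theorem sec_ext {V : X.left.affineOpens} {s t : Sec X V}
    (h : ∀ x ∈ V.1, ∃ (V' : X.left.affineOpens) (h : V'.1 ≤ V.1), x ∈ V'.1 ∧ secRes X h s = secRes X h t) :
    s = t := by
  choose V' hV' hx hs using h
  exact X.left.sheaf.eq_of_locally_eq' (fun x : V.1 => (V' x.1 x.2).1) V.1
    (fun x => homOfLE (hV' x.1 x.2)) (fun x hxV => Opens.mem_iSup.mpr ⟨⟨x, hxV⟩, hx x hxV⟩) s t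
    (fun x => hs x.1 x.2)

/-- A set of affine opens that is a basis of the topology. -/
def IsAffineBasis (𝒰 : Set X.left.affineOpens) : Prop :=
  ∀ (x : X.left) (W : Opens X.left), x ∈ W → ∃ V ∈ 𝒰, x ∈ V.1 ∧ V.1 ≤ W

variable {𝒰 : Set X.left.affineOpens}

theorem IsAffineBasis.ext (h𝒰 : IsAffineBasis 𝒰) {V : X.left.affineOpens} {s t : Sec X V}
    (h : ∀ V' ∈ 𝒰, ∀ hV : V'.1 ≤ V.1, secRes X hV s = secRes X hV t) : s = t :=
  sec_ext fun x hx => by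
    obtain ⟨V', h1, h2, h3⟩ := h𝒰 x V.1 hx
    exact ⟨V', h3, h2, h V' h1 h3⟩

/-- The members of a set of affine opens that lie in an open. -/
abbrev Below (𝒰 : Set X.left.affineOpens) (W : Opens X.left) : Type u :=
  {V : X.left.affineOpens // V ∈ 𝒰 ∧ V.1 ≤ W}

theorem IsAffineBasis.glue (h𝒰 : IsAffineBasis 𝒰) {V : X.left.affineOpens} (s : ∀ V' : Below 𝒰 V.1, Sec X V'.1)
    (hs : ∀ (V₁ V₂ : Below 𝒰 V.1) (h : V₂.1.1 ≤ V₁.1.1), secRes X h (s V₁) = s V₂) :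
    ∃ t : Sec X V, ∀ V' : Below 𝒰 V.1, secRes X V'.2.2 t = s V' := by
  obtain ⟨t, ht, -⟩ := X.left.sheaf.existsUnique_gluing' (fun V' : Below 𝒰 V.1 => V'.1.1) V.1
    (fun V' => homOfLE V'.2.2)
    (fun x hx => by
      obtain ⟨V', h1, h2, h3⟩ := h𝒰 x V.1 hx
      exact Opens.mem_iSup.mpr ⟨⟨V', h1, h3⟩, h2⟩) s
    (fun V₁ V₂ => by
      have hB : ∀ x : (V₁.1.1 ⊓ V₂.1.1 : Opens X.left), ∃ V' ∈ 𝒰, x.1 ∈ V'.1 ∧ V'.1 ≤ V₁.1.1 ⊓ V₂.1.1 :=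
        fun x => h𝒰 x.1 _ x.2
      choose V' hV' hx hle using hB
      refine X.left.sheaf.eq_of_locally_eq' (fun x => (V' x).1) _ (fun x => homOfLE (hle x))
        (fun x hxV => Opens.mem_iSup.mpr ⟨⟨x, hxV⟩, hx ⟨x, hxV⟩⟩) _ _ (fun x => ?_)
      have h1 := hs V₁ ⟨V' x, hV' x, ((hle x).trans inf_le_left).trans V₁.2.2⟩ ((hle x).trans inf_le_left)
      have h2 := hs V₂ ⟨V' x, hV' x, ((hle x).trans inf_le_left).trans V₁.2.2⟩ ((hle x).trans inf_le_right)
      have e1 := X.left.presheaf.map_comp (V₁.1.1.infLELeft V₂.1.1).op (homOfLE (hle x)).op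
      have e2 := X.left.presheaf.map_comp (V₁.1.1.infLERight V₂.1.1).op (homOfLE (hle x)).op
      have e1' := RingHom.congr_fun (congrArg CommRingCat.Hom.hom e1) (s V₁)
      have e2' := RingHom.congr_fun (congrArg CommRingCat.Hom.hom e2) (s V₂)
      exact e1'.symm.trans ((h1.trans h2.symm).trans e2'))
  exact ⟨t, ht⟩

theorem IsAffineBasis.glue_finite (h𝒰 : IsAffineBasis 𝒰) {V : X.left.affineOpens} {σ : Type*}
    (s : ∀ V' : Below 𝒰 V.1, σ → Sec X V'.1) (hfin : ∀ V', (Function.support (s V')).Finite)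
    (hs : ∀ (V₁ V₂ : Below 𝒰 V.1) (h : V₂.1.1 ≤ V₁.1.1) m, secRes X h (s V₁ m) = s V₂ m) :
    ∃ t : σ →₀ Sec X V, ∀ (V' : Below 𝒰 V.1) m, secRes X V'.2.2 (t m) = s V' m := by
  have h1 := fun m => h𝒰.glue (fun V' => s V' m) (fun V₁ V₂ h => hs V₁ V₂ h m)
  choose t ht using h1
  obtain ⟨I, hI⟩ := V.2.isCompact.elim_finite_subcover (fun V' : Below 𝒰 V.1 => (V'.1.1 : Set X.left))
    (fun V' => V'.1.1.2) (fun x hx => by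
      obtain ⟨V', h1, h2, h3⟩ := h𝒰 x V.1 hx
      exact Set.mem_iUnion.mpr ⟨⟨V', h1, h3⟩, h2⟩)
  have hsup : (Function.support t).Finite := by
    refine (I.finite_toSet.biUnion fun V' _ => hfin V').subset fun m hm => ?_
    by_contra hcon
    simp only [Set.mem_iUnion, not_exists, Function.mem_support, not_not] at hcon
    refine hm (sec_ext fun x hx => ?_)
    obtain ⟨V', hV', hxV'⟩ := Set.mem_iUnion₂.mp (hI hx)
    exact ⟨V'.1, V'.2.2, hxV', by rw [ht, hcon V' hV', map_zero]⟩
  refine ⟨Finsupp.ofSupportFinite t hsup, fun V' m => ?_⟩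
  rw [Finsupp.ofSupportFinite_coe, ht]

/-- Gluing polynomials. -/
theorem IsAffineBasis.glue_mvPolynomial (h𝒰 : IsAffineBasis 𝒰) {V : X.left.affineOpens} {σ : Type*}
    (p : ∀ V' : Below 𝒰 V.1, MvPolynomial σ (Sec X V'.1))
    (hp : ∀ (V₁ V₂ : Below 𝒰 V.1) (h : V₂.1.1 ≤ V₁.1.1),
      MvPolynomial.mapAlgHom (secRes X h) (p V₁) = p V₂) :
    ∃ q : MvPolynomial σ (Sec X V), ∀ V' : Below 𝒰 V.1, MvPolynomial.mapAlgHom (secRes X V'.2.2) q = p V' := by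
  obtain ⟨t, ht⟩ := h𝒰.glue_finite (fun V' m => MvPolynomial.coeff m (p V'))
    (fun V' => (p V').support.finite_toSet.subset fun m hm => MvPolynomial.mem_support_iff.mpr hm)
    (fun V₁ V₂ h m => by
      rw [← hp V₁ V₂ h]
      exact (MvPolynomial.coeff_map (secRes X h : Sec X V₁.1 →+* Sec X V₂.1) (p V₁) m).symm)
  refine ⟨t.sum fun m b => MvPolynomial.monomial m b, fun V' => MvPolynomial.ext _ _ fun m => ?_⟩
  have h1 : MvPolynomial.coeff m (t.sum fun m b => MvPolynomial.monomial m b) = t m := by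
    classical
    rw [Finsupp.sum, MvPolynomial.coeff_sum]
    simp only [MvPolynomial.coeff_monomial]
    rw [Finset.sum_ite_eq' t.support m]
    simp only [Finsupp.mem_support_iff, ne_eq, ite_not, ite_eq_right_iff]
    exact fun h => h.symm
  refine (MvPolynomial.coeff_map (secRes X V'.2.2 : Sec X V →+* Sec X V'.1) _ m).trans ?_
  rw [h1]
  exact ht V' m

theorem IsAffineBasis.mvPolynomial_ext (h𝒰 : IsAffineBasis 𝒰) {V : X.left.affineOpens} {σ : Type*}
    {p q : MvPolynomial σ (Sec X V)} (h : ∀ V' : Below 𝒰 V.1,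
      MvPolynomial.mapAlgHom (secRes X V'.2.2) p = MvPolynomial.mapAlgHom (secRes X V'.2.2) q) : p = q :=
  MvPolynomial.ext _ _ fun m => h𝒰.ext fun V' h1 h2 => by
    have h3 := congrArg (MvPolynomial.coeff m) (h ⟨V', h1, h2⟩)
    exact ((MvPolynomial.coeff_map (secRes X h2 : Sec X V →+* Sec X V') p m).symm.trans h3).trans
      (MvPolynomial.coeff_map (secRes X h2 : Sec X V →+* Sec X V') q m)

/-- Gluing polynomials in one variable. -/
theorem IsAffineBasis.glue_polynomial (h𝒰 : IsAffineBasis 𝒰) {V : X.left.affineOpens}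
    (p : ∀ V' : Below 𝒰 V.1, Polynomial (Sec X V'.1))
    (hp : ∀ (V₁ V₂ : Below 𝒰 V.1) (h : V₂.1.1 ≤ V₁.1.1),
      (p V₁).map (secRes X h : Sec X V₁.1 →+* Sec X V₂.1) = p V₂) :
    ∃ q : Polynomial (Sec X V), ∀ V' : Below 𝒰 V.1, q.map (secRes X V'.2.2 : Sec X V →+* Sec X V'.1) = p V' := by
  obtain ⟨t, ht⟩ := h𝒰.glue_finite (fun V' m => (p V').coeff m)
    (fun V' => (p V').support.finite_toSet.subset fun m hm => Polynomial.mem_support_iff.mpr hm)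
    (fun V₁ V₂ h m => by
      rw [← hp V₁ V₂ h, Polynomial.coeff_map]
      rfl)
  refine ⟨t.sum fun m b => Polynomial.monomial m b, fun V' => Polynomial.ext fun m => ?_⟩
  have h1 : (t.sum fun m b => Polynomial.monomial m b).coeff m = t m := by
    classical
    rw [Finsupp.sum, Polynomial.finsetSum_coeff]
    simp only [Polynomial.coeff_monomial]
    rw [Finset.sum_ite_eq' t.support m]
    simp only [Finsupp.mem_support_iff, ne_eq, ite_not, ite_eq_right_iff]
    exact fun h => h.symm
  rw [Polynomial.coeff_map, h1]
  exact ht V' m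

theorem IsAffineBasis.polynomial_ext (h𝒰 : IsAffineBasis 𝒰) {V : X.left.affineOpens}
    {p q : Polynomial (Sec X V)} (h : ∀ V' : Below 𝒰 V.1,
      p.map (secRes X V'.2.2 : Sec X V →+* Sec X V'.1) = q.map (secRes X V'.2.2 : Sec X V →+* Sec X V'.1)) :
    p = q :=
  Polynomial.ext fun m => h𝒰.ext fun V' h1 h2 => by
    have h3 := congrArg (fun r => Polynomial.coeff r m) (h ⟨V', h1, h2⟩)
    simp only [Polynomial.coeff_map] at h3
    exact h3

end Gluing

section ChartBasis

variable {k : Type u} [Field k] {M : SchOver k} (L : ArcSpace M)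

/-- The affine opens of the arc space that carry charts. -/
def chartOpens : Set L.X.left.affineOpens := Set.range Chart.V

/-- The affine opens of the arc space that carry charts with coordinates. -/
def coordOpens : Set L.X.left.affineOpens :=
  {V | ∃ c : Chart L, c.V = V ∧ ∃ 𝒳 : FormBasis k (Sec M c.U), 𝒳.IsCoord}

theorem coordOpens_isAffineBasis [Smooth M.hom] : IsAffineBasis (coordOpens L) := fun x W hx => by
  obtain ⟨_, ⟨V, hV, rfl⟩, hxV, -⟩ :=
    L.X.left.isBasis_affineOpens.exists_subset_of_mem_open (Set.mem_univ x) isOpen_univ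
  obtain ⟨U, hU, h𝒳⟩ := exists_coord (arcCenter L ⟨V, hV⟩ ⟨x, hxV⟩)
  obtain ⟨c, hcU, hxc, -, hcW⟩ := exists_chart ⟨V, hV⟩ ⟨x, hxV⟩ U hU W hx
  subst hcU
  exact ⟨c.V, ⟨c, rfl, h𝒳⟩, hxc, hcW⟩

theorem coordOpens_subset : coordOpens L ⊆ chartOpens L := by
  rintro _ ⟨c, rfl, -⟩
  exact ⟨c, rfl⟩

theorem chartOpens_isAffineBasis [Smooth M.hom] : IsAffineBasis (chartOpens L) := fun x W hx => by
  obtain ⟨V, hV, h⟩ := coordOpens_isAffineBasis L x W hx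
  exact ⟨V, coordOpens_subset L hV, h⟩

variable {L}

/-- Around a point that lies in two charts there is a chart that lies in both. -/
theorem exists_common_chart (c c' : Chart L) (W : Opens L.X.left) {x : L.X.left} (hx : x ∈ c.V.1)
    (hx' : x ∈ c'.V.1) (hW : x ∈ W) :
    ∃ d : Chart L, d.U.1 ≤ c.U.1 ∧ d.U.1 ≤ c'.U.1 ∧ d.V.1 ≤ c.V.1 ∧ d.V.1 ≤ c'.V.1 ∧ d.V.1 ≤ W ∧ x ∈ d.V.1 := by
  obtain ⟨_, ⟨V, hV, rfl⟩, hxV, hVW⟩ := L.X.left.isBasis_affineOpens.exists_subset_of_mem_open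
    (show x ∈ c.V.1 ⊓ c'.V.1 from ⟨hx, hx'⟩) (c.V.1 ⊓ c'.V.1).2
  have h1 : arcCenter L ⟨V, hV⟩ ⟨x, hxV⟩ ∈ c.U.1 ⊓ c'.U.1 := by
    constructor
    · have h2 : V ≤ c.V.1 := fun y hy => (hVW hy).1
      rw [arcCenter_res (V := c.V) (V' := ⟨V, hV⟩) h2 ⟨x, hxV⟩]
      exact arcCenter_mem c _
    · have h2 : V ≤ c'.V.1 := fun y hy => (hVW hy).2
      rw [arcCenter_res (V := c'.V) (V' := ⟨V, hV⟩) h2 ⟨x, hxV⟩]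
      exact arcCenter_mem c' _
  obtain ⟨_, ⟨U, hU, rfl⟩, hxU, hUW⟩ := M.left.isBasis_affineOpens.exists_subset_of_mem_open
    h1 (c.U.1 ⊓ c'.U.1).2
  obtain ⟨d, hdU, hxd, hdV, hdW⟩ := exists_chart ⟨V, hV⟩ ⟨x, hxV⟩ ⟨U, hU⟩ hxU W hW
  have hdU' : d.U.1 = U := congrArg Subtype.val hdU
  exact ⟨d, fun y hy => (hUW (hdU' ▸ hy)).1, fun y hy => (hUW (hdU' ▸ hy)).2, fun y hy => (hVW (hdV hy)).1,
    fun y hy => (hVW (hdV hy)).2, hdW, hxd⟩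

end ChartBasis

/-! ## Gluing Poisson vertex algebras -/

section GluePVA

variable {k B B' : Type*} [Field k] [CommRing B] [CommRing B'] [Algebra k B] [Algebra k B'] (f : B →ₐ[k] B')

theorem map_polynomial_sum {N N' : Type*} [AddCommGroup N] [AddCommGroup N'] (θ : N →+ N') (g : ℕ → B →+ N)
    (g' : ℕ → B' →+ N') (h : ∀ m b, θ (g m b) = g' m (f b)) (p : Polynomial B) :
    θ (p.sum fun m b => g m b) = (p.map (f : B →+* B')).sum fun m b => g' m b := by
  induction p using Polynomial.induction_on' with
  | add p q hp hq =>
    rw [Polynomial.map_add, Polynomial.sum_add_index p q _ (fun m => map_zero (g m)) (fun m => map_add (g m)),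
      Polynomial.sum_add_index _ _ _ (fun m => map_zero (g' m)) (fun m => map_add (g' m)), map_add, hp, hq]
  | monomial m b =>
    rw [Polynomial.map_monomial, Polynomial.sum_monomial_index _ _ (map_zero (g m)),
      Polynomial.sum_monomial_index _ _ (map_zero (g' m)), h]
    rfl

theorem map_polyCoefMap {δ : B →ₗ[k] B} {δ' : B' →ₗ[k] B'} (hf : ∀ x, f (δ x) = δ' (f x)) (p : Polynomial B) :
    (polyCoefMap δ p).map (f : B →+* B') = polyCoefMap δ' (p.map (f : B →+* B')) := by
  induction p using Polynomial.induction_on' with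
  | add p q hp hq => simp only [map_add, Polynomial.map_add, hp, hq]
  | monomial m b =>
    rw [polyCoefMap_monomial, Polynomial.map_monomial, Polynomial.map_monomial, polyCoefMap_monomial]
    exact congrArg _ (hf b)

theorem map_aeval_polynomial {σ : Type*} (e : MvPolynomial σ B) (e' : MvPolynomial σ B')
    (he : MvPolynomial.map (f : B →+* B') e = e') (p : Polynomial B) :
    MvPolynomial.map (f : B →+* B') (Polynomial.aeval e p) = Polynomial.aeval e' (p.map (f : B →+* B')) := by
  rw [Polynomial.aeval_def, Polynomial.aeval_def, Polynomial.hom_eval₂, Polynomial.eval₂_map, he]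
  congr 1
  ext b
  simp [MvPolynomial.algebraMap_eq]

/-- Compatibility of Poisson vertex structures with a homomorphism. -/
structure PVA.Compat (𝒱 : PVA k B) (𝒱' : PVA k B') : Prop where
  δ : ∀ x, f (𝒱.δ x) = 𝒱'.δ (f x)
  br : ∀ x y, 𝒱'.br (f x) (f y) = (𝒱.br x y).map (f : B →+* B')

variable {f} in
theorem PVA.eq_of_compat {𝒱 𝒱' : PVA k B} {f : B →ₐ[k] B} (hf : ∀ x, f x = x) (h : 𝒱.Compat f 𝒱') :
    𝒱 = 𝒱' := by
  obtain rfl : f = AlgHom.id k B := AlgHom.ext hf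
  have e : 𝒱.δ = 𝒱'.δ := Derivation.ext h.δ
  have e' : 𝒱.br = 𝒱'.br := LinearMap.ext₂ fun x y => by simpa using (h.br x y).symm
  cases 𝒱
  cases 𝒱'
  simp only at e e'
  subst e e'
  rfl

/-- The terms of the right hand side of skew symmetry. -/
def skewTerm (δ : Derivation k B B) (m : ℕ) : B →+ Polynomial B :=
  ((-(polyCoefMap δ.toLinearMap + LinearMap.mulLeft k Polynomial.X) : Module.End k (Polynomial B)) ^ m :
    Module.End k (Polynomial B)).toAddMonoidHom.comp (Polynomial.C : B →+* Polynomial B).toAddMonoidHom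

theorem map_skewTerm {δ : Derivation k B B} {δ' : Derivation k B' B'} (hf : ∀ x, f (δ x) = δ' (f x)) (m : ℕ)
    (b : B) : (skewTerm δ m b).map (f : B →+* B') = skewTerm δ' m (f b) := by
  change Polynomial.map _ (((-(polyCoefMap δ.toLinearMap + LinearMap.mulLeft k Polynomial.X) :
    Module.End k (Polynomial B)) ^ m) (Polynomial.C b)) =
    ((-(polyCoefMap δ'.toLinearMap + LinearMap.mulLeft k Polynomial.X) :
      Module.End k (Polynomial B')) ^ m) (Polynomial.C (f b))
  induction m with
  | zero => simp
  | succ m ih =>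
    rw [pow_succ', pow_succ', Module.End.mul_apply, Module.End.mul_apply, ← ih]
    simp only [LinearMap.neg_apply, LinearMap.add_apply, LinearMap.mulLeft_apply, Polynomial.map_neg,
      Polynomial.map_add, Polynomial.map_mul, Polynomial.map_X]
    rw [map_polyCoefMap f (δ' := δ'.toLinearMap) hf]

/-- The terms that occur in the Jacobi identity. -/
def jacobiTerm (u v : MvPolynomial (Fin 2) B) (g : B →ₗ[k] Polynomial B) (m : ℕ) :
    B →+ MvPolynomial (Fin 2) B :=
  (LinearMap.mulLeft k (u ^ m) ∘ₗ ((Polynomial.aeval v : Polynomial B →ₐ[B] _).restrictScalars k).toLinearMap ∘ₗ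
    g).toAddMonoidHom

theorem map_jacobiTerm {u v : MvPolynomial (Fin 2) B} {u' v' : MvPolynomial (Fin 2) B'}
    (hu : MvPolynomial.map (f : B →+* B') u = u') (hv : MvPolynomial.map (f : B →+* B') v = v')
    {g : B →ₗ[k] Polynomial B} {g' : B' →ₗ[k] Polynomial B'}
    (hg : ∀ b, (g b).map (f : B →+* B') = g' (f b)) (m : ℕ) (b : B) :
    MvPolynomial.map (f : B →+* B') (jacobiTerm u v g m b) = jacobiTerm u' v' g' m (f b) := by
  change MvPolynomial.map _ (u ^ m * Polynomial.aeval v (g b)) = u' ^ m * Polynomial.aeval v' (g' (f b))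
  rw [map_mul, map_pow, hu, map_aeval_polynomial f v v' hv, hg]

/-- A derivation and a bracket that are compatible with a jointly injective family of homomorphisms to
Poisson vertex algebras form a Poisson vertex algebra. -/
def PVA.ofFamily {ι : Type*} {C : ι → Type*} [∀ i, CommRing (C i)] [∀ i, Algebra k (C i)]
    (f : ∀ i, B →ₐ[k] C i) (hinj : ∀ x y, (∀ i, f i x = f i y) → x = y) (𝒱 : ∀ i, PVA k (C i))
    (δ : Derivation k B B) (br : B →ₗ[k] B →ₗ[k] Polynomial B) (hδ : ∀ i x, f i (δ x) = (𝒱 i).δ (f i x))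
    (hbr : ∀ i x y, (𝒱 i).br (f i x) (f i y) = (br x y).map (f i : B →+* C i)) : PVA k B :=
  have hp : ∀ p q : Polynomial B, (∀ i, p.map (f i : B →+* C i) = q.map (f i : B →+* C i)) → p = q :=
    fun p q h => Polynomial.ext fun m => hinj _ _ fun i => by
      have h1 := congrArg (fun r => Polynomial.coeff r m) (h i)
      simp only [Polynomial.coeff_map] at h1
      exact h1
  have hmv : ∀ p q : MvPolynomial (Fin 2) B, (∀ i, MvPolynomial.map (f i : B →+* C i) p =
      MvPolynomial.map (f i : B →+* C i) q) → p = q :=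
    fun p q h => MvPolynomial.ext _ _ fun m => hinj _ _ fun i => by
      have h1 := congrArg (MvPolynomial.coeff m) (h i)
      simp only [MvPolynomial.coeff_map] at h1
      exact h1
  { δ := δ
    br := br
    δ_br := fun a b => hp _ _ fun i => by
      rw [map_polyCoefMap (f i) (δ' := (𝒱 i).δ.toLinearMap) (hδ i), ← hbr, (𝒱 i).δ_br, Polynomial.map_add,
        ← hbr, ← hbr, hδ, hδ]
    sesq := fun a b => hp _ _ fun i => by
      rw [← hbr, hδ, (𝒱 i).sesq, Polynomial.map_neg, Polynomial.map_mul, Polynomial.map_X, hbr]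
    skew := fun a b => hp _ _ fun i => by
      rw [← hbr, (𝒱 i).skew, Polynomial.map_neg, hbr]
      congr 1
      exact (map_polynomial_sum (f i) (Polynomial.mapRingHom (f i : B →+* C i)).toAddMonoidHom (skewTerm δ)
        (skewTerm (𝒱 i).δ) (map_skewTerm (f i) (hδ i)) (br b a)).symm
    leibniz := fun a b c => hp _ _ fun i => by
      rw [← hbr, map_mul, (𝒱 i).leibniz]
      simp only [Polynomial.map_add, Polynomial.map_mul, Polynomial.map_C, hbr]
      rfl
    jacobi := fun a b c => hmv _ _ fun i => by
      have h1 := map_polynomial_sum (f i) (MvPolynomial.map (f i : B →+* C i)).toAddMonoidHom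
        (jacobiTerm (MvPolynomial.X 0) (MvPolynomial.X 0 + MvPolynomial.X 1) (br.flip c))
        (jacobiTerm (MvPolynomial.X 0) (MvPolynomial.X 0 + MvPolynomial.X 1) ((𝒱 i).br.flip (f i c)))
        (map_jacobiTerm (f i) (by simp) (by simp) (fun x => (hbr i x c).symm)) (br a b)
      have h2 := map_polynomial_sum (f i) (MvPolynomial.map (f i : B →+* C i)).toAddMonoidHom
        (jacobiTerm (MvPolynomial.X 1) (MvPolynomial.X 0) (br a))
        (jacobiTerm (MvPolynomial.X 1) (MvPolynomial.X 0) ((𝒱 i).br (f i a)))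
        (map_jacobiTerm (f i) (by simp) (by simp) (fun x => (hbr i a x).symm)) (br b c)
      have h3 := map_polynomial_sum (f i) (MvPolynomial.map (f i : B →+* C i)).toAddMonoidHom
        (jacobiTerm (MvPolynomial.X 0) (MvPolynomial.X 1) (br b))
        (jacobiTerm (MvPolynomial.X 0) (MvPolynomial.X 1) ((𝒱 i).br (f i b)))
        (map_jacobiTerm (f i) (by simp) (by simp) (fun x => (hbr i b x).symm)) (br a c)
      rw [map_sub]
      refine h1.trans ((?_ : _ = _).trans (congrArg₂ (· - ·) h2 h3).symm)
      rw [← hbr, ← hbr, ← hbr]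
      exact (𝒱 i).jacobi (f i a) (f i b) (f i c) }

end GluePVA

/-! ## The Poisson vertex structure of the arc space -/

section ArcPVA

variable {k : Type u} [Field k] {M : SchOver k} {L : ArcSpace M} (P : PoissonStr M)

/-- The Poisson vertex structure on a chart. -/
structure IsChartPVA (c : Chart L) (𝒱 : PVA k (Sec L.X c.V)) : Prop where
  δ : IsArcDerivation c.ev 𝒱.δ
  br : ∀ a b, 𝒱.br (jet c.ev 0 a) (jet c.ev 0 b) = Polynomial.C (jet c.ev 0 ((P.bracket c.U).br a b))

variable [CharZero k] [Smooth M.hom]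

theorem exists_isChartPVA (c : Chart L) : ∃ 𝒱, IsChartPVA P c 𝒱 := by
  obtain ⟨δ, hδ⟩ := c.jetUniversal.exists_arcDerivation
  obtain ⟨𝒳⟩ := exists_formBasis c.U
  exact ⟨c.jetUniversal.pva hδ 𝒳 (P.bracket c.U), hδ, fun a b => c.jetUniversal.pva_br_jet hδ 𝒳 _ a b⟩

variable {P}

theorem IsChartPVA.compat_of_le {c c' : Chart L} {𝒱 : PVA k (Sec L.X c.V)} {𝒱' : PVA k (Sec L.X c'.V)}
    (h : IsChartPVA P c 𝒱) (h' : IsChartPVA P c' 𝒱') (hU : c'.U.1 ≤ c.U.1) (hV : c'.V.1 ≤ c.V.1) :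
    𝒱.Compat (secRes L.X hV) 𝒱' := by
  have hδ := c.jetUniversal.delta_compat (secRes L.X hV) 𝒱.δ 𝒱'.δ fun a i => by
    rw [h.δ, ← c.jet_res c' hU hV, h'.δ, c.jet_res c' hU hV]
    simp
  refine ⟨hδ, c.jetUniversal.br_compat 𝒱 𝒱' h.δ _ hδ fun a b => ?_⟩
  rw [← c.jet_res c' hU hV, ← c.jet_res c' hU hV, h'.br, h.br, P.res hU, c.jet_res c' hU hV, Polynomial.map_C]
  rfl

theorem PVA.compat_of_cover {V V' : L.X.left.affineOpens} (hV : V'.1 ≤ V.1) {𝒱 : PVA k (Sec L.X V)}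
    {𝒱' : PVA k (Sec L.X V')} (h : ∀ x ∈ V'.1, ∃ (V'' : L.X.left.affineOpens) (hV'' : V''.1 ≤ V'.1)
      (𝒱'' : PVA k (Sec L.X V'')), x ∈ V''.1 ∧ 𝒱.Compat (secRes L.X (hV''.trans hV)) 𝒱'' ∧
        𝒱'.Compat (secRes L.X hV'') 𝒱'') : 𝒱.Compat (secRes L.X hV) 𝒱' := by
  refine ⟨fun x => sec_ext fun y hy => ?_, fun x x' => Polynomial.ext fun m => sec_ext fun y hy => ?_⟩
  · obtain ⟨V'', hV'', 𝒱'', hy'', h1, h2⟩ := h y hy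
    refine ⟨V'', hV'', hy'', ?_⟩
    rw [secRes_comp, h1.δ, h2.δ, secRes_comp]
  · obtain ⟨V'', hV'', 𝒱'', hy'', h1, h2⟩ := h y hy
    refine ⟨V'', hV'', hy'', ?_⟩
    have e1 := congrArg (fun r => Polynomial.coeff r m) (h1.br x x')
    have e2 := congrArg (fun r => Polynomial.coeff r m) (h2.br (secRes L.X hV x) (secRes L.X hV x'))
    simp only [secRes_comp] at e2
    rw [e1] at e2
    simp only [Polynomial.coeff_map] at e2 ⊢
    refine e2.symm.trans ?_
    exact (secRes_comp L.X hV hV'' _).symm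

theorem IsChartPVA.compat {c c' : Chart L} {𝒱 : PVA k (Sec L.X c.V)} {𝒱' : PVA k (Sec L.X c'.V)}
    (h : IsChartPVA P c 𝒱) (h' : IsChartPVA P c' 𝒱') (hV : c'.V.1 ≤ c.V.1) :
    𝒱.Compat (secRes L.X hV) 𝒱' :=
  PVA.compat_of_cover hV fun x hx => by
    obtain ⟨d, h1, h2, h3, h4, -, h5⟩ := exists_common_chart c c' ⊤ (hV hx) hx trivial
    obtain ⟨𝒱'', h''⟩ := exists_isChartPVA P d
    exact ⟨d.V, h4, 𝒱'', h5, h.compat_of_le h'' h1 h3, h'.compat_of_le h'' h2 h4⟩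

variable (P) in
/-- The Poisson vertex structure on an affine open of the arc space. -/
def IsArcPVA (V : L.X.left.affineOpens) (𝒱 : PVA k (Sec L.X V)) : Prop :=
  ∀ (c : Chart L) (h : c.V.1 ≤ V.1) (𝒱' : PVA k (Sec L.X c.V)), IsChartPVA P c 𝒱' → 𝒱.Compat (secRes L.X h) 𝒱'

theorem IsArcPVA.compat {V V' : L.X.left.affineOpens} (hV : V'.1 ≤ V.1) {𝒱 : PVA k (Sec L.X V)}
    {𝒱' : PVA k (Sec L.X V')} (h : IsArcPVA P V 𝒱) (h' : IsArcPVA P V' 𝒱') : 𝒱.Compat (secRes L.X hV) 𝒱' :=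
  PVA.compat_of_cover hV fun x hx => by
    obtain ⟨_, ⟨c, rfl⟩, hxc, hc⟩ := chartOpens_isAffineBasis L x V'.1 hx
    obtain ⟨𝒱'', h''⟩ := exists_isChartPVA P c
    exact ⟨c.V, hc, 𝒱'', hxc, h c (hc.trans hV) 𝒱'' h'', h' c hc 𝒱'' h''⟩

theorem IsArcPVA.eq {V : L.X.left.affineOpens} {𝒱 𝒱' : PVA k (Sec L.X V)} (h : IsArcPVA P V 𝒱)
    (h' : IsArcPVA P V 𝒱') : 𝒱 = 𝒱' := PVA.eq_of_compat (secRes_self L.X le_rfl) (h.compat le_rfl h')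

theorem IsArcPVA.isChartPVA {c : Chart L} {𝒱 : PVA k (Sec L.X c.V)} (h : IsArcPVA P c.V 𝒱) : IsChartPVA P c 𝒱 := by
  obtain ⟨𝒱', h'⟩ := exists_isChartPVA P c
  rwa [PVA.eq_of_compat (secRes_self L.X le_rfl) (h c le_rfl 𝒱' h')]

theorem exists_isArcPVA (V : L.X.left.affineOpens) : ∃ 𝒱, IsArcPVA P V 𝒱 := by
  have hB := chartOpens_isAffineBasis L
  have h1 : ∀ V' : Below (chartOpens L) V.1, ∃ 𝒱' : PVA k (Sec L.X V'.1), ∀ (c : Chart L) (h : c.V.1 ≤ V'.1.1)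
      (𝒱'' : PVA k (Sec L.X c.V)), IsChartPVA P c 𝒱'' → 𝒱'.Compat (secRes L.X h) 𝒱'' := by
    rintro ⟨_, ⟨c, rfl⟩, hc⟩
    obtain ⟨𝒱', h'⟩ := exists_isChartPVA P c
    exact ⟨𝒱', fun c' hc' 𝒱'' h'' => h'.compat h'' hc'⟩
  choose 𝒱 h𝒱 using h1
  have hcompat : ∀ (V₁ V₂ : Below (chartOpens L) V.1) (h : V₂.1.1 ≤ V₁.1.1),
      (𝒱 V₁).Compat (secRes L.X h) (𝒱 V₂) := fun V₁ V₂ h => IsArcPVA.compat h (h𝒱 V₁) (h𝒱 V₂)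
  have hδ := fun x : Sec L.X V => hB.glue (fun V' : Below (chartOpens L) V.1 =>
    (𝒱 V').δ (secRes L.X V'.2.2 x)) fun V₁ V₂ h => by rw [(hcompat V₁ V₂ h).δ, secRes_comp]
  choose δ hδ using hδ
  have hbr := fun x y : Sec L.X V => hB.glue_polynomial (fun V' : Below (chartOpens L) V.1 =>
    (𝒱 V').br (secRes L.X V'.2.2 x) (secRes L.X V'.2.2 y)) fun V₁ V₂ h => by
      rw [← (hcompat V₁ V₂ h).br, secRes_comp, secRes_comp]
  choose br hbr using hbr
  have ext : ∀ x y : Sec L.X V, (∀ V' : Below (chartOpens L) V.1, secRes L.X V'.2.2 x = secRes L.X V'.2.2 y) →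
      x = y := fun x y h => hB.ext fun V' h1 h2 => h ⟨V', h1, h2⟩
  have pext := fun p q : Polynomial (Sec L.X V) => hB.polynomial_ext (p := p) (q := q)
  let δ' : Derivation k (Sec L.X V) (Sec L.X V) := Derivation.mk'
    { toFun := δ
      map_add' := fun x y => ext _ _ fun V' => by simp only [map_add, hδ]
      map_smul' := fun t x => ext _ _ fun V' => by
        rw [hδ, map_smul, Derivation.map_smul, RingHom.id_apply, map_smul, hδ] }
    (fun x y => ext _ _ fun V' => by
      change secRes L.X V'.2.2 (δ (x * y)) = secRes L.X V'.2.2 (x * δ y + y * δ x)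
      simp only [hδ, map_mul, map_add, Derivation.leibniz, smul_eq_mul])
  let br' : Sec L.X V →ₗ[k] Sec L.X V →ₗ[k] Polynomial (Sec L.X V) := LinearMap.mk₂ k br
    (fun x x' y => pext _ _ fun V' => by simp only [hbr, Polynomial.map_add, map_add, LinearMap.add_apply])
    (fun t x y => pext _ _ fun V' => by
      rw [hbr, map_smul, map_smul, LinearMap.smul_apply, ← hbr]
      exact (map_smul (Polynomial.mapAlgHom (secRes L.X V'.2.2)) t (br x y)).symm)
    (fun x y y' => pext _ _ fun V' => by simp only [hbr, Polynomial.map_add, map_add])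
    (fun t x y => pext _ _ fun V' => by
      rw [hbr, map_smul, map_smul, ← hbr]
      exact (map_smul (Polynomial.mapAlgHom (secRes L.X V'.2.2)) t (br x y)).symm)
  obtain ⟨𝒱₀, hfam⟩ : ∃ 𝒱₀ : PVA k (Sec L.X V), ∀ V' : Below (chartOpens L) V.1,
      𝒱₀.Compat (secRes L.X V'.2.2) (𝒱 V') :=
    ⟨PVA.ofFamily (fun V' : Below (chartOpens L) V.1 => secRes L.X V'.2.2) ext 𝒱 δ' br'
        (fun V' x => hδ x V') (fun V' x y => (hbr x y V').symm),
      fun V' => ⟨fun x => hδ x V', fun x y => (hbr x y V').symm⟩⟩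
  refine ⟨𝒱₀, fun c hc 𝒱' h' => ?_⟩
  have h2 := hfam ⟨c.V, ⟨c, rfl⟩, hc⟩
  rwa [PVA.eq_of_compat (secRes_self L.X le_rfl) (h𝒱 ⟨c.V, ⟨c, rfl⟩, hc⟩ c le_rfl 𝒱' h')] at h2

theorem PVStr.IsArc.isArcPVA {S : PVStr L.X} (hS : S.IsArc P) (V : L.X.left.affineOpens) :
    IsArcPVA P V (S.pva V) := fun c h 𝒱' h' => by
  have e : 𝒱' = S.pva c.V := c.jetUniversal.pva_unique h'.δ (hS.δ c) fun a b => by rw [h'.br, hS.br]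
  subst e
  exact ⟨fun x => (S.res_δ h x).symm, S.res_br h⟩

theorem exists_unique_isArc : ∃! S : PVStr L.X, S.IsArc P := by
  choose 𝒱 h𝒱 using fun V : L.X.left.affineOpens => exists_isArcPVA (P := P) V
  refine ⟨⟨𝒱, fun h b => (((h𝒱 _).compat h (h𝒱 _)).δ b).symm, fun h => ((h𝒱 _).compat h (h𝒱 _)).br⟩,
    ⟨fun c => (h𝒱 c.V).isChartPVA.δ, fun c => (h𝒱 c.V).isChartPVA.br⟩, fun S hS => ?_⟩
  have e : S.pva = 𝒱 := funext fun V => (hS.isArcPVA V).eq (h𝒱 V)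
  cases S
  simp only at e
  subst e
  rfl

theorem exists_unique_isCotangent : ∃! 𝒜 : ∀ c : Chart L, TopLieAlgebroid c.ev,
    ∀ c, (𝒜 c).IsCotangent (P.bracket c.U) := by
  have 𝒳 := fun c : Chart L => Classical.choice (exists_formBasis c.U)
  refine ⟨fun c => c.jetUniversal.algebroid (P.bracket c.U) (𝒳 c),
    fun c => c.jetUniversal.algebroid_isCotangent _ _, fun 𝒜 h => funext fun c => ?_⟩
  exact c.jetUniversal.isCotangent_unique _ (𝒳 c) (h c) (c.jetUniversal.algebroid_isCotangent _ _)

end ArcPVA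

/-! ## The complex of continuous cochains -/

section LoopComplexes

variable {k : Type u} [Field k] [CharZero k] {M : SchOver k} [Smooth M.hom] {L : ArcSpace M} {P : PoissonStr M}

/-- A basis of forms on a chart. -/
def Chart.forms (c : Chart L) : FormBasis k (Sec M c.U) := Classical.choice (exists_formBasis c.U)

variable {c c' : Chart L} (hU : c'.U.1 ≤ c.U.1) (hV : c'.V.1 ≤ c.V.1)

theorem anchor_res {A : TopLieAlgebroid c.ev} {A' : TopLieAlgebroid c'.ev}
    (hA : A.IsCotangent (P.bracket c.U)) (hA' : A'.IsCotangent (P.bracket c'.U)) (m : ℕ) (a : Sec M c.U)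
    (x : Sec L.X c.V) : A'.anchor (formGen c'.ev (ArcRing.z c'.ev ^ m) (secRes M hU a)) (secRes L.X hV x) =
      secRes L.X hV (A.anchor (formGen c.ev (ArcRing.z c.ev ^ m) a) x) := by
  refine (c.jetUniversal.delta_compat (secRes L.X hV) _ _ (fun b i => ?_) x).symm
  rw [hA.anchor, ← c.jet_res c' hU hV, hA'.anchor, ArcRing.coeff_z_pow_mul, ArcRing.coeff_z_pow_mul, P.res hU]
  split_ifs
  · exact (c.jet_res c' hU hV _ _).symm
  · exact map_zero _

/-- Compatibility of cochains with restriction. -/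
def IsResOf {n : ℕ} (φ : (Fin n → LoopForms c.ev) → Sec L.X c.V) (φ' : (Fin n → LoopForms c'.ev) → Sec L.X c'.V) :
    Prop := ∀ (m : Fin n → ℕ) (a : Fin n → Sec M c.U),
  φ' (fun q => formGen c'.ev (ArcRing.z c'.ev ^ m q) (secRes M hU (a q))) =
    secRes L.X hV (φ fun q => formGen c.ev (ArcRing.z c.ev ^ m q) (a q))

theorem dInsert_res {A : TopLieAlgebroid c.ev} {A' : TopLieAlgebroid c'.ev}
    (hA : A.IsCotangent (P.bracket c.U)) (hA' : A'.IsCotangent (P.bracket c'.U)) {n : ℕ}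
    {φ : (Fin n → LoopForms c.ev) → Sec L.X c.V} {φ' : (Fin n → LoopForms c'.ev) → Sec L.X c'.V}
    (h : IsResOf hU hV φ φ') : IsResOf hU hV (A.dInsert φ) (A'.dInsert φ') := by
  intro m a
  cases n with
  | zero => exact (map_zero _).symm
  | succ n =>
    simp only [TopLieAlgebroid.dInsert, map_sum]
    refine Finset.sum_congr rfl fun i _ => Finset.sum_congr rfl fun j _ => ?_
    split_ifs with hij
    · rw [map_zsmul, hA.br, hA'.br, P.res hU]
      congr 1
      have e := h (Fin.cons (m i.castSucc + m j) fun q => m (j.succAbove (i.succAbove q)))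
        (Fin.cons ((P.bracket c.U).br (a i.castSucc) (a j)) fun q => a (j.succAbove (i.succAbove q)))
      have e1 : ∀ (u : Fin (n + 1) → LoopForms c.ev) (v : LoopForms c.ev) (w : Fin n → LoopForms c.ev),
          u 0 = v → (∀ q, u q.succ = w q) → φ u = φ (Fin.cons v w) := fun u v w h1 h2 =>
        congrArg φ (funext fun q => Fin.cases h1 h2 q)
      have e2 : ∀ (u : Fin (n + 1) → LoopForms c'.ev) (v : LoopForms c'.ev) (w : Fin n → LoopForms c'.ev),
          u 0 = v → (∀ q, u q.succ = w q) → φ' u = φ' (Fin.cons v w) := fun u v w h1 h2 =>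
        congrArg φ' (funext fun q => Fin.cases h1 h2 q)
      rw [e1 _ _ _ rfl (fun q => rfl), e2 _ _ _ rfl (fun q => rfl)] at e
      exact e
    · exact (map_zero _).symm

theorem d_res {A : TopLieAlgebroid c.ev} {A' : TopLieAlgebroid c'.ev}
    (hA : A.IsCotangent (P.bracket c.U)) (hA' : A'.IsCotangent (P.bracket c'.U)) {n : ℕ}
    {φ : (Fin n → LoopForms c.ev) → Sec L.X c.V} {φ' : (Fin n → LoopForms c'.ev) → Sec L.X c'.V}
    (h : IsResOf hU hV φ φ') : IsResOf hU hV (A.d φ) (A'.d φ') := by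
  intro m a
  rw [TopLieAlgebroid.d, TopLieAlgebroid.d, map_add, map_sum, dInsert_res hU hV hA hA' h]
  congr 1
  refine Finset.sum_congr rfl fun i _ => ?_
  rw [map_zsmul, ← anchor_res hU hV hA hA']
  congr 2
  exact h (fun q => m (i.succAbove q)) fun q => a (i.succAbove q)

theorem cochainDelta_res {S : PVStr L.X} (hS : S.IsArc P) {n : ℕ}
    {φ : (Fin n → LoopForms c.ev) → Sec L.X c.V} {φ' : (Fin n → LoopForms c'.ev) → Sec L.X c'.V}
    (hφ : IsLoopCochain φ) (hφ' : IsLoopCochain φ') (h : IsResOf hU hV φ φ') :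
    IsResOf hU hV (cochainDelta _ (hS.δ c) φ) (cochainDelta _ (hS.δ c') φ') := by
  have key : ∀ (d : Chart L) (ψ : (Fin n → LoopForms d.ev) → Sec L.X d.V), IsLoopCochain ψ →
      ∀ (m : Fin n → ℕ) (a : Fin n → Sec M d.U) (i : Fin n),
      ψ (Function.update (fun q => formGen d.ev (ArcRing.z d.ev ^ m q) (a q)) i
        (loopDelta d.ev _ (hS.δ d) (formGen d.ev (ArcRing.z d.ev ^ m i) (a i)))) =
      -(m i • ψ fun q => formGen d.ev (ArcRing.z d.ev ^ (Function.update m i (m i - 1) q)) (a q)) := by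
    intro d ψ hψ m a i
    have e := d.jetUniversal.loopDelta_expForm (hS.δ d) d.forms (m i) (jet d.ev 0 (a i))
    rw [d.jetUniversal.expForm_jet, d.jetUniversal.expForm_jet] at e
    rw [e, ← hψ.slot_apply, map_neg, map_nsmul, hψ.slot_apply]
    congr 3
    funext q
    rcases eq_or_ne q i with rfl | hq
    · simp
    · simp [hq]
  intro m a
  rw [cochainDelta, cochainDelta, map_sub, map_sum, h m a, S.res_δ]
  congr 1
  refine Finset.sum_congr rfl fun i _ => ?_
  rw [key c' φ' hφ' m (fun q => secRes M hU (a q)) i, key c φ hφ, map_neg, map_nsmul, h]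

theorem isLoopComplex {S : PVStr L.X} (hS : S.IsArc P) {𝒜 : ∀ c : Chart L, TopLieAlgebroid c.ev}
    (h𝒜 : ∀ c, (𝒜 c).IsCotangent (P.bracket c.U)) : IsLoopComplex 𝒜 hS where
  mem n W φ hφ := ⟨fun c => (h𝒜 c.1).d_isLoopCochain c.1.jetUniversal c.1.forms (hφ.1 c),
    fun c c' hU hV => d_res hU hV (h𝒜 c.1) (h𝒜 c'.1) (hφ.2 c c' hU hV)⟩
  sq n W φ hφ := funext fun c => (h𝒜 c.1).d_d c.1.jetUniversal c.1.forms (hφ.1 c)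
  mem_δ n W φ hφ := ⟨fun c => (hφ.1 c).cochainDelta (hS.δ c.1),
    fun c c' hU hV => cochainDelta_res hU hV hS (hφ.1 c) (hφ.1 c') (hφ.2 c c' hU hV)⟩
  comm n W φ hφ := funext fun c => (h𝒜 c.1).d_cochainDelta c.1.jetUniversal c.1.forms (hS.δ c.1) (hφ.1 c)

end LoopComplexes

/-! ## Descent for polynomial cochains -/

section Descent

theorem totalOp_map {k B B' : Type*} [Field k] [CharZero k] [CommRing B] [Algebra k B] [CommRing B'] [Algebra k B']
    {n : ℕ} (f : B →ₐ[k] B') {δ : Derivation k B B} {δ' : Derivation k B' B'} (hf : ∀ x, f (δ x) = δ' (f x))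
    (p : MvPolynomial (Fin n) B) :
    MvPolynomial.mapAlgHom f (totalOp δ n p) = totalOp δ' n (MvPolynomial.mapAlgHom f p) :=
  dcoeff_ext k fun m => by
    simp only [dcoeff_mapAlgHom, dcoeff_totalOp, map_add, map_sum, map_nsmul, hf]

theorem IsPolyCochain.of_family {k B : Type u} [Field k] [CommRing B] [Algebra k B] [CharZero k] {n : ℕ}
    {ι : Type*} {C : ι → Type u} [∀ i, CommRing (C i)] [∀ i, Algebra k (C i)] (f : ∀ i, B →ₐ[k] C i)
    (hinj : ∀ p q : MvPolynomial (Fin n) B,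
      (∀ i, MvPolynomial.mapAlgHom (f i) p = MvPolynomial.mapAlgHom (f i) q) → p = q)
    {δ : Derivation k B B} {δ' : ∀ i, Derivation k (C i) (C i)} (hδ : ∀ i x, f i (δ x) = δ' i (f i x))
    {F : (Fin n → B) → MvPolynomial (Fin n) B} {F' : ∀ i, (Fin n → C i) → MvPolynomial (Fin n) (C i)}
    (hF' : ∀ i, IsPolyCochain (δ' i) (F' i))
    (h : ∀ i x, MvPolynomial.mapAlgHom (f i) (F x) = F' i fun q => f i (x q)) : IsPolyCochain δ F where
  add a i b c := hinj _ _ fun j => by simp only [h, map_add, map_update_comp, (hF' j).add]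
  smul a i t b := hinj _ _ fun j => by simp only [h, map_smul, map_update_comp, (hF' j).smul]
  sesq a i := hinj _ _ fun j => by
    rw [h, map_update_comp, hδ, map_neg, map_mul, h, MvPolynomial.mapAlgHom_apply, MvPolynomial.map_X]
    exact (hF' j).sesq (fun q => f j (a q)) i
  antisymm a τ := hinj _ _ fun j => by
    rw [map_zsmul, h, MvPolynomial.mapAlgHom_apply, MvPolynomial.map_rename]
    have e := (hF' j).antisymm (fun q => f j (a q)) τ
    have e' := h j (a ∘ τ)
    rw [MvPolynomial.mapAlgHom_apply] at e'
    rw [e']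
    exact e
  leibniz a i b c := hinj _ _ fun j => by
    simp only [map_add, shiftMulPoly_map (f j) (hδ j), h, map_update_comp, map_mul, (hF' j).leibniz]

variable {k : Type u} [Field k] [CharZero k] {X : SchOver k} {𝒰 : Set X.left.affineOpens} (S : PVStr X)

theorem lamQuot_ext (h𝒰 : IsAffineBasis 𝒰) {V : X.left.affineOpens} {n : ℕ} {v w : LamQuot (S.pva V).δ (n + 1)}
    (h : ∀ V' : Below 𝒰 V.1, S.lamRes V'.2.2 (n + 1) v = S.lamRes V'.2.2 (n + 1) w) : v = w := by
  obtain ⟨p, rfl⟩ := Submodule.Quotient.mk_surjective _ v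
  obtain ⟨q, rfl⟩ := Submodule.Quotient.mk_surjective _ w
  have h1 : ∀ V' : Below 𝒰 V.1, ∃ r, totalOp (S.pva V'.1).δ (n + 1) r =
      MvPolynomial.mapAlgHom (secRes X V'.2.2) (p - q) := fun V' => by
    obtain ⟨r, hr⟩ := (Submodule.Quotient.eq _).mp (h V')
    exact ⟨r, by rw [hr, map_sub]; rfl⟩
  choose r hr using h1
  have hres : ∀ {V₁ V₂ : X.left.affineOpens} (hV : V₂.1 ≤ V₁.1) x,
      secRes X hV ((S.pva V₁).δ x) = (S.pva V₂).δ (secRes X hV x) := fun hV x => (S.res_δ hV x).symm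
  obtain ⟨s, hs⟩ := h𝒰.glue_mvPolynomial r fun V₁ V₂ h => by
    apply totalOp_injective (S.pva V₂.1).δ
    rw [← totalOp_map _ (hres h), hr, hr]
    exact MvPolynomial.ext _ _ fun m => by
      simp only [MvPolynomial.mapAlgHom_apply, MvPolynomial.coeff_map]
      exact secRes_comp X V₁.2.2 h _
  refine (Submodule.Quotient.eq _).mpr ⟨s, h𝒰.mvPolynomial_ext fun V' => ?_⟩
  rw [totalOp_map _ (hres V'.2.2), hs, hr]

theorem isCochain_of_family (h𝒰 : IsAffineBasis 𝒰) {V : X.left.affineOpens} {n : ℕ}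
    {Y : (Fin (n + 1) → Sec X V) → LamQuot (S.pva V).δ (n + 1)}
    (Y' : ∀ V' : Below 𝒰 V.1, (Fin (n + 1) → Sec X V'.1) → LamQuot (S.pva V'.1).δ (n + 1))
    (hY' : ∀ V', (S.pva V'.1).IsCochain (Y' V'))
    (h : ∀ V' a, Y' V' (fun q => secRes X V'.2.2 (a q)) = S.lamRes V'.2.2 _ (Y a)) : (S.pva V).IsCochain Y := by
  have hres : ∀ {V₁ V₂ : X.left.affineOpens} (hV : V₂.1 ≤ V₁.1) x,
      secRes X hV ((S.pva V₁).δ x) = (S.pva V₂).δ (secRes X hV x) := fun hV x => (S.res_δ hV x).symm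
  refine ⟨exists_multilinear (fun a i b c => ?_) (fun a i t b => ?_), fun a i => ?_, fun a τ => ?_,
    fun a i b c => ?_⟩ <;> refine lamQuot_ext S h𝒰 fun V' => ?_
  · simp only [map_add, ← h, map_update_comp, (hY' V').isSlotwise.add]
  · simp only [map_smul, ← h, map_update_comp, (hY' V').isSlotwise.smul]
  · rw [← h, map_update_comp, hres, map_neg]
    refine ((hY' V').sesq (fun q => secRes X V'.2.2 (a q)) i).trans ?_
    rw [h]
    exact congrArg _ (lamMap_lamMul _ (hres V'.2.2) i (Y a)).symm
  · rw [map_zsmul, ← h]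
    refine (lamMap_lamPerm _ (hres V'.2.2) τ (Y (a ∘ τ))).trans ?_
    exact (congrArg _ (h V' (a ∘ τ)).symm).trans ((hY' V').antisymm (fun q => secRes X V'.2.2 (a q)) τ)
  · rw [map_add, ← h, map_update_comp, map_mul, (hY' V').leibniz, ← map_update_comp, ← map_update_comp, h, h]
    exact congrArg₂ (· + ·) (lamMap_shiftMul _ (hres V'.2.2) i b _).symm (lamMap_shiftMul _ (hres V'.2.2) i c _).symm

theorem lamRes_d {V V' : X.left.affineOpens} (hV : V'.1 ≤ V.1) {n : ℕ} {Y : (Fin n → Sec X V) → LamQuot (S.pva V).δ n}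
    {Y' : (Fin n → Sec X V') → LamQuot (S.pva V').δ n} (hY' : (S.pva V').IsCochain Y')
    (h : ∀ a, Y' (fun q => secRes X hV (a q)) = S.lamRes hV n (Y a)) (a : Fin (n + 1) → Sec X V) :
    (S.pva V').d Y' (fun q => secRes X hV (a q)) = S.lamRes hV _ ((S.pva V).d Y a) :=
  lamMap_d (secRes X hV) (fun x => (S.res_δ hV x).symm) (S.res_br hV) hY' h a

end Descent

/-! ## The morphism of complexes -/

section Phi

variable {k : Type u} [Field k] [CharZero k] {M : SchOver k} [Smooth M.hom] {L : ArcSpace M} {P : PoissonStr M}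
  {S : PVStr L.X} (hS : S.IsArc P) {n : ℕ}

/-- The polynomial `φ(e^{λ_1 z} dx_1, …, e^{λ_n z} dx_n)` on a chart. -/
def chartPoly (c : Chart L) (φ : (Fin n → LoopForms c.ev) → Sec L.X c.V) (x : Fin n → Sec L.X c.V) :
    MvPolynomial (Fin n) (Sec L.X c.V) := c.jetUniversal.expPoly (hS.δ c) c.forms φ x

theorem chartPoly_isPolyCochain {c : Chart L} {φ : (Fin n → LoopForms c.ev) → Sec L.X c.V} (hφ : IsLoopCochain φ) :
    IsPolyCochain (S.pva c.V).δ (chartPoly hS c φ) := c.jetUniversal.expPoly_isPolyCochain (hS.δ c) c.forms hφ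

theorem chartPoly_jet (c : Chart L) (φ : (Fin n → LoopForms c.ev) → Sec L.X c.V) (a : Fin n → Sec M c.U) :
    chartPoly hS c φ (fun q => jet c.ev 0 (a q)) = expEval c.ev φ a := c.jetUniversal.expPoly_jet (hS.δ c) c.forms φ a

theorem dcoeff_chartPoly_jet {c : Chart L} {φ : (Fin n → LoopForms c.ev) → Sec L.X c.V} (hφ : IsLoopCochain φ)
    (a : Fin n → Sec M c.U) (m : Fin n →₀ ℕ) : dcoeff m (chartPoly hS c φ fun q => jet c.ev 0 (a q)) =
      φ fun q => formGen c.ev (ArcRing.z c.ev ^ m q) (a q) := by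
  refine (c.jetUniversal.dcoeff_expPoly (hS.δ c) c.forms hφ _ m).trans (congrArg φ ?_)
  exact funext fun q => c.jetUniversal.expForm_jet (hS.δ c) c.forms _ _

theorem chartPoly_add {c : Chart L} {φ ψ : (Fin n → LoopForms c.ev) → Sec L.X c.V} (hφ : IsLoopCochain φ)
    (hψ : IsLoopCochain ψ) (x : Fin n → Sec L.X c.V) :
    chartPoly hS c (φ + ψ) x = chartPoly hS c φ x + chartPoly hS c ψ x := dcoeff_ext k fun m => by
  rw [chartPoly, chartPoly, chartPoly, map_add, c.jetUniversal.dcoeff_expPoly _ _ hφ,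
    c.jetUniversal.dcoeff_expPoly _ _ hψ, c.jetUniversal.dcoeff_expPoly _ _ (hφ.add hψ)]
  rfl

theorem chartPoly_smul {c : Chart L} {φ : (Fin n → LoopForms c.ev) → Sec L.X c.V} (hφ : IsLoopCochain φ) (t : k)
    (x : Fin n → Sec L.X c.V) : chartPoly hS c (t • φ) x = t • chartPoly hS c φ x := dcoeff_ext k fun m => by
  rw [chartPoly, chartPoly, dcoeff_smul, c.jetUniversal.dcoeff_expPoly _ _ hφ,
    c.jetUniversal.dcoeff_expPoly _ _ (hφ.smul t)]
  rfl

theorem chartPoly_cochainDelta {c : Chart L} {φ : (Fin n → LoopForms c.ev) → Sec L.X c.V} (hφ : IsLoopCochain φ)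
    (x : Fin n → Sec L.X c.V) : chartPoly hS c (cochainDelta _ (hS.δ c) φ) x =
      totalOp (S.pva c.V).δ n (chartPoly hS c φ x) := c.jetUniversal.expPoly_cochainDelta (hS.δ c) c.forms hφ x

theorem chartPoly_d {c : Chart L} {A : TopLieAlgebroid c.ev} (hA : A.IsCotangent (P.bracket c.U))
    {φ : (Fin n → LoopForms c.ev) → Sec L.X c.V} (hφ : IsLoopCochain φ) :
    quotCochain (S.pva c.V).δ (chartPoly hS c (A.d φ)) = (S.pva c.V).d (quotCochain _ (chartPoly hS c φ)) := by
  have e : S.pva c.V = c.jetUniversal.pva (hS.δ c) c.forms (P.bracket c.U) :=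
    c.jetUniversal.pva_unique (hS.δ c) (hS.δ c) fun a b => by rw [hS.br, c.jetUniversal.pva_br_jet]
  rw [PVA.d_quotCochain]
  congr 1
  refine funext fun x => c.jetUniversal.expPoly_d (hS.δ c) c.forms hA (S.pva c.V) (fun m x y => ?_) hφ x
  have e' : (S.pva c.V).br x y = c.jetUniversal.brPoly (hS.δ c) c.forms (P.bracket c.U) x y :=
    congrArg (fun 𝒱 : PVA k (Sec L.X c.V) => 𝒱.br x y) e
  rw [e', c.jetUniversal.pcoeff_brPoly]

theorem mvPolynomial_ext_of_cover {X : SchOver k} {V : X.left.affineOpens} {σ : Type*}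
    {p q : MvPolynomial σ (Sec X V)} (h : ∀ x ∈ V.1, ∃ (V' : X.left.affineOpens) (h : V'.1 ≤ V.1), x ∈ V'.1 ∧
      MvPolynomial.mapAlgHom (secRes X h) p = MvPolynomial.mapAlgHom (secRes X h) q) : p = q :=
  MvPolynomial.ext _ _ fun m => sec_ext fun x hx => by
    obtain ⟨V', h1, h2, h3⟩ := h x hx
    have h4 := congrArg (MvPolynomial.coeff m) h3
    simp only [MvPolynomial.mapAlgHom_apply, MvPolynomial.coeff_map] at h4
    exact ⟨V', h1, h2, h4⟩

theorem mapAlgHom_secRes_comp {X : SchOver k} {V V' V'' : X.left.affineOpens} (h : V'.1 ≤ V.1) (h' : V''.1 ≤ V'.1)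
    {σ : Type*} (p : MvPolynomial σ (Sec X V)) :
    MvPolynomial.mapAlgHom (secRes X h') (MvPolynomial.mapAlgHom (secRes X h) p) =
      MvPolynomial.mapAlgHom (secRes X (h'.trans h)) p := MvPolynomial.ext _ _ fun m => by
  simp only [MvPolynomial.mapAlgHom_apply, MvPolynomial.coeff_map]
  exact secRes_comp X h h' _

theorem mapAlgHom_secRes_self {X : SchOver k} {V : X.left.affineOpens} (h : V.1 ≤ V.1) {σ : Type*}
    (p : MvPolynomial σ (Sec X V)) : MvPolynomial.mapAlgHom (secRes X h) p = p := MvPolynomial.ext _ _ fun m => by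
  rw [MvPolynomial.mapAlgHom_apply, MvPolynomial.coeff_map]
  exact secRes_self X h _

theorem chartPoly_res_of_le {c c' : Chart L} (hU : c'.U.1 ≤ c.U.1) (hV : c'.V.1 ≤ c.V.1)
    {φ : (Fin n → LoopForms c.ev) → Sec L.X c.V} {φ' : (Fin n → LoopForms c'.ev) → Sec L.X c'.V}
    (hφ : IsLoopCochain φ) (hφ' : IsLoopCochain φ') (h : IsResOf hU hV φ φ') (x : Fin n → Sec L.X c.V) :
    chartPoly hS c' φ' (fun q => secRes L.X hV (x q)) = MvPolynomial.mapAlgHom (secRes L.X hV) (chartPoly hS c φ x) := by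
  refine IsPolyCochain.natural (secRes L.X hV) c.jetUniversal (hS.δ c) c.forms (fun x => (S.res_δ hV x).symm)
    (chartPoly_isPolyCochain hS hφ) (chartPoly_isPolyCochain hS hφ') (fun a => dcoeff_ext k fun m => ?_) x
  simp only [← c.jet_res c' hU hV]
  rw [dcoeff_chartPoly_jet hS hφ', dcoeff_mapAlgHom, dcoeff_chartPoly_jet hS hφ]
  exact h (fun q => m q) a

variable {W : Opens L.X.left}

theorem chartPoly_res (φ : loopCochains L n W) (c c' : {c : Chart L // c.V.1 ≤ W}) (hV : c'.1.V.1 ≤ c.1.V.1)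
    (x : Fin n → Sec L.X c.1.V) : chartPoly hS c'.1 (φ.1 c') (fun q => secRes L.X hV (x q)) =
      MvPolynomial.mapAlgHom (secRes L.X hV) (chartPoly hS c.1 (φ.1 c) x) :=
  mvPolynomial_ext_of_cover fun y hy => by
    obtain ⟨d, h1, h2, h3, h4, h5, h6⟩ := exists_common_chart c.1 c'.1 W (hV hy) hy (c'.2 hy)
    refine ⟨d.V, h4, h6, ?_⟩
    rw [mapAlgHom_secRes_comp, ← chartPoly_res_of_le hS h2 h4 (φ.2.1 c') (φ.2.1 ⟨d, h5⟩) (φ.2.2 c' ⟨d, h5⟩ h2 h4),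
      ← chartPoly_res_of_le hS h1 h3 (φ.2.1 c) (φ.2.1 ⟨d, h5⟩) (φ.2.2 c ⟨d, h5⟩ h1 h3)]
    simp only [secRes_comp]

/-- The polynomials that are given on charts by `chartPoly`. -/
def IsSecPoly (φ : loopCochains L n W) {V : L.X.left.affineOpens} (hV : V.1 ≤ W)
    (F : (Fin n → Sec L.X V) → MvPolynomial (Fin n) (Sec L.X V)) : Prop :=
  ∀ (c : Chart L) (h : c.V.1 ≤ V.1) (x : Fin n → Sec L.X V), MvPolynomial.mapAlgHom (secRes L.X h) (F x) =
    chartPoly hS c (φ.1 ⟨c, h.trans hV⟩) fun q => secRes L.X h (x q)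

variable {hS}

theorem IsSecPoly.eq_res {φ : loopCochains L n W} {W' : Opens L.X.left} (f : W' ≤ W) {V V' : L.X.left.affineOpens}
    (hVV' : V'.1 ≤ V.1) {hV : V.1 ≤ W} {hV' : V'.1 ≤ W'} {F : (Fin n → Sec L.X V) → MvPolynomial (Fin n) (Sec L.X V)}
    {F' : (Fin n → Sec L.X V') → MvPolynomial (Fin n) (Sec L.X V')} (hF : IsSecPoly hS φ hV F)
    (hF' : IsSecPoly hS (loopRes L n f φ) hV' F') (x : Fin n → Sec L.X V) :
    F' (fun q => secRes L.X hVV' (x q)) = MvPolynomial.mapAlgHom (secRes L.X hVV') (F x) :=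
  mvPolynomial_ext_of_cover fun y hy => by
    obtain ⟨_, ⟨c, rfl⟩, hxc, hc⟩ := chartOpens_isAffineBasis L y V'.1 hy
    refine ⟨c.V, hc, hxc, ?_⟩
    rw [hF' c hc, mapAlgHom_secRes_comp, hF c (hc.trans hVV')]
    simp only [secRes_comp]
    rfl

theorem IsSecPoly.unique {φ : loopCochains L n W} {V : L.X.left.affineOpens} {hV : V.1 ≤ W}
    {F F' : (Fin n → Sec L.X V) → MvPolynomial (Fin n) (Sec L.X V)} (hF : IsSecPoly hS φ hV F)
    (hF' : IsSecPoly hS φ hV F') : F = F' := funext fun x => mvPolynomial_ext_of_cover fun y hy => by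
  obtain ⟨_, ⟨c, rfl⟩, hxc, hc⟩ := chartOpens_isAffineBasis L y V.1 hy
  exact ⟨c.V, hc, hxc, by rw [hF c hc, hF' c hc]⟩

variable (hS)

theorem exists_isSecPoly (φ : loopCochains L n W) (V : L.X.left.affineOpens) (hV : V.1 ≤ W) :
    ∃ F, IsSecPoly hS φ hV F := by
  have hB := chartOpens_isAffineBasis L
  have h1 : ∀ V' : Below (chartOpens L) V.1, ∃ F : (Fin n → Sec L.X V'.1) → MvPolynomial (Fin n) (Sec L.X V'.1),
      IsSecPoly hS φ (V'.2.2.trans hV) F := by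
    rintro ⟨_, ⟨c, rfl⟩, hc⟩
    exact ⟨chartPoly hS c (φ.1 ⟨c, hc.trans hV⟩),
      fun c' h x => (chartPoly_res hS φ ⟨c, hc.trans hV⟩ ⟨c', _⟩ h x).symm⟩
  choose F hF using h1
  have h2 := fun x : Fin n → Sec L.X V => hB.glue_mvPolynomial
    (fun V' => F V' fun q => secRes L.X V'.2.2 (x q)) fun V₁ V₂ h => by
      rw [← IsSecPoly.eq_res le_rfl h (hF V₁) (hF V₂)]
      simp only [secRes_comp]
  choose G hG using h2
  refine ⟨G, fun c h x => ?_⟩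
  rw [hG x ⟨c.V, ⟨c, rfl⟩, h⟩]
  have e := hF ⟨c.V, ⟨c, rfl⟩, h⟩ c le_rfl fun q => secRes L.X h (x q)
  rw [mapAlgHom_secRes_self] at e
  simp only [secRes_self] at e
  exact e

/-- The polynomial `φ(e^{λ_1 z} dx_1, …, e^{λ_n z} dx_n)` on an affine open. -/
def secPoly (φ : loopCochains L n W) (V : L.X.left.affineOpens) (hV : V.1 ≤ W) :
    (Fin n → Sec L.X V) → MvPolynomial (Fin n) (Sec L.X V) := Classical.choose (exists_isSecPoly hS φ V hV)

theorem secPoly_isSecPoly (φ : loopCochains L n W) (V : L.X.left.affineOpens) (hV : V.1 ≤ W) :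
    IsSecPoly hS φ hV (secPoly hS φ V hV) := Classical.choose_spec (exists_isSecPoly hS φ V hV)

theorem secPoly_chart (φ : loopCochains L n W) (c : Chart L) (hc : c.V.1 ≤ W) :
    secPoly hS φ c.V hc = chartPoly hS c (φ.1 ⟨c, hc⟩) := funext fun x => by
  have e := secPoly_isSecPoly hS φ c.V hc c le_rfl x
  rw [mapAlgHom_secRes_self] at e
  simp only [secRes_self] at e
  exact e

theorem secPoly_isPolyCochain (φ : loopCochains L n W) (V : L.X.left.affineOpens) (hV : V.1 ≤ W) :
    IsPolyCochain (S.pva V).δ (secPoly hS φ V hV) :=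
  IsPolyCochain.of_family (fun c : {c : Chart L // c.V.1 ≤ V.1} => secRes L.X c.2)
    (fun p q h => mvPolynomial_ext_of_cover fun y hy => by
      obtain ⟨_, ⟨c, rfl⟩, hxc, hc⟩ := chartOpens_isAffineBasis L y V.1 hy
      exact ⟨c.V, hc, hxc, h ⟨c, hc⟩⟩)
    (fun c x => (S.res_δ c.2 x).symm)
    (fun c => chartPoly_isPolyCochain hS (φ.2.1 ⟨c.1, c.2.trans hV⟩))
    (fun c x => secPoly_isSecPoly hS φ V hV c.1 c.2 x)

/-- The cochain that corresponds to a section of the big complex. -/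
def toCochain (W : Opens L.X.left) : loopCochains L n W →ₗ[k] S.cochains n W where
  toFun φ := ⟨fun V => quotCochain (S.pva V.1).δ (secPoly hS φ V.1 V.2),
    fun V => (secPoly_isPolyCochain hS φ V.1 V.2).isCochain,
    fun V V' h x => congrArg Submodule.Quotient.mk
      (IsSecPoly.eq_res le_rfl h (secPoly_isSecPoly hS φ V.1 V.2) (secPoly_isSecPoly hS φ V'.1 V'.2) x)⟩
  map_add' φ ψ := Subtype.ext <| funext fun V => funext fun x => congrArg Submodule.Quotient.mk <| congrFun
    ((secPoly_isSecPoly hS (φ + ψ) V.1 V.2).unique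
      (F' := fun x => secPoly hS φ V.1 V.2 x + secPoly hS ψ V.1 V.2 x) fun c h x => by
        rw [map_add, secPoly_isSecPoly hS φ V.1 V.2 c h, secPoly_isSecPoly hS ψ V.1 V.2 c h]
        exact (chartPoly_add hS (φ.2.1 _) (ψ.2.1 _) _).symm) x
  map_smul' t φ := Subtype.ext <| funext fun V => funext fun x => congrArg Submodule.Quotient.mk <| congrFun
    ((secPoly_isSecPoly hS (t • φ) V.1 V.2).unique (F' := fun x => t • secPoly hS φ V.1 V.2 x) fun c h x => by
        rw [map_smul, secPoly_isSecPoly hS φ V.1 V.2 c h]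
        exact (chartPoly_smul hS (φ.2.1 _) t _).symm) x

theorem toCochain_res {W' : Opens L.X.left} (f : W' ≤ W) (φ : loopCochains L n W) :
    toCochain hS W' (loopRes L n f φ) = S.res n f (toCochain hS W φ) :=
  Subtype.ext <| funext fun V => funext fun x => congrArg Submodule.Quotient.mk <| congrFun
    ((secPoly_isSecPoly hS (loopRes L n f φ) V.1 V.2).unique
      fun c h x => secPoly_isSecPoly hS φ V.1 (V.2.trans f) c h x) x

theorem toCochain_delta {φ : LoopFam L n W} (hφ : φ ∈ loopCochains L n W)
    (hφ' : loopFamDelta hS n W φ ∈ loopCochains L n W) : toCochain hS W ⟨_, hφ'⟩ = 0 :=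
  Subtype.ext <| funext fun V => funext fun x => (Submodule.Quotient.mk_eq_zero _).mpr
    ⟨secPoly hS ⟨φ, hφ⟩ V.1 V.2 x, (congrFun ((secPoly_isSecPoly hS ⟨_, hφ'⟩ V.1 V.2).unique
      (F' := fun x => totalOp (S.pva V.1).δ n (secPoly hS ⟨φ, hφ⟩ V.1 V.2 x)) fun c h x => by
        rw [totalOp_map _ (δ' := (S.pva c.V).δ) fun x => (S.res_δ h x).symm, secPoly_isSecPoly hS ⟨φ, hφ⟩ V.1 V.2 c h]
        exact (chartPoly_cochainDelta hS (hφ.1 ⟨c, h.trans V.2⟩) _).symm) x).symm⟩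

theorem toCochain_d {𝒜 : ∀ c : Chart L, TopLieAlgebroid c.ev} (h𝒜 : ∀ c, (𝒜 c).IsCotangent (P.bracket c.U))
    {φ : LoopFam L n W} (hφ : φ ∈ loopCochains L n W) (hφ' : loopFamD 𝒜 n W φ ∈ loopCochains L (n + 1) W) :
    (toCochain hS W ⟨_, hφ'⟩).1 = S.famD n W (toCochain hS W ⟨φ, hφ⟩).1 :=
  funext fun V => funext fun x => lamQuot_ext S (chartOpens_isAffineBasis L) fun ⟨_, ⟨c, hc⟩, hV⟩ => by
    subst hc
    rw [← (toCochain hS W ⟨_, hφ'⟩).2.2 V ⟨c.V, hV.trans V.2⟩ hV]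
    refine Eq.trans ?_ (lamRes_d S hV ((toCochain hS W ⟨φ, hφ⟩).2.1 ⟨c.V, hV.trans V.2⟩)
      ((toCochain hS W ⟨φ, hφ⟩).2.2 V ⟨c.V, hV.trans V.2⟩ hV) x)
    change quotCochain _ (secPoly hS ⟨_, hφ'⟩ c.V _) _ =
      (S.pva c.V).d (quotCochain _ (secPoly hS ⟨φ, hφ⟩ c.V _)) _
    rw [secPoly_chart, secPoly_chart]
    exact congrFun (chartPoly_d hS (h𝒜 c) (hφ.1 ⟨c, hV.trans V.2⟩)) _

end Phi

/-! ## Local surjectivity and the kernel -/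

section Local

variable {k : Type u} [Field k] [CharZero k] {M : SchOver k} {L : ArcSpace M} {n : ℕ}

theorem Chart.jet_shrink (c : Chart L) {V : L.X.left.affineOpens} (h : V.1 ≤ c.V.1) (i : ℕ) (a : Sec M c.U) :
    jet (c.shrink V h).ev i a = secRes L.X h (jet c.ev i a) :=
  PowerSeries.coeff_map (secRes L.X h : Sec L.X c.V →+* Sec L.X V) i (c.ev a)

theorem exists_vecField (c : Chart L) {V : L.X.left.affineOpens} (h : V.1 ≤ c.V.1)
    (η : Derivation k (Sec M c.U) (Sec M c.U)) : ∃ D : Derivation k (Sec L.X V) (Sec L.X V),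
      ∀ a i, D (secRes L.X h (jet c.ev i a)) = secRes L.X h (jet c.ev i (η a)) := by
  obtain ⟨D, hD⟩ := (c.shrink V h).jetUniversal.exists_jetDerivation η
  exact ⟨D, fun a i => (congrArg D (c.jet_shrink h i a)).symm.trans ((hD a i).trans (c.jet_shrink h i (η a)))⟩

/-- The vector field on a smaller open that is induced by a vector field on `M`. -/
def Chart.vecField (c : Chart L) {V : L.X.left.affineOpens} (h : V.1 ≤ c.V.1)
    (η : Derivation k (Sec M c.U) (Sec M c.U)) : Derivation k (Sec L.X V) (Sec L.X V) :=
  Classical.choose (exists_vecField c h η)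

theorem Chart.vecField_jet (c : Chart L) {V : L.X.left.affineOpens} (h : V.1 ≤ c.V.1)
    (η : Derivation k (Sec M c.U) (Sec M c.U)) (a : Sec M c.U) (i : ℕ) :
    c.vecField h η (secRes L.X h (jet c.ev i a)) = secRes L.X h (jet c.ev i (η a)) :=
  Classical.choose_spec (exists_vecField c h η) a i

theorem Chart.vecField_res (c : Chart L) {V V' : L.X.left.affineOpens} (h : V.1 ≤ c.V.1) (h' : V'.1 ≤ V.1)
    (η : Derivation k (Sec M c.U) (Sec M c.U)) (x : Sec L.X V) :
    c.vecField (h'.trans h) η (secRes L.X h' x) = secRes L.X h' (c.vecField h η x) := by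
  have e (a : Sec M c.U) (i : ℕ) : secRes L.X h' (c.vecField h η (secRes L.X h (jet c.ev i a))) =
      c.vecField (h'.trans h) η (secRes L.X h' (secRes L.X h (jet c.ev i a))) := by
    rw [c.vecField_jet, secRes_comp, secRes_comp, c.vecField_jet]
  exact ((c.shrink V h).jetUniversal.delta_compat (secRes L.X h') _ _ fun a i => e a i) x |>.symm

variable (c : Chart L) (𝒳 : FormBasis k (Sec M c.U))
  (Q : (Fin n → Fin 𝒳.r) → MvPolynomial (Fin n) (Sec L.X c.V))

/-- The section of the big complex over a chart with coordinates that is given by a family of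
polynomials. -/
def liftSection : loopCochains L n c.V.1 :=
  ⟨fun c' => liftCochain c'.1.ev (fun j => c.vecField c'.2 (𝒳.η j)) fun J => MvPolynomial.mapAlgHom (secRes L.X c'.2) (Q J),
    fun c' => liftCochain_isLoopCochain _ _, fun c' c'' hU hV m a => by
      have e := liftCochain_map (fun j => c.vecField c'.2 (𝒳.η j))
        (fun J => MvPolynomial.mapAlgHom (secRes L.X c'.2) (Q J)) (ev' := c''.1.ev) (secRes M hU) (secRes L.X hV)
        (c'.1.jet_res c''.1 hU hV) (fun j => c.vecField c''.2 (𝒳.η j)) (fun j => c.vecField_res c'.2 hV (𝒳.η j)) m a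
      simp only [mapAlgHom_secRes_comp] at e
      exact e⟩

variable [Smooth M.hom] {P : PoissonStr M} {S : PVStr L.X} (hS : S.IsArc P)

variable {𝒳} in
theorem chartPoly_liftSection (h𝒳 : 𝒳.IsCoord) (J : Fin n → Fin 𝒳.r) :
    chartPoly hS c ((liftSection c 𝒳 Q).1 ⟨c, le_rfl⟩) (fun q => jet c.ev 0 (𝒳.x (J q))) = altPoly k Q J := by
  rw [chartPoly_jet, ← c.jetUniversal.expPoly_jet (hS.δ c) 𝒳]
  have e : (liftSection c 𝒳 Q).1 ⟨c, le_rfl⟩ = liftCochain c.ev (fun j => c.vecField le_rfl (𝒳.η j)) Q := by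
    change liftCochain _ _ _ = _
    simp only [mapAlgHom_secRes_self]
  rw [e]
  refine c.jetUniversal.expPoly_liftCochain 𝒳 (hS.δ c) h𝒳 (fun j a i => ?_) Q J
  have e' := c.vecField_jet le_rfl (𝒳.η j) a i
  rwa [secRes_self, secRes_self] at e'

variable {c} in
theorem chartPoly_injective {φ ψ : (Fin n → LoopForms c.ev) → Sec L.X c.V} (hφ : IsLoopCochain φ)
    (hψ : IsLoopCochain ψ) (h : ∀ J : Fin n → Fin 𝒳.r, chartPoly hS c φ (fun q => jet c.ev 0 (𝒳.x (J q))) =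
      chartPoly hS c ψ fun q => jet c.ev 0 (𝒳.x (J q))) : φ = ψ := by
  obtain ⟨N, hN⟩ := hφ.continuous
  obtain ⟨N', hN'⟩ := hψ.continuous
  refine sub_eq_zero.mp (IsAlt.eq_zero_of_generators 𝒳 (hφ.isAlt.sub hψ.isAlt) (N := max N N')
    (fun v hv => ?_) fun s => ?_)
  · obtain ⟨i, hi⟩ := hv
    rw [Pi.sub_apply, hN v ⟨i, loopFilt_mono (le_max_left _ _) hi⟩,
      hN' v ⟨i, loopFilt_mono (le_max_right _ _) hi⟩, sub_zero]
  · have e := congrArg (dcoeff (expo fun q => ((s q).2 : ℕ))) (h fun q => (s q).1)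
    rw [dcoeff_chartPoly_jet hS hφ, dcoeff_chartPoly_jet hS hψ] at e
    exact sub_eq_zero.mpr e

variable {c} in
theorem loopCochains_ext (hS : S.IsArc P) {φ ψ : loopCochains L n c.V.1} (h : φ.1 ⟨c, le_rfl⟩ = ψ.1 ⟨c, le_rfl⟩) : φ = ψ := by
  refine Subtype.ext (funext fun c' => chartPoly_injective c'.1.forms hS (φ.2.1 c') (ψ.2.1 c') fun J => ?_)
  have e := IsPolyCochain.natural (AlgHom.id k (Sec L.X c'.1.V)) (c.shrink c'.1.V c'.2).jetUniversal
    (hS.δ (c.shrink c'.1.V c'.2)) c.forms (fun _ => rfl) (chartPoly_isPolyCochain (c := c'.1) hS (φ.2.1 c'))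
    (chartPoly_isPolyCochain (c := c'.1) hS (ψ.2.1 c')) (fun a => ?_)
    (fun q => jet c'.1.ev 0 (c'.1.forms.x (J q)))
  · have e' : MvPolynomial.mapAlgHom (σ := Fin n) (AlgHom.id k (Sec L.X c'.1.V)) = AlgHom.id k _ :=
      AlgHom.ext fun p => MvPolynomial.map_id p
    rw [e'] at e
    exact e.symm
  · have e' : MvPolynomial.mapAlgHom (σ := Fin n) (AlgHom.id k (Sec L.X c'.1.V)) = AlgHom.id k _ :=
      AlgHom.ext fun p => MvPolynomial.map_id p
    rw [e']
    change chartPoly hS c'.1 (ψ.1 c') (fun q => secRes L.X c'.2 (jet c.ev 0 (a q))) =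
      chartPoly hS c'.1 (φ.1 c') fun q => secRes L.X c'.2 (jet c.ev 0 (a q))
    rw [chartPoly_res hS φ ⟨c, le_rfl⟩ c' c'.2 fun q => jet c.ev 0 (a q),
      chartPoly_res hS ψ ⟨c, le_rfl⟩ c' c'.2 fun q => jet c.ev 0 (a q), h]

variable {c} in
theorem cochains_ext (hS : S.IsArc P) {Y Z : S.cochains n c.V.1} (h : Y.1 ⟨c.V, le_rfl⟩ = Z.1 ⟨c.V, le_rfl⟩) : Y = Z :=
  Subtype.ext <| funext fun V => by
    refine PVA.IsCochain.ext (c.shrink V.1 V.2).jetUniversal (hS.δ (c.shrink V.1 V.2)) c.forms (Y.2.1 V) (Z.2.1 V)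
      fun J => ?_
    change Y.1 V (fun q => secRes L.X V.2 (jet c.ev 0 (c.forms.x (J q)))) =
      Z.1 V fun q => secRes L.X V.2 (jet c.ev 0 (c.forms.x (J q)))
    rw [Y.2.2 ⟨c.V, le_rfl⟩ V V.2 fun q => jet c.ev 0 (c.forms.x (J q)),
      Z.2.2 ⟨c.V, le_rfl⟩ V V.2 fun q => jet c.ev 0 (c.forms.x (J q)), h]

variable {𝒳}

theorem exists_lift (h𝒳 : 𝒳.IsCoord) {Y : (Fin n → Sec L.X c.V) → LamQuot (S.pva c.V).δ n}
    (hY : (S.pva c.V).IsCochain Y) : ∃ φ : loopCochains L n c.V.1,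
      quotCochain (S.pva c.V).δ (chartPoly hS c (φ.1 ⟨c, le_rfl⟩)) = Y := by
  have h1 := fun J : Fin n → Fin 𝒳.r => Submodule.Quotient.mk_surjective _ (Y fun q => jet c.ev 0 (𝒳.x (J q)))
  choose Q hQ using h1
  refine ⟨liftSection c 𝒳 Q, PVA.IsCochain.ext c.jetUniversal (hS.δ c) 𝒳
    (chartPoly_isPolyCochain (c := c) hS ((liftSection c 𝒳 Q).2.1 ⟨c, le_rfl⟩)).isCochain hY fun J => ?_⟩
  rw [quotCochain, chartPoly_liftSection c Q hS h𝒳]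
  exact mk_altPoly (S.pva c.V).δ Q _ hQ J fun τ => hY.antisymm (fun q => jet c.ev 0 (𝒳.x (J q))) τ

/-- Local surjectivity. -/
theorem exists_local_preimage {W : Opens L.X.left} (Y : S.cochains n W) {x : L.X.left} (hx : x ∈ W) :
    ∃ (V : L.X.left.affineOpens) (hV : V.1 ≤ W) (φ : loopCochains L n V.1), x ∈ V.1 ∧
      toCochain hS V.1 φ = S.res n hV Y := by
  obtain ⟨_, ⟨c, rfl, 𝒳, h𝒳⟩, hxc, hc⟩ := coordOpens_isAffineBasis L x W hx
  obtain ⟨φ, hφ⟩ := exists_lift c hS h𝒳 (Y.2.1 ⟨c.V, hc⟩)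
  refine ⟨c.V, hc, φ, hxc, cochains_ext hS (Eq.trans ?_ hφ)⟩
  change quotCochain _ (secPoly hS φ c.V _) = _
  rw [secPoly_chart]

/-- The kernel is locally the image of `δ`. -/
theorem exists_local_primitive {W : Opens L.X.left} (φ : loopCochains L n W) (h : toCochain hS W φ = 0)
    {x : L.X.left} (hx : x ∈ W) : ∃ (V : L.X.left.affineOpens) (hV : V.1 ≤ W) (ψ : loopCochains L n V.1), x ∈ V.1 ∧
      loopFamDelta hS n V.1 ψ.1 = (loopRes L n hV φ).1 := by
  obtain ⟨_, ⟨c, rfl, 𝒳, h𝒳⟩, hxc, hc⟩ := coordOpens_isAffineBasis L x W hx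
  have h1 : ∀ y, quotCochain (S.pva c.V).δ (chartPoly hS c (φ.1 ⟨c, hc⟩)) y = 0 := fun y => by
    rw [← secPoly_chart]
    exact congrFun (congrFun (congrArg Subtype.val h) ⟨c.V, hc⟩) y
  choose Q hQ using fun J : Fin n → Fin 𝒳.r =>
    (Submodule.Quotient.mk_eq_zero _).mp (h1 fun q => jet c.ev 0 (𝒳.x (J q)))
  have hmem : loopFamDelta hS n c.V.1 (liftSection c 𝒳 Q).1 ∈ loopCochains L n c.V.1 :=
    ⟨fun c' => ((liftSection c 𝒳 Q).2.1 c').cochainDelta (hS.δ c'.1), fun c' c'' hU hV => cochainDelta_res hU hV hS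
      ((liftSection c 𝒳 Q).2.1 c') ((liftSection c 𝒳 Q).2.1 c'') ((liftSection c 𝒳 Q).2.2 c' c'' hU hV)⟩
  have e : (⟨_, hmem⟩ : loopCochains L n c.V.1) = loopRes L n hc φ := by
    refine loopCochains_ext hS (chartPoly_injective 𝒳 hS (hmem.1 _) (φ.2.1 ⟨c, hc⟩) fun J => ?_)
    refine (chartPoly_cochainDelta hS ((liftSection c 𝒳 Q).2.1 _) _).trans ?_
    rw [chartPoly_liftSection c Q hS h𝒳]
    exact totalOp_altPoly _ Q (fun J => chartPoly hS c (φ.1 ⟨c, hc⟩) fun q => jet c.ev 0 (𝒳.x (J q))) hQ J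
      fun τ => (chartPoly_isPolyCochain hS (φ.2.1 ⟨c, hc⟩)).antisymm (fun q => jet c.ev 0 (𝒳.x (J q))) τ
  exact ⟨c.V, hc, liftSection c 𝒳 Q, hxc, congrArg Subtype.val e⟩

theorem isCochain_d (hS : S.IsArc P) {V : L.X.left.affineOpens} (hV : V ∈ coordOpens L)
    {Y : (Fin n → Sec L.X V) → LamQuot (S.pva V).δ n} (hY : (S.pva V).IsCochain Y) :
    (S.pva V).IsCochain ((S.pva V).d Y) ∧ (S.pva V).d ((S.pva V).d Y) = 0 := by
  obtain ⟨c, rfl, 𝒳, h𝒳⟩ := hV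
  obtain ⟨φ, rfl⟩ := exists_lift c hS h𝒳 hY
  obtain ⟨𝒜, h𝒜, -⟩ := exists_unique_isCotangent (L := L) (P := P)
  have hd := (h𝒜 c).d_isLoopCochain c.jetUniversal c.forms (φ.2.1 ⟨c, le_rfl⟩)
  rw [← chartPoly_d hS (h𝒜 c) (φ.2.1 _), ← chartPoly_d hS (h𝒜 c) hd,
    (h𝒜 c).d_d c.jetUniversal c.forms (φ.2.1 ⟨c, le_rfl⟩)]
  refine ⟨(chartPoly_isPolyCochain hS hd).isCochain, funext fun x => ?_⟩
  have e := chartPoly_smul hS (IsLoopCochain.zero (ev := c.ev) (n := n + 2)) (0 : k) x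
  rw [zero_smul, zero_smul] at e
  exact congrArg Submodule.Quotient.mk e

theorem isComplex (hS : S.IsArc P) : S.IsComplex := by
  have hmem : ∀ n W, ∀ Y ∈ S.cochains n W, S.famD n W Y ∈ S.cochains (n + 1) W := fun n W Y hY =>
    ⟨fun V => isCochain_of_family S (coordOpens_isAffineBasis L)
      (fun V' => (S.pva V'.1).d (Y ⟨V'.1, V'.2.2.trans V.2⟩))
      (fun V' => (isCochain_d hS V'.2.1 (hY.1 ⟨V'.1, V'.2.2.trans V.2⟩)).1)
      (fun V' a => lamRes_d S V'.2.2 (hY.1 ⟨V'.1, V'.2.2.trans V.2⟩) (hY.2 V ⟨V'.1, V'.2.2.trans V.2⟩ V'.2.2) a),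
    fun V V' h a => lamRes_d S h (hY.1 V') (hY.2 V V' h) a⟩
  refine ⟨hmem, fun n W Y hY => funext fun V => funext fun a =>
    lamQuot_ext S (coordOpens_isAffineBasis L) fun V' => ?_⟩
  have h1 := (hmem (n + 1) W _ (hmem n W Y hY)).2 V ⟨V'.1, V'.2.2.trans V.2⟩ V'.2.2 a
  rw [← h1]
  exact (congrFun (isCochain_d hS V'.2.1 (hY.1 ⟨V'.1, V'.2.2.trans V.2⟩)).2 _).trans (map_zero _).symm

end Local

/-! ## Wedge products of vector fields -/

section Wedge

theorem dcoeff_prod_aeval_X {k B : Type*} [Field k] [CommRing B] [Algebra k B] {n : ℕ} (r : Fin n → Polynomial B)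
    (m : Fin n →₀ ℕ) : dcoeff m (∏ q, Polynomial.aeval (MvPolynomial.X q : MvPolynomial (Fin n) B) (r q)) =
      ∏ q, pcoeff (m q) (r q) := by
  classical
  have key : ∀ (s : Finset (Fin n)) (m : Fin n →₀ ℕ),
      dcoeff m (∏ q ∈ s, Polynomial.aeval (MvPolynomial.X q : MvPolynomial (Fin n) B) (r q)) =
        if ∀ q, q ∉ s → m q = 0 then ∏ q ∈ s, pcoeff (m q) (r q) else 0 := fun s => by
    induction s using Finset.induction_on with
    | empty =>
      intro m
      rw [Finset.prod_empty, Finset.prod_empty, ← MvPolynomial.C_1, dcoeff_C]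
      exact if_congr (by simp [Finsupp.ext_iff]) rfl rfl
    | insert i s hi ih =>
      intro m
      set p := ∏ q ∈ s, Polynomial.aeval (MvPolynomial.X q : MvPolynomial (Fin n) B) (r q)
      have e : Polynomial.aeval (MvPolynomial.X i : MvPolynomial (Fin n) B) (r i) * p = (r i).sum fun j c =>
          MvPolynomial.X i ^ j * (LinearMap.mulRight k p ∘ₗ
            (Algebra.linearMap B (MvPolynomial (Fin n) B)).restrictScalars k) c := by
        rw [Polynomial.aeval_def, Polynomial.eval₂_eq_sum, Polynomial.sum_def, Polynomial.sum_def, Finset.sum_mul]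
        refine Finset.sum_congr rfl fun j _ => ?_
        rw [mul_comm (algebraMap B _ _), mul_assoc]
        rfl
      rw [Finset.prod_insert hi, Finset.prod_insert hi, e, dcoeff_sum_X_pow_mul]
      have h1 : ∀ j (c : B), dcoeff (m - Finsupp.single i j) ((LinearMap.mulRight k p ∘ₗ
          (Algebra.linearMap B (MvPolynomial (Fin n) B)).restrictScalars k) c) =
          c * dcoeff (m - Finsupp.single i j) p := fun j c => dcoeff_C_mul _ c p
      simp only [h1, ih]
      have hne : ∀ q, q ≠ i → ∀ j, (m - Finsupp.single i j : Fin n →₀ ℕ) q = m q := fun q hq j => by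
        rw [Finsupp.tsub_apply, Finsupp.single_eq_of_ne hq, Nat.sub_zero]
      rw [Finset.sum_eq_single (m i)]
      · rw [Nat.choose_self, one_smul]
        have h2 : (∀ q, q ∉ s → (m - Finsupp.single i (m i) : Fin n →₀ ℕ) q = 0) ↔ ∀ q, q ∉ insert i s → m q = 0 := by
          refine ⟨fun h q hq => ?_, fun h q hq => ?_⟩
          · rw [Finset.mem_insert, not_or] at hq
            rw [← hne q hq.1 (m i)]
            exact h q hq.2
          · by_cases hqi : q = i
            · subst hqi; simp
            · rw [hne q hqi]
              exact h q (by simp [hqi, hq])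
        rw [if_congr h2 rfl rfl, mul_ite, mul_zero]
        refine if_congr Iff.rfl ?_ rfl
        rw [Finset.prod_congr rfl fun q hq => by rw [hne q (fun h => hi (h ▸ hq))]]
      · intro j hj hji
        rw [if_neg fun h => ?_, mul_zero, smul_zero]
        have := h i hi
        rw [Finsupp.tsub_apply, Finsupp.single_eq_same] at this
        rw [Finset.mem_range] at hj
        omega
      · intro h
        exact absurd (Finset.mem_range.mpr (Nat.lt_succ_self _)) h
  rw [key, if_pos fun q hq => absurd (Finset.mem_univ q) hq]

variable {k A B : Type u} [Field k] [CommRing A] [CommRing B] [Algebra k A] [Algebra k B] [CharZero k]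
variable {ev : A →ₐ[k] PowerSeries B} {δ : Derivation k B B} {n : ℕ}

theorem thetaLam_eq_aeval (δ : Derivation k B B) (η : Derivation k A A) (i : ℕ) (q : Fin n) (a : A) :
    thetaLam ev δ η i q a = Polynomial.aeval (MvPolynomial.X q) (((i.factorial : k)⁻¹) •
      (-1 : ℤ) ^ i • (pneg δ ^ i) (Polynomial.C (jet ev 0 (η a)))) := by
  have h : ∀ j (b : B), ((coefMap δ.toLinearMap + LinearMap.mulLeft k (MvPolynomial.X q) :
      Module.End k (MvPolynomial (Fin n) B)) ^ j) (MvPolynomial.C b) =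
      Polynomial.aeval (MvPolynomial.X q) ((-1 : ℤ) ^ j • (pneg δ ^ j) (Polynomial.C b)) := fun j b => by
    induction j with
    | zero => simp [MvPolynomial.algebraMap_eq]
    | succ j ih =>
      rw [pow_succ', Module.End.mul_apply, ih, LinearMap.add_apply, coefMap_aeval_X, pow_succ' (pneg δ),
        Module.End.mul_apply, pneg_apply, pow_succ, mul_neg_one, neg_smul, smul_neg, neg_neg, smul_add, map_add,
        map_zsmul (polyCoefMap _), map_zsmul _ _ (Polynomial.X * _), map_mul, Polynomial.aeval_X, map_zsmul, map_zsmul,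
        map_zsmul, LinearMap.mulLeft_apply]
  rw [thetaLam, h]
  exact (AlgHom.map_smul_of_tower _ _ _).symm

theorem pcoeff_thetaLam (hδ : IsArcDerivation ev δ) (η : Derivation k A A) (i j : ℕ) (a : A) :
    pcoeff j (((i.factorial : k)⁻¹) • (-1 : ℤ) ^ i • (pneg δ ^ i) (Polynomial.C (jet ev 0 (η a)))) =
      thetaForm ev η i (formGen ev (ArcRing.z ev ^ j) a) := by
  rw [pcoeff_smul, map_zsmul, pcoeff_pneg_pow, thetaForm, contract_formGen, ArcRing.coeff_z_pow_mul, dpow_jet hδ]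
  split_ifs with h
  · rw [smul_smul, ← mul_pow, neg_one_mul, neg_neg, one_pow, one_smul, ← Nat.cast_smul_eq_nsmul k,
      inv_smul_smul₀ (Nat.cast_ne_zero.mpr i.factorial_ne_zero)]
    rfl
  · rw [smul_zero, smul_zero]

theorem dcoeff_det_thetaLam (hδ : IsArcDerivation ev δ) (b : B) (η : Fin n → Derivation k A A) (i : Fin n → ℕ)
    (a : Fin n → A) (m : Fin n →₀ ℕ) : dcoeff m (MvPolynomial.C b * Matrix.det (Matrix.of fun p q =>
      thetaLam ev δ (η p) (i p) q (a q))) =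
        thetaWedge ev b η i fun q => formGen ev (ArcRing.z ev ^ m q) (a q) := by
  rw [dcoeff_C_mul, thetaWedge, Matrix.det_apply, Matrix.det_apply, map_sum]
  refine congrArg _ (Finset.sum_congr rfl fun σ _ => ?_)
  simp only [Units.smul_def, map_zsmul, Matrix.of_apply, thetaLam_eq_aeval]
  rw [dcoeff_prod_aeval_X (k := k)]
  simp only [pcoeff_thetaLam hδ]

end Wedge

/-! ## The isomorphism of complexes of sheaves -/

section Isomorphism

open Limits

variable {k : Type u} [Field k] [CharZero k] {M : SchOver k} [Smooth M.hom] {L : ArcSpace M} {P : PoissonStr M}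
  {S : PVStr L.X} {hS : S.IsArc P} {𝒜 : ∀ c : Chart L, TopLieAlgebroid c.ev}

/-- The morphism of complexes of presheaves `φ ↦ φ(e^{λ_1 z} -, …, e^{λ_n z} -)`. -/
def toCochainHom (h𝒜 : ∀ c, (𝒜 c).IsCotangent (P.bracket c.U)) (hP : S.IsComplex) (hL : IsLoopComplex 𝒜 hS) :
    loopPresheafComplex hL ⟶ S.presheafComplex hP :=
  CochainComplex.ofHom (X := loopPresheafComplex hL) (Y := S.presheafComplex hP)
    (fun n => { app := fun W => ModuleCat.ofHom (toCochain hS W.unop)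
                naturality := fun W W' f => by
                  ext φ
                  exact toCochain_res hS f.unop.le φ })
    (fun n => by
      have hd : (loopPresheafComplex hL).d n (n + 1) = loopPresheafD hL n := CochainComplex.of_d ..
      have hd' : (S.presheafComplex hP).d n (n + 1) = S.presheafD hP n := CochainComplex.of_d ..
      rw [hd, hd']
      ext W φ
      exact Subtype.ext (toCochain_d hS h𝒜 φ.2 (hL.mem n W.unop φ.1 φ.2)).symm)

variable (h𝒜 : ∀ c, (𝒜 c).IsCotangent (P.bracket c.U)) (hP : S.IsComplex) (hL : IsLoopComplex 𝒜 hS)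

theorem delta_toCochainHom : loopPresheafDelta hL ≫ toCochainHom h𝒜 hP hL = 0 := by
  ext n W φ
  exact toCochain_delta hS φ.2 (hL.mem_δ n W.unop φ.1 φ.2)

/-- The induced morphism on the quotient by `δ`, in complexes of presheaves. -/
def descHom : cokernel (loopPresheafDelta hL) ⟶ S.presheafComplex hP :=
  cokernel.desc _ _ (delta_toCochainHom h𝒜 hP hL)

theorem exists_cokernelProj_eq (n : ℕ) (W : (Opens L.X.left)ᵒᵖ)
    (y : ((cokernel (loopPresheafDelta hL)).X n).obj W) : ∃ φ : loopCochains L n W.unop,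
      (((cokernel.π (loopPresheafDelta hL)).f n).app W).hom φ = y :=
  (ModuleCat.epi_iff_surjective (((cokernel.π (loopPresheafDelta hL)).f n).app W)).mp inferInstance y

theorem descHom_proj (n : ℕ) (W : (Opens L.X.left)ᵒᵖ) (φ : loopCochains L n W.unop) :
    (((descHom h𝒜 hP hL).f n).app W).hom ((((cokernel.π (loopPresheafDelta hL)).f n).app W).hom φ) =
      toCochain hS W.unop φ := by
  have e : cokernel.π (loopPresheafDelta hL) ≫ descHom h𝒜 hP hL = toCochainHom h𝒜 hP hL := cokernel.π_desc _ _ _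
  exact congrArg (fun f : loopPresheafComplex hL ⟶ S.presheafComplex hP => ((f.f n).app W).hom φ) e

theorem isLocallySurjective_descHom (n : ℕ) :
    Presheaf.IsLocallySurjective (Opens.grothendieckTopology L.X.left) ((descHom h𝒜 hP hL).f n) where
  imageSieve_mem {W} Y := fun x hx => by
    obtain ⟨V, hV, φ, hxV, e⟩ := exists_local_preimage hS Y hx
    refine ⟨V.1, homOfLE hV, ⟨(((cokernel.π (loopPresheafDelta hL)).f n).app (op V.1)).hom φ, ?_⟩, hxV⟩
    exact (descHom_proj h𝒜 hP hL n (op V.1) φ).trans e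

theorem isLocallyInjective_descHom (n : ℕ) :
    Presheaf.IsLocallyInjective (Opens.grothendieckTopology L.X.left) ((descHom h𝒜 hP hL).f n) where
  equalizerSieve_mem {W} y y' h := fun x hx => by
    obtain ⟨φ, rfl⟩ := exists_cokernelProj_eq hL n W y
    obtain ⟨φ', rfl⟩ := exists_cokernelProj_eq hL n W y'
    have h1 : toCochain hS W.unop (φ - φ') = 0 := by
      rw [map_sub, sub_eq_zero, ← descHom_proj h𝒜 hP hL n W φ, ← descHom_proj h𝒜 hP hL n W φ']
      exact h
    obtain ⟨V, hV, ψ, hxV, e⟩ := exists_local_primitive hS (φ - φ') h1 hx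
    refine ⟨V.1, homOfLE hV, ?_, hxV⟩
    set π := cokernel.π (loopPresheafDelta hL)
    have h2 : ∀ φ : loopCochains L n W.unop, ((cokernel (loopPresheafDelta hL)).X n).map (homOfLE hV).op
        (((π.f n).app W).hom φ) = ((π.f n).app (op V.1)).hom (loopRes L n hV φ) := fun φ =>
      (NatTrans.naturality_apply (π.f n) (homOfLE hV).op φ).symm
    refine (h2 φ).trans (Eq.trans ?_ (h2 φ').symm)
    let g : loopCochains L n V.1 →ₗ[k] ((cokernel (loopPresheafDelta hL)).X n).obj (op V.1) :=
      ((π.f n).app (op V.1)).hom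
    change g _ = g _
    rw [← sub_eq_zero, ← map_sub, ← map_sub]
    have h3 : loopRes L n hV (φ - φ') = (((loopPresheafDelta hL).f n).app (op V.1)).hom ψ := Subtype.ext e.symm
    rw [h3]
    have h4 : loopPresheafDelta hL ≫ π = 0 := cokernel.condition _
    exact congrArg (fun f : loopPresheafComplex hL ⟶ cokernel (loopPresheafDelta hL) =>
      ((f.f n).app (op V.1)).hom ψ) h4

theorem isIso_sheafify_descHom : IsIso ((sheafify L.X).map (descHom h𝒜 hP hL)) := by
  have h : ∀ n, IsIso (((sheafify L.X).map (descHom h𝒜 hP hL)).f n) := fun n => by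
    have := isLocallySurjective_descHom h𝒜 hP hL n
    have := isLocallyInjective_descHom h𝒜 hP hL n
    have := (Opens.grothendieckTopology L.X.left).W_of_isLocallyBijective ((descHom h𝒜 hP hL).f n)
    exact (GrothendieckTopology.W_iff _ _).mp this
  exact HomologicalComplex.Hom.isIso_of_components _

/-- The isomorphism of complexes of sheaves. -/
def loopComplexIso : loopComplex hL ≅ S.complex hP :=
  have := isIso_sheafify_descHom h𝒜 hP hL
  (PreservesCokernel.iso (sheafify L.X) (loopPresheafDelta hL)).symm ≪≫
    (asIso ((sheafify L.X).map (descHom h𝒜 hP hL)) : (sheafify L.X).obj (cokernel (loopPresheafDelta hL)) ≅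
      (sheafify L.X).obj (S.presheafComplex hP))

theorem loopProj_loopComplexIso : loopProj hL ≫ (loopComplexIso h𝒜 hP hL).hom =
    (sheafify L.X).map (toCochainHom h𝒜 hP hL) := by
  have e : cokernel.π ((sheafify L.X).map (loopPresheafDelta hL)) ≫ (PreservesCokernel.iso (sheafify L.X) (loopPresheafDelta hL)).inv =
      (sheafify L.X).map (cokernel.π (loopPresheafDelta hL)) := by
    rw [Iso.comp_inv_eq]
    exact (PreservesCokernel.π_iso_hom (sheafify L.X) (loopPresheafDelta hL)).symm
  have e' : cokernel.π (loopPresheafDelta hL) ≫ descHom h𝒜 hP hL = toCochainHom h𝒜 hP hL := cokernel.π_desc _ _ _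
  rw [← e', Functor.map_comp, ← e, Category.assoc]
  rfl

theorem mk_expEval (n : ℕ) (W : Opens L.X.left) (φ : loopCochains L n W) (c : Chart L) (hc : c.V.1 ≤ W)
    (a : Fin n → Sec M c.U) : (imageFam (toCochainHom h𝒜 hP hL) n W φ).1 ⟨c.V, hc⟩ (fun q => jet c.ev 0 (a q)) =
      Submodule.Quotient.mk (expEval c.ev (φ.1 ⟨c, hc⟩) a) := by
  change Submodule.Quotient.mk (secPoly hS φ c.V hc fun q => jet c.ev 0 (a q)) = _
  rw [secPoly_chart, chartPoly_jet]

theorem expEval_thetaWedge (hS : S.IsArc P) {n : ℕ} (c : Chart L) (b : Sec L.X c.V) (η : Fin n → Derivation k (Sec M c.U) (Sec M c.U))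
    (i : Fin n → ℕ) (h : IsLoopCochain (thetaWedge c.ev b η i)) (a : Fin n → Sec M c.U) :
    expEval c.ev (thetaWedge c.ev b η i) a =
      MvPolynomial.C b * Matrix.det (Matrix.of fun p q => thetaLam c.ev (S.pva c.V).δ (η p) (i p) q (a q)) :=
  dcoeff_ext k fun m => by
    rw [dcoeff_det_thetaLam (hS.δ c), ← chartPoly_jet hS, dcoeff_chartPoly_jet hS h]

end Isomorphism

end LoopPoisson

end

theorem mainTheorem2 {k : Type u} [Field k] [IsAlgClosed k] [CharZero k]
    (M : LoopPoisson.SchOver k) [Smooth M.hom] (P : LoopPoisson.PoissonStr M)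
    (L : LoopPoisson.ArcSpace M) :
    -- the Poisson vertex structure of the arc space
    (∃! S : LoopPoisson.PVStr L.X, S.IsArc P) ∧
    ∀ (S : LoopPoisson.PVStr L.X) (hS : S.IsArc P),
      -- the topological Lie algebroid `∫ Ω¹`
      (∃! 𝒜 : ∀ c : LoopPoisson.Chart L, LoopPoisson.TopLieAlgebroid c.ev,
        ∀ c, (𝒜 c).IsCotangent (P.bracket c.U)) ∧
      ∀ 𝒜 : ∀ c : LoopPoisson.Chart L, LoopPoisson.TopLieAlgebroid c.ev,
        (∀ c, (𝒜 c).IsCotangent (P.bracket c.U)) →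
        -- both sides are complexes, and the first one is acted on by `δ`
        ∃ (hP : S.IsComplex) (hL : LoopPoisson.IsLoopComplex 𝒜 hS)
          -- a morphism of complexes of presheaves, and the isomorphism of complexes of sheaves
          -- that it induces on the quotient by `δ`
          (Φ : LoopPoisson.loopPresheafComplex hL ⟶ S.presheafComplex hP)
          (e : LoopPoisson.loopComplex hL ≅ S.complex hP),
          LoopPoisson.loopProj hL ≫ e.hom = (LoopPoisson.sheafify L.X).map Φ ∧
          -- `φ` is sent to `(a_1, …, a_n) ↦ φ(e^{λ_1 z} da_1, …, e^{λ_n z} da_n)` on functions on `M`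
          (∀ (n : ℕ) (W : Opens L.X.left) (φ : LoopPoisson.loopCochains L n W)
            (c : LoopPoisson.Chart L) (hc : c.V.1 ≤ W) (a : Fin n → LoopPoisson.Sec M c.U),
            (LoopPoisson.imageFam Φ n W φ).1 ⟨c.V, hc⟩ (fun q => LoopPoisson.jet c.ev 0 (a q)) =
              Submodule.Quotient.mk (LoopPoisson.expEval c.ev (φ.1 ⟨c, hc⟩) a)) ∧
          -- `b · (η^1)_{i_1} ∧ ⋯ ∧ (η^n)_{i_n}` is sent to `b` times the wedge product of the
          -- `(1 / i_p!) (λ + δ)^{i_p} (η^p ⊗ 1)`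
          (∀ (n : ℕ) (W : Opens L.X.left) (φ : LoopPoisson.loopCochains L n W)
            (c : LoopPoisson.Chart L) (hc : c.V.1 ≤ W) (b : LoopPoisson.Sec L.X c.V)
            (η : Fin n → Derivation k (LoopPoisson.Sec M c.U) (LoopPoisson.Sec M c.U))
            (i : Fin n → ℕ), φ.1 ⟨c, hc⟩ = LoopPoisson.thetaWedge c.ev b η i →
            ∀ a : Fin n → LoopPoisson.Sec M c.U,
              (LoopPoisson.imageFam Φ n W φ).1 ⟨c.V, hc⟩ (fun q => LoopPoisson.jet c.ev 0 (a q)) =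
                Submodule.Quotient.mk (MvPolynomial.C b * Matrix.det (Matrix.of fun p q =>
                  LoopPoisson.thetaLam c.ev (S.pva c.V).δ (η p) (i p) q (a q)))) :=
  ⟨LoopPoisson.exists_unique_isArc, fun _ hS => ⟨LoopPoisson.exists_unique_isCotangent, fun _ h𝒜 =>
    ⟨LoopPoisson.isComplex hS, LoopPoisson.isLoopComplex hS h𝒜, LoopPoisson.toCochainHom h𝒜 _ _,
      LoopPoisson.loopComplexIso h𝒜 _ _, LoopPoisson.loopProj_loopComplexIso h𝒜 _ _, LoopPoisson.mk_expEval h𝒜 _ _,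
      fun n W φ c hc b η i h a => by
        rw [LoopPoisson.mk_expEval h𝒜, h, LoopPoisson.expEval_thetaWedge hS c b η i (h ▸ φ.2.1 ⟨c, hc⟩)]⟩⟩⟩
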